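/- **Setting and notation.** Let $n\ge 2$. The Fourier transform is $\mathcal F[\varphi](\xi)=(2\pi)^{-n/2}\int_{\mathbb R^n}\varphi(x)e^{-ix\cdot\xi}\,dx$. Let $G(t,x)=(4\pi t)^{-n/2}e^{-|x|^2/(4t)}$, and let $R_k=\partial_k(-\Delta)^{-1/2}$ and $(-\Delta)^{-1/2}$ be the Fourier multipliers with symbols $i\xi_k/|\xi|$ and $|\xi|^{-1}$. For a multi-index $\alpha\in\mathbb Z_+^n$ put $|\alpha|=\sum_i\alpha_i$, $\alpha!=\prod_i\alpha_i!$, $x^\alpha=\prod_i x_i^{\alpha_i}$, $\nabla^\alpha=\prod_i\partial_i^{\alpha_i}$. Let $(u,p)$ be a smooth solution on $(0,\infty)\times\mathbb R^n$ of the Navier–Stokes equations $$\partial_t u+(u\cdot\nabla)u=\Delta u-\nabla p,\qquad \nabla\cdot u=0,$$ whose initial velocity $u(0)=a$ is attained in the sense of distributions as $t\to+0$. Assume $\nabla\cdot a=0$, let $\omega_{0ij}=\partial_i a_j-\partial_j a_i$ (in the sense of distributions), and suppose that $a\in L^1(\mathbb R^n)$ and $a_j=-\sum_{k=1}^n R_k(-\Delta)^{-1/2}\omega_{0kj}$.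 For $t>0$ let $\omega_{ij}=\partial_i u_j-\partial_j u_i$. Put, for $1\le m\le n$, $$U_{j;m}(t)=-\sum_{|\alpha|=m+1}\sum_{k=1}^n\frac{\nabla^\alpha R_k(-\Delta)^{-1/2}G(t)}{\alpha!}\int_{\mathbb R^n}(-y)^\alpha\omega_{0kj}(y)\,dy-\sum_{2l+|\beta|=m}\sum_{h=1}^n\frac{\partial_t^l\nabla^\beta G(t)}{l!\,\beta!}\int_0^\infty\!\!\int_{\mathbb R^n}(-s)^l(-y)^\beta(\omega_{hj}u_h)(s,y)\,dy\,ds,$$ $$U^S_{j;m}(t)=-\sum_{2l+|\beta|=m}\sum_{k,h=1}^n\frac{\partial_t^l\nabla^\beta R_kR_jG(t)}{l!\,\beta!}\int_0^t\!\!\int_{\mathbb R^n}(-s)^l(-y)^\beta(\omega_{hk}u_h)(s,y)\,dy\,ds,$$ and $U_m=(U_{j;m})_{j=1}^n$, $U^S_m=(U^S_{j;m})_{j=1}^n$. **Proposition 1.2.** Let $\omega_0\in L^1(\mathbb R^n)\cap L^\infty(\mathbb R^n)$ and $|x|^{n+2}\omega_0\in L^1(\mathbb R^n)$. Suppose that for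 every $1\le q\le\infty$ there is a constant $C$ such that $$\|u(t)\|_{L^q(\mathbb R^n)}\le C(1+t)^{-\frac n2(1-\frac1q)-\frac12}\qquad\text{for all } t\ge 0.$$ Then all the functions $(-s)^l(-y)^\beta(\omega_{hk}u_h)(s,y)$ with $2l+|\beta|\le n$ and $1\le h,k\le n$ are integrable over $(0,\infty)\times\mathbb R^n$, and $$\Bigl\||x|^\mu\Bigl(u(t)-\sum_{m=1}^n(U_m+U_m^S)(t)\Bigr)\Bigr\|_{L^q(\mathbb R^n)}=O\Bigl(t^{-\frac n2(1-\frac1q)-\frac n2-\frac12+\frac\mu2}\log(2+t)\Bigr)\qquad\text{as } t\to+\infty$$ holds for $q=1$ and real $0\le\mu\le n-1$, and for $1<q\le\infty$ and real $0\le\mu\le n$ (the implied constant may depend on the solution, $q$ and $\mu$). -/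

import Mathlib

open MeasureTheory Filter Topology Set
open scoped ENNReal FourierTransform ContDiff

noncomputable section

namespace NSAsymp

/-- Euclidean space of dimension `n`. -/
abbrev Eu (n : ℕ) : Type := EuclideanSpace ℝ (Fin n)

/-- The partial derivative `∂_j f` at `x`. -/
def pderiv {n : ℕ} (j : Fin n) (f : Eu n → ℝ) (x : Eu n) : ℝ :=
  fderiv ℝ f x (EuclideanSpace.single j 1)

/-- `∇^β f = ∂_1^{β_1} ⋯ ∂_n^{β_n} f` for a multi-index `β`. -/
def multiDeriv {n : ℕ} (β : Fin n → ℕ) (f : Eu n → ℝ) : Eu n → ℝ :=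
  (List.finRange n).foldr (fun j g => (pderiv j)^[β j] g) f

/-- `(∂_t^l ∇^β K)(t, x)` for a function `K` of time and space. -/
def mixedDeriv {n : ℕ} (l : ℕ) (β : Fin n → ℕ) (K : ℝ → Eu n → ℝ) (t : ℝ) (x : Eu n) : ℝ :=
  iteratedDeriv l (fun s => multiDeriv β (K s) x) t

/-- `β! = β_1! ⋯ β_n!`. -/
def multiFactorial {n : ℕ} (β : Fin n → ℕ) : ℝ := ∏ j, ((β j).factorial : ℝ)

/-- `(-y)^β = (-y_1)^{β_1} ⋯ (-y_n)^{β_n}`. -/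
def negPow {n : ℕ} (β : Fin n → ℕ) (y : Eu n) : ℝ := ∏ j, (-(y j)) ^ β j

/-- Test functions: smooth with compact support. -/
def IsTest {n : ℕ} (φ : Eu n → ℝ) : Prop := ContDiff ℝ ∞ φ ∧ HasCompactSupport φ

/-- The Gauss (heat) kernel `G(t, x)`. -/
def heatKernel {n : ℕ} (t : ℝ) (x : Eu n) : ℝ :=
  (4 * Real.pi * t) ^ (-(n : ℝ) / 2) * Real.exp (-‖x‖ ^ 2 / (4 * t))

/-- The symbol `i ξ_k / |ξ|` of the Riesz transform `R_k = ∂_k (-Δ)^{-1/2}`. -/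
def rieszSymbol {n : ℕ} (k : Fin n) (ξ : Eu n) : ℂ := Complex.I * ((ξ k / ‖ξ‖ : ℝ) : ℂ)

/-- The symbol `|ξ|^{-1}` of `(-Δ)^{-1/2}`. -/
def invSqrtLapSymbol {n : ℕ} (ξ : Eu n) : ℂ := ((‖ξ‖⁻¹ : ℝ) : ℂ)

/-- The Fourier multiplier with symbol `m` applied to `f`, i.e. the inverse Fourier transform of
`m(ξ)` times the Fourier transform of `f`. The frequency of Mathlib's transform is `w = ξ / (2π)`.
The symbols used below satisfy `m(-ξ) = conj (m ξ)`, so that the result is real. -/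
def fourierMultiplier {n : ℕ} (m : Eu n → ℂ) (f : Eu n → ℝ) (x : Eu n) : ℝ :=
  (𝓕⁻ (fun w : Eu n => m ((2 * Real.pi) • w) * 𝓕 (fun y : Eu n => (f y : ℂ)) w) x).re

/-- `R_k (-Δ)^{-1/2} G(t, x)`. -/
def rieszInvHeat {n : ℕ} (k : Fin n) (t : ℝ) : Eu n → ℝ :=
  fourierMultiplier (fun ξ => rieszSymbol k ξ * invSqrtLapSymbol ξ) (heatKernel t)

/-- `R_k R_j G(t, x)`. -/
def rieszRieszHeat {n : ℕ} (k j : Fin n) (t : ℝ) : Eu n → ℝ :=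
  fourierMultiplier (fun ξ => rieszSymbol k ξ * rieszSymbol j ξ) (heatKernel t)

/-- `a` is integrable and `a_j = - ∑_k R_k (-Δ)^{-1/2} b_{kj}`, the operators being Fourier
multipliers. -/
def BiotSavart {n : ℕ} (a : Eu n → Eu n) (b : Fin n → Fin n → Eu n → ℝ) : Prop :=
  Integrable a ∧ ∀ j : Fin n, ∀ᵐ w : Eu n,
    𝓕 (fun y : Eu n => ((a y j : ℝ) : ℂ)) w =
      -∑ k : Fin n, rieszSymbol k ((2 * Real.pi) • w) * invSqrtLapSymbol ((2 * Real.pi) • w) *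
        𝓕 (fun y : Eu n => (b k j y : ℂ)) w

/-- `∇ · a = 0` in the sense of distributions. -/
def WeakDivFree {n : ℕ} (a : Eu n → Eu n) : Prop :=
  ∀ φ : Eu n → ℝ, IsTest φ → ∫ x, ∑ j, a x j * pderiv j φ x = 0

/-- `b_{ij} = ∂_i a_j - ∂_j a_i` in the sense of distributions. -/
def IsWeakVorticity {n : ℕ} (a : Eu n → Eu n) (b : Fin n → Fin n → Eu n → ℝ) : Prop :=
  ∀ i j : Fin n, ∀ φ : Eu n → ℝ, IsTest φ →
    ∫ x, b i j x * φ x = -∫ x, (a x j * pderiv i φ x - a x i * pderiv j φ x)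

/-- `(u, p)` is a smooth global solution of the incompressible Navier-Stokes equations on
`(0, ∞) × ℝⁿ`, and the initial velocity `u(0)` is attained in the sense of distributions. -/
structure IsNSSolution {n : ℕ} (u : ℝ → Eu n → Eu n) (p : ℝ → Eu n → ℝ) : Prop where
  smooth_velocity : ContDiffOn ℝ ∞ (fun z : ℝ × Eu n => u z.1 z.2) (Ioi 0 ×ˢ univ)
  smooth_pressure : ContDiffOn ℝ ∞ (fun z : ℝ × Eu n => p z.1 z.2) (Ioi 0 ×ˢ univ)
  momentum : ∀ t : ℝ, 0 < t → ∀ (x : Eu n) (j : Fin n),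
    deriv (fun s => u s x j) t + ∑ h, u t x h * pderiv h (fun y => u t y j) x =
      ∑ h, pderiv h (pderiv h (fun y => u t y j)) x - pderiv j (p t) x
  div_free : ∀ t : ℝ, 0 < t → ∀ x : Eu n, ∑ j, pderiv j (fun y => u t y j) x = 0
  initial : ∀ (j : Fin n) (φ : Eu n → ℝ), IsTest φ →
    Tendsto (fun t => ∫ x, u t x j * φ x) (𝓝[>] 0) (𝓝 (∫ x, u 0 x j * φ x))

/-- The decay `‖u(t)‖_{L^q} ≤ C (1+t)^{-(n/2)(1-1/q)-1/2}` for `t ≥ 0` and `1 ≤ q ≤ ∞`. -/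
def VelocityDecay {n : ℕ} (u : ℝ → Eu n → Eu n) : Prop :=
  ∀ q : ℝ≥0∞, 1 ≤ q → ∃ C : ℝ, ∀ t : ℝ, 0 ≤ t →
    eLpNorm (u t) q volume ≤
      ENNReal.ofReal (C * (1 + t) ^ (-(n : ℝ) / 2 * (1 - (q⁻¹).toReal) - 1 / 2))

/-- The vorticity tensor `ω_{ij} = ∂_i u_j - ∂_j u_i`. -/
def vorticity {n : ℕ} (u : ℝ → Eu n → Eu n) (i j : Fin n) (t : ℝ) (x : Eu n) : ℝ :=
  pderiv i (fun y => u t y j) x - pderiv j (fun y => u t y i) x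

/-- The integrand `(-s)^l (-y)^β (ω_{hj} u_h)(s, y)`. -/
def momentIntegrand {n : ℕ} (u : ℝ → Eu n → Eu n) (l : ℕ) (β : Fin n → ℕ) (h j : Fin n)
    (s : ℝ) (y : Eu n) : ℝ :=
  (-s) ^ l * negPow β y * (vorticity u h j s y * u s y h)

/-- `∫_S ∫_{ℝⁿ} (-s)^l (-y)^β (ω_{hj} u_h)(s, y) dy ds`. -/
def spaceTimeMoment {n : ℕ} (u : ℝ → Eu n → Eu n) (S : Set ℝ) (l : ℕ) (β : Fin n → ℕ)
    (h j : Fin n) : ℝ :=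
  ∫ s in S, ∫ y, momentIntegrand u l β h j s y

/-- The multi-indices `α ∈ ℤ_+ⁿ` with `|α| = m`. -/
def multiIndices (n m : ℕ) : Finset (Fin n → ℕ) := Finset.piAntidiag Finset.univ m

/-- The profile `U_{j;m}(t, x)`. The second sum runs over the pairs `(l, β)` with
`2 l + |β| = m`. -/
def profileU {n : ℕ} (ω₀ : Fin n → Fin n → Eu n → ℝ) (u : ℝ → Eu n → Eu n) (m : ℕ) (j : Fin n)
    (t : ℝ) (x : Eu n) : ℝ :=
  -(∑ α ∈ multiIndices n (m + 1), ∑ k : Fin n,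
      multiDeriv α (rieszInvHeat k t) x / multiFactorial α * ∫ y, negPow α y * ω₀ k j y) -
    ∑ l ∈ Finset.range (m / 2 + 1), ∑ β ∈ multiIndices n (m - 2 * l), ∑ h : Fin n,
      mixedDeriv l β heatKernel t x / ((l.factorial : ℝ) * multiFactorial β) *
        spaceTimeMoment u (Ioi 0) l β h j

/-- The profile `U^S_{j;m}(t, x)`. The sum runs over the pairs `(l, β)` with `2 l + |β| = m`. -/
def profileUS {n : ℕ} (u : ℝ → Eu n → Eu n) (m : ℕ) (j : Fin n) (t : ℝ) (x : Eu n) : ℝ :=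
  -∑ l ∈ Finset.range (m / 2 + 1), ∑ β ∈ multiIndices n (m - 2 * l), ∑ k : Fin n, ∑ h : Fin n,
      mixedDeriv l β (rieszRieszHeat k j) t x / ((l.factorial : ℝ) * multiFactorial β) *
        spaceTimeMoment u (Ioc 0 t) l β h k

/-- The vector field `u(t) - ∑_{m=1}^n (U_m + U^S_m)(t)`. -/
def expansionError {n : ℕ} (ω₀ : Fin n → Fin n → Eu n → ℝ) (u : ℝ → Eu n → Eu n) (t : ℝ)
    (x : Eu n) : Eu n :=
  WithLp.toLp 2 fun j : Fin n =>
    u t x j - ∑ m ∈ Finset.Icc 1 n, (profileU ω₀ u m j t x + profileUS u m j t x)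

end NSAsymp

end

open MeasureTheory Filter Topology Set
open scoped ENNReal FourierTransform ContDiff

noncomputable section

namespace NSAsymp

open scoped Real
open Real (dist_eq div_rpow enorm_of_nonneg exp exp_add exp_le_exp exp_neg exp_pos inv_rpow log
  mul_rpow norm_eq_abs norm_of_nonneg pi_ne_zero pi_pos rpow_add rpow_le_rpow
  rpow_le_rpow_of_nonpos rpow_mul rpow_natCast rpow_neg rpow_neg_one rpow_nonneg rpow_zero sq_sqrt
  sqrt sqrt_eq_rpow sqrt_nonneg sqrt_pos sqrt_sq)
open ENNReal (add_ne_top mul_ne_top ofReal ofReal_add ofReal_le_ofReal ofReal_lt_top ofReal_mul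
  ofReal_natCast ofReal_ne_top ofReal_one ofReal_pow ofReal_toReal sum_lt_top)
open Finset (aemeasurable_fun_sum card_univ induction_on mem_sigma mul_sum single_le_sum
  sum_add_distrib sum_comm sum_congr sum_const sum_eq_zero sum_insert sum_le_sum sum_mul
  sum_neg_distrib sum_nonneg sum_range_succ' sum_sigma' sum_sub_distrib)
open EuclideanSpace (coe_proj inner_single_right norm_sq_eq proj single)
open Complex (I_im I_re I_sq abs_re_le_norm add_re mul_re neg_re norm_I norm_exp norm_real
  ofRealCLM ofReal_cpow ofReal_div ofReal_exp ofReal_re reCLM reCLM_apply re_sum real_smul sub_re)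

variable {n : ℕ}

lemma lintegral_ofReal_mul {α : Type*} [MeasurableSpace α] {ν : Measure α} {c : ℝ} {f : α → ℝ≥0∞} :
    ∫⁻ a, ofReal c * f a ∂ν = ofReal c * ∫⁻ a, f a ∂ν :=
  lintegral_const_mul' _ _ ofReal_ne_top

lemma heatKernel_pos {t : ℝ} (ht : 0 < t) (x : Eu n) : 0 < heatKernel t x := by
  unfold heatKernel; positivity

lemma heatKernel_nonneg {t : ℝ} (ht : 0 ≤ t) (x : Eu n) : 0 ≤ heatKernel t x := by
  unfold heatKernel; positivity

lemma continuous_heatKernel (t : ℝ) : Continuous (heatKernel (n := n) t) := by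
  unfold heatKernel; fun_prop

lemma heatKernel_neg (t : ℝ) (x : Eu n) : heatKernel t (-x) = heatKernel t x := by simp [heatKernel]

lemma integrable_exp_neg_sq {b : ℝ} (hb : 0 < b) :
    Integrable (fun x : Eu n => exp (-b * ‖x‖ ^ 2)) := by
  have := GaussianFourier.integrable_cexp_neg_mul_sq_norm_add (V := Eu n) (b := (b : ℂ))
    (by simpa using hb) 0 0
  convert! this.norm using 2 with x
  rw [norm_exp]
  simp [← Complex.ofReal_pow]

lemma heatKernel_eq {t : ℝ} (x : Eu n) :
    heatKernel t x = (4 * π * t) ^ (-(n : ℝ) / 2) * exp (-(1 / (4 * t)) * ‖x‖ ^ 2) := by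
  unfold heatKernel; congr 2; ring

lemma integrable_heatKernel {t : ℝ} (ht : 0 < t) : Integrable (heatKernel (n := n) t) := by
  have h := (integrable_exp_neg_sq (n := n) (b := 1 / (4 * t)) (by positivity)).const_mul
    ((4 * π * t) ^ (-(n : ℝ) / 2))
  exact h.congr (.of_forall fun x => (heatKernel_eq x).symm)

lemma integral_heatKernel {t : ℝ} (ht : 0 < t) : ∫ x : Eu n, heatKernel t x = 1 := by
  simp_rw [heatKernel_eq]
  rw [integral_const_mul, GaussianFourier.integral_rexp_neg_mul_sq_norm (by positivity)]
  rw [finrank_euclideanSpace_fin]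
  rw [show π / (1 / (4 * t)) = 4 * π * t by field_simp,
    ← rpow_add (by positivity), show -(n : ℝ) / 2 + n / 2 = 0 by ring, rpow_zero]

lemma integral_heatKernel_sub {t : ℝ} (ht : 0 < t) (x : Eu n) :
    ∫ y : Eu n, heatKernel t (x - y) = 1 := by
  rw [integral_sub_left_eq_self (fun y => heatKernel t y) volume x, integral_heatKernel ht]

lemma heatKernel_le {t : ℝ} (ht : 0 < t) (x : Eu n) :
    heatKernel t x ≤ (4 * π * t) ^ (-(n : ℝ) / 2) := by
  unfold heatKernel
  refine mul_le_of_le_one_right (by positivity) (Real.exp_le_one_iff.2 ?_)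
  have : 0 ≤ ‖x‖ ^ 2 / (4 * t) := by positivity
  rw [neg_div]; linarith

lemma heatKernel_mul_heatKernel {a b : ℝ} (ha : 0 < a) (hb : 0 < b) (x y : Eu n) :
    heatKernel a (x - y) * heatKernel b y =
      heatKernel (a + b) x * heatKernel (a * b / (a + b)) ((b / (a + b)) • x - y) := by
  unfold heatKernel
  have e1 : (4 * π * a) ^ (-(n : ℝ) / 2) * (4 * π * b) ^ (-(n : ℝ) / 2) =
      (4 * π * (a + b)) ^ (-(n : ℝ) / 2) * (4 * π * (a * b / (a + b))) ^ (-(n : ℝ) / 2) := by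
    rw [← mul_rpow (by positivity) (by positivity), ← mul_rpow (by positivity) (by positivity)]
    congr 1; field_simp
  have e2 : -‖x - y‖ ^ 2 / (4 * a) + -‖y‖ ^ 2 / (4 * b) = -‖x‖ ^ 2 / (4 * (a + b)) +
      -‖(b / (a + b)) • x - y‖ ^ 2 / (4 * (a * b / (a + b))) := by
    rw [@norm_sub_sq_real, @norm_sub_sq_real, norm_smul, inner_smul_left]
    simp only [norm_eq_abs, mul_pow, sq_abs, conj_trivial]
    field_simp
    ring
  calc _ = ((4 * π * a) ^ (-(n : ℝ) / 2) * (4 * π * b) ^ (-(n : ℝ) / 2)) *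
        exp (-‖x - y‖ ^ 2 / (4 * a) + -‖y‖ ^ 2 / (4 * b)) := by rw [exp_add]; ring
    _ = _ := by rw [e1, e2, exp_add]; ring

lemma lintegral_heatKernel_sub {t : ℝ} (ht : 0 < t) (x : Eu n) :
    ∫⁻ y : Eu n, ofReal (heatKernel t (x - y)) = 1 := by
  rw [← ofReal_integral_eq_lintegral_ofReal, integral_heatKernel_sub ht, ofReal_one]
  · exact (integrable_heatKernel ht).comp_sub_left x
  · exact .of_forall fun y => heatKernel_nonneg ht.le _

lemma lintegral_heatKernel_sub_right {t : ℝ} (ht : 0 < t) (y : Eu n) :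
    ∫⁻ x : Eu n, ofReal (heatKernel t (x - y)) = 1 := by
  rw [← lintegral_heatKernel_sub ht y]
  exact lintegral_congr fun x => by rw [← heatKernel_neg, neg_sub]

lemma lintegral_heatKernel_mul {a b : ℝ} (ha : 0 < a) (hb : 0 < b) (x z : Eu n) :
    ∫⁻ y, ofReal (heatKernel a (x - y)) * ofReal (heatKernel b (y - z)) =
      ofReal (heatKernel (a + b) (x - z)) := by
  have h : ∀ y : Eu n, ofReal (heatKernel a (x - y)) *
      ofReal (heatKernel b (y - z)) = ofReal (heatKernel (a + b) (x - z)) *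
        ofReal (heatKernel (a * b / (a + b)) (((b / (a + b)) • (x - z) + z) - y)) := by
    intro y
    rw [← ofReal_mul (heatKernel_nonneg ha.le _),
      ← ofReal_mul (heatKernel_nonneg (by positivity) _)]
    have := heatKernel_mul_heatKernel ha hb (x - z) (y - z)
    rw [show x - z - (y - z) = x - y by abel,
      show (b / (a + b)) • (x - z) - (y - z) = (b / (a + b)) • (x - z) + z - y by abel] at this
    rw [this]
  simp_rw [h]
  rw [lintegral_const_mul _ (by
    exact ((continuous_heatKernel _).comp (continuous_const.sub continuous_id)).measurable.ennreal_ofReal),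
    lintegral_heatKernel_sub (by positivity), mul_one]

lemma heatKernel_eq_two_mul {t : ℝ} (ht : 0 < t) (x : Eu n) :
    heatKernel t x = 2 ^ ((n : ℝ) / 2) * exp (-(‖x‖ ^ 2 / (8 * t))) * heatKernel (2 * t) x := by
  unfold heatKernel
  have : (4 * π * (2 * t)) ^ (-(n : ℝ) / 2) =
      (2 : ℝ) ^ (-(n : ℝ) / 2) * (4 * π * t) ^ (-(n : ℝ) / 2) := by
    rw [← mul_rpow (by positivity) (by positivity)]; congr 1; ring
  rw [this]
  have h2 : (2 : ℝ) ^ ((n : ℝ) / 2) * (2 : ℝ) ^ (-(n : ℝ) / 2) = 1 := by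
    rw [← rpow_add (by positivity), show (n : ℝ) / 2 + -(n : ℝ) / 2 = 0 by ring, rpow_zero]
  have h3 : exp (-‖x‖ ^ 2 / (4 * t)) = exp (-(‖x‖ ^ 2 / (8 * t))) *
      exp (-‖x‖ ^ 2 / (4 * (2 * t))) := by
    rw [← exp_add]; congr 1; field_simp; ring
  rw [h3]
  linear_combination (-(exp (-(‖x‖ ^ 2 / (8 * t))) *
      exp (-‖x‖ ^ 2 / (4 * (2 * t))) * (4 * π * t) ^ (-(n : ℝ) / 2))) * h2

/-- Powers of `|x|` are absorbed by the Gaussian at the price of doubling the time. -/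
lemma exists_pow_mul_heatKernel_le (n k : ℕ) : ∃ C : ℝ, 0 < C ∧ ∀ (t : ℝ) (x : Eu n), 0 < t →
    ‖x‖ ^ k * heatKernel t x ≤ C * t ^ ((k : ℝ) / 2) * heatKernel (2 * t) x := by
  refine ⟨2 ^ ((n : ℝ) / 2) * (8 ^ k * (k.factorial + 1)), by positivity, fun t x ht => ?_⟩
  rw [heatKernel_eq_two_mul ht]
  have hk : 0 ≤ heatKernel (2 * t) x := heatKernel_nonneg (by positivity) x
  have key : ‖x‖ ^ k * exp (-(‖x‖ ^ 2 / (8 * t))) ≤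
      8 ^ k * (k.factorial + 1) * t ^ ((k : ℝ) / 2) := by
    set r := ‖x‖ / sqrt t with hr
    have hst : 0 < sqrt t := sqrt_pos.2 ht
    have hr0 : 0 ≤ r := by positivity
    have hx : ‖x‖ = r * sqrt t := by rw [hr]; field_simp
    have ht' : t ^ ((k : ℝ) / 2) = sqrt t ^ k := by
      rw [sqrt_eq_rpow, ← rpow_natCast, ← rpow_mul ht.le]; congr 1; ring
    have hs : sqrt t ^ 2 = t := sq_sqrt ht.le
    have e : ‖x‖ ^ 2 / (8 * t) = r ^ 2 / 8 := by rw [hx, mul_pow, hs]; field_simp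
    rw [e, ht', hx, mul_pow]
    have h1 : r ^ k * exp (-(r ^ 2 / 8)) ≤ 8 ^ k * (k.factorial + 1) := by
      rw [exp_neg, ← div_eq_mul_inv, div_le_iff₀ (exp_pos _)]
      have h8 : (1 : ℝ) ≤ 8 ^ k := one_le_pow₀ (by norm_num)
      have hf : (1 : ℝ) ≤ k.factorial := by exact_mod_cast Nat.factorial_pos k
      rcases le_total r 1 with h | h
      · calc r ^ k ≤ 1 := pow_le_one₀ hr0 h
          _ ≤ 8 ^ k * (k.factorial + 1) * 1 := by nlinarith
          _ ≤ _ := by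
            gcongr
            exact Real.one_le_exp (by positivity)
      · have h2 : (r ^ 2 / 8) ^ k / k.factorial ≤ exp (r ^ 2 / 8) :=
          Real.pow_div_factorial_le_exp _ (by positivity) k
        have h3 : r ^ k ≤ 8 ^ k * (r ^ 2 / 8) ^ k := by
          rw [← mul_pow]
          exact pow_le_pow_left₀ hr0 (by nlinarith) k
        calc r ^ k ≤ 8 ^ k * (r ^ 2 / 8) ^ k := h3
          _ = 8 ^ k * k.factorial * ((r ^ 2 / 8) ^ k / k.factorial) := by field_simp
          _ ≤ 8 ^ k * k.factorial * exp (r ^ 2 / 8) := by gcongr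
          _ ≤ _ := by gcongr; linarith
    calc r ^ k * sqrt t ^ k * exp (-(r ^ 2 / 8))
        = r ^ k * exp (-(r ^ 2 / 8)) * sqrt t ^ k := by ring
      _ ≤ _ := by gcongr
  calc ‖x‖ ^ k * (2 ^ ((n : ℝ) / 2) * exp (-(‖x‖ ^ 2 / (8 * t))) * heatKernel (2 * t) x)
      = 2 ^ ((n : ℝ) / 2) * (‖x‖ ^ k * exp (-(‖x‖ ^ 2 / (8 * t)))) * heatKernel (2 * t) x := by ring
    _ ≤ 2 ^ ((n : ℝ) / 2) * (8 ^ k * (k.factorial + 1) * t ^ ((k : ℝ) / 2)) *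
        heatKernel (2 * t) x := by gcongr
    _ = _ := by ring

lemma heatKernel_le_two_mul {t : ℝ} (ht : 0 < t) (x : Eu n) :
    heatKernel t x ≤ 2 ^ ((n : ℝ) / 2) * heatKernel (2 * t) x := by
  rw [heatKernel_eq_two_mul ht]
  have hk : 0 ≤ heatKernel (2 * t) x := heatKernel_nonneg (by positivity) x
  gcongr
  refine mul_le_of_le_one_right (by positivity) (Real.exp_le_one_iff.2 ?_)
  have : 0 ≤ ‖x‖ ^ 2 / (8 * t) := by positivity
  linarith

lemma hasFDerivAt_heatKernel {t : ℝ} (x : Eu n) :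
    HasFDerivAt (heatKernel t) (-(heatKernel t x / (2 * t)) • innerSL ℝ x) x := by
  have h := (((hasStrictFDerivAt_norm_sq x).hasFDerivAt.const_mul (-(1 / (4 * t)))).exp).const_mul
    ((4 * π * t) ^ (-(n : ℝ) / 2))
  refine (h.congr_fderiv ?_).congr_of_eventuallyEq (.of_forall fun y => heatKernel_eq y)
  ext v
  simp only [heatKernel_eq, smul_apply, smul_eq_mul, innerSL_apply_apply, nsmul_eq_mul]
  push_cast
  ring

lemma pderiv_heatKernel {t : ℝ} (j : Fin n) (x : Eu n) :
    pderiv j (heatKernel t) x = -(x j / (2 * t)) * heatKernel t x := by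
  rw [pderiv, (hasFDerivAt_heatKernel x).fderiv]
  simp [inner_single_right]
  ring

lemma exists_abs_pderiv_heatKernel_le (n : ℕ) : ∃ C : ℝ, 0 < C ∧ ∀ (t : ℝ) (j : Fin n) (x : Eu n),
    0 < t → |pderiv j (heatKernel t) x| ≤ C * t ^ (-(1 / 2) : ℝ) * heatKernel (2 * t) x := by
  obtain ⟨C, hC, h⟩ := exists_pow_mul_heatKernel_le n 1
  refine ⟨C, hC, fun t j x ht => ?_⟩
  rw [pderiv_heatKernel, abs_mul, abs_neg, abs_div, abs_of_pos (heatKernel_pos ht x),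
    abs_of_pos (show 0 < 2 * t by positivity)]
  have h1 := h t x ht
  have h2 : |x j| ≤ ‖x‖ := by simpa using PiLp.norm_apply_le x j
  have hk := heatKernel_nonneg ht.le x
  have hk2 : 0 ≤ heatKernel (2 * t) x := heatKernel_nonneg (by positivity) x
  have e : t ^ (-(1 / 2) : ℝ) = t⁻¹ * t ^ (((1 : ℕ) : ℝ) / 2) := by
    rw [← rpow_neg_one, ← rpow_add ht]; norm_num
  rw [e]
  calc |x j| / (2 * t) * heatKernel t x ≤ ‖x‖ / t * heatKernel t x := by
        gcongr
        linarith
    _ = t⁻¹ * (‖x‖ ^ 1 * heatKernel t x) := by rw [pow_one]; ring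
    _ ≤ t⁻¹ * (C * t ^ (((1 : ℕ) : ℝ) / 2) * heatKernel (2 * t) x) := by gcongr
    _ = _ := by ring

/-- The factor `exp (-4π² t |w|² + 2π i ⟨w, x⟩)`. -/
def heatPhase (t : ℝ) (x w : Eu n) : ℂ :=
  Complex.exp (((-(4 * π ^ 2 * ‖w‖ ^ 2) * t : ℝ) : ℂ) + (2 * π * inner ℝ w x : ℝ) * Complex.I)

/-- The function with Fourier transform `m(w) exp (-4π² t |w|²)`. -/
def heatMult (m : Eu n → ℂ) (t : ℝ) (x : Eu n) : ℂ := ∫ w, m w * heatPhase t x w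

/-- Symbols that are `O(|w|^{k-1})`. -/
def SymbolGrowth (k : ℕ) (m : Eu n → ℂ) : Prop :=
  AEStronglyMeasurable m volume ∧ ∃ C, ∀ w, ‖m w‖ ≤ C * (‖w‖⁻¹ * ‖w‖ ^ k)

/-- The symbol of `∂_t` on `heatMult`. -/
def timeSymbol (w : Eu n) : ℂ := ((-(4 * π ^ 2 * ‖w‖ ^ 2) : ℝ) : ℂ)

/-- The symbol of the derivative in the direction `v` on `heatMult`. -/
def dirSymbol (v w : Eu n) : ℂ := ((2 * π * inner ℝ w v : ℝ) : ℂ) * Complex.I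

lemma norm_heatPhase (t : ℝ) (x w : Eu n) :
    ‖heatPhase t x w‖ = exp (-(4 * π ^ 2 * t) * ‖w‖ ^ 2) := by
  rw [heatPhase, norm_exp]
  simp only [add_re, ofReal_re, mul_re, I_re, Complex.ofReal_im, I_im]
  congr 1; ring

lemma continuous_heatPhase (t : ℝ) (x : Eu n) : Continuous (heatPhase t x) := by
  unfold heatPhase; fun_prop

lemma continuous_timeSymbol : Continuous (timeSymbol (n := n)) := by unfold timeSymbol; fun_prop

lemma continuous_dirSymbol (v : Eu n) : Continuous (dirSymbol v) := by unfold dirSymbol; fun_prop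

lemma norm_timeSymbol (w : Eu n) : ‖timeSymbol w‖ = 4 * π ^ 2 * ‖w‖ ^ 2 := by
  rw [timeSymbol, norm_real, norm_neg, norm_of_nonneg (by positivity)]

lemma norm_dirSymbol_le (v w : Eu n) : ‖dirSymbol v w‖ ≤ 2 * π * ‖v‖ * ‖w‖ := by
  rw [dirSymbol, norm_mul, norm_real, norm_I, mul_one, norm_mul, norm_of_nonneg (by positivity)]
  have := norm_inner_le_norm (𝕜 := ℝ) w v
  nlinarith [pi_pos]

lemma dirSymbol_single (j : Fin n) (w : Eu n) :
    dirSymbol (single j 1) w = ((2 * π * w j : ℝ) : ℂ) * Complex.I := by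
  rw [dirSymbol, inner_single_right]
  simp

lemma dirSymbol_eq_sum (v w : Eu n) :
    dirSymbol v w = ∑ j, (v j : ℂ) * dirSymbol (single j 1) w := by
  simp only [dirSymbol_single]
  simp only [dirSymbol, PiLp.inner_apply, RCLike.inner_apply, conj_trivial]
  push_cast
  rw [mul_sum, sum_mul]
  exact sum_congr rfl fun j _ => by ring

lemma integrable_norm_pow_mul_exp (hn : 2 ≤ n) (k : ℕ) {b : ℝ} (hb : 0 < b) :
    Integrable (fun w : Eu n => ‖w‖⁻¹ * ‖w‖ ^ k * exp (-b * ‖w‖ ^ 2)) := by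
  have : Nonempty (Fin n) := ⟨⟨0, by omega⟩⟩
  have : Nontrivial (Eu n) := inferInstance
  rw [integrable_fun_norm_addHaar (volume : Measure (Eu n))
    (f := fun r : ℝ => r⁻¹ * r ^ k * exp (-b * r ^ 2)), finrank_euclideanSpace_fin]
  have h := (integrable_rpow_mul_exp_neg_mul_sq hb (s := ((n - 2 + k : ℕ) : ℝ))
    (by have : (0 : ℝ) ≤ ((n - 2 + k : ℕ) : ℝ) := Nat.cast_nonneg _
        linarith)).integrableOn (s := Ioi 0)
  refine h.congr_fun (fun y hy => ?_) measurableSet_Ioi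
  have hy' : (y : ℝ) ≠ 0 := ne_of_gt hy
  obtain ⟨a, rfl⟩ : ∃ a, n = a + 2 := ⟨n - 2, by omega⟩
  simp only [smul_eq_mul, rpow_natCast]
  rw [show a + 2 - 2 + k = a + k by omega, show a + 2 - 1 = a + 1 by omega, pow_add, pow_succ]
  field_simp
  ring

namespace SymbolGrowth

variable {m m' : Eu n → ℂ} {k j : ℕ}

lemma mul {g : Eu n → ℂ} (hm : SymbolGrowth k m) (hg : AEStronglyMeasurable g volume) {C : ℝ}
    (hC : ∀ w, ‖g w‖ ≤ C * ‖w‖ ^ j) : SymbolGrowth (k + j) (fun w => g w * m w) := by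
  obtain ⟨h1, D, hD⟩ := hm
  refine ⟨hg.mul h1, C * D, fun w => ?_⟩
  rw [norm_mul]
  calc ‖g w‖ * ‖m w‖ ≤ (C * ‖w‖ ^ j) * (D * (‖w‖⁻¹ * ‖w‖ ^ k)) :=
        mul_le_mul (hC w) (hD w) (norm_nonneg _) ((norm_nonneg _).trans (hC w))
    _ = _ := by rw [pow_add]; ring

lemma timeSymbol_mul (hm : SymbolGrowth k m) :
    SymbolGrowth (k + 2) (fun w => timeSymbol w * m w) :=
  hm.mul continuous_timeSymbol.aestronglyMeasurable (fun w => (norm_timeSymbol w).le)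

lemma dirSymbol_mul (hm : SymbolGrowth k m) (v : Eu n) :
    SymbolGrowth (k + 1) (fun w => dirSymbol v w * m w) :=
  hm.mul (continuous_dirSymbol v).aestronglyMeasurable
    (fun w => by simpa using norm_dirSymbol_le v w)

lemma integrable_norm_mul (hn : 2 ≤ n) (hm : SymbolGrowth k m) {b : ℝ} (hb : 0 < b) :
    Integrable (fun w => ‖m w‖ * exp (-b * ‖w‖ ^ 2)) := by
  obtain ⟨h1, D, hD⟩ := hm
  refine ((integrable_norm_pow_mul_exp hn k hb).const_mul D).mono'
    (h1.norm.mul (by fun_prop)) (.of_forall fun w => ?_)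
  rw [norm_mul, norm_norm, norm_of_nonneg (exp_pos _).le, ← mul_assoc]
  exact mul_le_mul_of_nonneg_right (hD w) (exp_pos _).le

lemma integrable (hn : 2 ≤ n) (hm : SymbolGrowth k m) {t : ℝ} (ht : 0 < t) (x : Eu n) :
    Integrable (fun w => m w * heatPhase t x w) := by
  refine (hm.integrable_norm_mul hn (b := 4 * π ^ 2 * t) (by positivity)).mono'
    (hm.1.mul (continuous_heatPhase t x).aestronglyMeasurable) (.of_forall fun w => ?_)
  rw [norm_mul, norm_heatPhase]

end SymbolGrowth

lemma heatMult_congr {m m' : Eu n → ℂ} (h : ∀ᵐ w, m w = m' w) (t : ℝ) (x : Eu n) :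
    heatMult m t x = heatMult m' t x :=
  integral_congr_ae (by filter_upwards [h] with w hw; rw [hw])

lemma heatMult_const_mul (c : ℂ) (m : Eu n → ℂ) (t : ℝ) (x : Eu n) :
    heatMult (fun w => c * m w) t x = c * heatMult m t x := by
  simp only [heatMult, mul_assoc, integral_const_mul]

lemma heatMult_sum (hn : 2 ≤ n) {ι : Type*} (s : Finset ι) {k : ι → ℕ} {m : ι → Eu n → ℂ}
    (hm : ∀ i ∈ s, SymbolGrowth (k i) (m i)) {t : ℝ} (ht : 0 < t) (x : Eu n) :
    heatMult (fun w => ∑ i ∈ s, m i w) t x = ∑ i ∈ s, heatMult (m i) t x := by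
  simp only [heatMult, sum_mul]
  exact integral_finsetSum s fun i hi => (hm i hi).integrable hn ht x

/-- The derivative of `(t, x) ↦ heatPhase t x w` divided by `heatPhase t x w`. -/
def phaseDeriv (w : Eu n) : ℝ × Eu n →L[ℝ] ℂ :=
  ofRealCLM.comp ((-(4 * π ^ 2 * ‖w‖ ^ 2)) • ContinuousLinearMap.fst ℝ ℝ (Eu n)) +
    Complex.I • ofRealCLM.comp ((2 * π) • (innerSL ℝ w).comp (ContinuousLinearMap.snd ℝ ℝ (Eu n)))

lemma phaseDeriv_apply (w : Eu n) (z : ℝ × Eu n) :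
    phaseDeriv w z = z.1 * timeSymbol w + dirSymbol z.2 w := by
  simp [phaseDeriv, timeSymbol, dirSymbol]
  ring

lemma continuous_phaseDeriv : Continuous (phaseDeriv (n := n)) := by unfold phaseDeriv; fun_prop

lemma norm_phaseDeriv_le (w : Eu n) :
    ‖phaseDeriv w‖ ≤ 4 * π ^ 2 * ‖w‖ ^ 2 + 2 * π * ‖w‖ := by
  refine ContinuousLinearMap.opNorm_le_bound _ (by positivity) fun z => ?_
  rw [phaseDeriv_apply]
  refine (norm_add_le _ _).trans ?_
  rw [norm_mul, norm_timeSymbol, norm_real, add_mul]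
  have h1 := norm_fst_le z
  have h2 := norm_snd_le z
  have h3 := norm_dirSymbol_le z.2 w
  refine add_le_add ?_ (h3.trans ?_)
  · rw [mul_comm]; gcongr
  · calc 2 * π * ‖z.2‖ * ‖w‖ ≤ 2 * π * ‖z‖ * ‖w‖ := by gcongr
      _ = _ := by ring

lemma hasFDerivAt_heatPhase (w : Eu n) (z : ℝ × Eu n) :
    HasFDerivAt (fun z : ℝ × Eu n => heatPhase z.1 z.2 w)
      (heatPhase z.1 z.2 w • phaseDeriv w) z := by
  have e : (fun z : ℝ × Eu n => heatPhase z.1 z.2 w) = fun z => Complex.exp (phaseDeriv w z) := by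
    funext z
    rw [phaseDeriv_apply, heatPhase, timeSymbol, dirSymbol]
    push_cast
    ring_nf
  have h := ((phaseDeriv w).hasFDerivAt (x := z)).cexp
  rw [← congrFun e z] at h
  rw [e]
  exact h

lemma hasFDerivAt_heatMult (hn : 2 ≤ n) {m : Eu n → ℂ} {k : ℕ} (hm : SymbolGrowth k m)
    {z : ℝ × Eu n} (hz : 0 < z.1) :
    HasFDerivAt (fun z : ℝ × Eu n => heatMult m z.1 z.2)
      (heatMult (fun w => timeSymbol w * m w) z.1 z.2 •
          ofRealCLM.comp (ContinuousLinearMap.fst ℝ ℝ (Eu n)) +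
        ∑ j, heatMult (fun w => dirSymbol (single j 1) w * m w) z.1 z.2 •
          ofRealCLM.comp ((proj j).comp (ContinuousLinearMap.snd ℝ ℝ (Eu n)))) z := by
  set b : ℝ := 4 * π ^ 2 * (z.1 / 2) with hb
  have hb0 : 0 < b := by positivity
  have hbd : ∀ (y : ℝ × Eu n) w, z.1 / 2 ≤ y.1 →
      ‖(m w * heatPhase y.1 y.2 w) • phaseDeriv w‖ ≤
      ‖timeSymbol w * m w‖ * exp (-b * ‖w‖ ^ 2) +
      ‖((2 * π * ‖w‖ : ℝ) : ℂ) * m w‖ * exp (-b * ‖w‖ ^ 2) := by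
    intro y w hy
    rw [norm_smul, norm_mul, norm_heatPhase, norm_mul, norm_mul, norm_timeSymbol, norm_real,
      norm_of_nonneg (show 0 ≤ 2 * π * ‖w‖ by positivity)]
    have hp := norm_phaseDeriv_le w
    have he : exp (-(4 * π ^ 2 * y.1) * ‖w‖ ^ 2) ≤ exp (-b * ‖w‖ ^ 2) := by
      rw [exp_le_exp, hb]
      have : 0 ≤ 4 * π ^ 2 * ‖w‖ ^ 2 := by positivity
      nlinarith
    calc _ ≤ ‖m w‖ * exp (-b * ‖w‖ ^ 2) *
          (4 * π ^ 2 * ‖w‖ ^ 2 + 2 * π * ‖w‖) := by gcongr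
      _ = _ := by ring
  have hmeas : ∀ y : ℝ × Eu n, AEStronglyMeasurable (fun w => m w * heatPhase y.1 y.2 w) :=
    fun y => hm.1.mul (continuous_heatPhase _ _).aestronglyMeasurable
  have hbi : Integrable (fun w => ‖timeSymbol w * m w‖ * exp (-b * ‖w‖ ^ 2) +
      ‖((2 * π * ‖w‖ : ℝ) : ℂ) * m w‖ * exp (-b * ‖w‖ ^ 2)) :=
    (hm.timeSymbol_mul.integrable_norm_mul hn hb0).add
      ((hm.mul (g := fun w => ((2 * π * ‖w‖ : ℝ) : ℂ)) (j := 1) (C := 2 * π)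
      (Continuous.aestronglyMeasurable (by fun_prop)) (fun w => by
        rw [norm_real, norm_of_nonneg (by positivity), pow_one])).integrable_norm_mul
        hn hb0)
  have hint : Integrable (fun w => (m w * heatPhase z.1 z.2 w) • phaseDeriv w) :=
    hbi.mono' ((hmeas z).smul continuous_phaseDeriv.aestronglyMeasurable)
      (.of_forall fun w => hbd z w (by linarith))
  have key := hasFDerivAt_integral_of_dominated_of_fderiv_le (𝕜 := ℝ)
    (F := fun (z : ℝ × Eu n) w => m w * heatPhase z.1 z.2 w)
    (F' := fun (z : ℝ × Eu n) w => (m w * heatPhase z.1 z.2 w) • phaseDeriv w)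
    (x₀ := z) (μ := volume) (s := Metric.ball z (z.1 / 2))
    (Metric.ball_mem_nhds _ (by positivity)) (.of_forall hmeas)
    (hm.integrable hn hz _) hint.1 (.of_forall fun w y hy => hbd y w ?_) hbi
    (.of_forall fun w y hy => ?_)
  · refine key.congr_fderiv (ContinuousLinearMap.ext fun v => ?_)
    rw [ContinuousLinearMap.integral_apply hint]
    have h1 := (hm.timeSymbol_mul.integrable hn hz z.2).const_mul (v.1 : ℂ)
    have h2 := fun j => ((hm.dirSymbol_mul (single j 1)).integrable hn hz z.2).const_mul (v.2 j : ℂ)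
    have e : ∀ w, ((m w * heatPhase z.1 z.2 w) • phaseDeriv w) v =
        (v.1 : ℂ) * (timeSymbol w * m w * heatPhase z.1 z.2 w) + ∑ j, (v.2 j : ℂ) *
          (dirSymbol (single j 1) w * m w * heatPhase z.1 z.2 w) := by
      intro w
      rw [smul_apply, phaseDeriv_apply, dirSymbol_eq_sum, smul_eq_mul, mul_add, mul_sum]
      congr 1
      · ring
      · exact sum_congr rfl fun j _ => by ring
    simp_rw [e]
    rw [integral_add h1 (integrable_finsetSum _ fun j _ => h2 j), integral_const_mul,
      integral_finsetSum _ fun j _ => h2 j]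
    simp [integral_const_mul, heatMult, mul_comm]
  · have h := (abs_lt.1 ((norm_fst_le (y - z)).trans_lt (by simpa [dist_eq_norm] using hy))).1
    simp at h
    linarith
  · have h := (hasFDerivAt_heatPhase w y).const_mul (m w)
    rwa [smul_smul] at h

lemma contDiffOn_heatMult (hn : 2 ≤ n) {m : Eu n → ℂ} {k : ℕ} (hm : SymbolGrowth k m) :
    ContDiffOn ℝ ∞ (fun z : ℝ × Eu n => heatMult m z.1 z.2) (Ioi 0 ×ˢ univ) := by
  have hS : IsOpen (Ioi (0 : ℝ) ×ˢ (univ : Set (Eu n))) := isOpen_Ioi.prod isOpen_univ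
  rw [contDiffOn_infty]
  intro N
  induction N generalizing m k with
  | zero =>
    simp only [Nat.cast_zero, contDiffOn_zero]
    exact fun z hz => (hasFDerivAt_heatMult hn hm hz.1).continuousAt.continuousWithinAt
  | succ N ih =>
    push_cast
    rw [contDiffOn_succ_iff_fderiv_of_isOpen hS]
    refine ⟨fun z hz => (hasFDerivAt_heatMult hn hm hz.1).differentiableAt.differentiableWithinAt,
      by simp, ?_⟩
    refine ContDiffOn.congr ?_ (fun z hz => (hasFDerivAt_heatMult hn hm hz.1).fderiv)
    exact ((ih hm.timeSymbol_mul).smul contDiffOn_const).add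
      (ContDiffOn.sum fun j _ => (ih (hm.dirSymbol_mul _)).smul contDiffOn_const)

lemma hasDerivAt_heatMult_time (hn : 2 ≤ n) {m : Eu n → ℂ} {k : ℕ} (hm : SymbolGrowth k m)
    {t : ℝ} (ht : 0 < t) (x : Eu n) :
    HasDerivAt (fun s => heatMult m s x) (heatMult (fun w => timeSymbol w * m w) t x) t := by
  have h := (hasFDerivAt_heatMult hn hm (z := (t, x)) ht).comp_hasDerivAt t
    ((hasDerivAt_id t).prodMk (hasDerivAt_const t x))
  refine h.congr_deriv ?_
  simp

lemma hasFDerivAt_heatMult_space (hn : 2 ≤ n) {m : Eu n → ℂ} {k : ℕ} (hm : SymbolGrowth k m)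
    {t : ℝ} (ht : 0 < t) (x : Eu n) :
    HasFDerivAt (heatMult m t)
      (∑ j, heatMult (fun w => dirSymbol (single j 1) w * m w) t x •
          ofRealCLM.comp (proj j)) x := by
  have h := (hasFDerivAt_heatMult hn hm (z := (t, x)) ht).comp x
    ((hasFDerivAt_const t x).prodMk (hasFDerivAt_id x))
  refine h.congr_fderiv ?_
  ext v
  simp

lemma hasDerivAt_heatMult_line (hn : 2 ≤ n) {m : Eu n → ℂ} {k : ℕ} (hm : SymbolGrowth k m)
    {t : ℝ} (ht : 0 < t) (x v : Eu n) (θ : ℝ) :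
    HasDerivAt (fun θ : ℝ => heatMult m t (x + θ • v))
      (heatMult (fun w => dirSymbol v w * m w) t (x + θ • v)) θ := by
  have hl : HasDerivAt (fun θ : ℝ => x + θ • v) v θ := by
    simpa using ((hasDerivAt_id θ).smul_const v).const_add x
  have h := (hasFDerivAt_heatMult_space hn hm ht (x + θ • v)).comp_hasDerivAt θ hl
  refine h.congr_deriv ?_
  simp_rw [dirSymbol_eq_sum v, sum_mul, mul_assoc]
  rw [heatMult_sum hn (k := fun _ => k + 1 + 0) _ (fun j _ =>
    (hm.dirSymbol_mul (single j 1)).mul (g := fun _ => (v j : ℂ)) (C := ‖v j‖)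
      (by fun_prop) (by simp)) ht]
  simp [heatMult_const_mul, mul_comm]

lemma pderiv_heatMult_re (hn : 2 ≤ n) {m : Eu n → ℂ} {k : ℕ} (hm : SymbolGrowth k m)
    {t : ℝ} (ht : 0 < t) (j : Fin n) :
    pderiv j (fun x => (heatMult m t x).re) =
      fun x => (heatMult (fun w => dirSymbol (single j 1) w * m w) t x).re := by
  funext x
  have h := reCLM.hasFDerivAt.comp x (hasFDerivAt_heatMult_space hn hm ht x)
  rw [pderiv, show (fun x => (heatMult m t x).re) = reCLM ∘ heatMult m t from rfl, h.fderiv]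
  simp

/-- The symbol `∏_j (2π i w_j)^{β_j}` of `∇^β`. -/
def multiSymbol (β : Fin n → ℕ) (w : Eu n) : ℂ := ∏ j, dirSymbol (single j 1) w ^ β j

lemma norm_multiSymbol_le (β : Fin n → ℕ) (w : Eu n) :
    ‖multiSymbol β w‖ ≤ (2 * π) ^ (∑ j, β j) * ‖w‖ ^ (∑ j, β j) := by
  rw [multiSymbol, norm_prod, ← mul_pow, ← Finset.prod_pow_eq_pow_sum]
  refine Finset.prod_le_prod (fun j _ => norm_nonneg _) fun j _ => ?_
  rw [norm_pow]
  gcongr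
  simpa using norm_dirSymbol_le (single j 1) w

lemma continuous_multiSymbol (β : Fin n → ℕ) : Continuous (multiSymbol β) := by
  unfold multiSymbol
  exact continuous_finsetProd _ fun j _ => (continuous_dirSymbol _).pow _

lemma SymbolGrowth.multiSymbol_mul {m : Eu n → ℂ} {k : ℕ} (hm : SymbolGrowth k m) (β : Fin n → ℕ) :
    SymbolGrowth (k + ∑ j, β j) (fun w => multiSymbol β w * m w) :=
  hm.mul (continuous_multiSymbol β).aestronglyMeasurable (norm_multiSymbol_le β)

lemma SymbolGrowth.timeSymbol_pow_mul {m : Eu n → ℂ} {k : ℕ} (hm : SymbolGrowth k m) (l : ℕ) :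
    SymbolGrowth (k + 2 * l) (fun w => timeSymbol w ^ l * m w) :=
  hm.mul (C := (4 * π ^ 2) ^ l) (continuous_timeSymbol.pow l).aestronglyMeasurable
    (fun w => by rw [norm_pow, norm_timeSymbol, mul_pow, pow_mul])

lemma SymbolGrowth.dirSymbol_pow_mul {m : Eu n → ℂ} {k : ℕ} (hm : SymbolGrowth k m) (v : Eu n)
    (l : ℕ) : SymbolGrowth (k + l) (fun w => dirSymbol v w ^ l * m w) :=
  hm.mul (C := (2 * π * ‖v‖) ^ l) ((continuous_dirSymbol v).pow l).aestronglyMeasurable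
    (fun w => by
      rw [norm_pow, ← mul_pow]; exact pow_le_pow_left₀ (norm_nonneg _) (norm_dirSymbol_le v w) l)

lemma iterate_pderiv_heatMult_re (hn : 2 ≤ n) {m : Eu n → ℂ} {k : ℕ} (hm : SymbolGrowth k m)
    {t : ℝ} (ht : 0 < t) (j : Fin n) (b : ℕ) :
    (pderiv j)^[b] (fun x => (heatMult m t x).re) =
      fun x => (heatMult (fun w => dirSymbol (single j 1) w ^ b * m w) t x).re := by
  induction b with
  | zero => simp
  | succ b ih =>
    rw [Function.iterate_succ_apply', ih, pderiv_heatMult_re hn (hm.dirSymbol_pow_mul _ b) ht]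
    funext x
    congr 2
    funext w
    ring

lemma multiDeriv_heatMult_re (hn : 2 ≤ n) {m : Eu n → ℂ} {k : ℕ} (hm : SymbolGrowth k m)
    {t : ℝ} (ht : 0 < t) (β : Fin n → ℕ) :
    multiDeriv β (fun x => (heatMult m t x).re) =
      fun x => (heatMult (fun w => multiSymbol β w * m w) t x).re := by
  have key : ∀ L : List (Fin n), (∃ k, SymbolGrowth k (fun w =>
      (L.map fun j => dirSymbol (single j 1) w ^ β j).prod * m w)) ∧
      L.foldr (fun j g => (pderiv j)^[β j] g) (fun x => (heatMult m t x).re) =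
      fun x => (heatMult (fun w =>
        (L.map fun j => dirSymbol (single j 1) w ^ β j).prod * m w) t x).re := by
    intro L
    induction L with
    | nil => exact ⟨⟨k, by simpa using hm⟩, by simp⟩
    | cons j L ih =>
      obtain ⟨⟨k', hk'⟩, ih⟩ := ih
      simp only [List.map_cons, List.prod_cons, List.foldr_cons, mul_assoc]
      refine ⟨⟨_, hk'.dirSymbol_pow_mul (single j 1) (β j)⟩, ?_⟩
      rw [ih, iterate_pderiv_heatMult_re hn hk' ht]
  rw [multiDeriv, (key _).2]
  simp only [multiSymbol, Fin.prod_univ_def]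

lemma iteratedDeriv_heatMult_re (hn : 2 ≤ n) {m : Eu n → ℂ} {k : ℕ} (hm : SymbolGrowth k m)
    (l : ℕ) {t : ℝ} (ht : 0 < t) (x : Eu n) :
    iteratedDeriv l (fun s => (heatMult m s x).re) t =
      (heatMult (fun w => timeSymbol w ^ l * m w) t x).re := by
  induction l generalizing t with
  | zero => simp
  | succ l ih =>
    rw [iteratedDeriv_succ]
    have e : iteratedDeriv l (fun s => (heatMult m s x).re) =ᶠ[𝓝 t]
        fun s => (heatMult (fun w => timeSymbol w ^ l * m w) s x).re := by
      filter_upwards [Ioi_mem_nhds ht] with s hs using ih hs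
    rw [e.deriv_eq]
    have h := reCLM.hasFDerivAt.comp_hasDerivAt t
      (hasDerivAt_heatMult_time hn (hm.timeSymbol_pow_mul l) ht x)
    rw [show (fun s => (heatMult (fun w => timeSymbol w ^ l * m w) s x).re) =
      reCLM ∘ fun s => heatMult (fun w => timeSymbol w ^ l * m w) s x from rfl, h.deriv]
    simp only [reCLM_apply]
    congr 2
    funext w
    ring

lemma mixedDeriv_heatMult_re (hn : 2 ≤ n) {m : Eu n → ℂ} {k : ℕ} (hm : SymbolGrowth k m)
    (K : ℝ → Eu n → ℝ) (hK : ∀ s, 0 < s → K s = fun x => (heatMult m s x).re)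
    (l : ℕ) (β : Fin n → ℕ) {t : ℝ} (ht : 0 < t) (x : Eu n) :
    mixedDeriv l β K t x =
      (heatMult (fun w => timeSymbol w ^ l * (multiSymbol β w * m w)) t x).re := by
  have e : (fun s => multiDeriv β (K s) x) =ᶠ[𝓝 t]
      fun s => (heatMult (fun w => multiSymbol β w * m w) s x).re := by
    filter_upwards [Ioi_mem_nhds ht] with s hs
    rw [hK s hs, multiDeriv_heatMult_re hn hm hs]
  rw [mixedDeriv, e.iteratedDeriv_eq, iteratedDeriv_heatMult_re hn (hm.multiSymbol_mul β) l ht]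

lemma hasTemperateGrowth_fderiv {E F : Type} [NormedAddCommGroup E] [NormedSpace ℝ E]
    [NormedAddCommGroup F] [NormedSpace ℝ F] {f : E → F} (hf : f.HasTemperateGrowth) :
    (fderiv ℝ f).HasTemperateGrowth := by
  refine ⟨hf.1.fderiv_right (by simp), fun k => ?_⟩
  obtain ⟨j, C, h⟩ := hf.2 (k + 1)
  exact ⟨j, C, fun x => by rw [norm_iteratedFDeriv_fderiv]; exact h x⟩

lemma exists_pow_mul_exp_le (N : ℕ) {c : ℝ} (hc : 0 < c) :
    ∃ C : ℝ, ∀ r : ℝ, 0 ≤ r → (1 + r) ^ N * exp (-(c * r ^ 2)) ≤ C := by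
  set d := min c 1 with hd
  have hd0 : 0 < d := lt_min hc one_pos
  refine ⟨4 ^ N * N.factorial * (1 / d) ^ N * exp 1, fun r hr => ?_⟩
  have h1 : (d * (1 + r ^ 2)) ^ N / N.factorial ≤ exp (d * (1 + r ^ 2)) :=
    Real.pow_div_factorial_le_exp _ (by positivity) N
  have h2 : (1 + r) ^ N ≤ (4 * (1 + r ^ 2)) ^ N :=
    pow_le_pow_left₀ (by positivity) (by nlinarith [sq_nonneg (r - 1)]) N
  have h3 : (4 * (1 + r ^ 2)) ^ N = 4 ^ N * N.factorial * (1 / d) ^ N *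
      ((d * (1 + r ^ 2)) ^ N / N.factorial) := by
    have : (N.factorial : ℝ) ≠ 0 := by positivity
    rw [mul_pow, mul_pow, one_div, inv_pow]
    field_simp
  have h4 : exp (d * (1 + r ^ 2)) * exp (-(c * r ^ 2)) ≤ exp 1 := by
    rw [← exp_add, exp_le_exp]
    have : d ≤ 1 := min_le_right _ _
    have : d ≤ c := min_le_left _ _
    nlinarith [sq_nonneg r]
  calc (1 + r) ^ N * exp (-(c * r ^ 2))
      ≤ (4 ^ N * N.factorial * (1 / d) ^ N * exp (d * (1 + r ^ 2))) *
        exp (-(c * r ^ 2)) := by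
          gcongr
          exact h2.trans (h3.le.trans (by gcongr))
    _ = 4 ^ N * N.factorial * (1 / d) ^ N * (exp (d * (1 + r ^ 2)) * exp (-(c * r ^ 2))) := by ring
    _ ≤ _ := by gcongr

lemma contDiff_exp_neg_sq {E : Type} [NormedAddCommGroup E] [InnerProductSpace ℝ E] (c : ℝ) :
    ContDiff ℝ ∞ (fun x : E => exp (-(c * ‖x‖ ^ 2))) :=
  ((contDiff_const.mul (contDiff_norm_sq ℝ)).neg).exp

/-- A Gaussian times a function of temperate growth decays rapidly, with all its derivatives. -/
lemma exists_iteratedFDeriv_gaussian_smul_le {E : Type} [NormedAddCommGroup E]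
    [InnerProductSpace ℝ E] {c : ℝ} (hc : 0 < c) (k : ℕ) :
    ∀ {F : Type} [NormedAddCommGroup F] [NormedSpace ℝ F] {P : E → F},
    P.HasTemperateGrowth → ∀ N : ℕ, ∃ C, ∀ x,
      ‖x‖ ^ N * ‖iteratedFDeriv ℝ k (fun x => exp (-(c * ‖x‖ ^ 2)) • P x) x‖ ≤ C := by
  induction k with
  | zero =>
    intro F _ _ P hP N
    obtain ⟨j, C, h⟩ := hP.2 0
    obtain ⟨D, hD⟩ := exists_pow_mul_exp_le (N + j) hc
    refine ⟨|C| * D, fun x => ?_⟩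
    have h' : ‖P x‖ ≤ |C| * (1 + ‖x‖) ^ j := by
      have := h x
      rw [norm_iteratedFDeriv_zero] at this
      exact this.trans (by gcongr; exact le_abs_self C)
    rw [norm_iteratedFDeriv_zero, norm_smul, norm_of_nonneg (exp_pos _).le]
    have h2 : ‖x‖ ^ N ≤ (1 + ‖x‖) ^ N := by gcongr; linarith
    calc _ ≤ (1 + ‖x‖) ^ N * (exp (-(c * ‖x‖ ^ 2)) * (|C| * (1 + ‖x‖) ^ j)) := by gcongr
      _ = |C| * ((1 + ‖x‖) ^ (N + j) * exp (-(c * ‖x‖ ^ 2))) := by rw [pow_add]; ring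
      _ ≤ _ := by gcongr; exact hD _ (norm_nonneg _)
  | succ k ih =>
    intro F _ _ P hP N
    have hd : fderiv ℝ (fun x => exp (-(c * ‖x‖ ^ 2)) • P x) = fun x =>
        exp (-(c * ‖x‖ ^ 2)) • (fderiv ℝ P x +
          (-(2 * c)) • (ContinuousLinearMap.smulRightL ℝ E F (innerSL ℝ x) (P x))) := by
      funext x
      have h1 : HasFDerivAt (fun x : E => exp (-(c * ‖x‖ ^ 2))) _ x :=
        (((hasStrictFDerivAt_norm_sq x).hasFDerivAt.const_mul c).neg).exp
      have h2 := (hP.1.differentiable (by simp) x).hasFDerivAt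
      refine (h1.smul h2).fderiv.trans ?_
      ext v
      simp
      module
    have hT : Function.HasTemperateGrowth (fun x => fderiv ℝ P x +
          (-(2 * c)) • (ContinuousLinearMap.smulRightL ℝ E F (innerSL ℝ x) (P x))) := by
      refine (hasTemperateGrowth_fderiv hP).add ?_
      exact (Function.HasTemperateGrowth.const (-(2 * c))).smul
        (ContinuousLinearMap.bilinear_hasTemperateGrowth (𝕜 := ℝ)
          (ContinuousLinearMap.smulRightL ℝ E F) (innerSL ℝ).hasTemperateGrowth hP)
    obtain ⟨C, hC⟩ := ih hT N
    refine ⟨C, fun x => ?_⟩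
    rw [← norm_iteratedFDeriv_fderiv, hd]
    exact hC x

/-- Symbols of temperate growth that are positively homogeneous of degree `p`. -/
structure HomSymbol (p : ℕ) (P : Eu n → ℂ) : Prop where
  temperate : P.HasTemperateGrowth
  hom : ∀ c : ℝ, 0 < c → ∀ w, P (c • w) = (c : ℂ) ^ p * P w

namespace HomSymbol

variable {p q : ℕ} {P Q : Eu n → ℂ}

lemma mul (hP : HomSymbol p P) (hQ : HomSymbol q Q) : HomSymbol (p + q) (fun w => P w * Q w) :=
  ⟨hP.temperate.mul hQ.temperate, fun c hc w => by rw [hP.hom c hc, hQ.hom c hc, pow_add]; ring⟩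

lemma one : HomSymbol 0 (fun _ : Eu n => (1 : ℂ)) := ⟨.const 1, by simp⟩

lemma pow (hP : HomSymbol p P) (l : ℕ) : HomSymbol (p * l) (fun w => P w ^ l) := by
  induction l with
  | zero => simpa using one
  | succ l ih => simpa [pow_succ, mul_add] using ih.mul hP

lemma time : HomSymbol 2 (timeSymbol (n := n)) := by
  refine ⟨?_, fun c hc w => ?_⟩
  · have h1 : Function.HasTemperateGrowth (fun w : Eu n => -(4 * π ^ 2 * ‖w‖ ^ 2)) :=
      ((Function.HasTemperateGrowth.const _).mul (Function.hasTemperateGrowth_norm_sq _)).neg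
    exact ofRealCLM.hasTemperateGrowth.comp h1
  · simp only [timeSymbol, norm_smul, norm_of_nonneg hc.le]
    push_cast; ring

lemma dir (v : Eu n) : HomSymbol 1 (dirSymbol v) := by
  refine ⟨?_, fun c hc w => ?_⟩
  · have h1 : Function.HasTemperateGrowth (fun w : Eu n => 2 * π * inner ℝ w v) :=
      (Function.HasTemperateGrowth.const _).mul (Function.hasTemperateGrowth_inner_left v)
    exact (ofRealCLM.hasTemperateGrowth.comp h1).mul (.const _)
  · simp only [dirSymbol, inner_smul_left, conj_trivial]
    push_cast; ring

lemma multi (β : Fin n → ℕ) : HomSymbol (∑ j, β j) (multiSymbol β) := by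
  have key : ∀ s : Finset (Fin n), HomSymbol (∑ j ∈ s, β j)
      (fun w : Eu n => ∏ j ∈ s, dirSymbol (single j 1) w ^ β j) := by
    intro s
    induction s using induction_on with
    | empty => simpa using one
    | insert a s ha ih =>
      simp only [sum_insert ha, Finset.prod_insert ha]
      simpa using ((dir (single a 1)).pow (β a)).mul ih
  exact key _

lemma norm_le (hP : HomSymbol p P) : ∃ C, 0 ≤ C ∧ ∀ w, w ≠ 0 → ‖P w‖ ≤ C * ‖w‖ ^ p := by
  obtain ⟨C, hC⟩ := (isCompact_sphere (0 : Eu n) 1).exists_bound_of_continuousOn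
    hP.temperate.1.continuous.continuousOn
  refine ⟨|C|, abs_nonneg _, fun w hw => ?_⟩
  have hw' : 0 < ‖w‖ := norm_pos_iff.2 hw
  have h := hP.hom ‖w‖ hw' (‖w‖⁻¹ • w)
  rw [smul_smul, mul_inv_cancel₀ hw'.ne', one_smul] at h
  rw [h, norm_mul, norm_pow, norm_real, norm_norm, mul_comm]
  gcongr
  refine (hC _ ?_).trans (le_abs_self C)
  simp [norm_smul, hw'.ne']

def _root_.NSAsymp.quotSymbol (P : Eu n → ℂ) (w : Eu n) : ℂ := P w / ((4 * π ^ 2 * ‖w‖ ^ 2 : ℝ) : ℂ)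

lemma growth_quot (hP : HomSymbol (p + 1) P) : SymbolGrowth p (quotSymbol P) := by
  obtain ⟨C, hC0, hC⟩ := hP.norm_le
  refine ⟨?_, C, fun w => ?_⟩
  · refine Measurable.aestronglyMeasurable ?_
    exact hP.temperate.1.continuous.measurable.div (by fun_prop)
  · rw [quotSymbol, norm_div, norm_real, norm_of_nonneg (by positivity)]
    rcases eq_or_ne w 0 with rfl | hw
    · simp
    · have hw' : 0 < ‖w‖ := norm_pos_iff.2 hw
      rw [div_le_iff₀ (by positivity)]
      refine (hC w hw).trans ?_
      have : (1 : ℝ) ≤ 4 * π ^ 2 := by nlinarith [Real.pi_gt_three]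
      calc C * ‖w‖ ^ (p + 1) = C * (‖w‖⁻¹ * ‖w‖ ^ p) * (1 * ‖w‖ ^ 2) := by field_simp; ring
        _ ≤ _ := by gcongr

lemma neg_time_mul (hP : HomSymbol p P) : HomSymbol (p + 2) (fun w => -timeSymbol w * P w) := by
  have h : HomSymbol 2 (fun w : Eu n => -timeSymbol w) :=
    ⟨time.temperate.neg, fun c hc w => by rw [time.hom c hc]; ring⟩
  have := h.mul hP
  rwa [add_comm] at this

end HomSymbol

lemma ae_ne_zero (hn : 2 ≤ n) : ∀ᵐ w : Eu n, w ≠ 0 := by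
  have : Nonempty (Fin n) := ⟨⟨0, by omega⟩⟩
  have : Nontrivial (Eu n) := inferInstance
  exact Measure.ae_ne volume 0

lemma quotSymbol_neg_time_mul {w : Eu n} (hw : w ≠ 0) (P : Eu n → ℂ) :
    quotSymbol (fun w => -timeSymbol w * P w) w = P w := by
  have : ((4 * π ^ 2 * ‖w‖ ^ 2 : ℝ) : ℂ) ≠ 0 := by
    have := norm_pos_iff.2 hw
    exact_mod_cast (by positivity : (4 * π ^ 2 * ‖w‖ ^ 2 : ℝ) ≠ 0)
  rw [quotSymbol, timeSymbol, Complex.ofReal_neg, neg_neg, mul_div_assoc, mul_div_cancel₀ _ this]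

lemma heatMult_quot_neg_time_mul (hn : 2 ≤ n) (P : Eu n → ℂ) (t : ℝ) (x : Eu n) :
    heatMult (quotSymbol (fun w => -timeSymbol w * P w)) t x = heatMult P t x :=
  heatMult_congr (by
    filter_upwards [ae_ne_zero hn] with w hw using quotSymbol_neg_time_mul hw P) t x

lemma heatMult_eq_fourierInv (m : Eu n → ℂ) (t : ℝ) (x : Eu n) :
    heatMult m t x = 𝓕⁻ (fun w => (exp (-(4 * π ^ 2 * t * ‖w‖ ^ 2)) : ℝ) • m w) x := by
  rw [Real.fourierInv_eq', heatMult]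
  refine integral_congr_ae (.of_forall fun w => ?_)
  simp only [heatPhase, Complex.exp_add, real_smul, smul_eq_mul]
  push_cast
  ring_nf

lemma exists_heatMult_one_le {P : Eu n → ℂ} (hP : P.HasTemperateGrowth) (R : ℝ) :
    ∃ C, 0 ≤ C ∧ ∀ x, ‖heatMult P 1 x‖ ≤ C * (1 + ‖x‖ ^ 2) ^ (-R) := by
  have hc : (0 : ℝ) < 4 * π ^ 2 * 1 := by positivity
  let S : SchwartzMap (Eu n) ℂ :=
    ⟨fun w => (exp (-(4 * π ^ 2 * 1 * ‖w‖ ^ 2)) : ℝ) • P w,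
      (contDiff_exp_neg_sq _).smul hP.1,
      fun N k => exists_iteratedFDeriv_gaussian_smul_le hc k hP N⟩
  obtain ⟨k, hk⟩ := exists_nat_ge (2 * R)
  obtain ⟨C1, h1⟩ := (𝓕⁻ S).decay 0 0
  obtain ⟨C2, h2⟩ := (𝓕⁻ S).decay k 0
  have hC1 : 0 ≤ C1 := h1.1.le
  have hC2 : 0 ≤ C2 := h2.1.le
  refine ⟨2 ^ k * (C1 + C2), by positivity, fun x => ?_⟩
  have e : heatMult P 1 x = (𝓕⁻ S) x := by
    rw [heatMult_eq_fourierInv, SchwartzMap.fourierInv_coe]; rfl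
  have h1 := h1.2 x
  have h2 := h2.2 x
  rw [norm_iteratedFDeriv_zero, ← e] at h1 h2
  rw [pow_zero, one_mul] at h1
  rw [rpow_neg (by positivity), ← div_eq_mul_inv, le_div_iff₀ (by positivity)]
  have hx := norm_nonneg x
  have h3 : (1 + ‖x‖ ^ 2) ^ R ≤ (1 + ‖x‖) ^ k := by
    calc (1 + ‖x‖ ^ 2) ^ R ≤ (1 + ‖x‖ ^ 2) ^ ((k : ℝ) / 2) :=
          Real.rpow_le_rpow_of_exponent_le (by nlinarith) (by linarith)
      _ ≤ ((1 + ‖x‖) ^ 2) ^ ((k : ℝ) / 2) := by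
          gcongr
          nlinarith
      _ = _ := by
          rw [← rpow_natCast _ 2, ← rpow_mul (by positivity), ← rpow_natCast]
          congr 1; push_cast; ring
  have h4 : (1 + ‖x‖) ^ k ≤ 2 ^ k * (1 + ‖x‖ ^ k) := by
    rcases le_total ‖x‖ 1 with h | h
    · calc (1 + ‖x‖) ^ k ≤ 2 ^ k := pow_le_pow_left₀ (by positivity) (by linarith) k
        _ ≤ _ := le_mul_of_one_le_right (by positivity) (by linarith [pow_nonneg hx k])
    · calc (1 + ‖x‖) ^ k ≤ (2 * ‖x‖) ^ k := pow_le_pow_left₀ (by positivity) (by linarith) k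
        _ = 2 ^ k * ‖x‖ ^ k := mul_pow _ _ _
        _ ≤ _ := by gcongr; linarith
  calc ‖heatMult P 1 x‖ * (1 + ‖x‖ ^ 2) ^ R
      ≤ ‖heatMult P 1 x‖ * (2 ^ k * (1 + ‖x‖ ^ k)) := by gcongr; exact h3.trans h4
    _ = 2 ^ k * (‖heatMult P 1 x‖ + ‖x‖ ^ k * ‖heatMult P 1 x‖) := by ring
    _ ≤ _ := by gcongr

lemma heatMult_scaling {p : ℕ} {P : Eu n → ℂ} (hP : HomSymbol p P) {t : ℝ} (ht : 0 < t)
    (x : Eu n) : heatMult P t x =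
      ((t ^ (-((n : ℝ) + p) / 2) : ℝ) : ℂ) * heatMult P 1 ((sqrt t)⁻¹ • x) := by
  have hs : 0 < sqrt t := sqrt_pos.2 ht
  have hs2 : sqrt t ^ 2 = t := sq_sqrt ht.le
  have h := Measure.integral_comp_smul (volume : Measure (Eu n))
    (fun w => P w * heatPhase 1 ((sqrt t)⁻¹ • x) w) (sqrt t)
  rw [finrank_euclideanSpace_fin, abs_of_pos (by positivity)] at h
  have e : ∀ w, P (sqrt t • w) * heatPhase 1 ((sqrt t)⁻¹ • x) (sqrt t • w) =
      ((sqrt t : ℝ) : ℂ) ^ p * (P w * heatPhase t x w) := by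
    intro w
    rw [hP.hom _ hs, mul_assoc]
    congr 2
    simp only [heatPhase, norm_smul, inner_smul_left, inner_smul_right, norm_of_nonneg hs.le,
      mul_pow, hs2, conj_trivial]
    have e1 : -(4 * π ^ 2 * (t * ‖w‖ ^ 2)) * 1 = -(4 * π ^ 2 * ‖w‖ ^ 2) * t := by ring
    have e2 : 2 * π * ((sqrt t)⁻¹ * (sqrt t * inner ℝ w x)) =
        2 * π * inner ℝ w x := by
      rw [inv_mul_cancel_left₀ hs.ne']
    rw [e1, e2]
  simp_rw [e] at h
  rw [integral_const_mul] at h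
  change _ = _ • heatMult P 1 _ at h
  change _ * heatMult P t x = _ at h
  have e2 : t ^ (-((n : ℝ) + p) / 2) = (sqrt t ^ p)⁻¹ * (sqrt t ^ n)⁻¹ := by
    rw [← mul_inv, ← pow_add, sqrt_eq_rpow, ← rpow_natCast, ← rpow_mul ht.le, ← rpow_neg ht.le]
    congr 1; push_cast; ring
  rw [e2, Complex.ofReal_mul, mul_assoc, ← real_smul (x := (sqrt t ^ n)⁻¹), ← h]
  push_cast
  rw [inv_mul_cancel_left₀]
  exact pow_ne_zero _ (by exact_mod_cast hs.ne')

/-- Pointwise decay of the derivatives of the heat kernel. -/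
lemma exists_heatMult_le {p : ℕ} {P : Eu n → ℂ} (hP : HomSymbol p P) (r : ℝ) :
    ∃ C, 0 ≤ C ∧ ∀ (t : ℝ) (x : Eu n), 0 < t →
      ‖heatMult P t x‖ ≤ C * t ^ r * (t + ‖x‖ ^ 2) ^ (-((n : ℝ) + p) / 2 - r) := by
  obtain ⟨C, hC0, hC⟩ := exists_heatMult_one_le hP.temperate (((n : ℝ) + p) / 2 + r)
  refine ⟨C, hC0, fun t x ht => ?_⟩
  rw [heatMult_scaling hP ht, norm_mul, norm_real, norm_of_nonneg (by positivity)]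
  have e : 1 + ‖(sqrt t)⁻¹ • x‖ ^ 2 = t⁻¹ * (t + ‖x‖ ^ 2) := by
    rw [norm_smul, mul_pow, norm_inv, inv_pow, norm_of_nonneg (sqrt_nonneg _), sq_sqrt ht.le]
    field_simp
  have h := hC ((sqrt t)⁻¹ • x)
  rw [e, mul_rpow (by positivity) (by positivity), inv_rpow ht.le, ← rpow_neg ht.le, neg_neg] at h
  calc _ ≤ t ^ (-((n : ℝ) + p) / 2) * (C * (t ^ (((n : ℝ) + p) / 2 + r) *
        (t + ‖x‖ ^ 2) ^ (-(((n : ℝ) + p) / 2 + r)))) := by gcongr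
    _ = C * (t ^ (-((n : ℝ) + p) / 2) * t ^ (((n : ℝ) + p) / 2 + r)) *
        (t + ‖x‖ ^ 2) ^ (-(((n : ℝ) + p) / 2 + r)) := by ring
    _ = _ := by
      rw [← rpow_add ht]; congr 2
      · congr 1; ring
      · ring

lemma tendsto_heatMult_atTop (hn : 2 ≤ n) {m : Eu n → ℂ} {k : ℕ} (hm : SymbolGrowth k m)
    (x : Eu n) : Tendsto (fun t => heatMult m t x) atTop (𝓝 0) := by
  have h : Tendsto (fun t => ∫ w, m w * heatPhase t x w) atTop (𝓝 (∫ _ : Eu n, (0 : ℂ))) := by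
    refine tendsto_integral_filter_of_dominated_convergence
      (fun w => ‖m w‖ * exp (-(4 * π ^ 2 * 1) * ‖w‖ ^ 2))
      (.of_forall fun t => hm.1.mul (continuous_heatPhase t x).aestronglyMeasurable)
      ?_ (hm.integrable_norm_mul hn (by positivity)) ?_
    · filter_upwards [eventually_ge_atTop 1] with t ht
      refine .of_forall fun w => ?_
      rw [norm_mul, norm_heatPhase]
      gcongr
    · filter_upwards [ae_ne_zero hn] with w hw
      have hw' := norm_pos_iff.2 hw
      rw [tendsto_zero_iff_norm_tendsto_zero]
      simp_rw [norm_mul, norm_heatPhase]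
      rw [← mul_zero ‖m w‖]
      refine Tendsto.const_mul _ (Real.tendsto_exp_atBot.comp ?_)
      have : (fun t : ℝ => -(4 * π ^ 2 * t) * ‖w‖ ^ 2) =
          fun t => (-(4 * π ^ 2 * ‖w‖ ^ 2)) * t := by funext t; ring
      rw [this]
      exact tendsto_id.const_mul_atTop_of_neg (by
        have : 0 < 4 * π ^ 2 * ‖w‖ ^ 2 := by positivity
        linarith)
  rw [integral_zero] at h
  exact h

lemma integral_Ioi_add_rpow {t a e : ℝ} (hta : 0 < t + a) (he : 1 < e) :
    ∫ s in Ioi t, (s + a) ^ (-e) = (t + a) ^ (1 - e) / (e - 1) := by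
  have hd : ∀ s ∈ Ici t, HasDerivAt (fun s => (s + a) ^ (1 - e) / (1 - e)) ((s + a) ^ (-e)) s := by
    intro s hs
    have hs' : s + a ≠ 0 := by have : t ≤ s := hs; linarith
    have h := ((((hasDerivAt_id s).add_const a).rpow_const (p := 1 - e) (Or.inl hs'))).div_const
      (1 - e)
    refine h.congr_deriv ?_
    have : 1 - e ≠ 0 := by linarith
    simp only [id]
    rw [show 1 - e - 1 = -e by ring]
    field_simp
  rw [integral_Ioi_of_hasDerivAt_of_tendsto' (m := 0) hd
    (integrableOn_add_rpow_Ioi_of_lt (by linarith) (by linarith))]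
  · rw [zero_sub, ← neg_sub e 1, div_neg, neg_neg]
  · rw [← zero_div (1 - e)]
    refine Tendsto.div_const ?_ _
    have := (tendsto_rpow_neg_atTop (show 0 < e - 1 by linarith)).comp
      (tendsto_atTop_add_const_right atTop a tendsto_id)
    refine this.congr fun s => ?_
    simp

/-- Pointwise decay of the kernels with symbol `P(ξ) |ξ|^{-2} exp (-t |ξ|²)`. -/
lemma exists_heatMult_quot_le (hn : 2 ≤ n) {p : ℕ} {P : Eu n → ℂ} (hp : 1 ≤ p)
    (hP : HomSymbol p P) :
    ∃ C, 0 ≤ C ∧ ∀ (t : ℝ) (x : Eu n), 0 < t →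
      ‖heatMult (quotSymbol P) t x‖ ≤ C * (t + ‖x‖ ^ 2) ^ (-((n : ℝ) + p - 2) / 2) := by
  obtain ⟨C, hC0, hC⟩ := exists_heatMult_le hP 0
  have he : 1 < ((n : ℝ) + p) / 2 := by
    have : (2 : ℝ) ≤ n := by exact_mod_cast hn
    have : (1 : ℝ) ≤ p := by exact_mod_cast hp
    linarith
  refine ⟨C / (((n : ℝ) + p) / 2 - 1), div_nonneg hC0 (by linarith), fun t x ht => ?_⟩
  obtain ⟨q, rfl⟩ : ∃ q, p = q + 1 := ⟨p - 1, by omega⟩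
  have hg := hP.growth_quot
  have hd : ∀ s ∈ Ici t, HasDerivAt (fun s => heatMult (quotSymbol P) s x) (-heatMult P s x) s := by
    intro s hs
    have hs' : 0 < s := lt_of_lt_of_le ht hs
    refine (hasDerivAt_heatMult_time hn hg hs' x).congr_deriv ?_
    rw [← heatMult_quot_neg_time_mul hn P, ← neg_one_mul, ← heatMult_const_mul]
    congr 1
    funext w
    simp only [quotSymbol]
    ring
  have hb : ∀ s ∈ Ioi t, ‖-heatMult P s x‖ ≤ C * (s + ‖x‖ ^ 2) ^ (-(((n : ℝ) + (q + 1 : ℕ)) / 2)) := by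
    intro s hs
    have := hC s x (ht.trans hs)
    rw [norm_neg]
    refine this.trans (le_of_eq ?_)
    rw [rpow_zero, mul_one]
    congr 2; ring
  have hbi : IntegrableOn (fun s => C * (s + ‖x‖ ^ 2) ^ (-(((n : ℝ) + (q + 1 : ℕ)) / 2))) (Ioi t) :=
    (integrableOn_add_rpow_Ioi_of_lt (by linarith) (by nlinarith [sq_nonneg ‖x‖])).const_mul C
  have hmeas : AEStronglyMeasurable (fun s => -heatMult P s x) (volume.restrict (Ioi t)) := by
    refine ContinuousOn.aestronglyMeasurable ?_ measurableSet_Ioi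
    have h2 : ContinuousOn (fun s => heatMult (quotSymbol (fun w => -timeSymbol w * P w)) s x)
        (Ioi t) := fun s hs => (hasDerivAt_heatMult_time hn (hP.neg_time_mul.growth_quot)
          (ht.trans hs) x).continuousAt.continuousWithinAt
    simp_rw [heatMult_quot_neg_time_mul hn] at h2
    exact h2.neg
  have hi : IntegrableOn (fun s => -heatMult P s x) (Ioi t) :=
    hbi.mono' hmeas ((ae_restrict_iff' measurableSet_Ioi).2 (.of_forall hb))
  have h := integral_Ioi_of_hasDerivAt_of_tendsto' hd hi (tendsto_heatMult_atTop hn hg x)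
  rw [zero_sub] at h
  rw [← norm_neg, ← h]
  refine (norm_integral_le_of_norm_le hbi
    ((ae_restrict_iff' measurableSet_Ioi).2 (.of_forall hb))).trans (le_of_eq ?_)
  rw [integral_const_mul, integral_Ioi_add_rpow (by positivity) he]
  rw [show 1 - ((n : ℝ) + (q + 1 : ℕ)) / 2 = -((n : ℝ) + (q + 1 : ℕ) - 2) / 2 by ring]
  ring

lemma norm_sub_taylor_le (N : ℕ) (F : ℕ → ℝ → ℂ) {B : ℝ}
    (hF : ∀ b ≤ N, ∀ θ ∈ Icc (0 : ℝ) 1, HasDerivAt (F b) (F (b + 1) θ) θ)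
    (hB : ∀ θ ∈ Icc (0 : ℝ) 1, ‖F (N + 1) θ‖ ≤ B) :
    ∀ θ ∈ Icc (0 : ℝ) 1,
      ‖F 0 θ - ∑ b ∈ Finset.range (N + 1), (θ : ℂ) ^ b / (b.factorial : ℂ) * F b 0‖ ≤ B := by
  have hB0 : 0 ≤ B := (norm_nonneg _).trans (hB 0 (by simp))
  have step : ∀ (g g' : ℝ → ℂ), g 0 = 0 → (∀ θ ∈ Icc (0 : ℝ) 1, HasDerivAt g (g' θ) θ) →
      (∀ θ ∈ Icc (0 : ℝ) 1, ‖g' θ‖ ≤ B) → ∀ θ ∈ Icc (0 : ℝ) 1, ‖g θ‖ ≤ B := by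
    intro g g' h0 hd hb θ hθ
    have := (convex_Icc (0 : ℝ) 1).norm_image_sub_le_of_norm_hasDerivWithin_le
      (fun x hx => (hd x hx).hasDerivWithinAt) hb (x := 0) (by simp) hθ
    rw [h0, sub_zero, sub_zero, norm_of_nonneg hθ.1] at this
    exact this.trans (mul_le_of_le_one_right hB0 hθ.2)
  induction N generalizing F with
  | zero =>
    refine step _ (F 1) (by simp) (fun θ hθ => ?_) hB
    simpa using (hF 0 le_rfl θ hθ).sub_const (F 0 0)
  | succ N ih =>
    refine step _ (fun θ => F 1 θ - ∑ b ∈ Finset.range (N + 1),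
      (θ : ℂ) ^ b / (b.factorial : ℂ) * F (b + 1) 0) ?_ (fun θ hθ => ?_) ?_
    · rw [sum_range_succ']; simp
    · refine (hF 0 (by omega) θ hθ).sub ?_
      have h : ∀ b ∈ Finset.range (N + 1 + 1), HasDerivAt
          (fun θ : ℝ => (θ : ℂ) ^ b / (b.factorial : ℂ) * F b 0)
          ((b : ℂ) * (θ : ℂ) ^ (b - 1) / (b.factorial : ℂ) * F b 0) θ := by
        intro b _
        have h1 := ((hasDerivAt_id (θ : ℂ)).pow b).comp_ofReal
        simpa using (h1.div_const (b.factorial : ℂ)).mul_const (F b 0)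
      refine (HasDerivAt.fun_sum h).congr_deriv ?_
      rw [sum_range_succ']
      simp only [Nat.cast_zero, zero_mul, zero_div, add_zero, Nat.add_sub_cancel]
      refine sum_congr rfl fun b _ => ?_
      rw [Nat.factorial_succ]
      push_cast
      have h1 : (b : ℂ) + 1 ≠ 0 := by exact_mod_cast Nat.succ_ne_zero b
      have h2 : (b.factorial : ℂ) ≠ 0 := by exact_mod_cast Nat.factorial_ne_zero b
      field_simp
    · exact ih (fun b => F (b + 1)) (fun b hb => hF (b + 1) (by omega)) hB

lemma dirSymbol_pow_eq (v w : Eu n) (b : ℕ) :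
    dirSymbol v w ^ b = ∑ β ∈ multiIndices n b,
      (((Nat.multinomial Finset.univ β : ℝ) * ∏ j, v j ^ β j : ℝ) : ℂ) * multiSymbol β w := by
  rw [dirSymbol_eq_sum, Finset.sum_pow_eq_sum_piAntidiag, multiIndices]
  refine sum_congr rfl fun β _ => ?_
  simp only [mul_pow, Finset.prod_mul_distrib, multiSymbol]
  push_cast
  ring

lemma heatMult_dir_pow (hn : 2 ≤ n) {m : Eu n → ℂ} {k : ℕ} (hm : SymbolGrowth k m) (l b : ℕ)
    (v : Eu n) {t : ℝ} (ht : 0 < t) (x : Eu n) :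
    heatMult (fun w => timeSymbol w ^ l * (dirSymbol v w ^ b * m w)) t x =
      ∑ β ∈ multiIndices n b,
        (((Nat.multinomial Finset.univ β : ℝ) * ∏ j, v j ^ β j : ℝ) : ℂ) *
        heatMult (fun w => timeSymbol w ^ l * (multiSymbol β w * m w)) t x := by
  simp_rw [dirSymbol_pow_eq, ← heatMult_const_mul]
  rw [← heatMult_sum hn (k := fun β => k + ∑ j, β j + 2 * l + 0) _ (fun β _ =>
    ((hm.multiSymbol_mul β).timeSymbol_pow_mul l).mul (g := fun _ =>
      (((Nat.multinomial Finset.univ β : ℝ) * ∏ j, v j ^ β j : ℝ) : ℂ))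
      (by fun_prop) (fun w => by rw [pow_zero, mul_one])) ht]
  congr 1
  funext w
  rw [sum_mul, mul_sum]
  exact sum_congr rfl fun β _ => by ring

lemma sum_of_mem_multiIndices {b : ℕ} {β : Fin n → ℕ} (h : β ∈ multiIndices n b) :
    ∑ j, β j = b := by
  simpa [multiIndices] using h

lemma abs_prod_pow_le (v : Eu n) (β : Fin n → ℕ) : |∏ j, v j ^ β j| ≤ ‖v‖ ^ (∑ j, β j) := by
  rw [Finset.abs_prod, ← Finset.prod_pow_eq_pow_sum]
  refine Finset.prod_le_prod (fun j _ => abs_nonneg _) fun j _ => ?_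
  rw [abs_pow]
  gcongr
  simpa using PiLp.norm_apply_le v j

lemma abs_negPow_le (y : Eu n) (β : Fin n → ℕ) : |negPow β y| ≤ ‖y‖ ^ (∑ j, β j) := by
  have := abs_prod_pow_le (-y) β
  simpa [negPow] using this

lemma multinomial_mul_div_factorial {b : ℕ} {β : Fin n → ℕ} (h : β ∈ multiIndices n b) :
    (Nat.multinomial Finset.univ β : ℝ) / b.factorial = 1 / multiFactorial β := by
  have h1 := Nat.multinomial_spec Finset.univ β
  rw [sum_of_mem_multiIndices h] at h1
  have h2 : multiFactorial β * (Nat.multinomial Finset.univ β : ℝ) = b.factorial := by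
    rw [multiFactorial]; exact_mod_cast h1
  have h3 : (b.factorial : ℝ) ≠ 0 := by positivity
  have h4 : multiFactorial β ≠ 0 := by unfold multiFactorial; positivity
  rw [div_eq_div_iff h3 h4, ← h2]; ring

lemma HomSymbol.exists_multi_le (hn : 2 ≤ n) {p : ℕ} {P : Eu n → ℂ} (hp : 1 ≤ p)
    (hP : HomSymbol p P) (l : ℕ) (β : Fin n → ℕ) :
    ∃ C, 0 ≤ C ∧ ∀ (t : ℝ) (x : Eu n), 0 < t →
      ‖heatMult (fun w => timeSymbol w ^ l * (multiSymbol β w * quotSymbol P w)) t x‖ ≤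
        C * (t + ‖x‖ ^ 2) ^ (-((n : ℝ) + p - 2 + 2 * l + (∑ j, β j : ℕ)) / 2) := by
  obtain ⟨C, hC0, hC⟩ := exists_heatMult_quot_le hn (p := 2 * l + (∑ j, β j + p)) (by omega)
    ((HomSymbol.time.pow l).mul ((HomSymbol.multi β).mul hP))
  refine ⟨C, hC0, fun t x ht => ?_⟩
  have e : (fun w => timeSymbol w ^ l * (multiSymbol β w * quotSymbol P w)) =
      quotSymbol (fun w => timeSymbol w ^ l * (multiSymbol β w * P w)) := by
    funext w; simp only [quotSymbol]; ring
  rw [e]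
  refine (hC t x ht).trans (le_of_eq ?_)
  congr 2
  push_cast
  ring

lemma HomSymbol.exists_dir_le (hn : 2 ≤ n) {p : ℕ} {P : Eu n → ℂ} (hp : 1 ≤ p)
    (hP : HomSymbol p P) (l b : ℕ) :
    ∃ C, 0 ≤ C ∧ ∀ (v : Eu n) (t : ℝ) (x : Eu n), 0 < t →
      ‖heatMult (fun w => timeSymbol w ^ l * (dirSymbol v w ^ b * quotSymbol P w)) t x‖ ≤
        C * ‖v‖ ^ b * (t + ‖x‖ ^ 2) ^ (-((n : ℝ) + p - 2 + 2 * l + b) / 2) := by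
  choose C hC0 hC using fun β => hP.exists_multi_le hn hp l β
  obtain ⟨q, rfl⟩ : ∃ q, p = q + 1 := ⟨p - 1, by omega⟩
  refine ⟨∑ β ∈ multiIndices n b, (Nat.multinomial Finset.univ β : ℝ) * C β,
    sum_nonneg fun β _ => mul_nonneg (by positivity) (hC0 β), fun v t x ht => ?_⟩
  rw [heatMult_dir_pow hn hP.growth_quot l b v ht, sum_mul, sum_mul]
  refine (norm_sum_le _ _).trans (sum_le_sum fun β hβ => ?_)
  have h1 := hC β t x ht
  have h2 := abs_prod_pow_le v β
  rw [sum_of_mem_multiIndices hβ] at h1 h2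
  rw [norm_mul, norm_real, norm_mul, norm_of_nonneg (Nat.cast_nonneg _), norm_eq_abs]
  calc _ ≤ (Nat.multinomial Finset.univ β : ℝ) * ‖v‖ ^ b *
        (C β * (t + ‖x‖ ^ 2) ^ (-((n : ℝ) + (q + 1 : ℕ) - 2 + 2 * l + b) / 2)) := by gcongr
    _ = _ := by ring

/-- The parabolic Taylor polynomial of order `N` in `(s, y)` of the kernel
`K(t - s, x - y)`, `K` having the symbol `P(ξ) |ξ|^{-2} exp (-t |ξ|²)`. -/
def kernelTaylor (P : Eu n → ℂ) (N : ℕ) (t : ℝ) (x : Eu n) (s : ℝ) (y : Eu n) : ℂ :=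
  ∑ m ∈ Finset.range (N + 1), ∑ l ∈ Finset.range (m / 2 + 1), ∑ β ∈ multiIndices n (m - 2 * l),
    (((-s) ^ l * negPow β y / ((l.factorial : ℝ) * multiFactorial β) : ℝ) : ℂ) *
      heatMult (fun w => timeSymbol w ^ l * (multiSymbol β w * quotSymbol P w)) t x

lemma sum_range_parabolic {M : Type*} [AddCommMonoid M] (N : ℕ) (f : ℕ → ℕ → M) :
    ∑ m ∈ Finset.range (N + 1), ∑ l ∈ Finset.range (m / 2 + 1), f l (m - 2 * l) =
      ∑ l ∈ Finset.range (N / 2 + 1), ∑ b ∈ Finset.range (N - 2 * l + 1), f l b := by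
  rw [sum_sigma', sum_sigma']
  refine Finset.sum_bij' (fun a _ => ⟨a.2, a.1 - 2 * a.2⟩) (fun a _ => ⟨a.2 + 2 * a.1, a.1⟩)
    ?_ ?_ ?_ ?_ ?_
  · rintro ⟨m, l⟩ h
    simp only [mem_sigma, Finset.mem_range] at h ⊢
    omega
  · rintro ⟨l, b⟩ h
    simp only [mem_sigma, Finset.mem_range] at h ⊢
    omega
  · rintro ⟨m, l⟩ h
    simp only [mem_sigma, Finset.mem_range] at h
    simp only [Sigma.mk.injEq, heq_eq_eq, and_true]
    omega
  · rintro ⟨l, b⟩ h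
    simp
  · rintro ⟨m, l⟩ h
    rfl

lemma kernelTaylor_eq (hn : 2 ≤ n) {p : ℕ} {P : Eu n → ℂ} (hP : HomSymbol (p + 1) P) (N : ℕ)
    {t : ℝ} (ht : 0 < t) (x : Eu n) (s : ℝ) (y : Eu n) :
    kernelTaylor P N t x s y = ∑ l ∈ Finset.range (N / 2 + 1), ((-s : ℝ) : ℂ) ^ l / (l.factorial : ℂ) *
      ∑ b ∈ Finset.range (N - 2 * l + 1), 1 / (b.factorial : ℂ) *
        heatMult (fun w => timeSymbol w ^ l * (dirSymbol (-y) w ^ b * quotSymbol P w)) t x := by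
  rw [kernelTaylor, sum_range_parabolic N (fun l b => ∑ β ∈ multiIndices n b,
    (((-s) ^ l * negPow β y / ((l.factorial : ℝ) * multiFactorial β) : ℝ) : ℂ) *
      heatMult (fun w => timeSymbol w ^ l * (multiSymbol β w * quotSymbol P w)) t x)]
  refine sum_congr rfl fun l _ => ?_
  rw [mul_sum]
  refine sum_congr rfl fun b _ => ?_
  rw [heatMult_dir_pow hn hP.growth_quot l b (-y) ht, mul_sum, mul_sum]
  refine sum_congr rfl fun β hβ => ?_
  rw [← mul_assoc, ← mul_assoc]
  congr 1
  have h : (((-s) ^ l * negPow β y / ((l.factorial : ℝ) * multiFactorial β) : ℝ)) =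
      (-s) ^ l / l.factorial * (1 / b.factorial *
        ((Nat.multinomial Finset.univ β : ℝ) * ∏ j, (-y) j ^ β j)) := by
    have h1 := multinomial_mul_div_factorial hβ
    calc _ = (-s) ^ l / l.factorial * (1 / multiFactorial β * negPow β y) := by
          rw [div_mul_eq_mul_div, mul_comm (1 / multiFactorial β), mul_one_div, mul_div_assoc',
            div_div, mul_comm (multiFactorial β)]
      _ = _ := by
        rw [← h1]
        simp only [negPow, PiLp.neg_apply]
        ring
  rw [h]
  push_cast
  ring

/-- The kernel `(t + |z|²)^{-(n+1)/2}`. -/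
def decayKernel (t : ℝ) (z : Eu n) : ℝ := (t + ‖z‖ ^ 2) ^ (-((n : ℝ) + 1) / 2)

lemma decayKernel_nonneg {t : ℝ} (ht : 0 ≤ t) (z : Eu n) : 0 ≤ decayKernel t z := by
  unfold decayKernel; positivity

lemma pow_mul_pow_le_rpow {s : ℝ} (hs : 0 ≤ s) (y : Eu n) (l b : ℕ) :
    s ^ l * ‖y‖ ^ b ≤ (s + ‖y‖ ^ 2) ^ ((2 * l + b : ℝ) / 2) := by
  have h0 : 0 ≤ s + ‖y‖ ^ 2 := by positivity
  have h1 : s ^ l ≤ (s + ‖y‖ ^ 2) ^ (l : ℝ) := by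
    rw [rpow_natCast]; gcongr; nlinarith [sq_nonneg ‖y‖]
  have h2 : ‖y‖ ^ b ≤ (s + ‖y‖ ^ 2) ^ ((b : ℝ) / 2) := by
    calc ‖y‖ ^ b = (‖y‖ ^ 2) ^ ((b : ℝ) / 2) := by
          rw [← rpow_natCast ‖y‖ 2, ← rpow_mul (norm_nonneg _), ← rpow_natCast]
          congr 1; push_cast; ring
      _ ≤ _ := by gcongr; linarith
  calc _ ≤ (s + ‖y‖ ^ 2) ^ (l : ℝ) * (s + ‖y‖ ^ 2) ^ ((b : ℝ) / 2) := by gcongr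
    _ = _ := by
      rw [← Real.rpow_add_of_nonneg h0 (by positivity) (by positivity)]
      congr 1; ring

lemma rpow_mul_rpow_le_of_le {σ ρ e e₀ d K : ℝ} (hσ : 0 ≤ σ) (hρ : 0 < ρ) (he₀ : 0 < e₀)
    (hee : e₀ ≤ e) (hle : σ ≤ K * ρ) (hK : 0 ≤ K) :
    σ ^ e * ρ ^ (-(d + e)) ≤ K ^ (e - e₀) * (σ ^ e₀ * ρ ^ (-(d + e₀))) := by
  have h1 : σ ^ e = σ ^ e₀ * σ ^ (e - e₀) := by
    rw [← Real.rpow_add_of_nonneg hσ he₀.le (by linarith)]; congr 1; ring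
  have h2 : σ ^ (e - e₀) ≤ K ^ (e - e₀) * ρ ^ (e - e₀) := by
    rw [← mul_rpow hK hρ.le]
    exact rpow_le_rpow hσ hle (by linarith)
  have h3 : ρ ^ (-(d + e₀)) = ρ ^ (e - e₀) * ρ ^ (-(d + e)) := by rw [← rpow_add hρ]; congr 1; ring
  rw [h1, h3]
  calc σ ^ e₀ * σ ^ (e - e₀) * ρ ^ (-(d + e)) ≤
        σ ^ e₀ * (K ^ (e - e₀) * ρ ^ (e - e₀)) * ρ ^ (-(d + e)) := by gcongr
    _ = _ := by ring

lemma parabolic_near {t s θ : ℝ} {x y z : Eu n} (hs : 0 ≤ s) (ht : 0 < t) (hθ : θ ∈ Icc (0 : ℝ) 1)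
    (h : 8 * (s + ‖y‖ ^ 2) ≤ t + ‖x‖ ^ 2) (hz : ‖z - x‖ ≤ ‖y‖) :
    (t + ‖x‖ ^ 2) / 4 ≤ t - θ * s + ‖z‖ ^ 2 := by
  have h1 : ‖x‖ ≤ ‖z‖ + ‖y‖ := by
    have : x = z - (z - x) := by abel
    calc ‖x‖ = ‖z - (z - x)‖ := by rw [← this]
      _ ≤ ‖z‖ + ‖z - x‖ := norm_sub_le _ _
      _ ≤ _ := by gcongr
  have h2 : ‖x‖ ^ 2 ≤ 2 * ‖z‖ ^ 2 + 2 * ‖y‖ ^ 2 := by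
    nlinarith [sq_nonneg (‖z‖ - ‖y‖), norm_nonneg x, norm_nonneg z, norm_nonneg y]
  have h3 : θ * s ≤ s := mul_le_of_le_one_left hs hθ.2
  nlinarith [sq_nonneg ‖x‖]

lemma rpow_neg_le_of_quarter_le {ρ ρ' e : ℝ} (hρ : 0 < ρ) (h : ρ / 4 ≤ ρ') (he : 0 ≤ e) :
    ρ' ^ (-e) ≤ 4 ^ e * ρ ^ (-e) := by
  calc ρ' ^ (-e) ≤ (ρ / 4) ^ (-e) :=
        rpow_le_rpow_of_nonpos (by positivity) h (by linarith)
    _ = _ := by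
      rw [div_eq_mul_inv, mul_rpow hρ.le (by positivity), inv_rpow (by positivity),
        ← rpow_neg (by positivity), neg_neg, mul_comm]

/-- The parabolic Taylor remainder for `s + |y|²` small compared with `t + |x|²`. -/
lemma HomSymbol.exists_taylor_near (hn : 2 ≤ n) {p : ℕ} {P : Eu n → ℂ} (hp : 1 ≤ p)
    (hP : HomSymbol p P) (N : ℕ) :
    ∃ C, 0 ≤ C ∧ ∀ (t s : ℝ) (x y : Eu n), 0 ≤ s → s < t → 8 * (s + ‖y‖ ^ 2) ≤ t + ‖x‖ ^ 2 →
      ‖heatMult (quotSymbol P) (t - s) (x - y) - kernelTaylor P N t x s y‖ ≤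
        C * ((s + ‖y‖ ^ 2) ^ (((N : ℝ) + 1) / 2) *
          (t + ‖x‖ ^ 2) ^ (-(((n : ℝ) + p - 2) / 2 + ((N : ℝ) + 1) / 2))) := by
  choose C hC0 hC using fun l b => hP.exists_dir_le hn hp l b
  obtain ⟨q, rfl⟩ : ∃ q, p = q + 1 := ⟨p - 1, by omega⟩
  have hg := hP.growth_quot
  set d : ℝ := (n : ℝ) + (q + 1 : ℕ) - 2 with hd
  have hd0 : 0 < d := by
    have : (2 : ℝ) ≤ n := by exact_mod_cast hn
    have : (0 : ℝ) ≤ q := Nat.cast_nonneg q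
    rw [hd]; push_cast; linarith
  set L := N / 2 with hL
  have hLN : ((N : ℝ) + 1) / 2 ≤ ((L + 1 : ℕ) : ℝ) := by
    have : N + 1 ≤ 2 * (L + 1) := by omega
    have : (N : ℝ) + 1 ≤ 2 * ((L + 1 : ℕ) : ℝ) := by exact_mod_cast this
    linarith
  set e₀ : ℝ := ((N : ℝ) + 1) / 2 with he₀
  have he₀0 : 0 < e₀ := by positivity
  refine ⟨C (L + 1) 0 * 4 ^ (d / 2 + ((L + 1 : ℕ) : ℝ)) +
    ∑ l ∈ Finset.range (L + 1), C l (N - 2 * l + 1) * 4 ^ (d / 2 + e₀), ?_, ?_⟩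
  · refine add_nonneg (mul_nonneg (hC0 _ _) (by positivity)) (sum_nonneg fun l _ =>
      mul_nonneg (hC0 _ _) (by positivity))
  intro t s x y hs hst hnear
  have ht : 0 < t := lt_of_le_of_lt hs hst
  set ρ := t + ‖x‖ ^ 2 with hρ
  set σ := s + ‖y‖ ^ 2 with hσ
  have hρ0 : 0 < ρ := by positivity
  have hσ0 : 0 ≤ σ := by positivity
  set K : ℕ → ℕ → ℝ → Eu n → ℂ := fun l b =>
    heatMult (fun w => timeSymbol w ^ l * (dirSymbol (-y) w ^ b * quotSymbol P w)) with hK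
  have hKg : ∀ l b, SymbolGrowth (q + b + 2 * l)
      (fun w => timeSymbol w ^ l * (dirSymbol (-y) w ^ b * quotSymbol P w)) :=
    fun l b => (hg.dirSymbol_pow_mul (-y) b).timeSymbol_pow_mul l
  -- expansion in time
  have h1 := norm_sub_taylor_le L (fun l θ => ((-s : ℝ) : ℂ) ^ l * K l 0 (t - θ * s) (x - y))
    (B := C (L + 1) 0 * 4 ^ (d / 2 + ((L + 1 : ℕ) : ℝ)) * (σ ^ e₀ * ρ ^ (-(d / 2 + e₀))))
    (fun l _ θ hθ => by
      have hpos : 0 < t - θ * s := by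
        have := mul_le_of_le_one_left hs hθ.2
        linarith
      have h := (hasDerivAt_heatMult_time hn (hKg l 0) hpos (x - y)).scomp θ
        (((hasDerivAt_id θ).mul_const s).const_sub t)
      refine (h.const_mul (((-s : ℝ) : ℂ) ^ l)).congr_deriv ?_
      simp only [hK, real_smul]
      rw [pow_succ]
      have e : (fun w => timeSymbol w * (timeSymbol w ^ l * (dirSymbol (-y) w ^ 0 * quotSymbol P w)))
        = fun w => timeSymbol w ^ (l + 1) * (dirSymbol (-y) w ^ 0 * quotSymbol P w) := by
        funext w; ring
      rw [e]
      push_cast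
      ring)
    (fun θ hθ => by
      have hpos : 0 < t - θ * s := by
        have := mul_le_of_le_one_left hs hθ.2
        linarith
      have hb := hC (L + 1) 0 (-y) (t - θ * s) (x - y) hpos
      rw [pow_zero, mul_one] at hb
      rw [norm_mul, norm_pow, norm_real, norm_neg, norm_of_nonneg hs]
      have hq := parabolic_near hs ht hθ hnear (z := x - y) (by simp)
      have hq2 := rpow_neg_le_of_quarter_le hρ0 hq
        (show 0 ≤ d / 2 + ((L + 1 : ℕ) : ℝ) by positivity)
      have hs1 : s ^ (L + 1) ≤ σ ^ ((L + 1 : ℕ) : ℝ) := by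
        rw [rpow_natCast]; gcongr; rw [hσ]; nlinarith [sq_nonneg ‖y‖]
      have hcmp := rpow_mul_rpow_le_of_le (d := d / 2) (K := 1) hσ0 hρ0 he₀0 hLN
        (by linarith) zero_le_one
      rw [Real.one_rpow, one_mul] at hcmp
      rw [show -(d + 2 * ((L + 1 : ℕ) : ℝ) + ((0 : ℕ) : ℝ)) / 2 = -(d / 2 + ((L + 1 : ℕ) : ℝ)) by
        push_cast; ring] at hb
      calc _ ≤ σ ^ ((L + 1 : ℕ) : ℝ) * (C (L + 1) 0 * (4 ^ (d / 2 + ((L + 1 : ℕ) : ℝ)) *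
            ρ ^ (-(d / 2 + ((L + 1 : ℕ) : ℝ))))) :=
            mul_le_mul hs1 (hb.trans (mul_le_mul_of_nonneg_left hq2 (hC0 _ _))) (norm_nonneg _)
              (by positivity)
        _ = C (L + 1) 0 * 4 ^ (d / 2 + ((L + 1 : ℕ) : ℝ)) *
            (σ ^ ((L + 1 : ℕ) : ℝ) * ρ ^ (-(d / 2 + ((L + 1 : ℕ) : ℝ)))) := by ring
        _ ≤ _ := mul_le_mul_of_nonneg_left hcmp (mul_nonneg (hC0 _ _) (by positivity)))
    1 (by simp)
  -- expansion in space
  have h2 : ∀ l ∈ Finset.range (L + 1), s ^ l * ‖K l 0 t (x - y) -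
      ∑ b ∈ Finset.range (N - 2 * l + 1), 1 / (b.factorial : ℂ) * K l b t x‖ ≤
      C l (N - 2 * l + 1) * 4 ^ (d / 2 + e₀) * (σ ^ e₀ * ρ ^ (-(d / 2 + e₀))) := by
    intro l hl
    set M := N - 2 * l with hM
    have hexp : (2 * l + ((M + 1 : ℕ) : ℝ)) / 2 = e₀ := by
      have : 2 * l + (M + 1) = N + 1 := by have := Finset.mem_range.1 hl; omega
      rw [he₀]
      congr 1
      exact_mod_cast this
    have h := norm_sub_taylor_le M (fun b θ => K l b t (x + θ • (-y)))
      (B := C l (M + 1) * ‖y‖ ^ (M + 1) * (4 ^ (d / 2 + e₀) * ρ ^ (-(d / 2 + e₀))))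
      (fun b _ θ _ => by
        refine (hasDerivAt_heatMult_line hn (hKg l b) ht x (-y) θ).congr_deriv ?_
        simp only [hK]
        congr 1
        funext w; ring)
      (fun θ hθ => by
        have hb := hC l (M + 1) (-y) t (x + θ • (-y)) ht
        rw [norm_neg] at hb
        have hq := parabolic_near (s := 0) (θ := 0) (y := y) (x := x) (z := x + θ • (-y)) le_rfl ht (by simp)
          (by linarith [hnear, hs]) (by
            rw [add_sub_cancel_left, norm_smul, norm_neg, norm_of_nonneg hθ.1]
            exact mul_le_of_le_one_left (norm_nonneg _) hθ.2)
        rw [zero_mul, sub_zero] at hq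
        have hq2 := rpow_neg_le_of_quarter_le hρ0 hq (show 0 ≤ d / 2 + e₀ by positivity)
        rw [show -(d + 2 * (l : ℝ) + ((M + 1 : ℕ) : ℝ)) / 2 = -(d / 2 + e₀) by
          rw [← hexp]; ring] at hb
        exact hb.trans (mul_le_mul_of_nonneg_left hq2 (mul_nonneg (hC0 _ _) (by positivity))))
      1 (by simp)
    have hsy := pow_mul_pow_le_rpow hs y l (M + 1)
    rw [hexp] at hsy
    simp only [one_smul, zero_smul, add_zero, Complex.ofReal_one, one_pow, ← sub_eq_add_neg] at h
    calc _ ≤ s ^ l * (C l (M + 1) * ‖y‖ ^ (M + 1) * (4 ^ (d / 2 + e₀) * ρ ^ (-(d / 2 + e₀)))) := by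
          gcongr
      _ = C l (M + 1) * 4 ^ (d / 2 + e₀) * ((s ^ l * ‖y‖ ^ (M + 1)) * ρ ^ (-(d / 2 + e₀))) := by ring
      _ ≤ _ := by
        refine mul_le_mul_of_nonneg_left ?_ (mul_nonneg (hC0 _ _) (by positivity))
        gcongr
  have e0 : K 0 0 (t - s) (x - y) = heatMult (quotSymbol P) (t - s) (x - y) := by simp [hK]
  rw [kernelTaylor_eq hn hP N ht, ← e0]
  simp only [pow_zero, Complex.ofReal_one, one_pow, zero_mul, sub_zero, one_mul] at h1
  have split : K 0 0 (t - s) (x - y) - ∑ l ∈ Finset.range (L + 1),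
      ((-s : ℝ) : ℂ) ^ l / (l.factorial : ℂ) *
        ∑ b ∈ Finset.range (N - 2 * l + 1), 1 / (b.factorial : ℂ) * K l b t x =
      (K 0 0 (t - s) (x - y) - ∑ l ∈ Finset.range (L + 1),
        1 / (l.factorial : ℂ) * (((-s : ℝ) : ℂ) ^ l * K l 0 t (x - y))) +
      ∑ l ∈ Finset.range (L + 1), ((-s : ℝ) : ℂ) ^ l / (l.factorial : ℂ) * (K l 0 t (x - y) -
        ∑ b ∈ Finset.range (N - 2 * l + 1), 1 / (b.factorial : ℂ) * K l b t x) := by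
    have : ∀ l, ((-s : ℝ) : ℂ) ^ l / (l.factorial : ℂ) * (K l 0 t (x - y) -
        ∑ b ∈ Finset.range (N - 2 * l + 1), 1 / (b.factorial : ℂ) * K l b t x) =
        1 / (l.factorial : ℂ) * (((-s : ℝ) : ℂ) ^ l * K l 0 t (x - y)) -
        ((-s : ℝ) : ℂ) ^ l / (l.factorial : ℂ) *
        ∑ b ∈ Finset.range (N - 2 * l + 1), 1 / (b.factorial : ℂ) * K l b t x := fun l => by ring
    simp_rw [this, sum_sub_distrib]
    ring
  change ‖K 0 0 (t - s) (x - y) - ∑ l ∈ Finset.range (L + 1),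
      ((-s : ℝ) : ℂ) ^ l / (l.factorial : ℂ) *
        ∑ b ∈ Finset.range (N - 2 * l + 1), 1 / (b.factorial : ℂ) * K l b t x‖ ≤ _
  rw [split, add_mul, sum_mul]
  refine (norm_add_le _ _).trans (add_le_add h1 ((norm_sum_le _ _).trans
    (sum_le_sum fun l hl => ?_)))
  refine le_trans ?_ (h2 l hl)
  rw [norm_mul, norm_div, norm_pow, norm_real, norm_neg, norm_of_nonneg hs, Complex.norm_natCast]
  gcongr
  exact div_le_self (by positivity) (by exact_mod_cast Nat.factorial_pos l)

lemma rpow_mul_rpow_le_of_ge {σ ρ e e₀ d K : ℝ} (hσ : 0 < σ) (hρ : 0 < ρ)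
    (hee : e ≤ e₀) (hle : ρ ≤ K * σ) (hK : 0 ≤ K) :
    σ ^ e * ρ ^ (-(d + e)) ≤ K ^ (e₀ - e) * (σ ^ e₀ * ρ ^ (-(d + e₀))) := by
  have h1 : σ ^ e₀ = σ ^ e * σ ^ (e₀ - e) := by rw [← rpow_add hσ]; congr 1; ring
  have h2 : ρ ^ (e₀ - e) ≤ K ^ (e₀ - e) * σ ^ (e₀ - e) := by
    rw [← mul_rpow hK hσ.le]
    exact rpow_le_rpow hρ.le hle (by linarith)
  have h3 : ρ ^ (-(d + e)) = ρ ^ (e₀ - e) * ρ ^ (-(d + e₀)) := by rw [← rpow_add hρ]; congr 1; ring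
  rw [h1, h3]
  calc _ ≤ σ ^ e * (K ^ (e₀ - e) * σ ^ (e₀ - e) * ρ ^ (-(d + e₀))) := by gcongr
    _ = _ := by ring

lemma HomSymbol.exists_kernelTaylor_far (hn : 2 ≤ n) {p : ℕ} {P : Eu n → ℂ} (hp : 1 ≤ p)
    (hP : HomSymbol p P) (N : ℕ) :
    ∃ C, 0 ≤ C ∧ ∀ (t s : ℝ) (x y : Eu n), 0 ≤ s → 0 < t → t + ‖x‖ ^ 2 ≤ 8 * (s + ‖y‖ ^ 2) →
      ‖kernelTaylor P N t x s y‖ ≤ C * ((s + ‖y‖ ^ 2) ^ (((N : ℝ) + 1) / 2) *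
          (t + ‖x‖ ^ 2) ^ (-(((n : ℝ) + p - 2) / 2 + ((N : ℝ) + 1) / 2))) := by
  choose C hC0 hC using fun l β => hP.exists_multi_le hn hp l β
  refine ⟨∑ m ∈ Finset.range (N + 1), ∑ l ∈ Finset.range (m / 2 + 1),
    ∑ β ∈ multiIndices n (m - 2 * l), C l β * 8 ^ (((N : ℝ) + 1) / 2 - (m : ℝ) / 2),
    sum_nonneg fun m _ => sum_nonneg fun l _ => sum_nonneg fun β _ =>
      mul_nonneg (hC0 _ _) (by positivity), fun t s x y hs ht hfar => ?_⟩
  set ρ := t + ‖x‖ ^ 2 with hρ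
  set σ := s + ‖y‖ ^ 2 with hσ
  have hρ0 : 0 < ρ := by positivity
  have hσ0 : 0 < σ := by linarith
  rw [kernelTaylor, sum_mul]
  refine (norm_sum_le _ _).trans (sum_le_sum fun m hm => ?_)
  rw [sum_mul]
  refine (norm_sum_le _ _).trans (sum_le_sum fun l hl => ?_)
  rw [sum_mul]
  refine (norm_sum_le _ _).trans (sum_le_sum fun β hβ => ?_)
  have hm' := Finset.mem_range.1 hm
  have hl' := Finset.mem_range.1 hl
  have h1 := hC l β t x ht
  have hc : (2 * (l : ℝ) + ((m - 2 * l : ℕ) : ℝ)) = m := by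
    have : 2 * l + (m - 2 * l) = m := by omega
    exact_mod_cast this
  rw [sum_of_mem_multiIndices hβ, show -((n : ℝ) + p - 2 + 2 * l + ((m - 2 * l : ℕ) : ℝ)) / 2 =
    -(((n : ℝ) + p - 2) / 2 + (m : ℝ) / 2) by rw [← hc]; ring] at h1
  have h2 := abs_negPow_le y β
  rw [sum_of_mem_multiIndices hβ] at h2
  have h3 := pow_mul_pow_le_rpow hs y l (m - 2 * l)
  rw [hc] at h3
  have h4 : |(-s) ^ l * negPow β y / ((l.factorial : ℝ) * multiFactorial β)| ≤
      σ ^ ((m : ℝ) / 2) := by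
    rw [abs_div, abs_mul, abs_pow, abs_neg, abs_of_nonneg hs]
    refine le_trans (div_le_self (by positivity) ?_) (le_trans (by gcongr) h3)
    have h5 : (1 : ℝ) ≤ multiFactorial β := by
      unfold multiFactorial
      exact_mod_cast Finset.prod_pos fun j _ => Nat.factorial_pos (β j)
    have h6 : (1 : ℝ) ≤ l.factorial := by exact_mod_cast Nat.factorial_pos l
    rw [abs_of_nonneg (by positivity)]
    nlinarith
  rw [norm_mul, norm_real, norm_eq_abs]
  have h5 := rpow_mul_rpow_le_of_ge (d := ((n : ℝ) + p - 2) / 2) (e := (m : ℝ) / 2)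
    (e₀ := ((N : ℝ) + 1) / 2) hσ0 hρ0 (by
      have : (m : ℝ) ≤ N := by exact_mod_cast (by omega : m ≤ N)
      linarith) hfar (by norm_num)
  calc _ ≤ σ ^ ((m : ℝ) / 2) * (C l β * ρ ^ (-(((n : ℝ) + p - 2) / 2 + (m : ℝ) / 2))) := by gcongr
    _ = C l β * (σ ^ ((m : ℝ) / 2) * ρ ^ (-(((n : ℝ) + p - 2) / 2 + (m : ℝ) / 2))) := by ring
    _ ≤ C l β * (8 ^ (((N : ℝ) + 1) / 2 - (m : ℝ) / 2) * (σ ^ (((N : ℝ) + 1) / 2) *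
        ρ ^ (-(((n : ℝ) + p - 2) / 2 + ((N : ℝ) + 1) / 2)))) :=
      mul_le_mul_of_nonneg_left h5 (hC0 _ _)
    _ = _ := by ring

/-- The weighted parabolic Taylor remainder of the kernel with symbol
`P(ξ) |ξ|^{-2} exp (-t |ξ|²)`, uniformly in all the variables. -/
lemma HomSymbol.exists_taylor (hn : 2 ≤ n) {p N : ℕ} {P : Eu n → ℂ} (hp : 1 ≤ p) (hp2 : p ≤ 2)
    (hP : HomSymbol p P) (hN : N + p = n + 2) :
    ∃ C, 0 ≤ C ∧ ∀ (t s : ℝ) (x y : Eu n), 0 ≤ s → s < t →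
      (t + ‖x‖ ^ 2) ^ ((n : ℝ) / 2) *
        ‖heatMult (quotSymbol P) (t - s) (x - y) - kernelTaylor P N t x s y‖ ≤
        C * ((s + ‖y‖ ^ 2) ^ (((N : ℝ) + 1) / 2) *
          (decayKernel (t - s) (x - y) + decayKernel t x)) := by
  obtain ⟨C₁, hC₁, h₁⟩ := hP.exists_taylor_near hn hp N
  obtain ⟨C₂, hC₂, h₂⟩ := hP.exists_kernelTaylor_far hn hp N
  obtain ⟨C₃, hC₃, h₃⟩ := exists_heatMult_quot_le hn hp hP
  have hNp : (N : ℝ) + p = n + 2 := by exact_mod_cast hN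
  have hp2' : (p : ℝ) ≤ 2 := by exact_mod_cast hp2
  set K : ℝ := 8 ^ ((n : ℝ) / 2) * 18 ^ ((3 - (p : ℝ)) / 2) with hK
  refine ⟨C₁ + C₂ + C₃ * K, by positivity, fun t s x y hs hst => ?_⟩
  have ht : 0 < t := lt_of_le_of_lt hs hst
  set ρ := t + ‖x‖ ^ 2 with hρ
  set σ := s + ‖y‖ ^ 2 with hσ
  have hρ0 : 0 < ρ := by positivity
  have hσ0 : 0 ≤ σ := by positivity
  have hJ1 : 0 ≤ decayKernel (t - s) (x - y) := decayKernel_nonneg (by linarith) _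
  have hJ2 : 0 ≤ decayKernel t x := decayKernel_nonneg ht.le _
  have eJ : ρ ^ ((n : ℝ) / 2) * ρ ^ (-(((n : ℝ) + p - 2) / 2 + ((N : ℝ) + 1) / 2)) =
      decayKernel t x := by
    rw [← rpow_add hρ0, decayKernel]
    congr 1
    linarith
  have hS : 0 ≤ σ ^ (((N : ℝ) + 1) / 2) := by positivity
  rcases le_total (8 * σ) ρ with h | h
  · calc _ ≤ ρ ^ ((n : ℝ) / 2) * (C₁ * (σ ^ (((N : ℝ) + 1) / 2) *
          ρ ^ (-(((n : ℝ) + p - 2) / 2 + ((N : ℝ) + 1) / 2)))) := by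
          gcongr
          exact h₁ t s x y hs hst h
      _ = C₁ * (σ ^ (((N : ℝ) + 1) / 2) * decayKernel t x) := by rw [← eJ]; ring
      _ ≤ (C₁ + C₂ + C₃ * K) * (σ ^ (((N : ℝ) + 1) / 2) *
          (decayKernel (t - s) (x - y) + decayKernel t x)) := by
          refine mul_le_mul ?_ ?_ (by positivity) (by positivity)
          · linarith [mul_nonneg hC₃ (by positivity : 0 ≤ K)]
          · gcongr; linarith
  · have hσ1 : 0 < σ := by linarith
    have hT := h₂ t s x y hs ht h
    have hts : 0 < t - s := by linarith
    have hk := h₃ (t - s) (x - y) hts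
    set ρ' := t - s + ‖x - y‖ ^ 2 with hρ'
    have hρ'0 : 0 < ρ' := by positivity
    have hρ'σ : ρ' ≤ 18 * σ := by
      have : ‖x - y‖ ≤ ‖x‖ + ‖y‖ := norm_sub_le _ _
      have : ‖x - y‖ ^ 2 ≤ 2 * ‖x‖ ^ 2 + 2 * ‖y‖ ^ 2 := by
        nlinarith [sq_nonneg (‖x‖ - ‖y‖), norm_nonneg x, norm_nonneg y, norm_nonneg (x - y)]
      nlinarith
    have hk2 : ρ ^ ((n : ℝ) / 2) * ‖heatMult (quotSymbol P) (t - s) (x - y)‖ ≤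
        C₃ * K * (σ ^ (((N : ℝ) + 1) / 2) * decayKernel (t - s) (x - y)) := by
      have e1 : ρ' ^ (-((n : ℝ) + p - 2) / 2) = ρ' ^ ((3 - (p : ℝ)) / 2) *
          decayKernel (t - s) (x - y) := by
        rw [decayKernel, ← rpow_add hρ'0]; congr 1; ring
      have e2 : ρ' ^ ((3 - (p : ℝ)) / 2) ≤ 18 ^ ((3 - (p : ℝ)) / 2) * σ ^ ((3 - (p : ℝ)) / 2) := by
        rw [← mul_rpow (by norm_num) hσ0]
        exact rpow_le_rpow hρ'0.le hρ'σ (by linarith)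
      have e3 : ρ ^ ((n : ℝ) / 2) ≤ 8 ^ ((n : ℝ) / 2) * σ ^ ((n : ℝ) / 2) := by
        rw [← mul_rpow (by norm_num) hσ0]
        exact rpow_le_rpow hρ0.le h (by positivity)
      have e4 : σ ^ ((n : ℝ) / 2) * σ ^ ((3 - (p : ℝ)) / 2) = σ ^ (((N : ℝ) + 1) / 2) := by
        rw [← rpow_add hσ1]; congr 1; linarith
      calc _ ≤ 8 ^ ((n : ℝ) / 2) * σ ^ ((n : ℝ) / 2) * (C₃ * (18 ^ ((3 - (p : ℝ)) / 2) *
            σ ^ ((3 - (p : ℝ)) / 2) * decayKernel (t - s) (x - y))) := by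
            rw [e1] at hk
            refine mul_le_mul e3 (hk.trans ?_) (norm_nonneg _) (by positivity)
            gcongr
        _ = C₃ * K * ((σ ^ ((n : ℝ) / 2) * σ ^ ((3 - (p : ℝ)) / 2)) *
            decayKernel (t - s) (x - y)) := by rw [hK]; ring
        _ = _ := by rw [e4]
    have hT2 : ρ ^ ((n : ℝ) / 2) * ‖kernelTaylor P N t x s y‖ ≤
        C₂ * (σ ^ (((N : ℝ) + 1) / 2) * decayKernel t x) := by
      calc _ ≤ ρ ^ ((n : ℝ) / 2) * (C₂ * (σ ^ (((N : ℝ) + 1) / 2) *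
          ρ ^ (-(((n : ℝ) + p - 2) / 2 + ((N : ℝ) + 1) / 2)))) := by gcongr
        _ = _ := by rw [← eJ]; ring
    calc _ ≤ ρ ^ ((n : ℝ) / 2) * (‖heatMult (quotSymbol P) (t - s) (x - y)‖ +
          ‖kernelTaylor P N t x s y‖) := by gcongr; exact norm_sub_le _ _
      _ ≤ C₃ * K * (σ ^ (((N : ℝ) + 1) / 2) * decayKernel (t - s) (x - y)) +
          C₂ * (σ ^ (((N : ℝ) + 1) / 2) * decayKernel t x) := by rw [mul_add]; gcongr
      _ ≤ _ := by
        have a1 : 0 ≤ σ ^ (((N : ℝ) + 1) / 2) * decayKernel (t - s) (x - y) := by positivity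
        have a2 : 0 ≤ σ ^ (((N : ℝ) + 1) / 2) * decayKernel t x := by positivity
        have a3 : 0 ≤ C₃ * K := by positivity
        rw [mul_add (σ ^ (((N : ℝ) + 1) / 2)), mul_add]
        gcongr
        · linarith
        · linarith

/-- The real kernel with symbol `P(ξ) |ξ|^{-2} exp (-t |ξ|²)`. -/
def realKernel (P : Eu n → ℂ) (t : ℝ) (x : Eu n) : ℝ := (heatMult (quotSymbol P) t x).re

def heatSymbol (w : Eu n) : ℂ := -timeSymbol w * 1

lemma HomSymbol.heat : HomSymbol 2 (heatSymbol (n := n)) := HomSymbol.one.neg_time_mul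

lemma heatMult_one {t : ℝ} (ht : 0 < t) (x : Eu n) :
    heatMult (fun _ => 1) t x = (heatKernel t x : ℂ) := by
  have hb : 0 < (((4 * π ^ 2 * t : ℝ) : ℂ)).re := by rw [ofReal_re]; positivity
  have h := GaussianFourier.integral_cexp_neg_mul_sq_norm_add hb (2 * π * Complex.I) x
  rw [finrank_euclideanSpace_fin] at h
  have e : heatMult (fun _ => 1) t x = ∫ v : Eu n, Complex.exp (-((4 * π ^ 2 * t : ℝ) : ℂ) *
      ‖v‖ ^ 2 + 2 * π * Complex.I * inner ℝ x v) := by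
    refine integral_congr_ae (.of_forall fun w => ?_)
    simp only [heatPhase, one_mul]
    rw [real_inner_comm]
    push_cast
    ring_nf
  rw [e, h, heatKernel]
  have e1 : (π : ℂ) / ((4 * π ^ 2 * t : ℝ) : ℂ) = (((4 * π * t)⁻¹ : ℝ) : ℂ) := by
    rw [← ofReal_div]; congr 1; field_simp
  have e2 : ((n : ℂ) / 2) = (((n : ℝ) / 2 : ℝ) : ℂ) := by push_cast; rfl
  rw [e1, e2, ← ofReal_cpow (by positivity), inv_rpow (by positivity),
    ← rpow_neg (by positivity), Complex.ofReal_mul ((4 * π * t) ^ (-(n : ℝ) / 2)),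
    ofReal_exp]
  congr 2
  · congr 1; ring
  · have hpi : (π : ℂ) ≠ 0 := by exact_mod_cast pi_ne_zero
    have ht' : (t : ℂ) ≠ 0 := by exact_mod_cast ht.ne'
    push_cast
    rw [mul_pow, I_sq]
    field_simp
    norm_num
    ring

lemma heatKernel_eq_realKernel (hn : 2 ≤ n) {t : ℝ} (ht : 0 < t) :
    heatKernel t = realKernel (n := n) heatSymbol t := by
  funext x
  have := heatMult_quot_neg_time_mul hn (fun _ : Eu n => (1 : ℂ)) t x
  rw [realKernel]
  unfold heatSymbol
  rw [this, heatMult_one ht, ofReal_re]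

lemma fourier_heatKernel {t : ℝ} (ht : 0 < t) (w : Eu n) :
    𝓕 (fun y : Eu n => (heatKernel t y : ℂ)) w = ((exp (-(4 * π ^ 2 * t * ‖w‖ ^ 2)) : ℝ) : ℂ) := by
  have hb : 0 < (((1 / (4 * t) : ℝ) : ℂ)).re := by rw [ofReal_re]; positivity
  have h := fourier_gaussian_innerProductSpace hb w
  rw [finrank_euclideanSpace_fin] at h
  have e : (fun y : Eu n => (heatKernel t y : ℂ)) = fun y =>
      (((4 * π * t) ^ (-(n : ℝ) / 2) : ℝ) : ℂ) •
        Complex.exp (-((1 / (4 * t) : ℝ) : ℂ) * ‖y‖ ^ 2) := by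
    funext y
    rw [heatKernel_eq, Complex.ofReal_mul, ofReal_exp, smul_eq_mul]
    push_cast; rfl
  have e1 : (π : ℂ) / ((1 / (4 * t) : ℝ) : ℂ) = ((4 * π * t : ℝ) : ℂ) := by
    rw [← ofReal_div]; congr 1; field_simp
  have e2 : ((n : ℂ) / 2) = (((n : ℝ) / 2 : ℝ) : ℂ) := by push_cast; rfl
  rw [e1, e2, ← ofReal_cpow (by positivity)] at h
  have e3 := Real.fourier_eq (fun y : Eu n => Complex.exp (-((1 / (4 * t) : ℝ) : ℂ) * ‖y‖ ^ 2)) w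
  rw [e, Real.fourier_eq]
  simp_rw [smul_comm _ (((4 * π * t) ^ (-(n : ℝ) / 2) : ℝ) : ℂ)]
  rw [integral_smul, ← e3, h, smul_eq_mul, ← mul_assoc, ← Complex.ofReal_mul,
    ← rpow_add (by positivity), show -(n : ℝ) / 2 + n / 2 = 0 by ring, rpow_zero]
  have ht' : (t : ℂ) ≠ 0 := by exact_mod_cast ht.ne'
  rw [Complex.ofReal_one, one_mul, ofReal_exp]
  congr 1
  push_cast
  field_simp

lemma fourierMultiplier_heatKernel {t : ℝ} (ht : 0 < t) (m : Eu n → ℂ) (x : Eu n) :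
    fourierMultiplier m (heatKernel t) x = (heatMult (fun w => m ((2 * π) • w)) t x).re := by
  rw [fourierMultiplier, heatMult_eq_fourierInv]
  simp_rw [fourier_heatKernel ht, real_smul, mul_comm (m _)]

def gradSymbol (k : Fin n) (w : Eu n) : ℂ := dirSymbol (single k 1) w

def rieszRieszSymbol (k j : Fin n) (w : Eu n) : ℂ := dirSymbol (single j 1) w * gradSymbol k w

lemma HomSymbol.grad (k : Fin n) : HomSymbol 1 (gradSymbol k) := HomSymbol.dir _

lemma HomSymbol.rieszRiesz (k j : Fin n) : HomSymbol 2 (rieszRieszSymbol k j) :=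
  (HomSymbol.dir _).mul (HomSymbol.grad k)

lemma norm_two_pi_smul (w : Eu n) : ‖(2 * π) • w‖ = 2 * π * ‖w‖ := by
  rw [norm_smul, norm_of_nonneg (by positivity)]

lemma rieszInvHeat_eq {t : ℝ} (ht : 0 < t) (k : Fin n) :
    rieszInvHeat k t = realKernel (gradSymbol k) t := by
  funext x
  rw [rieszInvHeat, fourierMultiplier_heatKernel ht, realKernel]
  congr 2
  funext w
  simp only [quotSymbol, gradSymbol, dirSymbol_single, rieszSymbol, invSqrtLapSymbol,
    norm_two_pi_smul, PiLp.smul_apply, smul_eq_mul]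
  rcases eq_or_ne w 0 with rfl | hw
  · simp
  have hw' : (‖w‖ : ℂ) ≠ 0 := by exact_mod_cast (norm_pos_iff.2 hw).ne'
  have hpi : (π : ℂ) ≠ 0 := by exact_mod_cast pi_ne_zero
  push_cast
  field_simp
  norm_num
  ring

lemma rieszRieszHeat_eq {t : ℝ} (ht : 0 < t) (k j : Fin n) :
    rieszRieszHeat k j t = realKernel (rieszRieszSymbol k j) t := by
  funext x
  rw [rieszRieszHeat, fourierMultiplier_heatKernel ht, realKernel]
  congr 2
  funext w
  simp only [quotSymbol, rieszRieszSymbol, gradSymbol, dirSymbol_single, rieszSymbol,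
    norm_two_pi_smul, PiLp.smul_apply, smul_eq_mul]
  rcases eq_or_ne w 0 with rfl | hw
  · simp
  have hw' : (‖w‖ : ℂ) ≠ 0 := by exact_mod_cast (norm_pos_iff.2 hw).ne'
  have hpi : (π : ℂ) ≠ 0 := by exact_mod_cast pi_ne_zero
  push_cast
  field_simp
  try ring

lemma pderiv_realKernel (hn : 2 ≤ n) {p : ℕ} {P : Eu n → ℂ} (hP : HomSymbol (p + 1) P) {t : ℝ}
    (ht : 0 < t) (j : Fin n) : pderiv j (realKernel P t) =
      realKernel (fun w => dirSymbol (single j 1) w * P w) t := by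
  have := pderiv_heatMult_re hn hP.growth_quot ht j
  change pderiv j (fun x => (heatMult (quotSymbol P) t x).re) = _
  rw [this]
  funext x
  simp only [realKernel]
  congr 2
  funext w
  simp only [quotSymbol]; ring

lemma contDiffOn_realKernel (hn : 2 ≤ n) {p : ℕ} {P : Eu n → ℂ} (hP : HomSymbol (p + 1) P) :
    ContDiffOn ℝ ∞ (fun z : ℝ × Eu n => realKernel P z.1 z.2) (Ioi 0 ×ˢ univ) :=
  reCLM.contDiff.comp_contDiffOn (contDiffOn_heatMult hn hP.growth_quot)

lemma sum_dirSymbol_sq (w : Eu n) :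
    ∑ j, dirSymbol (single j 1) w * dirSymbol (single j 1) w = timeSymbol w := by
  simp only [dirSymbol_single, timeSymbol, norm_sq_eq, norm_eq_abs, sq_abs]
  push_cast
  rw [mul_sum, ← sum_neg_distrib]
  refine sum_congr rfl fun j _ => ?_
  linear_combination (2 * (π : ℂ) * (w j : ℂ)) ^ 2 * Complex.I_mul_I

lemma realKernel_sum (hn : 2 ≤ n) {p : ℕ} {ι : Type*} (s : Finset ι) {P : ι → Eu n → ℂ}
    (hP : ∀ i ∈ s, HomSymbol (p + 1) (P i)) {t : ℝ} (ht : 0 < t) (x : Eu n) :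
    ∑ i ∈ s, realKernel (P i) t x = realKernel (fun w => ∑ i ∈ s, P i w) t x := by
  have h := heatMult_sum hn s (k := fun _ => p) (m := fun i => quotSymbol (P i))
    (fun i hi => (hP i hi).growth_quot) ht x
  simp only [realKernel, ← re_sum, ← h]
  congr 2
  funext w
  simp only [quotSymbol, Finset.sum_div]

lemma hasDerivAt_realKernel (hn : 2 ≤ n) {p : ℕ} {P : Eu n → ℂ} (hP : HomSymbol (p + 1) P) {t : ℝ}
    (ht : 0 < t) (x : Eu n) : HasDerivAt (fun s => realKernel P s x)
      (∑ j, pderiv j (pderiv j (realKernel P t)) x) t := by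
  have h := reCLM.hasFDerivAt.comp_hasDerivAt t (hasDerivAt_heatMult_time hn hP.growth_quot ht x)
  refine h.congr_deriv ?_
  have hd : ∀ j : Fin n, HomSymbol (p + 1 + 1)
      (fun w => dirSymbol (single j 1) w * P w) := fun j => by
    have := (HomSymbol.dir (single j 1)).mul hP
    rwa [add_comm] at this
  have hd2 : ∀ j : Fin n, HomSymbol (p + 1 + 1 + 1) (fun w => dirSymbol (single j 1) w *
      (dirSymbol (single j 1) w * P w)) := fun j => by
    have := (HomSymbol.dir (single j 1)).mul (hd j)
    rwa [add_comm] at this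
  have e : ∀ j, pderiv j (pderiv j (realKernel P t)) x = realKernel (fun w =>
      dirSymbol (single j 1) w *
      (dirSymbol (single j 1) w * P w)) t x := fun j => by
    rw [pderiv_realKernel hn hP ht, pderiv_realKernel hn (hd j) ht]
  simp_rw [e]
  rw [realKernel_sum hn _ (fun j _ => hd2 j) ht, realKernel]
  simp only [reCLM_apply]
  congr 2
  funext w
  simp only [quotSymbol, ← mul_assoc, ← sum_mul, sum_dirSymbol_sq]
  ring

lemma pderiv_rieszInvHeat (hn : 2 ≤ n) {t : ℝ} (ht : 0 < t) (k j : Fin n) :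
    pderiv j (rieszInvHeat k t) = rieszRieszHeat k j t := by
  rw [rieszInvHeat_eq ht, rieszRieszHeat_eq ht, pderiv_realKernel hn (HomSymbol.grad k) ht]
  rfl

lemma rieszRieszHeat_symm {t : ℝ} (ht : 0 < t) (k j : Fin n) :
    rieszRieszHeat k j t = rieszRieszHeat j k t := by
  rw [rieszRieszHeat_eq ht, rieszRieszHeat_eq ht]
  congr 1
  funext w
  simp only [rieszRieszSymbol, gradSymbol]; ring

lemma sum_rieszRieszHeat (hn : 2 ≤ n) {t : ℝ} (ht : 0 < t) (x : Eu n) :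
    ∑ k : Fin n, rieszRieszHeat k k t x = -heatKernel t x := by
  simp_rw [rieszRieszHeat_eq ht]
  rw [realKernel_sum hn _ (fun j _ => HomSymbol.rieszRiesz j j) ht,
    heatKernel_eq_realKernel hn ht, realKernel, realKernel, ← neg_re]
  congr 1
  rw [← neg_one_mul, ← heatMult_const_mul]
  congr 1
  funext w
  simp only [rieszRieszSymbol, gradSymbol, sum_dirSymbol_sq, quotSymbol, heatSymbol]
  ring

lemma exists_abs_realKernel_le (hn : 2 ≤ n) {p : ℕ} {P : Eu n → ℂ} (hp : 1 ≤ p)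
    (hP : HomSymbol p P) :
    ∃ C, 0 ≤ C ∧ ∀ (t : ℝ) (x : Eu n), 0 < t →
      |realKernel P t x| ≤ C * (t + ‖x‖ ^ 2) ^ (-((n : ℝ) + p - 2) / 2) := by
  obtain ⟨C, h0, h⟩ := exists_heatMult_quot_le hn hp hP
  exact ⟨C, h0, fun t x ht => (abs_re_le_norm _).trans (h t x ht)⟩

lemma re_kernelTaylor (hn : 2 ≤ n) {p : ℕ} {P : Eu n → ℂ} (hP : HomSymbol (p + 1) P)
    (K : ℝ → Eu n → ℝ) (hK : ∀ s, 0 < s → K s = realKernel P s) (N : ℕ) {t : ℝ} (ht : 0 < t)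
    (x : Eu n) (s : ℝ) (y : Eu n) :
    (kernelTaylor P N t x s y).re =
      ∑ m ∈ Finset.range (N + 1), ∑ l ∈ Finset.range (m / 2 + 1), ∑ β ∈ multiIndices n (m - 2 * l),
        mixedDeriv l β K t x / ((l.factorial : ℝ) * multiFactorial β) *
          ((-s) ^ l * negPow β y) := by
  simp only [kernelTaylor, re_sum]
  refine sum_congr rfl fun m _ => sum_congr rfl fun l _ =>
    sum_congr rfl fun β _ => ?_
  rw [mixedDeriv_heatMult_re hn hP.growth_quot K hK l β ht, Complex.re_ofReal_mul]
  ring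

/-- The weighted parabolic Taylor remainder of a real kernel. -/
lemma HomSymbol.exists_real_taylor (hn : 2 ≤ n) {p N : ℕ} {P : Eu n → ℂ} (hp : p + 1 ≤ 2)
    (hP : HomSymbol (p + 1) P) (hN : N + (p + 1) = n + 2) (K : ℝ → Eu n → ℝ)
    (hK : ∀ s, 0 < s → K s = realKernel P s) :
    ∃ C, 0 ≤ C ∧ ∀ (t s : ℝ) (x y : Eu n), 0 ≤ s → s < t →
      (t + ‖x‖ ^ 2) ^ ((n : ℝ) / 2) *
        |K (t - s) (x - y) - ∑ m ∈ Finset.range (N + 1), ∑ l ∈ Finset.range (m / 2 + 1),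
          ∑ β ∈ multiIndices n (m - 2 * l),
            mixedDeriv l β K t x / ((l.factorial : ℝ) * multiFactorial β) *
              ((-s) ^ l * negPow β y)| ≤
        C * ((s + ‖y‖ ^ 2) ^ (((N : ℝ) + 1) / 2) *
          (decayKernel (t - s) (x - y) + decayKernel t x)) := by
  obtain ⟨C, hC0, hC⟩ := hP.exists_taylor hn (by omega) hp hN
  refine ⟨C, hC0, fun t s x y hs hst => le_trans ?_ (hC t s x y hs hst)⟩
  have ht : 0 < t := lt_of_le_of_lt hs hst
  gcongr
  rw [← re_kernelTaylor hn hP K hK N ht, hK _ (by linarith), realKernel, ← sub_re]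
  exact abs_re_le_norm _

/-- Derivatives of the heat kernel decay faster than any power. -/
lemma exists_mixedDeriv_heatKernel_le (hn : 2 ≤ n) (l : ℕ) (β : Fin n → ℕ) (r : ℝ) :
    ∃ C, 0 ≤ C ∧ ∀ (t : ℝ) (x : Eu n), 0 < t → |mixedDeriv l β heatKernel t x| ≤
      C * t ^ r * (t + ‖x‖ ^ 2) ^ (-((n : ℝ) + 2 * l + (∑ j, β j : ℕ)) / 2 - r) := by
  obtain ⟨C, hC0, hC⟩ := exists_heatMult_le ((HomSymbol.time.pow l).mul (HomSymbol.multi β)) r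
  refine ⟨C, hC0, fun t x ht => ?_⟩
  rw [mixedDeriv_heatMult_re hn HomSymbol.heat.growth_quot heatKernel
    (fun s hs => heatKernel_eq_realKernel hn hs) l β ht]
  refine (abs_re_le_norm _).trans ?_
  have e : heatMult (fun w => timeSymbol w ^ l * (multiSymbol β w * quotSymbol heatSymbol w)) t x =
      heatMult (fun w => timeSymbol w ^ l * multiSymbol β w) t x := by
    refine heatMult_congr ?_ t x
    filter_upwards [ae_ne_zero hn] with w hw
    have := quotSymbol_neg_time_mul hw (fun _ => (1 : ℂ))
    unfold heatSymbol
    rw [this, mul_one]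
  rw [e]
  refine (hC t x ht).trans (le_of_eq ?_)
  congr 2
  push_cast
  ring

section Slices

variable {f g : Eu n → ℝ} {x : Eu n}

lemma pderiv_add (i : Fin n) (hf : DifferentiableAt ℝ f x) (hg : DifferentiableAt ℝ g x) :
    pderiv i (fun y => f y + g y) x = pderiv i f x + pderiv i g x := by
  simp [pderiv, fderiv_fun_add hf hg]

lemma pderiv_sub (i : Fin n) (hf : DifferentiableAt ℝ f x) (hg : DifferentiableAt ℝ g x) :
    pderiv i (fun y => f y - g y) x = pderiv i f x - pderiv i g x := by
  simp [pderiv, fderiv_fun_sub hf hg]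

lemma pderiv_mul (i : Fin n) (hf : DifferentiableAt ℝ f x) (hg : DifferentiableAt ℝ g x) :
    pderiv i (fun y => f y * g y) x = pderiv i f x * g x + f x * pderiv i g x := by
  simp [pderiv, fderiv_fun_mul hf hg]; ring

lemma pderiv_sum {ι : Type*} (s : Finset ι) {F : ι → Eu n → ℝ} (i : Fin n)
    (hF : ∀ k ∈ s, DifferentiableAt ℝ (F k) x) :
    pderiv i (fun y => ∑ k ∈ s, F k y) x = ∑ k ∈ s, pderiv i (F k) x := by
  simp [pderiv, fderiv_fun_sum hF]

lemma contDiff_pderiv (i : Fin n) (hf : ContDiff ℝ ∞ f) : ContDiff ℝ ∞ (pderiv i f) := by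
  unfold pderiv
  exact (hf.fderiv_right (by simp)).clm_apply contDiff_const

lemma pderiv_comm (i j : Fin n) (hf : ContDiff ℝ ∞ f) (x : Eu n) :
    pderiv i (pderiv j f) x = pderiv j (pderiv i f) x := by
  have hd : DifferentiableAt ℝ (fderiv ℝ f) x :=
    ((hf.fderiv_right (m := ∞) (by simp)).differentiable (by simp)) x
  have h : ∀ k l : Fin n, pderiv k (pderiv l f) x =
      fderiv ℝ (fderiv ℝ f) x (single k 1) (single l 1) := by
    intro k l
    have : HasFDerivAt (pderiv l f)
        ((ContinuousLinearMap.apply ℝ ℝ (single l (1 : ℝ) : Eu n)).comp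
          (fderiv ℝ (fderiv ℝ f) x)) x :=
      ((ContinuousLinearMap.apply ℝ ℝ (single l (1 : ℝ) : Eu n)).hasFDerivAt).comp x hd.hasFDerivAt
    rw [pderiv, this.fderiv]
    simp
  rw [h, h]
  exact (hf.contDiffAt.isSymmSndFDerivAt (by simp [minSmoothness_of_isRCLikeNormedField]; exact WithTop.coe_le_coe.2 (le_top : (2 : ℕ∞) ≤ ⊤))) _ _

lemma pderiv_eq_zero_of_notMem_tsupport (i : Fin n) (h : x ∉ tsupport f) : pderiv i f x = 0 := by
  have : x ∉ tsupport (fderiv ℝ f) := fun h' => h (tsupport_fderiv_subset ℝ h')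
  rw [pderiv, image_eq_zero_of_notMem_tsupport this]; simp

lemma hasCompactSupport_pderiv (i : Fin n) (h : HasCompactSupport f) :
    HasCompactSupport (pderiv i f) :=
  h.mono' fun x hx => by
    by_contra h'
    exact hx (pderiv_eq_zero_of_notMem_tsupport i h')

/-- Integration by parts in one variable, under integrability assumptions. -/
lemma integral_pderiv_mul_of_integrable (i : Fin n) (hf : Differentiable ℝ f)
    (hg : Differentiable ℝ g) (h1 : Integrable fun x => pderiv i f x * g x)
    (h2 : Integrable fun x => f x * pderiv i g x) (h3 : Integrable fun x => f x * g x) :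
    ∫ x, pderiv i f x * g x = -∫ x, f x * pderiv i g x := by
  have := integral_mul_fderiv_eq_neg_fderiv_mul_of_integrable
    (v := (single i (1 : ℝ) : Eu n)) (f := f) (g := g) (μ := volume) h1 h2 h3
    (fun x _ => hf x) (fun x _ => hg x)
  rw [eq_neg_iff_add_eq_zero, add_comm]
  simp only [pderiv]
  linarith

lemma integral_pderiv_mul (i : Fin n) (hf : ContDiff ℝ ∞ f) (hg : ContDiff ℝ ∞ g)
    (hc : HasCompactSupport g) :
    ∫ x, pderiv i f x * g x = -∫ x, f x * pderiv i g x := by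
  refine integral_pderiv_mul_of_integrable i (hf.differentiable (by simp))
    (hg.differentiable (by simp)) ?_ ?_ ?_
  · exact ((contDiff_pderiv i hf).continuous.mul hg.continuous).integrable_of_hasCompactSupport
      hc.mul_left
  · exact (hf.continuous.mul (contDiff_pderiv i hg).continuous).integrable_of_hasCompactSupport
      (hasCompactSupport_pderiv i hc).mul_left
  · exact (hf.continuous.mul hg.continuous).integrable_of_hasCompactSupport hc.mul_left

end Slices

/-- Smoothness on `(0, ∞) × ℝⁿ`. -/
def SmoothPos (F : ℝ → Eu n → ℝ) : Prop :=
  ContDiffOn ℝ ∞ (fun z : ℝ × Eu n => F z.1 z.2) (Ioi 0 ×ˢ univ)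

lemma isOpen_posTime : IsOpen (Ioi (0 : ℝ) ×ˢ (univ : Set (Eu n))) := isOpen_Ioi.prod isOpen_univ

namespace SmoothPos

variable {F H : ℝ → Eu n → ℝ} {t : ℝ}

lemma contDiffAt (hF : SmoothPos F) (ht : 0 < t) (x : Eu n) :
    ContDiffAt ℝ ∞ (fun z : ℝ × Eu n => F z.1 z.2) (t, x) :=
  ContDiffOn.contDiffAt hF (isOpen_posTime.mem_nhds ⟨ht, mem_univ x⟩)

lemma hasFDerivAt (hF : SmoothPos F) (ht : 0 < t) (x : Eu n) :
    HasFDerivAt (fun z : ℝ × Eu n => F z.1 z.2)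
      (fderiv ℝ (fun z : ℝ × Eu n => F z.1 z.2) (t, x)) (t, x) :=
  ((hF.contDiffAt ht x).differentiableAt (by simp)).hasFDerivAt

lemma slice (hF : SmoothPos F) (ht : 0 < t) : ContDiff ℝ ∞ (F t) := by
  rw [contDiff_iff_contDiffAt]
  intro x
  exact (hF.contDiffAt ht x).comp x (contDiff_prodMk_right t).contDiffAt

lemma continuousOn (hF : SmoothPos F) :
    ContinuousOn (fun z : ℝ × Eu n => F z.1 z.2) (Ioi 0 ×ˢ univ) := ContDiffOn.continuousOn hF

lemma continuous_slice (hF : SmoothPos F) (ht : 0 < t) : Continuous (F t) := (hF.slice ht).continuous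

lemma pderiv_eq (hF : SmoothPos F) (ht : 0 < t) (x : Eu n) (i : Fin n) :
    pderiv i (F t) x = fderiv ℝ (fun z : ℝ × Eu n => F z.1 z.2) (t, x) (0, single i 1) := by
  have h := (hF.hasFDerivAt ht x).comp x ((hasFDerivAt_const t x).prodMk (hasFDerivAt_id x))
  rw [pderiv, show F t = (fun z : ℝ × Eu n => F z.1 z.2) ∘ fun y => (t, y) from rfl]
  erw [h.fderiv]
  simp

lemma hasDerivAt (hF : SmoothPos F) (ht : 0 < t) (x : Eu n) :
    HasDerivAt (fun s => F s x) (fderiv ℝ (fun z : ℝ × Eu n => F z.1 z.2) (t, x) (1, 0)) t :=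
  HasFDerivAt.comp_hasDerivAt (f := fun s : ℝ => (s, x)) t (hF.hasFDerivAt ht x)
    ((hasDerivAt_id t).prodMk (hasDerivAt_const t x))

lemma hasDerivAt' (hF : SmoothPos F) (ht : 0 < t) (x : Eu n) :
    HasDerivAt (fun s => F s x) (deriv (fun s => F s x) t) t :=
  (hF.hasDerivAt ht x).differentiableAt.hasDerivAt

lemma clm_apply (hF : SmoothPos F) (v : ℝ × Eu n) :
    SmoothPos (fun t x => fderiv ℝ (fun z : ℝ × Eu n => F z.1 z.2) (t, x) v) :=
  (ContDiffOn.fderiv_of_isOpen hF isOpen_posTime (m := ∞) (by simp)).clm_apply contDiffOn_const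

lemma congr (hF : SmoothPos F) (h : ∀ t, 0 < t → ∀ x, H t x = F t x) : SmoothPos H :=
  ContDiffOn.congr hF fun z hz => h z.1 hz.1 z.2

lemma pd (hF : SmoothPos F) (i : Fin n) : SmoothPos (fun t => pderiv i (F t)) :=
  (hF.clm_apply (0, single i 1)).congr fun _ ht x => hF.pderiv_eq ht x i

lemma td (hF : SmoothPos F) : SmoothPos (fun t x => deriv (fun s => F s x) t) :=
  (hF.clm_apply (1, 0)).congr fun _ ht x => (hF.hasDerivAt ht x).deriv

lemma sub (hF : SmoothPos F) (hH : SmoothPos H) : SmoothPos (fun t x => F t x - H t x) :=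
  ContDiffOn.sub hF hH

lemma mul (hF : SmoothPos F) (hH : SmoothPos H) : SmoothPos (fun t x => F t x * H t x) :=
  ContDiffOn.mul hF hH

lemma sum {ι : Type*} {s : Finset ι} {F : ι → ℝ → Eu n → ℝ} (h : ∀ i ∈ s, SmoothPos (F i)) :
    SmoothPos (fun t x => ∑ i ∈ s, F i t x) :=
  ContDiffOn.sum h

lemma of_space {f : Eu n → ℝ} (hf : ContDiff ℝ ∞ f) : SmoothPos (fun _ => f) :=
  (hf.comp contDiff_snd).contDiffOn

lemma deriv_pderiv (hF : SmoothPos F) (ht : 0 < t) (x : Eu n) (i : Fin n) :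
    deriv (fun s => pderiv i (F s) x) t = pderiv i (fun y => deriv (fun s => F s y) t) x := by
  set D := fderiv ℝ (fun z : ℝ × Eu n => F z.1 z.2) with hD
  have hd : DifferentiableAt ℝ D (t, x) :=
    ((ContDiffOn.fderiv_of_isOpen hF isOpen_posTime (m := ∞) (by simp)).contDiffAt
      (isOpen_posTime.mem_nhds
        (show ((t, x) : ℝ × Eu n) ∈ Ioi 0 ×ˢ univ from ⟨ht, mem_univ x⟩))).differentiableAt (by simp)
  have key : ∀ v w : ℝ × Eu n, fderiv ℝ (fun z : ℝ × Eu n => D (z.1, z.2) v) (t, x) w =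
      fderiv ℝ D (t, x) w v := by
    intro v w
    have : HasFDerivAt (fun z : ℝ × Eu n => D (z.1, z.2) v)
        ((ContinuousLinearMap.apply ℝ ℝ v).comp (fderiv ℝ D (t, x))) (t, x) :=
      ((ContinuousLinearMap.apply ℝ ℝ v).hasFDerivAt).comp (t, x) hd.hasFDerivAt
    rw [this.fderiv]
    simp
  have h1 : (fun s => pderiv i (F s) x) =ᶠ[𝓝 t] fun s => D (s, x) (0, single i 1) := by
    filter_upwards [Ioi_mem_nhds ht] with s hs using hF.pderiv_eq hs x i
  have h2 : (fun y => deriv (fun s => F s y) t) = fun y => D (t, y) (1, 0) := by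
    funext y
    exact (hF.hasDerivAt ht y).deriv
  rw [h1.deriv_eq, ((hF.clm_apply (0, single i 1)).hasDerivAt ht x).deriv, h2,
    (hF.clm_apply (1, 0)).pderiv_eq ht x i]
  change fderiv ℝ (fun z : ℝ × Eu n => D (z.1, z.2) _) (t, x) _ =
    fderiv ℝ (fun z : ℝ × Eu n => D (z.1, z.2) _) (t, x) _
  rw [key, key]
  exact ((hF.contDiffAt ht x).isSymmSndFDerivAt (by simp [minSmoothness_of_isRCLikeNormedField]; exact WithTop.coe_le_coe.2 (le_top : (2 : ℕ∞) ≤ ⊤))) _ _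

end SmoothPos

namespace IsNSSolution

variable {u : ℝ → Eu n → Eu n} {p : ℝ → Eu n → ℝ}

lemma smooth_comp (h : IsNSSolution u p) (j : Fin n) : SmoothPos (fun t x => u t x j) :=
  (proj (𝕜 := ℝ) j).contDiff.comp_contDiffOn h.smooth_velocity

lemma smooth_vorticity (h : IsNSSolution u p) (i j : Fin n) : SmoothPos (vorticity u i j) :=
  ((h.smooth_comp j).pd i).sub ((h.smooth_comp i).pd j)

lemma vorticity_equation (h : IsNSSolution u p) {t : ℝ} (ht : 0 < t) (x : Eu n) (i j : Fin n) :
    deriv (fun s => vorticity u i j s x) t =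
      ∑ k, pderiv k (pderiv k (vorticity u i j t)) x -
        ∑ k, (pderiv i (fun y => u t y k * vorticity u k j t y) x -
          pderiv j (fun y => u t y k * vorticity u k i t y) x) := by
  have hU := h.smooth_comp
  have hUt : ∀ j, ContDiff ℝ ∞ (fun y => u t y j) := fun j => (hU j).slice ht
  have hP : ContDiff ℝ ∞ (p t) := SmoothPos.slice (F := p) h.smooth_pressure ht
  have hd : ∀ {f : Eu n → ℝ}, ContDiff ℝ ∞ f → DifferentiableAt ℝ f x :=
    fun hf => (hf.differentiable (by simp)) x
  have hw : ∀ i j, ContDiff ℝ ∞ (vorticity u i j t) := fun i j => (h.smooth_vorticity i j).slice ht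
  -- the `i`-th derivative of the `j`-th momentum equation
  have mom : ∀ i j, pderiv i (fun y => deriv (fun s => u s y j) t) x =
      ∑ k, pderiv i (pderiv k (pderiv k fun y => u t y j)) x - pderiv i (pderiv j (p t)) x -
        ∑ k, pderiv i (fun y => u t y k * pderiv k (fun y => u t y j) y) x := by
    intro i j
    have e : (fun y => deriv (fun s => u s y j) t) = fun y =>
        ((∑ k, pderiv k (pderiv k fun y => u t y j) y) - pderiv j (p t) y) -
          ∑ k, u t y k * pderiv k (fun y => u t y j) y := by
      funext y
      have := h.momentum t ht y j
      linarith
    have d1 : ∀ k ∈ Finset.univ, DifferentiableAt ℝ (pderiv k (pderiv k fun y => u t y j)) x :=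
      fun k _ => hd (contDiff_pderiv k (contDiff_pderiv k (hUt j)))
    have d2 : ∀ k ∈ Finset.univ, DifferentiableAt ℝ
        (fun y => u t y k * pderiv k (fun y => u t y j) y) x :=
      fun k _ => hd ((hUt k).mul (contDiff_pderiv k (hUt j)))
    rw [e, pderiv_sub i ((DifferentiableAt.fun_sum d1).fun_sub (hd (contDiff_pderiv j hP)))
      (DifferentiableAt.fun_sum d2), pderiv_sub i (DifferentiableAt.fun_sum d1)
      (hd (contDiff_pderiv j hP)), pderiv_sum _ i d1, pderiv_sum _ i d2]
  have hL : deriv (fun s => vorticity u i j s x) t =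
      pderiv i (fun y => deriv (fun s => u s y j) t) x -
        pderiv j (fun y => deriv (fun s => u s y i) t) x := by
    rw [← (hU j).deriv_pderiv ht, ← (hU i).deriv_pderiv ht]
    exact deriv_fun_sub (((hU j).pd i).hasDerivAt' ht x).differentiableAt
      (((hU i).pd j).hasDerivAt' ht x).differentiableAt
  have hLap : ∀ k, pderiv k (pderiv k (vorticity u i j t)) x =
      pderiv i (pderiv k (pderiv k fun y => u t y j)) x -
        pderiv j (pderiv k (pderiv k fun y => u t y i)) x := by
    intro k
    have e1 : pderiv k (vorticity u i j t) = fun y => pderiv i (pderiv k fun y => u t y j) y -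
        pderiv j (pderiv k fun y => u t y i) y := by
      funext y
      rw [pderiv_comm i k (hUt j), pderiv_comm j k (hUt i)]
      exact pderiv_sub k (((contDiff_pderiv i (hUt j)).differentiable (by simp)) y)
        (((contDiff_pderiv j (hUt i)).differentiable (by simp)) y)
    rw [e1, pderiv_sub k (hd (contDiff_pderiv i (contDiff_pderiv k (hUt j))))
      (hd (contDiff_pderiv j (contDiff_pderiv k (hUt i)))),
      pderiv_comm k i (contDiff_pderiv k (hUt j)), pderiv_comm k j (contDiff_pderiv k (hUt i))]
  have hN : ∀ k, pderiv i (fun y => u t y k * vorticity u k j t y) x -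
      pderiv j (fun y => u t y k * vorticity u k i t y) x =
      pderiv i (fun y => u t y k * pderiv k (fun y => u t y j) y) x -
        pderiv j (fun y => u t y k * pderiv k (fun y => u t y i) y) x := by
    intro k
    have a : ∀ i j, pderiv i (fun y => u t y k * vorticity u k j t y) x =
        pderiv i (fun y => u t y k * pderiv k (fun y => u t y j) y) x -
        (pderiv i (fun y => u t y k) x * pderiv j (fun y => u t y k) x +
          u t x k * pderiv i (pderiv j fun y => u t y k) x) := by
      intro i j
      have e : (fun y => u t y k * vorticity u k j t y) = fun y =>
          u t y k * pderiv k (fun y => u t y j) y - u t y k * pderiv j (fun y => u t y k) y := by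
        funext y; simp only [vorticity]; ring
      rw [e, pderiv_sub i (hd ((hUt k).mul (contDiff_pderiv k (hUt j))))
        (hd ((hUt k).mul (contDiff_pderiv j (hUt k)))),
        pderiv_mul i (f := fun y => u t y k) (g := pderiv j fun y => u t y k) (hd (hUt k))
          (hd (contDiff_pderiv j (hUt k)))]
    rw [a i j, a j i, pderiv_comm i j (hUt k)]
    ring
  rw [hL, mom, mom, pderiv_comm i j hP]
  simp_rw [hLap, hN, sum_sub_distrib]
  ring

end IsNSSolution

/-- Differentiation under the integral for families supported in a fixed compact set. -/
lemma hasDerivAt_integral_of_isCompact {F F' : ℝ → Eu n → ℝ} {a b t : ℝ} {K : Set (Eu n)}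
    (hK : IsCompact K) (hF : ∀ s ∈ Ioo a b, Continuous (F s))
    (hd : ∀ s ∈ Ioo a b, ∀ x, HasDerivAt (fun r => F r x) (F' s x) s)
    (hc : ContinuousOn (fun z : ℝ × Eu n => F' z.1 z.2) (Ioo a b ×ˢ univ))
    (h0 : ∀ s ∈ Ioo a b, ∀ x ∉ K, F s x = 0) (ht : t ∈ Ioo a b) :
    HasDerivAt (fun s => ∫ x, F s x) (∫ x, F' t x) t := by
  obtain ⟨c, hc1, hc2⟩ := exists_between ht.1
  obtain ⟨d, hd1, hd2⟩ := exists_between ht.2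
  have hsub : Icc c d ⊆ Ioo a b := fun s hs => ⟨hc1.trans_le hs.1, hs.2.trans_lt hd2⟩
  have h0' : ∀ s ∈ Ioo a b, ∀ x ∉ K, F' s x = 0 := by
    intro s hs x hx
    have e : (fun r => F r x) =ᶠ[𝓝 s] fun _ => 0 := by
      filter_upwards [Ioo_mem_nhds hs.1 hs.2] with r hr using h0 r hr x hx
    rw [← (hd s hs x).deriv, e.deriv_eq, deriv_const]
  have hF' : ∀ s ∈ Ioo a b, Continuous (F' s) := fun s hs => by
    have := hc.comp (f := fun x : Eu n => (s, x)) (s := univ) (by fun_prop) (fun x _ => ⟨hs, mem_univ x⟩)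
    exact continuousOn_univ.1 this
  obtain ⟨M, hM⟩ := (isCompact_Icc.prod hK).exists_bound_of_continuousOn
    (hc.mono (prod_mono hsub (subset_univ K)))
  have hsupp : ∀ s ∈ Ioo a b, HasCompactSupport (F s) := fun s hs =>
    HasCompactSupport.intro hK (h0 s hs)
  refine (hasDerivAt_integral_of_dominated_loc_of_deriv_le (F := F) (F' := F') (x₀ := t)
    (bound := K.indicator fun _ => M) (s := Icc c d) (Icc_mem_nhds hc2 hd1) ?_ ?_ ?_ ?_ ?_ ?_).2
  · filter_upwards [Ioo_mem_nhds ht.1 ht.2] with s hs using (hF s hs).aestronglyMeasurable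
  · exact (hF t ht).integrable_of_hasCompactSupport (hsupp t ht)
  · exact (hF' t ht).aestronglyMeasurable
  · refine .of_forall fun x s hs => ?_
    by_cases hx : x ∈ K
    · rw [indicator_of_mem hx]; exact hM (s, x) ⟨hs, hx⟩
    · rw [indicator_of_notMem hx, h0' s (hsub hs) x hx, norm_zero]
  · exact (integrable_indicator_iff hK.measurableSet).2 (integrableOn_const hK.measure_lt_top.ne)
  · exact .of_forall fun x s hs => hd s (hsub hs) x

lemma SmoothPos.hasDerivAt_integral {F : ℝ → Eu n → ℝ} (hF : SmoothPos F) {K : Set (Eu n)}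
    (hK : IsCompact K) (h0 : ∀ s, 0 < s → ∀ x ∉ K, F s x = 0) {t : ℝ} (ht : 0 < t) :
    HasDerivAt (fun s => ∫ x, F s x) (∫ x, deriv (fun s => F s x) t) t :=
  hasDerivAt_integral_of_isCompact (F' := fun t x => deriv (fun s => F s x) t)
    (a := 0) (b := t + 1) hK (fun _ hs => hF.continuous_slice hs.1)
    (fun _ hs x => hF.hasDerivAt' hs.1 x)
    (hF.td.continuousOn.mono (prod_mono (fun _ hs => hs.1) subset_rfl))
    (fun s hs => h0 s hs.1) ⟨ht, by linarith⟩

/-- Quantitative consequences of `VelocityDecay` for `q = 1` and `q = ∞`. -/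
structure VelocityBound (u : ℝ → Eu n → Eu n) (A : ℝ) : Prop where
  pos : 0 < A
  sup_le : ∀ t, 0 < t → ∀ x, ‖u t x‖ ≤ A * (1 + t) ^ (-((n : ℝ) + 1) / 2)
  integrable : ∀ t, 0 ≤ t → Integrable (u t)
  integral_le : ∀ t, 0 ≤ t → ∫ x, ‖u t x‖ ≤ A * (1 + t) ^ (-(1 / 2 : ℝ))

lemma IsNSSolution.continuous_velocity {u : ℝ → Eu n → Eu n} {p : ℝ → Eu n → ℝ}
    (h : IsNSSolution u p) {t : ℝ} (ht : 0 < t) : Continuous (u t) := by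
  have := h.smooth_velocity.continuousOn.comp (f := fun x : Eu n => (t, x)) (s := univ)
    (by fun_prop) (fun x _ => ⟨ht, mem_univ x⟩)
  exact continuousOn_univ.1 this

lemma IsNSSolution.exists_velocityBound {u : ℝ → Eu n → Eu n} {p : ℝ → Eu n → ℝ}
    (h : IsNSSolution u p) (hd : VelocityDecay u) (h0 : Integrable (u 0)) :
    ∃ A, VelocityBound u A := by
  obtain ⟨C1, hC1⟩ := hd 1 le_rfl
  obtain ⟨C2, hC2⟩ := hd ∞ le_top
  have hmeas : ∀ t, 0 ≤ t → AEStronglyMeasurable (u t) volume := by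
    intro t ht
    rcases ht.eq_or_lt with rfl | ht
    · exact h0.1
    · exact (h.continuous_velocity ht).aestronglyMeasurable
  have hpos : ∀ (t : ℝ), 0 ≤ t → 0 < 1 + t := fun t ht => by linarith
  refine ⟨max 1 (max C1 C2), ⟨by positivity, ?_, ?_, ?_⟩⟩
  · intro t ht x
    have h1 := hC2 t ht.le
    rw [eLpNorm_exponent_top] at h1
    have h2 : ∀ᵐ y, ‖u t y‖ₑ ≤ ofReal (C2 * (1 + t) ^ (-(n : ℝ) / 2 * (1 - ((∞ : ℝ≥0∞)⁻¹).toReal) - 1 / 2)) := by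
      filter_upwards [enorm_ae_le_eLpNormEssSup (u t) volume] with y hy using hy.trans h1
    have h3 : ∀ᵐ y, ‖u t y‖ ≤ max 1 (max C1 C2) * (1 + t) ^ (-((n : ℝ) + 1) / 2) := by
      filter_upwards [h2] with y hy
      have e : -(n : ℝ) / 2 * (1 - ((∞ : ℝ≥0∞)⁻¹).toReal) - 1 / 2 = -((n : ℝ) + 1) / 2 := by
        simp; ring
      rw [e, ← ofReal_norm] at hy
      have : ofReal ‖u t y‖ ≤ ofReal (max 1 (max C1 C2) * (1 + t) ^ (-((n : ℝ) + 1) / 2)) := by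
        refine hy.trans (ofReal_le_ofReal ?_)
        have := hpos t ht.le
        gcongr
        exact (le_max_right _ _).trans (le_max_right _ _)
      have h1t := hpos t ht.le
      exact (ENNReal.ofReal_le_ofReal_iff (by positivity)).1 this
    have hcl : IsClosed {y | ‖u t y‖ ≤ max 1 (max C1 C2) * (1 + t) ^ (-((n : ℝ) + 1) / 2)} :=
      isClosed_le (h.continuous_velocity ht).norm continuous_const
    have hdense : Dense {y | ‖u t y‖ ≤ max 1 (max C1 C2) * (1 + t) ^ (-((n : ℝ) + 1) / 2)} :=
      Measure.dense_of_ae h3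
    have := hcl.closure_eq ▸ hdense x
    exact this
  · intro t ht
    refine memLp_one_iff_integrable.1 ⟨hmeas t ht, (hC1 t ht).trans_lt ofReal_lt_top⟩
  · intro t ht
    have h1 := hC1 t ht
    rw [eLpNorm_one_eq_lintegral_enorm] at h1
    rw [integral_norm_eq_lintegral_enorm (hmeas t ht)]
    have h1t := hpos t ht
    refine ENNReal.toReal_le_of_le_ofReal (by positivity) (h1.trans (ofReal_le_ofReal ?_))
    have e : -(n : ℝ) / 2 * (1 - ((1 : ℝ≥0∞)⁻¹).toReal) - 1 / 2 = -(1 / 2 : ℝ) := by simp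
    rw [e]
    gcongr
    exact (le_max_left _ _).trans (le_max_right _ _)

namespace VelocityBound

variable {u : ℝ → Eu n → Eu n} {A t : ℝ}

lemma norm_le (hA : VelocityBound u A) (ht : 0 < t) (x : Eu n) : ‖u t x‖ ≤ A :=
  (hA.sup_le t ht x).trans (mul_le_of_le_one_right hA.pos.le
    (Real.rpow_le_one_of_one_le_of_nonpos (by linarith) (by have : (0 : ℝ) ≤ n := n.cast_nonneg
                                                            linarith)))

lemma norm_integral_le (hA : VelocityBound u A) (ht : 0 ≤ t) : ∫ x, ‖u t x‖ ≤ A :=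
  (hA.integral_le t ht).trans (mul_le_of_le_one_right hA.pos.le
    (Real.rpow_le_one_of_one_le_of_nonpos (by linarith) (by norm_num)))

lemma integrable_sq (hA : VelocityBound u A) (ht : 0 < t) : Integrable fun x => ‖u t x‖ ^ 2 := by
  have h := (hA.integrable t ht.le).norm
  refine (h.const_mul A).mono' (h.1.pow 2) (.of_forall fun x => ?_)
  rw [norm_of_nonneg (by positivity), sq]
  exact mul_le_mul_of_nonneg_right (hA.norm_le ht x) (norm_nonneg _)

lemma integral_sq_le (hA : VelocityBound u A) (ht : 0 < t) : ∫ x, ‖u t x‖ ^ 2 ≤ A ^ 2 := by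
  have h := (hA.integrable t ht.le).norm
  calc ∫ x, ‖u t x‖ ^ 2 ≤ ∫ x, A * ‖u t x‖ := by
        refine integral_mono (hA.integrable_sq ht) (h.const_mul A) fun x => ?_
        simp only [sq]
        exact mul_le_mul_of_nonneg_right (hA.norm_le ht x) (norm_nonneg _)
    _ = A * ∫ x, ‖u t x‖ := integral_const_mul _ _
    _ ≤ A ^ 2 := by rw [sq]; exact mul_le_mul_of_nonneg_left (hA.norm_integral_le ht.le) hA.pos.le

lemma abs_coord_le (x : Eu n) (i : Fin n) : |x i| ≤ ‖x‖ := by simpa using PiLp.norm_apply_le x i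

end VelocityBound

/-- The smooth cutoff equal to `1` on the ball of radius `R` and supported in that of radius `2R`. -/
def cutoffBump : ContDiffBump (0 : Eu n) := ⟨1, 2, one_pos, one_lt_two⟩

def cutoff (R : ℝ) (x : Eu n) : ℝ := cutoffBump (R⁻¹ • x)

section Cutoff

variable {R : ℝ}

lemma contDiff_cutoff (R : ℝ) : ContDiff ℝ ∞ (cutoff (n := n) R) :=
  cutoffBump.contDiff.comp (contDiff_const_smul R⁻¹)

lemma cutoff_nonneg (R : ℝ) (x : Eu n) : 0 ≤ cutoff R x := cutoffBump.nonneg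
lemma cutoff_le_one (R : ℝ) (x : Eu n) : cutoff R x ≤ 1 := cutoffBump.le_one

lemma cutoff_eq_one (hR : 0 < R) {x : Eu n} (hx : ‖x‖ ≤ R) : cutoff R x = 1 := by
  refine cutoffBump.one_of_mem_closedBall ?_
  rw [mem_closedBall_zero_iff, norm_smul, norm_inv, norm_of_nonneg hR.le]
  change R⁻¹ * ‖x‖ ≤ 1
  rw [inv_mul_le_iff₀ hR]; linarith

lemma cutoff_eq_zero (hR : 0 < R) {x : Eu n} (hx : x ∉ Metric.closedBall (0 : Eu n) (2 * R)) :
    cutoff R x = 0 := by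
  refine cutoffBump.zero_of_le_dist ?_
  rw [mem_closedBall_zero_iff, not_le] at hx
  rw [dist_zero_right, norm_smul, norm_inv, norm_of_nonneg hR.le]
  change 2 ≤ R⁻¹ * ‖x‖
  rw [inv_mul_eq_div, le_div_iff₀ hR]; exact hx.le

lemma hasCompactSupport_cutoff (hR : 0 < R) : HasCompactSupport (cutoff (n := n) R) :=
  HasCompactSupport.intro (isCompact_closedBall 0 (2 * R)) fun _ hx => cutoff_eq_zero hR hx

lemma tendsto_cutoff (x : Eu n) : Tendsto (fun R => cutoff R x) atTop (𝓝 1) := by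
  refine tendsto_const_nhds.congr' ?_
  filter_upwards [eventually_ge_atTop ‖x‖, eventually_gt_atTop 0] with R h1 h2
  exact (cutoff_eq_one h2 h1).symm

lemma exists_abs_deriv_cutoff_le : ∃ c : ℝ, 0 < c ∧ ∀ R : ℝ, 1 ≤ R → ∀ x : Eu n,
    (∀ k, |pderiv k (cutoff R) x| ≤ c * R⁻¹) ∧
      ∀ k, |pderiv k (pderiv k (cutoff R)) x| ≤ c * R⁻¹ := by
  have hs : ContDiff ℝ ∞ (cutoffBump (n := n)) := cutoffBump.contDiff
  have hcs : HasCompactSupport (cutoffBump (n := n)) := cutoffBump.hasCompactSupport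
  have hb : ∀ f : Eu n → ℝ, ContDiff ℝ ∞ f → HasCompactSupport f → ∃ C, ∀ x, |f x| ≤ C := by
    intro f hf hc
    obtain ⟨C, hC⟩ := hf.continuous.bounded_above_of_compact_support hc
    exact ⟨C, hC⟩
  have hscale : ∀ (f : Eu n → ℝ), ContDiff ℝ ∞ f → ∀ (R : ℝ) (k : Fin n) (x : Eu n),
      pderiv k (fun y => f (R⁻¹ • y)) x = R⁻¹ * pderiv k f (R⁻¹ • x) := by
    intro f hf R k x
    have h : HasFDerivAt (fun y : Eu n => f (R⁻¹ • y))
        ((fderiv ℝ f (R⁻¹ • x)).comp (R⁻¹ • ContinuousLinearMap.id ℝ (Eu n))) x :=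
      ((hf.differentiable (by simp)) (R⁻¹ • x)).hasFDerivAt.comp x
        ((hasFDerivAt_id x).const_smul R⁻¹)
    rw [pderiv, h.fderiv]
    simp [pderiv]
  choose C1 hC1 using fun k => hb _ (contDiff_pderiv k hs) (hasCompactSupport_pderiv k hcs)
  choose C2 hC2 using fun k => hb _ (contDiff_pderiv k (contDiff_pderiv k hs))
    (hasCompactSupport_pderiv k (hasCompactSupport_pderiv k hcs))
  refine ⟨1 + ∑ k, (|C1 k| + |C2 k|), by positivity, fun R hR x => ⟨fun k => ?_, fun k => ?_⟩⟩
  all_goals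
    have hR0 : 0 < R := by linarith
    have hR1 : R⁻¹ ≤ 1 := inv_le_one_of_one_le₀ hR
    have hsum : |C1 k| + |C2 k| ≤ ∑ k, (|C1 k| + |C2 k|) :=
      single_le_sum (f := fun k => |C1 k| + |C2 k|) (fun k _ => by positivity) (Finset.mem_univ k)
    have e : pderiv k (cutoff (n := n) R) = fun y => R⁻¹ * pderiv k cutoffBump (R⁻¹ • y) := by
      funext y; exact hscale _ hs R k y
  · rw [e]
    simp only [abs_mul, abs_inv, abs_of_pos hR0]
    rw [mul_comm]
    refine mul_le_mul_of_nonneg_right ?_ (by positivity)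
    linarith [hC1 k (R⁻¹ • x), le_abs_self (C1 k), abs_nonneg (C2 k)]
  · rw [e]
    have e2 : pderiv k (fun y => R⁻¹ * pderiv k (cutoffBump (n := n)) (R⁻¹ • y)) x =
        R⁻¹ * (R⁻¹ * pderiv k (pderiv k cutoffBump) (R⁻¹ • x)) := by
      rw [← hscale _ (contDiff_pderiv k hs)]
      have hd : DifferentiableAt ℝ (fun y => pderiv k (cutoffBump (n := n)) (R⁻¹ • y)) x :=
        (((contDiff_pderiv k hs).comp (contDiff_const_smul R⁻¹)).differentiable (by simp)) x
      rw [pderiv, fderiv_const_mul hd]; simp [pderiv]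
    rw [e2]
    simp only [abs_mul, abs_inv, abs_of_pos hR0]
    rw [mul_comm]
    refine mul_le_mul_of_nonneg_right ?_ (by positivity)
    have := hC2 k (R⁻¹ • x)
    have h3 := mul_le_of_le_one_left (abs_nonneg (pderiv k (pderiv k cutoffBump) (R⁻¹ • x))) hR1
    linarith [le_abs_self (C2 k), abs_nonneg (C1 k)]

end Cutoff

lemma integrable_mul_of_hasCompactSupport {f ψ : Eu n → ℝ} (hf : Continuous f) (hψ : Continuous ψ)
    (hc : HasCompactSupport ψ) : Integrable fun x => f x * ψ x :=
  (hf.mul hψ).integrable_of_hasCompactSupport hc.mul_left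

section Weak

variable {u : ℝ → Eu n → Eu n} {p : ℝ → Eu n → ℝ} {t : ℝ}

lemma IsNSSolution.contDiff_comp (h : IsNSSolution u p) (ht : 0 < t) (j : Fin n) :
    ContDiff ℝ ∞ (fun y => u t y j) := (h.smooth_comp j).slice ht

lemma IsNSSolution.contDiff_vorticity (h : IsNSSolution u p) (ht : 0 < t) (i j : Fin n) :
    ContDiff ℝ ∞ (vorticity u i j t) := (h.smooth_vorticity i j).slice ht

lemma IsNSSolution.weak_vorticity_equation (h : IsNSSolution u p) (ht : 0 < t) (i j : Fin n)
    {ψ : Eu n → ℝ} (hψ : ContDiff ℝ ∞ ψ) (hc : HasCompactSupport ψ) :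
    ∫ x, deriv (fun s => vorticity u i j s x) t * ψ x =
      (∑ k, -∫ x, pderiv k (vorticity u i j t) x * pderiv k ψ x) +
        ∑ k, ((∫ x, u t x k * vorticity u k j t x * pderiv i ψ x) -
          ∫ x, u t x k * vorticity u k i t x * pderiv j ψ x) := by
  have hw := fun i j => h.contDiff_vorticity ht i j
  have hf : ∀ k j, ContDiff ℝ ∞ fun y => u t y k * vorticity u k j t y :=
    fun k j => (h.contDiff_comp ht k).mul (hw k j)
  have e : (fun x => deriv (fun s => vorticity u i j s x) t * ψ x) = fun x =>
      ∑ k, pderiv k (pderiv k (vorticity u i j t)) x * ψ x -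
        ∑ k, (pderiv i (fun y => u t y k * vorticity u k j t y) x * ψ x -
          pderiv j (fun y => u t y k * vorticity u k i t y) x * ψ x) := by
    funext x
    rw [h.vorticity_equation ht x i j, sub_mul, sum_mul, sum_mul]
    simp_rw [sub_mul]
  have i1 : ∀ k, Integrable fun x => pderiv k (pderiv k (vorticity u i j t)) x * ψ x := fun k =>
    integrable_mul_of_hasCompactSupport
      (contDiff_pderiv k (contDiff_pderiv k (hw i j))).continuous hψ.continuous hc
  have i2 : ∀ i k j, Integrable fun x =>
      pderiv i (fun y => u t y k * vorticity u k j t y) x * ψ x := fun i k j =>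
    integrable_mul_of_hasCompactSupport (contDiff_pderiv i (hf k j)).continuous hψ.continuous hc
  rw [e, integral_sub (integrable_finsetSum _ fun k _ => i1 k)
    (integrable_finsetSum _ fun k _ => (i2 i k j).sub' (i2 j k i)),
    integral_finsetSum _ fun k _ => i1 k,
    integral_finsetSum _ fun k _ => (i2 i k j).sub' (i2 j k i)]
  simp_rw [fun k => integral_sub (i2 i k j) (i2 j k i),
    fun k => integral_pderiv_mul k (contDiff_pderiv k (hw i j)) hψ hc,
    fun k => integral_pderiv_mul i (hf k j) hψ hc, fun k => integral_pderiv_mul j (hf k i) hψ hc]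
  rw [sub_eq_add_neg, ← sum_neg_distrib]
  congr 1
  exact sum_congr rfl fun k _ => by ring

end Weak

section Pointwise

variable {a : Fin n → Fin n → ℝ} {b : Fin n → Fin n → Fin n → ℝ} {v q : Fin n → ℝ} {A c χ V : ℝ}

lemma abs_le_sqrt_sum_sq (a : Fin n → Fin n → ℝ) (i j : Fin n) :
    |a i j| ≤ √(∑ i, ∑ j, a i j ^ 2) := by
  refine Real.abs_le_sqrt ?_
  exact (single_le_sum (f := fun j => a i j ^ 2) (fun _ _ => sq_nonneg _)
    (Finset.mem_univ j)).trans (single_le_sum (f := fun i => ∑ j, a i j ^ 2)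
      (fun _ _ => sum_nonneg fun _ _ => sq_nonneg _) (Finset.mem_univ i))

lemma abs_le_sqrt_sum_sq₃ (b : Fin n → Fin n → Fin n → ℝ) (k i j : Fin n) :
    |b k i j| ≤ √(∑ i, ∑ j, ∑ k, b k i j ^ 2) := by
  refine Real.abs_le_sqrt ?_
  exact ((single_le_sum (f := fun k => b k i j ^ 2) (fun _ _ => sq_nonneg _)
    (Finset.mem_univ k)).trans (single_le_sum (f := fun j => ∑ k, b k i j ^ 2)
      (fun _ _ => sum_nonneg fun _ _ => sq_nonneg _) (Finset.mem_univ j))).trans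
    (single_le_sum (f := fun i => ∑ j, ∑ k, b k i j ^ 2)
      (fun _ _ => sum_nonneg fun _ _ => sum_nonneg fun _ _ => sq_nonneg _)
      (Finset.mem_univ i))

lemma sum_le_card_mul {f : Fin n → ℝ} {C : ℝ} (h : ∀ i, f i ≤ C) : ∑ i, f i ≤ n * C := by
  simpa using Finset.sum_le_card_nsmul Finset.univ f C fun i _ => h i

lemma energy_integrand_le (hA : 0 ≤ A) (hc : 0 ≤ c) (hχ0 : 0 ≤ χ) (hχ1 : χ ≤ 1)
    (hv : ∀ h, |v h| ≤ A) (hq : ∀ k, |q k| ≤ c) :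
    ∑ i, ∑ j, 2 * (∑ k, -((b k i j + 4 * q k * a i j) * b k i j) +
      ∑ h, (v h * a h j * χ * (b i i j + 4 * q i * a i j) -
        v h * a h i * χ * (b j i j + 4 * q j * a i j))) ≤
      -(∑ i, ∑ j, ∑ k, b k i j ^ 2) + (4 * n ^ 6 * (2 * c + A) ^ 2 + 16 * n ^ 3 * A * c) *
        ∑ i, ∑ j, a i j ^ 2 := by
  set α := √(∑ i, ∑ j, a i j ^ 2) with hα
  set β := √(∑ i, ∑ j, ∑ k, b k i j ^ 2) with hβ
  have hα2 : α ^ 2 = ∑ i, ∑ j, a i j ^ 2 := sq_sqrt (by positivity)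
  have hβ2 : β ^ 2 = ∑ i, ∑ j, ∑ k, b k i j ^ 2 := sq_sqrt (by positivity)
  have hα0 : 0 ≤ α := sqrt_nonneg _
  have hβ0 : 0 ≤ β := sqrt_nonneg _
  have ha := abs_le_sqrt_sum_sq a
  have hb := abs_le_sqrt_sum_sq₃ b
  rw [← hα] at ha
  rw [← hβ] at hb
  have t1 : ∀ i j k, -((b k i j + 4 * q k * a i j) * b k i j) ≤ -b k i j ^ 2 + 4 * c * α * β := by
    intro i j k
    have : |q k * a i j * b k i j| ≤ c * α * β := by
      rw [abs_mul, abs_mul]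
      gcongr
      exacts [hq k, ha i j, hb k i j]
    nlinarith [neg_abs_le (q k * a i j * b k i j)]
  have t2 : ∀ i j h m, |v h * a h m * χ * (b i i j + 4 * q i * a i j)| ≤
      A * α * (β + 4 * c * α) := by
    intro i j h m
    rw [abs_mul, abs_mul, abs_mul, abs_of_nonneg hχ0]
    have h1 : |b i i j + 4 * q i * a i j| ≤ β + 4 * c * α := by
      refine (abs_add_le _ _).trans (add_le_add (hb i i j) ?_)
      rw [abs_mul, abs_mul, abs_of_nonneg (by norm_num : (0 : ℝ) ≤ 4)]
      gcongr
      exacts [hq i, ha i j]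
    have h2 : |v h| * |a h m| * χ ≤ A * α * 1 := by
      gcongr
      exacts [hv h, ha h m]
    rw [mul_one] at h2
    gcongr
  have t2' : ∀ i j h m, |v h * a h m * χ * (b j i j + 4 * q j * a i j)| ≤
      A * α * (β + 4 * c * α) := by
    intro i j h m
    rw [abs_mul, abs_mul, abs_mul, abs_of_nonneg hχ0]
    have h1 : |b j i j + 4 * q j * a i j| ≤ β + 4 * c * α := by
      refine (abs_add_le _ _).trans (add_le_add (hb j i j) ?_)
      rw [abs_mul, abs_mul, abs_of_nonneg (by norm_num : (0 : ℝ) ≤ 4)]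
      gcongr
      exacts [hq j, ha i j]
    have h2 : |v h| * |a h m| * χ ≤ A * α * 1 := by
      gcongr
      exacts [hv h, ha h m]
    rw [mul_one] at h2
    gcongr
  have hij : ∀ i j, 2 * (∑ k, -((b k i j + 4 * q k * a i j) * b k i j) +
      ∑ h, (v h * a h j * χ * (b i i j + 4 * q i * a i j) -
        v h * a h i * χ * (b j i j + 4 * q j * a i j))) ≤
      -2 * ∑ k, b k i j ^ 2 + n * (8 * c * α * β + 4 * (A * α * (β + 4 * c * α))) := by
    intro i j
    have s1 : ∑ k, -((b k i j + 4 * q k * a i j) * b k i j) ≤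
        -(∑ k, b k i j ^ 2) + n * (4 * c * α * β) := by
      refine (sum_le_sum fun k _ => t1 i j k).trans_eq ?_
      rw [sum_add_distrib, sum_neg_distrib]; simp
    have s2 : ∑ h, (v h * a h j * χ * (b i i j + 4 * q i * a i j) -
        v h * a h i * χ * (b j i j + 4 * q j * a i j)) ≤
        n * (2 * (A * α * (β + 4 * c * α))) :=
      sum_le_card_mul fun h => by
        linarith [le_abs_self (v h * a h j * χ * (b i i j + 4 * q i * a i j)), t2 i j h j,
          neg_abs_le (v h * a h i * χ * (b j i j + 4 * q j * a i j)), t2' i j h i]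
    linarith
  have hs : ∀ K : ℝ, ∑ i, ∑ j, (-2 * ∑ k, b k i j ^ 2 + n * K) =
      -2 * ∑ i, ∑ j, ∑ k, b k i j ^ 2 + n ^ 3 * K := by
    intro K
    simp_rw [sum_add_distrib, ← mul_sum]
    simp; ring
  refine (sum_le_sum fun i _ => sum_le_sum fun j _ => hij i j).trans ?_
  rw [hs, ← hα2, ← hβ2]
  nlinarith [sq_nonneg (β - 2 * (n : ℝ) ^ 3 * (2 * c + A) * α)]

lemma enstrophy_integrand_le (hc : 0 ≤ c) (hV : 0 ≤ V) (hv : ∀ h, |v h| ≤ V)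
    (hq : ∀ k, |q k| ≤ c) {η : ℝ} (hη : 0 < η) :
    ∑ i, ∑ j, (-(v j * (2 * q i * a i j + b i i j)) + v i * (2 * q j * a i j + b j i j)) ≤
      (1 / 2) * ∑ i, ∑ j, a i j ^ 2 + η * ∑ i, ∑ j, ∑ k, b k i j ^ 2 +
        (8 * n ^ 4 * c ^ 2 + n ^ 4) * (1 + η⁻¹) * V ^ 2 := by
  set α := √(∑ i, ∑ j, a i j ^ 2) with hα
  set β := √(∑ i, ∑ j, ∑ k, b k i j ^ 2) with hβ
  have hα2 : α ^ 2 = ∑ i, ∑ j, a i j ^ 2 := sq_sqrt (by positivity)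
  have hβ2 : β ^ 2 = ∑ i, ∑ j, ∑ k, b k i j ^ 2 := sq_sqrt (by positivity)
  have hα0 : 0 ≤ α := sqrt_nonneg _
  have hβ0 : 0 ≤ β := sqrt_nonneg _
  have ha := abs_le_sqrt_sum_sq a
  have hb := abs_le_sqrt_sum_sq₃ b
  rw [← hα] at ha
  rw [← hβ] at hb
  have t : ∀ i j k m, |v m * (2 * q k * a i j + b k i j)| ≤ V * (2 * c * α + β) := by
    intro i j k m
    rw [abs_mul]
    have h1 : |2 * q k * a i j + b k i j| ≤ 2 * c * α + β := by
      refine (abs_add_le _ _).trans (add_le_add ?_ (hb k i j))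
      rw [abs_mul, abs_mul, abs_of_nonneg (by norm_num : (0 : ℝ) ≤ 2)]
      gcongr
      exacts [hq k, ha i j]
    have := hv m
    gcongr
  have h1 : ∑ i, ∑ j, (-(v j * (2 * q i * a i j + b i i j)) + v i * (2 * q j * a i j + b j i j)) ≤
      n * (n * (2 * (V * (2 * c * α + β)))) :=
    sum_le_card_mul fun i => sum_le_card_mul fun j => by
      linarith [neg_abs_le (v j * (2 * q i * a i j + b i i j)), t i j i j,
        le_abs_self (v i * (2 * q j * a i j + b j i j)), t i j j i]
  refine h1.trans ?_
  rw [← hα2, ← hβ2]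
  have h2 : 2 * ((n : ℝ) ^ 2 * V) * β ≤ η * β ^ 2 + (n ^ 2 * V) ^ 2 * η⁻¹ := by
    have : η * β ^ 2 + (n ^ 2 * V) ^ 2 * η⁻¹ - 2 * ((n : ℝ) ^ 2 * V) * β =
        (η * β - n ^ 2 * V) ^ 2 * η⁻¹ := by field_simp; ring
    have h0 : 0 ≤ (η * β - n ^ 2 * V) ^ 2 * η⁻¹ := by positivity
    linarith
  have h3 : 4 * ((n : ℝ) ^ 2 * c * V) * α ≤ (1 / 2) * α ^ 2 + 8 * (n ^ 2 * c * V) ^ 2 := by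
    nlinarith [sq_nonneg (α - 4 * ((n : ℝ) ^ 2 * c * V))]
  have h4 : (0 : ℝ) ≤ (n ^ 2 * V) ^ 2 := by positivity
  have h5 : 0 ≤ (n ^ 2 * c * V) ^ 2 * η⁻¹ := by positivity
  nlinarith
  
end Pointwise

section Energy

variable {u : ℝ → Eu n → Eu n} {p : ℝ → Eu n → ℝ} {t A c : ℝ} {χ : Eu n → ℝ}

/-- `∑_{ij} χ⁴ ω_{ij}²`. -/
def enstrophyDensity (u : ℝ → Eu n → Eu n) (χ : Eu n → ℝ) (t : ℝ) (x : Eu n) : ℝ :=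
  ∑ i, ∑ j, χ x ^ 4 * vorticity u i j t x ^ 2

/-- `∑_{ij} χ² ω_{ij}²`. -/
def cutoffEnstrophy (u : ℝ → Eu n → Eu n) (χ : Eu n → ℝ) (t : ℝ) (x : Eu n) : ℝ :=
  ∑ i, ∑ j, (χ x * vorticity u i j t x) ^ 2

/-- `∑_{ijk} χ⁴ (∂_k ω_{ij})²`. -/
def cutoffDissipation (u : ℝ → Eu n → Eu n) (χ : Eu n → ℝ) (t : ℝ) (x : Eu n) : ℝ :=
  ∑ i, ∑ j, ∑ k, (χ x ^ 2 * pderiv k (vorticity u i j t) x) ^ 2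

lemma hasCompactSupport_of_mul {f : Eu n → ℝ} (hc : HasCompactSupport χ)
    (h : ∀ x, χ x = 0 → f x = 0) : HasCompactSupport f :=
  hc.mono fun x hx h' => hx (h x h')

lemma integrable_cutoffEnstrophy (h : IsNSSolution u p) (ht : 0 < t) (hχ : ContDiff ℝ ∞ χ)
    (hc : HasCompactSupport χ) : Integrable (cutoffEnstrophy u χ t) := by
  refine Continuous.integrable_of_hasCompactSupport ?_ (hasCompactSupport_of_mul hc fun x hx => ?_)
  · exact continuous_finsetSum _ fun i _ => continuous_finsetSum _ fun j _ =>
      (hχ.continuous.mul (h.contDiff_vorticity ht i j).continuous).pow 2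
  · simp [cutoffEnstrophy, hx]

lemma integrable_cutoffDissipation (h : IsNSSolution u p) (ht : 0 < t) (hχ : ContDiff ℝ ∞ χ)
    (hc : HasCompactSupport χ) : Integrable (cutoffDissipation u χ t) := by
  refine Continuous.integrable_of_hasCompactSupport ?_ (hasCompactSupport_of_mul hc fun x hx => ?_)
  · exact continuous_finsetSum _ fun i _ => continuous_finsetSum _ fun j _ =>
      continuous_finsetSum _ fun k _ =>
      ((hχ.continuous.pow 2).mul (contDiff_pderiv k (h.contDiff_vorticity ht i j)).continuous).pow 2
  · simp [cutoffDissipation, hx]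

lemma pderiv_pow_mul {f g : Eu n → ℝ} (hf : ContDiff ℝ ∞ f) (hg : ContDiff ℝ ∞ g) (m : ℕ)
    (k : Fin n) (x : Eu n) :
    pderiv k (fun y => f y ^ (m + 1) * g y) x =
      (m + 1) * f x ^ m * pderiv k f x * g x + f x ^ (m + 1) * pderiv k g x := by
  have hfd := (hf.differentiable (by simp)) x
  rw [pderiv_mul k (f := fun y => f y ^ (m + 1)) (((hf.pow (m + 1)).differentiable (by simp)) x)
    ((hg.differentiable (by simp)) x)]
  congr 2
  rw [pderiv, fderiv_fun_pow (m + 1) hfd]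
  simp [pderiv]

lemma hasDerivAt_enstrophy (h : IsNSSolution u p) (ht : 0 < t) (hχ : ContDiff ℝ ∞ χ)
    (hc : HasCompactSupport χ) :
    HasDerivAt (fun s => ∫ x, enstrophyDensity u χ s x)
      (∑ i, ∑ j, 2 * ∫ x, deriv (fun s => vorticity u i j s x) t *
        (χ x ^ 4 * vorticity u i j t x)) t := by
  have hs : ∀ i j, SmoothPos fun t x => χ x ^ 4 * vorticity u i j t x ^ 2 := fun i j =>
    ((SmoothPos.of_space (hχ.pow 4)).mul ((h.smooth_vorticity i j).mul
      (h.smooth_vorticity i j))).congr fun t _ x => by ring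
  have hS : SmoothPos (enstrophyDensity u χ) :=
    SmoothPos.sum fun i _ => SmoothPos.sum fun j _ => hs i j
  have hd := hS.hasDerivAt_integral hc.isCompact (fun s _ x hx => by
    simp [enstrophyDensity, image_eq_zero_of_notMem_tsupport hx]) ht
  have e : ∀ x, deriv (fun s => enstrophyDensity u χ s x) t =
      ∑ i, ∑ j, 2 * (deriv (fun s => vorticity u i j s x) t * (χ x ^ 4 * vorticity u i j t x)) := by
    intro x
    have : HasDerivAt (fun s => enstrophyDensity u χ s x) (∑ i, ∑ j,
        χ x ^ 4 * (2 * vorticity u i j t x ^ (2 - 1) *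
          deriv (fun s => vorticity u i j s x) t)) t := by
      refine HasDerivAt.fun_sum fun i _ => HasDerivAt.fun_sum fun j _ => ?_
      exact (((h.smooth_vorticity i j).hasDerivAt' ht x).fun_pow 2).const_mul (χ x ^ 4)
    rw [this.deriv]
    refine sum_congr rfl fun i _ => sum_congr rfl fun j _ => ?_
    norm_num; ring
  have hi : ∀ i j, Integrable fun x => 2 * (deriv (fun s => vorticity u i j s x) t *
        (χ x ^ 4 * vorticity u i j t x)) := by
    intro i j
    refine (integrable_mul_of_hasCompactSupport ((h.smooth_vorticity i j).td.continuous_slice ht)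
      ((hχ.pow 4).continuous.mul (h.contDiff_vorticity ht i j).continuous)
      (hasCompactSupport_of_mul hc fun x hx => by simp [hx])).const_mul 2
  simp_rw [e] at hd
  rw [integral_finsetSum _ fun i _ => integrable_finsetSum _ fun j _ => hi i j] at hd
  refine hd.congr_deriv (sum_congr rfl fun i _ => ?_)
  rw [integral_finsetSum _ fun j _ => hi i j]
  exact sum_congr rfl fun j _ => integral_const_mul _ _

lemma deriv_enstrophy_le (h : IsNSSolution u p) (hA : VelocityBound u A) (ht : 0 < t)
    (hχ : ContDiff ℝ ∞ χ) (hc : HasCompactSupport χ) (h0 : ∀ x, 0 ≤ χ x) (h1 : ∀ x, χ x ≤ 1)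
    (hc0 : 0 ≤ c) (hq : ∀ k x, |pderiv k χ x| ≤ c) :
    ∑ i, ∑ j, 2 * ∫ x, deriv (fun s => vorticity u i j s x) t * (χ x ^ 4 * vorticity u i j t x) ≤
      -(∫ x, cutoffDissipation u χ t x) +
        (4 * n ^ 6 * (2 * c + A) ^ 2 + 16 * n ^ 3 * A * c) * ∫ x, cutoffEnstrophy u χ t x := by
  have hw := fun i j => h.contDiff_vorticity ht i j
  have hψ : ∀ i j, ContDiff ℝ ∞ fun x => χ x ^ (3 + 1) * vorticity u i j t x :=
    fun i j => (hχ.pow 4).mul (hw i j)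
  have hψc : ∀ i j, HasCompactSupport fun x => χ x ^ (3 + 1) * vorticity u i j t x :=
    fun i j => hasCompactSupport_of_mul hc fun x hx => by simp [hx]
  have hf : ∀ k j, Continuous fun y => u t y k * vorticity u k j t y :=
    fun k j => ((h.contDiff_comp ht k).mul (hw k j)).continuous
  have i1 : ∀ i j k, Integrable fun x => pderiv k (vorticity u i j t) x *
      pderiv k (fun x => χ x ^ (3 + 1) * vorticity u i j t x) x := fun i j k =>
    integrable_mul_of_hasCompactSupport (contDiff_pderiv k (hw i j)).continuous
      (contDiff_pderiv k (hψ i j)).continuous (hasCompactSupport_pderiv k (hψc i j))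
  have i2 : ∀ i j k l m, Integrable fun x => u t x k * vorticity u k l t x *
      pderiv m (fun x => χ x ^ (3 + 1) * vorticity u i j t x) x := fun i j k l m =>
    integrable_mul_of_hasCompactSupport (hf k l)
      (contDiff_pderiv m (hψ i j)).continuous (hasCompactSupport_pderiv m (hψc i j))
  have iI : ∀ i j, Integrable fun x => 2 * (∑ k, -(pderiv k (vorticity u i j t) x *
      pderiv k (fun x => χ x ^ (3 + 1) * vorticity u i j t x) x) +
      ∑ k, (u t x k * vorticity u k j t x *
        pderiv i (fun x => χ x ^ (3 + 1) * vorticity u i j t x) x -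
        u t x k * vorticity u k i t x *
        pderiv j (fun x => χ x ^ (3 + 1) * vorticity u i j t x) x)) := fun i j =>
    (((integrable_finsetSum _ fun k _ => (i1 i j k).fun_neg).fun_add
      (integrable_finsetSum _ fun k _ => (i2 i j k j i).sub' (i2 i j k i j))).const_mul 2)
  have e : ∑ i, ∑ j, 2 * ∫ x, deriv (fun s => vorticity u i j s x) t *
        (χ x ^ 4 * vorticity u i j t x) = ∫ x, ∑ i, ∑ j,
      2 * (∑ k, -(pderiv k (vorticity u i j t) x *
      pderiv k (fun x => χ x ^ (3 + 1) * vorticity u i j t x) x) +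
      ∑ k, (u t x k * vorticity u k j t x *
        pderiv i (fun x => χ x ^ (3 + 1) * vorticity u i j t x) x -
        u t x k * vorticity u k i t x *
        pderiv j (fun x => χ x ^ (3 + 1) * vorticity u i j t x) x)) := by
    rw [integral_finsetSum _ fun i _ => integrable_finsetSum _ fun j _ => iI i j]
    refine sum_congr rfl fun i _ => ?_
    rw [integral_finsetSum _ fun j _ => iI i j]
    refine sum_congr rfl fun j _ => ?_
    rw [integral_const_mul, h.weak_vorticity_equation ht i j (hψ i j) (hψc i j),
      integral_add (integrable_finsetSum _ fun k _ => (i1 i j k).fun_neg)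
      (integrable_finsetSum _ fun k _ => (i2 i j k j i).sub' (i2 i j k i j)),
      integral_finsetSum _ fun k _ => (i1 i j k).fun_neg,
      integral_finsetSum _ fun k _ => (i2 i j k j i).sub' (i2 i j k i j)]
    simp_rw [integral_neg, fun k => integral_sub (i2 i j k j i) (i2 i j k i j)]
  rw [e, ← integral_neg, ← integral_const_mul, ← integral_add
    (integrable_cutoffDissipation h ht hχ hc).fun_neg
    ((integrable_cutoffEnstrophy h ht hχ hc).const_mul _)]
  refine integral_mono (integrable_finsetSum _ fun i _ => integrable_finsetSum _ fun j _ => iI i j)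
    ((integrable_cutoffDissipation h ht hχ hc).fun_neg.add
    ((integrable_cutoffEnstrophy h ht hχ hc).const_mul _)) fun x => ?_
  refine le_trans (le_of_eq ?_) (energy_integrand_le (a := fun i j => χ x * vorticity u i j t x)
    (b := fun k i j => χ x ^ 2 * pderiv k (vorticity u i j t) x) (v := fun h => u t x h)
    (q := fun k => pderiv k χ x) hA.pos.le hc0 (h0 x) (h1 x)
    (fun h => (VelocityBound.abs_coord_le _ h).trans (hA.norm_le ht x)) (fun k => hq k x))
  refine sum_congr rfl fun i _ => sum_congr rfl fun j _ => ?_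
  congr 2
  · refine sum_congr rfl fun k _ => ?_
    rw [pderiv_pow_mul hχ (hw i j)]; push_cast; ring
  · refine sum_congr rfl fun k _ => ?_
    rw [pderiv_pow_mul hχ (hw i j), pderiv_pow_mul hχ (hw i j)]; push_cast; ring

lemma cutoffEnstrophy_le (h : IsNSSolution u p) (hA : VelocityBound u A) (ht : 0 < t)
    (hχ : ContDiff ℝ ∞ χ) (hc : HasCompactSupport χ)
    (hc0 : 0 ≤ c) (hq : ∀ k x, |pderiv k χ x| ≤ c) {η : ℝ} (hη : 0 < η) :
    ∫ x, cutoffEnstrophy u χ t x ≤ 2 * η * (∫ x, cutoffDissipation u χ t x) +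
      2 * (8 * n ^ 4 * c ^ 2 + n ^ 4) * A ^ 2 * (1 + η⁻¹) := by
  have hw := fun i j => h.contDiff_vorticity ht i j
  have hu := fun j => h.contDiff_comp ht j
  have hψ : ∀ i j, ContDiff ℝ ∞ fun x => χ x ^ (1 + 1) * vorticity u i j t x :=
    fun i j => (hχ.pow 2).mul (hw i j)
  have hψc : ∀ i j, HasCompactSupport fun x => χ x ^ (1 + 1) * vorticity u i j t x :=
    fun i j => hasCompactSupport_of_mul hc fun x hx => by simp [hx]
  have i1 : ∀ i j k m, Integrable fun x => u t x m *
      pderiv k (fun x => χ x ^ (1 + 1) * vorticity u i j t x) x := fun i j k m =>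
    integrable_mul_of_hasCompactSupport (hu m).continuous
      (contDiff_pderiv k (hψ i j)).continuous (hasCompactSupport_pderiv k (hψc i j))
  have i0 : ∀ i j k m, Integrable fun x => pderiv k (fun y => u t y m) x *
      (χ x ^ (1 + 1) * vorticity u i j t x) := fun i j k m =>
    integrable_mul_of_hasCompactSupport (contDiff_pderiv k (hu m)).continuous
      (hψ i j).continuous (hψc i j)
  have iE : ∀ i j, Integrable fun x => (χ x * vorticity u i j t x) ^ 2 := fun i j =>
    (((i0 i j i j).sub' (i0 i j j i))).congr (.of_forall fun x => by simp only [vorticity]; ring)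
  have e : ∫ x, cutoffEnstrophy u χ t x = ∫ x, ∑ i, ∑ j,
      (-(u t x j * pderiv i (fun x => χ x ^ (1 + 1) * vorticity u i j t x) x) +
        u t x i * pderiv j (fun x => χ x ^ (1 + 1) * vorticity u i j t x) x) := by
    unfold cutoffEnstrophy
    rw [integral_finsetSum _ fun i _ => integrable_finsetSum _ fun j _ => iE i j,
      integral_finsetSum _ fun i _ => integrable_finsetSum _ fun j _ =>
        (i1 i j i j).fun_neg.fun_add (i1 i j j i)]
    refine sum_congr rfl fun i _ => ?_
    rw [integral_finsetSum _ fun j _ => iE i j,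
      integral_finsetSum _ fun j _ => (i1 i j i j).fun_neg.fun_add (i1 i j j i)]
    refine sum_congr rfl fun j _ => ?_
    have : (fun x => (χ x * vorticity u i j t x) ^ 2) = fun x =>
        pderiv i (fun y => u t y j) x * (χ x ^ (1 + 1) * vorticity u i j t x) -
        pderiv j (fun y => u t y i) x * (χ x ^ (1 + 1) * vorticity u i j t x) := by
      funext x; simp only [vorticity]; ring
    rw [this, integral_sub (i0 i j i j) (i0 i j j i), integral_pderiv_mul i (hu j) (hψ i j) (hψc i j),
      integral_pderiv_mul j (hu i) (hψ i j) (hψc i j), integral_add (i1 i j i j).fun_neg (i1 i j j i)]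
    rw [integral_neg]
    ring
  have iQ := integrable_cutoffEnstrophy h ht hχ hc
  have iD := integrable_cutoffDissipation h ht hχ hc
  have iV := hA.integrable_sq ht
  have key : ∫ x, cutoffEnstrophy u χ t x ≤ ∫ x, ((1 / 2) * cutoffEnstrophy u χ t x +
      η * cutoffDissipation u χ t x +
      (8 * n ^ 4 * c ^ 2 + n ^ 4) * (1 + η⁻¹) * ‖u t x‖ ^ 2) := by
    rw [e]
    refine integral_mono (integrable_finsetSum _ fun i _ => integrable_finsetSum _ fun j _ =>
      (i1 i j i j).fun_neg.fun_add (i1 i j j i))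
      (((iQ.const_mul _).fun_add (iD.const_mul _)).fun_add (iV.const_mul _)) fun x => ?_
    refine le_trans (le_of_eq ?_) (enstrophy_integrand_le
      (a := fun i j => χ x * vorticity u i j t x)
      (b := fun k i j => χ x ^ 2 * pderiv k (vorticity u i j t) x) (v := fun h => u t x h)
      (q := fun k => pderiv k χ x) hc0 (norm_nonneg (u t x))
      (fun h => VelocityBound.abs_coord_le _ h) (fun k => hq k x) hη)
    refine sum_congr rfl fun i _ => sum_congr rfl fun j _ => ?_
    rw [pderiv_pow_mul hχ (hw i j), pderiv_pow_mul hχ (hw i j)]; push_cast; ring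
  rw [integral_add ((iQ.const_mul _).fun_add (iD.const_mul _)) (iV.const_mul _),
    integral_add (iQ.const_mul _) (iD.const_mul _), integral_const_mul, integral_const_mul,
    integral_const_mul] at key
  have hV := hA.integral_sq_le ht
  have hη' := inv_pos.2 hη
  have : (8 * (n : ℝ) ^ 4 * c ^ 2 + n ^ 4) * (1 + η⁻¹) * ∫ x, ‖u t x‖ ^ 2 ≤
      (8 * n ^ 4 * c ^ 2 + n ^ 4) * (1 + η⁻¹) * A ^ 2 := by gcongr
  linarith

lemma enstrophyDensity_le (h0 : ∀ x, 0 ≤ χ x) (h1 : ∀ x, χ x ≤ 1) (x : Eu n) :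
    enstrophyDensity u χ t x ≤ cutoffEnstrophy u χ t x := by
  refine sum_le_sum fun i _ => sum_le_sum fun j _ => ?_
  rw [mul_pow]
  exact mul_le_mul_of_nonneg_right (pow_le_pow_of_le_one (h0 x) (h1 x) (by norm_num)) (sq_nonneg _)

lemma enstrophy_le (h : IsNSSolution u p) (hA : VelocityBound u A) (hc0 : 0 ≤ c) (T : ℝ) :
    ∃ C, 0 ≤ C ∧ ∀ χ : Eu n → ℝ, ContDiff ℝ ∞ χ → HasCompactSupport χ → (∀ x, 0 ≤ χ x) →
      (∀ x, χ x ≤ 1) → (∀ k x, |pderiv k χ x| ≤ c) → ∀ t, 0 < t → t ≤ T →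
      ∫ x, enstrophyDensity u χ t x ≤ C / t := by
  set C1 : ℝ := 4 * n ^ 6 * (2 * c + A) ^ 2 + 16 * n ^ 3 * A * c with hC1
  set C2 : ℝ := 2 * (8 * n ^ 4 * c ^ 2 + n ^ 4) * A ^ 2 with hC2
  have hA0 := hA.pos
  have hC10 : 0 ≤ C1 := by positivity
  have hC20 : 0 ≤ C2 := by positivity
  set C3 : ℝ := C2 * (2 * |T| + C1 * |T| ^ 2 + (2 + C1 * |T|) * (4 + 2 * C1 * |T|)) with hC3
  refine ⟨2 * C3, by positivity, fun χ hχ hc h0 h1 hq t ht htT => ?_⟩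
  set Y := fun s => ∫ x, enstrophyDensity u χ s x with hY
  have hYd := fun s (hs : 0 < s) => hasDerivAt_enstrophy h hs hχ hc
  set t₀ := t / 2 with ht₀
  have ht₀0 : 0 < t₀ := by positivity
  have hZ : ∀ s, 0 < s → HasDerivAt (fun s => (s - t₀) ^ 2 * Y s)
      (2 * (s - t₀) * Y s + (s - t₀) ^ 2 * ∑ i, ∑ j, 2 * ∫ x,
        deriv (fun r => vorticity u i j r x) s * (χ x ^ 4 * vorticity u i j s x)) s := by
    intro s hs
    have h2 : HasDerivAt (fun s => (s - t₀) ^ 2) (2 * (s - t₀)) s := by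
      simpa using ((hasDerivAt_id s).sub_const t₀).fun_pow 2
    exact h2.mul (hYd s hs)
  have hZle : ∀ s ∈ interior (Icc t₀ t), deriv (fun s => (s - t₀) ^ 2 * Y s) s ≤ C3 := by
    intro s hs
    rw [interior_Icc] at hs
    have hs0 : 0 < s := ht₀0.trans hs.1
    rw [(hZ s hs0).deriv]
    set τ := s - t₀ with hτ
    have hτ0 : 0 < τ := sub_pos.2 hs.1
    have hτT : τ ≤ |T| := by
      have := le_abs_self T
      linarith [hs.2]
    set D := ∫ x, cutoffDissipation u χ s x
    set Q := ∫ x, cutoffEnstrophy u χ s x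
    have e1 : Y s ≤ Q := by
      refine integral_mono_of_nonneg (.of_forall fun x => ?_)
        (integrable_cutoffEnstrophy h hs0 hχ hc)
        (.of_forall fun x => enstrophyDensity_le h0 h1 x)
      exact sum_nonneg fun i _ => sum_nonneg fun j _ =>
        mul_nonneg (pow_nonneg (h0 x) 4) (sq_nonneg _)
    have e2 := deriv_enstrophy_le h hA hs0 hχ hc h0 h1 hc0 hq
    set η := τ / (4 + 2 * C1 * τ) with hη
    have hden : 0 < 4 + 2 * C1 * τ := by positivity
    have e3 := cutoffEnstrophy_le h hA hs0 hχ hc hc0 hq (η := η) (by positivity)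
    rw [← hC2] at e3
    rw [← hC1] at e2
    have hid : (2 * τ + τ ^ 2 * C1) * (2 * η) = τ ^ 2 := by rw [hη]; field_simp; ring
    have hid2 : (2 * τ + τ ^ 2 * C1) * (1 + η⁻¹) =
        2 * τ + C1 * τ ^ 2 + (2 + C1 * τ) * (4 + 2 * C1 * τ) := by
      rw [hη]; field_simp
    have e4 : (2 * τ + τ ^ 2 * C1) * Q ≤ τ ^ 2 * D + C2 *
        (2 * τ + C1 * τ ^ 2 + (2 + C1 * τ) * (4 + 2 * C1 * τ)) := by
      calc (2 * τ + τ ^ 2 * C1) * Q ≤ (2 * τ + τ ^ 2 * C1) * (2 * η * D + C2 * (1 + η⁻¹)) := by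
            exact mul_le_mul_of_nonneg_left e3 (by positivity)
        _ = (2 * τ + τ ^ 2 * C1) * (2 * η) * D + C2 * ((2 * τ + τ ^ 2 * C1) * (1 + η⁻¹)) := by ring
        _ = _ := by rw [hid, hid2]
    have e5 : C2 * (2 * τ + C1 * τ ^ 2 + (2 + C1 * τ) * (4 + 2 * C1 * τ)) ≤ C3 := by
      rw [hC3]; gcongr
    have e6 : 2 * τ * Y s ≤ 2 * τ * Q := by gcongr
    have e7 := mul_le_mul_of_nonneg_left e2 (sq_nonneg τ)
    calc _ ≤ 2 * τ * Q + τ ^ 2 * (-D + C1 * Q) := add_le_add e6 e7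
      _ = (2 * τ + τ ^ 2 * C1) * Q - τ ^ 2 * D := by ring
      _ ≤ C3 := by linarith
  have hpos : ∀ s ∈ Icc t₀ t, 0 < s := fun s hs => ht₀0.trans_le hs.1
  have := (convex_Icc t₀ t).image_sub_le_mul_sub_of_deriv_le
    (f := fun s => (s - t₀) ^ 2 * Y s) (C := C3)
    (fun s hs => (hZ s (hpos s hs)).continuousAt.continuousWithinAt)
    (fun s hs => (hZ s (hpos s (interior_subset hs))).differentiableAt.differentiableWithinAt)
    hZle t₀ ⟨le_rfl, by linarith⟩ t ⟨by linarith, le_rfl⟩ (by linarith)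
  simp only [sub_self] at this
  have hh : t - t₀ = t / 2 := by rw [ht₀]; ring
  rw [hh] at this
  have h3 : t ^ 2 * Y t ≤ 2 * C3 * t := by nlinarith
  rw [le_div_iff₀ ht]
  change Y t * t ≤ _
  nlinarith

/-- The vorticity is square integrable, locally uniformly with a singularity `1 / t`. -/
theorem IsNSSolution.exists_integral_vorticity_sq_le (h : IsNSSolution u p)
    (hA : VelocityBound u A) (T : ℝ) :
    ∃ C, 0 ≤ C ∧ ∀ i j, ∀ t, 0 < t → t ≤ T → Integrable (fun x => vorticity u i j t x ^ 2) ∧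
      ∫ x, vorticity u i j t x ^ 2 ≤ C / t := by
  obtain ⟨c, hc, hcut⟩ := exists_abs_deriv_cutoff_le (n := n)
  obtain ⟨C, hC0, hC⟩ := enstrophy_le h hA hc.le T
  refine ⟨C, hC0, fun i j t ht htT => ?_⟩
  have hcont : Continuous fun x => vorticity u i j t x ^ 2 :=
    (h.contDiff_vorticity ht i j).continuous.pow 2
  have hb : ∀ R : ℕ, 1 ≤ R → ∫ x in Metric.ball (0 : Eu n) R, vorticity u i j t x ^ 2 ≤ C / t := by
    intro R hR
    have hR1 : (1 : ℝ) ≤ R := by exact_mod_cast hR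
    have hR0 : (0 : ℝ) < R := by linarith
    refine le_trans ?_ (hC (cutoff R) (contDiff_cutoff _) (hasCompactSupport_cutoff hR0)
      (cutoff_nonneg _) (cutoff_le_one _) (fun k x => ((hcut R hR1 x).1 k).trans
        (mul_le_of_le_one_right hc.le (inv_le_one_of_one_le₀ hR1))) t ht htT)
    rw [← integral_indicator measurableSet_ball]
    refine integral_mono_of_nonneg (.of_forall fun x =>
      indicator_nonneg (fun _ _ => sq_nonneg _) x) ?_ (.of_forall fun x => ?_)
    · refine Continuous.integrable_of_hasCompactSupport ?_
        (hasCompactSupport_of_mul (hasCompactSupport_cutoff hR0) fun x hx => by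
          simp [enstrophyDensity, hx])
      exact continuous_finsetSum _ fun i _ => continuous_finsetSum _ fun j _ =>
        ((contDiff_cutoff R).continuous.pow 4).mul ((h.contDiff_vorticity ht i j).continuous.pow 2)
    · have hterm : ∀ i j, 0 ≤ cutoff (R : ℝ) x ^ 4 * vorticity u i j t x ^ 2 := fun i j =>
        mul_nonneg (pow_nonneg (cutoff_nonneg _ x) 4) (sq_nonneg _)
      by_cases hx : x ∈ Metric.ball (0 : Eu n) R
      · rw [indicator_of_mem hx]
        have hx' : ‖x‖ ≤ R := (mem_ball_zero_iff.1 hx).le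
        calc vorticity u i j t x ^ 2 = cutoff (R : ℝ) x ^ 4 * vorticity u i j t x ^ 2 := by
              rw [cutoff_eq_one hR0 hx']; ring
          _ ≤ ∑ j, cutoff (R : ℝ) x ^ 4 * vorticity u i j t x ^ 2 :=
            single_le_sum (fun j _ => hterm i j) (Finset.mem_univ j)
          _ ≤ enstrophyDensity u (cutoff R) t x :=
            single_le_sum (f := fun i => ∑ j, cutoff (R : ℝ) x ^ 4 * vorticity u i j t x ^ 2)
              (fun i _ => sum_nonneg fun j _ => hterm i j) (Finset.mem_univ i)
      · rw [indicator_of_notMem hx]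
        exact sum_nonneg fun i _ => sum_nonneg fun j _ => hterm i j
  have hcov : AECover (volume : Measure (Eu n)) atTop fun R : ℕ => Metric.ball (0 : Eu n) (R : ℝ) :=
    aecover_ball tendsto_natCast_atTop_atTop
  have hint : Integrable fun x => vorticity u i j t x ^ 2 := by
    refine hcov.integrable_of_integral_bounded_of_nonneg_ae (C / t) (fun R => ?_)
      (.of_forall fun x => sq_nonneg _) ?_
    · exact (hcont.continuousOn.integrableOn_compact (isCompact_closedBall 0 (R : ℝ))).mono_set
        Metric.ball_subset_closedBall
    · filter_upwards [eventually_ge_atTop 1] with R hR using hb R hR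
  refine ⟨hint, ?_⟩
  refine le_of_tendsto (hcov.integral_tendsto_of_countably_generated hint) ?_
  filter_upwards [eventually_ge_atTop 1] with R hR using hb R hR

end Energy

/-- The vorticity, extended to time `0` by the initial vorticity. -/
def vor (ω₀ : Fin n → Fin n → Eu n → ℝ) (u : ℝ → Eu n → Eu n) (i j : Fin n) (t : ℝ) : Eu n → ℝ :=
  if t = 0 then ω₀ i j else vorticity u i j t

lemma vor_of_pos (ω₀ : Fin n → Fin n → Eu n → ℝ) (u : ℝ → Eu n → Eu n) (i j : Fin n) {t : ℝ}
    (ht : 0 < t) : vor ω₀ u i j t = vorticity u i j t := if_neg ht.ne'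

lemma vor_zero (ω₀ : Fin n → Fin n → Eu n → ℝ) (u : ℝ → Eu n → Eu n) (i j : Fin n) :
    vor ω₀ u i j 0 = ω₀ i j := if_pos rfl

section Backward

variable {K : ℝ → Eu n → ℝ} {T s : ℝ} {x : Eu n}

lemma pderiv_comp_const_sub {f : Eu n → ℝ} (hf : ContDiff ℝ ∞ f) (k : Fin n) (x y : Eu n) :
    pderiv k (fun y => f (x - y)) y = -pderiv k f (x - y) := by
  have h : HasFDerivAt (fun y => f (x - y))
      ((fderiv ℝ f (x - y)).comp (-ContinuousLinearMap.id ℝ (Eu n))) y :=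
    ((hf.differentiable (by simp)) (x - y)).hasFDerivAt.comp y ((hasFDerivAt_id y).const_sub x)
  rw [pderiv, h.fderiv]
  simp [pderiv]

lemma contDiff_const_sub_comp {f : Eu n → ℝ} (hf : ContDiff ℝ ∞ f) (x : Eu n) :
    ContDiff ℝ ∞ fun y => f (x - y) := hf.comp (contDiff_const.sub contDiff_id)

lemma pderiv_pderiv_comp_const_sub {f : Eu n → ℝ} (hf : ContDiff ℝ ∞ f) (k : Fin n) (x y : Eu n) :
    pderiv k (pderiv k fun y => f (x - y)) y = pderiv k (pderiv k f) (x - y) := by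
  have e : (pderiv k fun y => f (x - y)) = fun y => -pderiv k f (x - y) := by
    funext y; exact pderiv_comp_const_sub hf k x y
  have h := pderiv_comp_const_sub (contDiff_pderiv k hf) k x y
  rw [e]
  unfold pderiv at h ⊢
  rw [fderiv_fun_neg, _root_.neg_apply, h, neg_neg]

lemma SmoothPos.continuousOn_backward (hK : SmoothPos K) (T : ℝ) (x : Eu n) :
    ContinuousOn (fun z : ℝ × Eu n => K (T - z.1) (x - z.2)) (Iio T ×ˢ univ) :=
  hK.continuousOn.comp (f := fun z : ℝ × Eu n => (T - z.1, x - z.2)) (by fun_prop)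
    fun z hz => ⟨show 0 < T - z.1 from sub_pos.2 hz.1, mem_univ _⟩

end Backward

/-- A smooth solution of the heat equation on `(0, ∞) × ℝⁿ`. -/
structure IsHeatSolution (K : ℝ → Eu n → ℝ) : Prop where
  smooth : SmoothPos K
  heat : ∀ t, 0 < t → ∀ x, HasDerivAt (fun s => K s x) (∑ k, pderiv k (pderiv k (K t)) x) t

section Duhamel

variable {u : ℝ → Eu n → Eu n} {p : ℝ → Eu n → ℝ} {A T t₀ t₁ : ℝ}
  {ω₀ : Fin n → Fin n → Eu n → ℝ} {K : ℝ → Eu n → ℝ} {χ : Eu n → ℝ}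

/-- The time derivative of `∫ ω_{ij} φ χ` for the backward heat solution
`φ(s, y) = K(T - s, x - y)`. -/
def duhamelDensity (u : ℝ → Eu n → Eu n) (K : ℝ → Eu n → ℝ) (χ : Eu n → ℝ) (T : ℝ) (x : Eu n)
    (i j : Fin n) (s : ℝ) (y : Eu n) : ℝ :=
  vorticity u i j s y * ∑ k, (-2 * pderiv k (K (T - s)) (x - y) * pderiv k χ y +
    K (T - s) (x - y) * pderiv k (pderiv k χ) y) +
  ∑ h, (u s y h * vorticity u h j s y *
      (-pderiv i (K (T - s)) (x - y) * χ y + K (T - s) (x - y) * pderiv i χ y) -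
    u s y h * vorticity u h i s y *
      (-pderiv j (K (T - s)) (x - y) * χ y + K (T - s) (x - y) * pderiv j χ y))

lemma hasDerivAt_integral_vorticity_mul (h : IsNSSolution u p) (hK : IsHeatSolution K)
    (hχ : ContDiff ℝ ∞ χ) (hc : HasCompactSupport χ) (x : Eu n) (i j : Fin n) {s : ℝ} (hs : 0 < s)
    (hsT : s < T) :
    HasDerivAt (fun s => ∫ y, vorticity u i j s y * (K (T - s) (x - y) * χ y))
      (∫ y, duhamelDensity u K χ T x i j s y) s := by
  have hw := h.smooth_vorticity i j
  have hKs : ∀ s, s < T → ContDiff ℝ ∞ (K (T - s)) := fun s hs => hK.smooth.slice (sub_pos.2 hs)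
  have hd := hasDerivAt_integral_of_isCompact (t := s) (a := 0) (b := T) (K := tsupport χ)
    (F := fun s y => vorticity u i j s y * (K (T - s) (x - y) * χ y))
    (F' := fun s y => deriv (fun r => vorticity u i j r y) s * (K (T - s) (x - y) * χ y) +
      vorticity u i j s y * (-(∑ k, pderiv k (pderiv k (K (T - s))) (x - y)) * χ y))
    hc.isCompact (fun s hs => (hw.continuous_slice hs.1).mul
      ((contDiff_const_sub_comp (hKs s hs.2) x).continuous.mul hχ.continuous))
    (fun s hs y => ?_) ?_ (fun s hs y hy => by simp [image_eq_zero_of_notMem_tsupport hy])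
    ⟨hs, hsT⟩
  · refine hd.congr_deriv ?_
    -- the spatial identity
    have hP := contDiff_const_sub_comp (hKs s hsT) x
    set P := fun y => K (T - s) (x - y) with hPdef
    have hPχ : ContDiff ℝ ∞ fun y => P y * χ y := hP.mul hχ
    have hPχc : HasCompactSupport fun y => P y * χ y := hc.mul_left
    have hwt := h.contDiff_vorticity hs i j
    have ePk : ∀ k y, pderiv k P y = -pderiv k (K (T - s)) (x - y) := fun k y =>
      pderiv_comp_const_sub (hKs s hsT) k x y
    have ePkk : ∀ k y, pderiv k (pderiv k P) y = pderiv k (pderiv k (K (T - s))) (x - y) :=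
      fun k y => pderiv_pderiv_comp_const_sub (hKs s hsT) k x y
    have dP : Differentiable ℝ P := hP.differentiable (by simp)
    have dχ : Differentiable ℝ χ := hχ.differentiable (by simp)
    have dPk : ∀ k, Differentiable ℝ (pderiv k P) := fun k =>
      (contDiff_pderiv k hP).differentiable (by simp)
    have dχk : ∀ k, Differentiable ℝ (pderiv k χ) := fun k =>
      (contDiff_pderiv k hχ).differentiable (by simp)
    have e1 : ∀ k y, pderiv k (fun y => P y * χ y) y = pderiv k P y * χ y + P y * pderiv k χ y :=
      fun k y => pderiv_mul k (dP y) (dχ y)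
    have e2 : ∀ k y, pderiv k (pderiv k fun y => P y * χ y) y =
        pderiv k (pderiv k P) y * χ y + 2 * pderiv k P y * pderiv k χ y +
          P y * pderiv k (pderiv k χ) y := by
      intro k y
      have : (pderiv k fun y => P y * χ y) = fun y => pderiv k P y * χ y + P y * pderiv k χ y := by
        funext y; exact e1 k y
      rw [this, pderiv_add k (((dPk k) y).fun_mul (dχ y)) ((dP y).fun_mul (dχk k y)),
        pderiv_mul k (dPk k y) (dχ y), pderiv_mul k (dP y) (dχk k y)]
      ring
    have i0 : Integrable fun y => deriv (fun r => vorticity u i j r y) s * (P y * χ y) :=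
      integrable_mul_of_hasCompactSupport (hw.td.continuous_slice hs) hPχ.continuous hPχc
    have hL : Continuous fun y => -(∑ k, pderiv k (pderiv k (K (T - s))) (x - y)) * χ y :=
      (continuous_finsetSum _ fun k _ => (contDiff_const_sub_comp
        (contDiff_pderiv k (contDiff_pderiv k (hKs s hsT))) x).continuous).neg.mul hχ.continuous
    have i1 : Integrable fun y => vorticity u i j s y *
        (-(∑ k, pderiv k (pderiv k (K (T - s))) (x - y)) * χ y) :=
      integrable_mul_of_hasCompactSupport hwt.continuous hL hc.mul_left
    have i2 : ∀ k, Integrable fun y => vorticity u i j s y *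
        pderiv k (pderiv k fun y => P y * χ y) y := fun k =>
      integrable_mul_of_hasCompactSupport hwt.continuous
        (contDiff_pderiv k (contDiff_pderiv k hPχ)).continuous
        (hasCompactSupport_pderiv k (hasCompactSupport_pderiv k hPχc))
    have i3 : ∀ k l m, Integrable fun y => u s y k * vorticity u k l s y *
        pderiv m (fun y => P y * χ y) y := fun k l m =>
      integrable_mul_of_hasCompactSupport
        ((h.contDiff_comp hs k).mul (h.contDiff_vorticity hs k l)).continuous
        (contDiff_pderiv m hPχ).continuous (hasCompactSupport_pderiv m hPχc)
    rw [integral_add i0 i1, h.weak_vorticity_equation hs i j hPχ hPχc]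
    have e3 : ∀ k, -∫ y, pderiv k (vorticity u i j s) y * pderiv k (fun y => P y * χ y) y =
        ∫ y, vorticity u i j s y * pderiv k (pderiv k fun y => P y * χ y) y := by
      intro k
      rw [integral_pderiv_mul k hwt (contDiff_pderiv k hPχ) (hasCompactSupport_pderiv k hPχc),
        neg_neg]
    simp_rw [e3, ← fun k => integral_sub (i3 k j i) (i3 k i j)]
    rw [← integral_finsetSum _ fun k _ => i2 k,
      ← integral_finsetSum _ fun k _ => (i3 k j i).sub' (i3 k i j),
      ← integral_add (integrable_finsetSum _ fun k _ => i2 k)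
        (integrable_finsetSum _ fun k _ => (i3 k j i).sub' (i3 k i j)),
      ← integral_add ((integrable_finsetSum _ fun k _ => i2 k).fun_add
        (integrable_finsetSum _ fun k _ => (i3 k j i).sub' (i3 k i j))) i1]
    refine integral_congr_ae (.of_forall fun y => ?_)
    simp only [duhamelDensity]
    simp_rw [e2, e1, ePkk, ePk]
    rw [add_right_comm]
    congr 1
    rw [← mul_sum, ← mul_add, neg_mul, sum_mul, ← sub_eq_add_neg, ← sum_sub_distrib]
    congr 1
    exact sum_congr rfl fun k _ => by ring
  · have h1 : HasDerivAt (fun s => K (T - s) (x - y))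
        (-(∑ k, pderiv k (pderiv k (K (T - s))) (x - y))) s := by
      have := HasDerivAt.comp s (h₂ := fun s => K s (x - y)) (h := fun s => T - s)
        (hK.heat (T - s) (sub_pos.2 hs.2) (x - y)) ((hasDerivAt_id' s).const_sub T)
      rw [mul_neg_one] at this
      exact this
    exact (hw.hasDerivAt' hs.1 y).mul (h1.mul_const (χ y))
  · have hsub : Ioo 0 T ×ˢ (univ : Set (Eu n)) ⊆ Ioi 0 ×ˢ univ :=
      prod_mono (fun _ hs => hs.1) subset_rfl
    have hsub' : Ioo 0 T ×ˢ (univ : Set (Eu n)) ⊆ Iio T ×ˢ univ :=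
      prod_mono (fun _ hs => hs.2) subset_rfl
    have c1 := hw.td.continuousOn.mono hsub
    have c2 := hw.continuousOn.mono hsub
    have c3 := (hK.smooth.continuousOn_backward T x).mono hsub'
    have c4 : ContinuousOn (fun z : ℝ × Eu n => χ z.2) (Ioo 0 T ×ˢ univ) :=
      (hχ.continuous.comp continuous_snd).continuousOn
    have c5 : ContinuousOn (fun z : ℝ × Eu n => ∑ k, pderiv k (pderiv k (K (T - z.1))) (x - z.2))
        (Ioo 0 T ×ˢ univ) := continuousOn_finsetSum _ fun k _ =>
      (((hK.smooth.pd k).pd k).continuousOn_backward T x).mono hsub'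
    exact (c1.mul (c3.mul c4)).add (c2.mul (c5.neg.mul c4))

/-- The initial vorticity is attained when tested against time dependent test functions. -/
lemma tendsto_integral_vorticity_mul_zero (h : IsNSSolution u p) (hA : VelocityBound u A)
    (hω : IsWeakVorticity (u 0) ω₀) (hK : SmoothPos K) (hT : 0 < T)
    (hχ : ContDiff ℝ ∞ χ) (hc : HasCompactSupport χ) (x : Eu n) (i j : Fin n) :
    Tendsto (fun s => ∫ y, vorticity u i j s y * (K (T - s) (x - y) * χ y)) (𝓝[>] 0)
      (𝓝 (∫ y, ω₀ i j y * (K (T - 0) (x - y) * χ y))) := by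
  have hKs : ∀ s, s < T → ContDiff ℝ ∞ fun y => K (T - s) (x - y) * χ y := fun s hs =>
    (contDiff_const_sub_comp (hK.slice (sub_pos.2 hs)) x).mul hχ
  have hKc : ∀ s, HasCompactSupport fun y => K (T - s) (x - y) * χ y := fun s => hc.mul_left
  set D : Fin n → ℝ → Eu n → ℝ := fun i s => pderiv i fun y => K (T - s) (x - y) * χ y with hD
  have hDcont : ∀ i, ContinuousOn (fun z : ℝ × Eu n => D i z.1 z.2) (Iio T ×ˢ univ) := by
    intro i
    have e : ∀ z ∈ Iio T ×ˢ (univ : Set (Eu n)), D i z.1 z.2 =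
        -pderiv i (K (T - z.1)) (x - z.2) * χ z.2 + K (T - z.1) (x - z.2) * pderiv i χ z.2 := by
      intro z hz
      have hk := hK.slice (sub_pos.2 hz.1)
      rw [hD]
      simp only
      rw [pderiv_mul i (((contDiff_const_sub_comp hk x).differentiable (by simp)) z.2)
        ((hχ.differentiable (by simp)) z.2), pderiv_comp_const_sub hk]
    refine ContinuousOn.congr ?_ e
    exact (((hK.pd i).continuousOn_backward T x).neg.mul
      (hχ.continuous.comp continuous_snd).continuousOn).add ((hK.continuousOn_backward T x).mul
        ((contDiff_pderiv i hχ).continuous.comp continuous_snd).continuousOn)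
  have hDslice : ∀ i s, s < T → Continuous (D i s) := fun i s hs =>
    (contDiff_pderiv i (hKs s hs)).continuous
  have hDc : ∀ i s, HasCompactSupport (D i s) := fun i s => hasCompactSupport_pderiv i (hKc s)
  have hD0 : ∀ i s, ∀ y ∉ tsupport χ, D i s y = 0 := fun i s y hy =>
    pderiv_eq_zero_of_notMem_tsupport i fun h' => hy (tsupport_mul_subset_right h')
  have hui : ∀ j s, 0 ≤ s → Integrable fun y => u s y j := fun j s hs =>
    (proj (𝕜 := ℝ) j).integrable_comp (hA.integrable s hs)
  have huD : ∀ i j s r, 0 ≤ s → r < T → Integrable fun y => u s y j * D i r y := by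
    intro i j s r hs hr
    obtain ⟨C, hC⟩ := (hDslice i r hr).bounded_above_of_compact_support (hDc i r)
    exact (hui j s hs).mul_bdd (hDslice i r hr).aestronglyMeasurable (.of_forall hC)
  -- convergence of one term
  have key : ∀ i j, Tendsto (fun s => ∫ y, u s y j * D i s y) (𝓝[>] 0)
      (𝓝 (∫ y, u 0 y j * D i 0 y)) := by
    intro i j
    have h1 : Tendsto (fun s => ∫ y, u s y j * D i 0 y) (𝓝[>] 0) (𝓝 (∫ y, u 0 y j * D i 0 y)) :=
      h.initial j (D i 0) ⟨contDiff_pderiv i (hKs 0 hT), hDc i 0⟩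
    have h2 : Tendsto (fun s => ∫ y, u s y j * (D i s y - D i 0 y)) (𝓝[>] 0) (𝓝 0) := by
      rw [Metric.tendsto_nhds]
      intro ε hε
      have huc : UniformContinuousOn (fun z : ℝ × Eu n => D i z.1 z.2)
          (Icc 0 (T / 2) ×ˢ tsupport χ) :=
        (isCompact_Icc.prod hc.isCompact).uniformContinuousOn_of_continuous
          ((hDcont i).mono (prod_mono (fun s hs => by
            have := hs.2
            change s < T
            linarith) (subset_univ _)))
      obtain ⟨δ, hδ, hδ'⟩ := Metric.uniformContinuousOn_iff.1 huc (ε / (2 * A))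
        (div_pos hε (mul_pos two_pos hA.pos))
      filter_upwards [Ioo_mem_nhdsGT (show 0 < min δ (T / 2) by positivity)] with s hs
      have hsδ : s < δ := hs.2.trans_le (min_le_left _ _)
      have hsT : s < T / 2 := hs.2.trans_le (min_le_right _ _)
      have hle : ∀ y, |D i s y - D i 0 y| ≤ ε / (2 * A) := by
        intro y
        by_cases hy : y ∈ tsupport χ
        · have := hδ' (s, y) ⟨⟨hs.1.le, hsT.le⟩, hy⟩ (0, y) ⟨⟨le_rfl, by positivity⟩, hy⟩ (by
            rw [Prod.dist_eq, dist_self]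
            simp only [dist_eq, sub_zero, abs_of_pos hs.1]
            exact max_lt hsδ hδ)
          rw [dist_eq] at this
          exact this.le
        · rw [hD0 i s y hy, hD0 i 0 y hy, sub_zero, abs_zero]
          exact (div_pos hε (mul_pos two_pos hA.pos)).le
      rw [dist_zero_right]
      calc ‖∫ y, u s y j * (D i s y - D i 0 y)‖ ≤ ∫ y, ε / (2 * A) * ‖u s y‖ := by
            refine norm_integral_le_of_norm_le ((hA.integrable s hs.1.le).norm.const_mul _)
              (.of_forall fun y => ?_)
            rw [norm_mul, mul_comm]
            exact mul_le_mul (hle y) (VelocityBound.abs_coord_le _ j) (norm_nonneg _)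
              (div_pos hε (mul_pos two_pos hA.pos)).le
        _ = ε / (2 * A) * ∫ y, ‖u s y‖ := integral_const_mul _ _
        _ ≤ ε / (2 * A) * A := mul_le_mul_of_nonneg_left (hA.norm_integral_le hs.1.le)
            (div_pos hε (mul_pos two_pos hA.pos)).le
        _ < ε := by
          have := hA.pos
          field_simp; linarith
    have h3 := h2.add h1
    rw [zero_add] at h3
    refine h3.congr' ?_
    filter_upwards [Ioo_mem_nhdsGT hT] with s hs
    have e : (fun y => u s y j * (D i s y - D i 0 y)) = fun y =>
        u s y j * D i s y - u s y j * D i 0 y := by funext y; ring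
    rw [e, integral_sub (huD i j s s hs.1.le hs.2) (huD i j s 0 hs.1.le hT)]
    ring
  have h0 : ∫ y, ω₀ i j y * (K (T - 0) (x - y) * χ y) =
      -((∫ y, u 0 y j * D i 0 y) - ∫ y, u 0 y i * D j 0 y) := by
    rw [hω i j _ ⟨hKs 0 hT, hKc 0⟩, integral_sub (huD i j 0 0 le_rfl hT) (huD j i 0 0 le_rfl hT)]
  rw [h0]
  refine ((key i j).sub (key j i)).neg.congr' ?_
  filter_upwards [Ioo_mem_nhdsGT hT] with s hs
  have hu := fun j => h.contDiff_comp hs.1 j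
  have iu : ∀ i j, Integrable fun y => pderiv i (fun y => u s y j) y * (K (T - s) (x - y) * χ y) :=
    fun i j => integrable_mul_of_hasCompactSupport (contDiff_pderiv i (hu j)).continuous
      (hKs s hs.2).continuous (hKc s)
  simp_rw [vorticity, sub_mul]
  rw [integral_sub (iu i j) (iu j i), integral_pderiv_mul i (hu j) (hKs s hs.2) (hKc s),
    integral_pderiv_mul j (hu i) (hKs s hs.2) (hKc s)]
  ring

def duhamelIntegrand (u : ℝ → Eu n → Eu n) (K : ℝ → Eu n → ℝ) (T : ℝ) (x : Eu n)
    (i j : Fin n) (s : ℝ) (y : Eu n) : ℝ :=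
  ∑ h, (u s y h * vorticity u h i s y * pderiv j (K (T - s)) (x - y) -
    u s y h * vorticity u h j s y * pderiv i (K (T - s)) (x - y))

lemma tendsto_integral_vorticity_mul (h : IsNSSolution u p) (hA : VelocityBound u A)
    (hω : IsWeakVorticity (u 0) ω₀) (hK : IsHeatSolution K)
    (hχ : ContDiff ℝ ∞ χ) (hc : HasCompactSupport χ) (ht₀ : 0 ≤ t₀) (hT : t₀ < T) (x : Eu n)
    (i j : Fin n) :
    Tendsto (fun s => ∫ y, vorticity u i j s y * (K (T - s) (x - y) * χ y)) (𝓝[>] t₀)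
      (𝓝 (∫ y, vor ω₀ u i j t₀ y * (K (T - t₀) (x - y) * χ y))) := by
  rcases ht₀.eq_or_lt with rfl | ht
  · rw [vor_zero]
    exact tendsto_integral_vorticity_mul_zero h hA hω hK.smooth hT hχ hc x i j
  · rw [vor_of_pos ω₀ u i j ht]
    exact (hasDerivAt_integral_vorticity_mul h hK hχ hc x i j ht hT).continuousAt.tendsto.mono_left
      nhdsWithin_le_nhds

theorem duhamel (h : IsNSSolution u p) (hA : VelocityBound u A)
    (hω : IsWeakVorticity (u 0) ω₀) (hK : IsHeatSolution K) (ht₀ : 0 ≤ t₀) (ht : t₀ < t₁)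
    (hT : t₁ < T) (x : Eu n) (i j : Fin n) {B : ℝ → Eu n → ℝ}
    (hB : ∀ s ∈ Ioo t₀ t₁, ∀ y, |K (T - s) (x - y)| ≤ B s y ∧
      ∀ k, |pderiv k (K (T - s)) (x - y)| ≤ B s y)
    (hint : ∀ i j, Integrable (fun z : ℝ × Eu n => vorticity u i j z.1 z.2 * B z.1 z.2)
      ((volume.restrict (Ioo t₀ t₁)).prod volume))
    (h₁ : Integrable fun y => vorticity u i j t₁ y * K (T - t₁) (x - y))
    (h₀ : Integrable fun y => vor ω₀ u i j t₀ y * K (T - t₀) (x - y)) :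
    (∫ y, vorticity u i j t₁ y * K (T - t₁) (x - y)) -
      ∫ y, vor ω₀ u i j t₀ y * K (T - t₀) (x - y) =
      ∫ z : ℝ × Eu n, duhamelIntegrand u K T x i j z.1 z.2
        ∂((volume.restrict (Ioo t₀ t₁)).prod volume) := by
  obtain ⟨c, hc, hcut⟩ := exists_abs_deriv_cutoff_le (n := n)
  have ht₁ : 0 < t₁ := ht₀.trans_lt ht
  have hA0 := hA.pos
  set m : Measure (ℝ × Eu n) := (volume.restrict (Ioo t₀ t₁)).prod volume with hm
  have hmr : m = (volume : Measure (ℝ × Eu n)).restrict (Ioo t₀ t₁ ×ˢ univ) := by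
    rw [hm, Measure.volume_eq_prod, ← Measure.prod_restrict, Measure.restrict_univ]
  have hmem : ∀ᵐ z ∂m, z.1 ∈ Ioo t₀ t₁ := by
    rw [hmr]
    filter_upwards [ae_restrict_mem (measurableSet_Ioo.prod MeasurableSet.univ)] with z hz using hz.1
  set Dom : ℝ × Eu n → ℝ := fun z => 3 * n * c * ‖vorticity u i j z.1 z.2 * B z.1 z.2‖ +
    ∑ h, (A * (1 + c) * ‖vorticity u h j z.1 z.2 * B z.1 z.2‖ +
      A * (1 + c) * ‖vorticity u h i z.1 z.2 * B z.1 z.2‖) with hDom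
  have hDomI : Integrable Dom m :=
    ((hint i j).norm.const_mul _).fun_add (integrable_finsetSum _ fun h _ =>
      ((hint h j).norm.const_mul _).fun_add ((hint h i).norm.const_mul _))
  have hmeas : ∀ R : ℝ, AEStronglyMeasurable
      (fun z : ℝ × Eu n => duhamelDensity u K (cutoff R) T x i j z.1 z.2) m := by
    intro R
    rw [hmr]
    refine ContinuousOn.aestronglyMeasurable ?_ (measurableSet_Ioo.prod MeasurableSet.univ)
    have hsub : Ioo t₀ t₁ ×ˢ (univ : Set (Eu n)) ⊆ Ioi 0 ×ˢ univ :=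
      prod_mono (fun _ hs => ht₀.trans_lt hs.1) subset_rfl
    have hsub' : Ioo t₀ t₁ ×ˢ (univ : Set (Eu n)) ⊆ Iio T ×ˢ univ :=
      prod_mono (fun _ hs => hs.2.trans hT) subset_rfl
    have cw := fun i j => (h.smooth_vorticity i j).continuousOn.mono hsub
    have cu := fun j => (h.smooth_comp j).continuousOn.mono hsub
    have cK := (hK.smooth.continuousOn_backward T x).mono hsub'
    have cKd := fun k => ((hK.smooth.pd k).continuousOn_backward T x).mono hsub'
    have cχ : ∀ f : Eu n → ℝ, ContDiff ℝ ∞ f →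
        ContinuousOn (fun z : ℝ × Eu n => f z.2) (Ioo t₀ t₁ ×ˢ univ) := fun f hf =>
      (hf.continuous.comp continuous_snd).continuousOn
    have c0 := cχ _ (contDiff_cutoff R)
    have c1 := fun k => cχ _ (contDiff_pderiv k (contDiff_cutoff R))
    have c2 := fun k => cχ _ (contDiff_pderiv k (contDiff_pderiv k (contDiff_cutoff R)))
    exact ((cw i j).mul (continuousOn_finsetSum _ fun k _ =>
      ((continuousOn_const.mul (cKd k)).mul (c1 k)).add (cK.mul (c2 k)))).add
      (continuousOn_finsetSum _ fun k _ =>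
        (((cu k).mul (cw k j)).mul (((cKd i).neg.mul c0).add (cK.mul (c1 i)))).sub
        (((cu k).mul (cw k i)).mul (((cKd j).neg.mul c0).add (cK.mul (c1 j)))))
  have hbound : ∀ R : ℝ, 1 ≤ R → ∀ᵐ z ∂m,
      ‖duhamelDensity u K (cutoff R) T x i j z.1 z.2‖ ≤ Dom z := by
    intro R hR
    filter_upwards [hmem] with z hz
    obtain ⟨b1, b2⟩ := hB z.1 hz z.2
    have hBnn : 0 ≤ B z.1 z.2 := (abs_nonneg _).trans b1
    have hR1 : R⁻¹ ≤ 1 := inv_le_one_of_one_le₀ hR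
    have d1 : ∀ k, |pderiv k (cutoff R) z.2| ≤ c := fun k =>
      ((hcut R hR z.2).1 k).trans (mul_le_of_le_one_right hc.le hR1)
    have d2 : ∀ k, |pderiv k (pderiv k (cutoff R)) z.2| ≤ c := fun k =>
      ((hcut R hR z.2).2 k).trans (mul_le_of_le_one_right hc.le hR1)
    have d0 : |cutoff R z.2| ≤ 1 := by
      rw [abs_of_nonneg (cutoff_nonneg _ _)]; exact cutoff_le_one _ _
    have hu : ∀ k, |u z.1 z.2 k| ≤ A := fun k =>
      (VelocityBound.abs_coord_le _ k).trans (hA.norm_le (ht₀.trans_lt hz.1) _)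
    rw [hDom]
    refine (norm_add_le _ _).trans (add_le_add ?_ ((norm_sum_le _ _).trans
      (sum_le_sum fun k _ => (norm_sub_le _ _).trans (add_le_add ?_ ?_))))
    · rw [norm_mul, norm_mul, norm_of_nonneg hBnn]
      have : ‖∑ k, (-2 * pderiv k (K (T - z.1)) (x - z.2) * pderiv k (cutoff R) z.2 +
          K (T - z.1) (x - z.2) * pderiv k (pderiv k (cutoff R)) z.2)‖ ≤
          n * (3 * c * B z.1 z.2) := by
        refine (norm_sum_le _ _).trans (sum_le_card_mul fun k => ?_)
        refine (norm_add_le _ _).trans ?_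
        simp only [norm_mul, norm_eq_abs, abs_neg, abs_two]
        have x1 := mul_le_mul (b2 k) (d1 k) (abs_nonneg _) hBnn
        have x2 := mul_le_mul b1 (d2 k) (abs_nonneg _) hBnn
        linarith
      calc _ ≤ ‖vorticity u i j z.1 z.2‖ * (n * (3 * c * B z.1 z.2)) :=
            mul_le_mul_of_nonneg_left this (norm_nonneg _)
        _ = _ := by ring
    all_goals
      rw [norm_mul, norm_mul, norm_mul, norm_of_nonneg hBnn]
    · have : ‖-pderiv i (K (T - z.1)) (x - z.2) * cutoff R z.2 +
          K (T - z.1) (x - z.2) * pderiv i (cutoff R) z.2‖ ≤ (1 + c) * B z.1 z.2 := by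
        refine (norm_add_le _ _).trans ?_
        simp only [norm_mul, norm_eq_abs, abs_neg]
        have x1 := mul_le_mul (b2 i) d0 (abs_nonneg _) hBnn
        have x2 := mul_le_mul b1 (d1 i) (abs_nonneg _) hBnn
        linarith
      calc _ ≤ A * ‖vorticity u k j z.1 z.2‖ * ((1 + c) * B z.1 z.2) :=
            mul_le_mul (mul_le_mul_of_nonneg_right (hu k) (norm_nonneg _)) this (norm_nonneg _)
              (by positivity)
        _ = _ := by ring
    · have : ‖-pderiv j (K (T - z.1)) (x - z.2) * cutoff R z.2 +
          K (T - z.1) (x - z.2) * pderiv j (cutoff R) z.2‖ ≤ (1 + c) * B z.1 z.2 := by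
        refine (norm_add_le _ _).trans ?_
        simp only [norm_mul, norm_eq_abs, abs_neg]
        have x1 := mul_le_mul (b2 j) d0 (abs_nonneg _) hBnn
        have x2 := mul_le_mul b1 (d1 j) (abs_nonneg _) hBnn
        linarith
      calc _ ≤ A * ‖vorticity u k i z.1 z.2‖ * ((1 + c) * B z.1 z.2) :=
            mul_le_mul (mul_le_mul_of_nonneg_right (hu k) (norm_nonneg _)) this (norm_nonneg _)
              (by positivity)
        _ = _ := by ring
  -- identity with cutoff
  have hR : ∀ R : ℝ, 1 ≤ R →
      (∫ y, vorticity u i j t₁ y * K (T - t₁) (x - y) * cutoff R y) -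
        ∫ y, vor ω₀ u i j t₀ y * K (T - t₀) (x - y) * cutoff R y =
      ∫ z : ℝ × Eu n, duhamelDensity u K (cutoff R) T x i j z.1 z.2 ∂m := by
    intro R hR
    have hR0 : 0 < R := by linarith
    have hχ := contDiff_cutoff (n := n) R
    have hχc := hasCompactSupport_cutoff (n := n) hR0
    have hI : Integrable (fun z : ℝ × Eu n => duhamelDensity u K (cutoff R) T x i j z.1 z.2) m :=
      hDomI.mono' (hmeas R) (hbound R hR)
    have hI' := hI.integral_prod_left
    have hftc := intervalIntegral.integral_eq_sub_of_hasDerivAt_of_tendsto ht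
      (f := fun s => ∫ y, vorticity u i j s y * (K (T - s) (x - y) * cutoff R y))
      (f' := fun s => ∫ y, duhamelDensity u K (cutoff R) T x i j s y)
      (fun s hs => hasDerivAt_integral_vorticity_mul h hK hχ hχc x i j (ht₀.trans_lt hs.1)
        (hs.2.trans hT))
      ((intervalIntegrable_iff_integrableOn_Ioo_of_le ht.le).2 hI')
      (tendsto_integral_vorticity_mul h hA hω hK hχ hχc ht₀ (ht.trans hT) x i j)
      ((hasDerivAt_integral_vorticity_mul h hK hχ hχc x i j ht₁ hT).continuousAt.tendsto.mono_left
        nhdsWithin_le_nhds)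
    rw [intervalIntegral.integral_of_le ht.le, integral_Ioc_eq_integral_Ioo] at hftc
    rw [hm, integral_prod _ hI, hftc]
    simp_rw [mul_assoc]
  -- remove the cutoff
  have hlim : ∀ f : Eu n → ℝ, Integrable f →
      Tendsto (fun R : ℝ => ∫ y, f y * cutoff R y) atTop (𝓝 (∫ y, f y)) := by
    intro f hf
    refine tendsto_integral_filter_of_dominated_convergence (fun y => ‖f y‖)
      (.of_forall fun R => hf.1.mul (contDiff_cutoff R).continuous.aestronglyMeasurable)
      (.of_forall fun R => .of_forall fun y => ?_) hf.norm
      (.of_forall fun y => ?_)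
    · rw [norm_mul, norm_of_nonneg (cutoff_nonneg R y)]
      exact mul_le_of_le_one_right (norm_nonneg _) (cutoff_le_one _ _)
    · simpa using (tendsto_cutoff y).const_mul (f y)
  have hL := (hlim _ h₁).sub (hlim _ h₀)
  have hRt : Tendsto (fun R : ℝ => ∫ z : ℝ × Eu n,
      duhamelDensity u K (cutoff R) T x i j z.1 z.2 ∂m) atTop
      (𝓝 (∫ z : ℝ × Eu n, duhamelIntegrand u K T x i j z.1 z.2 ∂m)) := by
    refine tendsto_integral_filter_of_dominated_convergence Dom
      (.of_forall hmeas) ?_ hDomI (.of_forall fun z => ?_)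
    · filter_upwards [eventually_ge_atTop 1] with R hR using hbound R hR
    · have hinv : Tendsto (fun R : ℝ => c * R⁻¹) atTop (𝓝 0) := by
        simpa using tendsto_inv_atTop_zero.const_mul c
      have t1 : ∀ k, Tendsto (fun R => pderiv k (cutoff R) z.2) atTop (𝓝 0) := fun k => by
        refine squeeze_zero_norm' ?_ hinv
        filter_upwards [eventually_ge_atTop 1] with R hR using (hcut R hR z.2).1 k
      have t2 : ∀ k, Tendsto (fun R => pderiv k (pderiv k (cutoff R)) z.2) atTop (𝓝 0) :=
        fun k => by
        refine squeeze_zero_norm' ?_ hinv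
        filter_upwards [eventually_ge_atTop 1] with R hR using (hcut R hR z.2).2 k
      have t0 := tendsto_cutoff z.2
      have e1 : Tendsto (fun R => vorticity u i j z.1 z.2 *
          ∑ k, (-2 * pderiv k (K (T - z.1)) (x - z.2) * pderiv k (cutoff R) z.2 +
          K (T - z.1) (x - z.2) * pderiv k (pderiv k (cutoff R)) z.2)) atTop
          (𝓝 (vorticity u i j z.1 z.2 * ∑ k : Fin n,
          (-2 * pderiv k (K (T - z.1)) (x - z.2) * 0 + K (T - z.1) (x - z.2) * 0))) :=
        (tendsto_finsetSum _ fun k _ => ((t1 k).const_mul _).add ((t2 k).const_mul _)).const_mul _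
      have e2 : ∀ i, Tendsto (fun R => -pderiv i (K (T - z.1)) (x - z.2) * cutoff R z.2 +
          K (T - z.1) (x - z.2) * pderiv i (cutoff R) z.2) atTop
          (𝓝 (-pderiv i (K (T - z.1)) (x - z.2) * 1 + K (T - z.1) (x - z.2) * 0)) := fun i =>
        (t0.const_mul _).add ((t1 i).const_mul _)
      have e3 := e1.add (tendsto_finsetSum Finset.univ fun h _ =>
        ((e2 i).const_mul (u z.1 z.2 h * vorticity u h j z.1 z.2)).sub
        ((e2 j).const_mul (u z.1 z.2 h * vorticity u h i z.1 z.2)))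
      refine (congrArg (Tendsto _ _) (congrArg 𝓝 ?_)).mp e3
      simp only [duhamelIntegrand, mul_zero, add_zero, Finset.sum_const_zero, zero_add, mul_one]
      exact sum_congr rfl fun k _ => by ring
  refine tendsto_nhds_unique hL (hRt.congr' ?_)
  filter_upwards [eventually_ge_atTop 1] with R h1 using (hR R h1).symm

end Duhamel

/-- The hypotheses on the solution and the initial data. -/
structure DecayFlow (ω₀ : Fin n → Fin n → Eu n → ℝ) (u : ℝ → Eu n → Eu n) (p : ℝ → Eu n → ℝ)
    (A : ℝ) : Prop where
  two_le : 2 ≤ n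
  sol : IsNSSolution u p
  bound : VelocityBound u A
  weak : IsWeakVorticity (u 0) ω₀
  integrable₀ : ∀ i j, Integrable (ω₀ i j)
  weight : ∀ i j, Integrable fun x : Eu n => ‖x‖ ^ (n + 2) * ω₀ i j x
  div : WeakDivFree (u 0)

lemma isHeatSolution_realKernel (hn : 2 ≤ n) {q : ℕ} {P : Eu n → ℂ} (hP : HomSymbol (q + 1) P)
    {K : ℝ → Eu n → ℝ} (hK : ∀ s, 0 < s → K s = realKernel P s) : IsHeatSolution K where
  smooth := SmoothPos.congr (F := realKernel P) (contDiffOn_realKernel hn hP) fun t ht x => by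
    rw [hK t ht]
  heat t ht x := by
    rw [hK t ht]
    refine (hasDerivAt_realKernel hn hP ht x).congr_of_eventuallyEq ?_
    filter_upwards [Ioi_mem_nhds ht] with s hs
    rw [hK s hs]

lemma isHeatSolution_heatKernel (hn : 2 ≤ n) : IsHeatSolution (heatKernel (n := n)) :=
  isHeatSolution_realKernel hn HomSymbol.heat fun _ hs => heatKernel_eq_realKernel hn hs

lemma isHeatSolution_rieszInvHeat (hn : 2 ≤ n) (k : Fin n) : IsHeatSolution (rieszInvHeat k) :=
  isHeatSolution_realKernel hn (HomSymbol.grad k) fun _ hs => rieszInvHeat_eq hs k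

lemma measurable_heatKernel : Measurable fun z : ℝ × Eu n => heatKernel z.1 z.2 := by
  unfold heatKernel; fun_prop

/-- The size of the vorticity at positive times. -/
def vorDen (u : ℝ → Eu n → Eu n) (s : ℝ) (y : Eu n) : ℝ≥0∞ :=
  if 0 < s then ∑ i, ∑ j, ‖vorticity u i j s y‖ₑ else 0

/-- The size of the vorticity, including the initial time. -/
def vorNorm (ω₀ : Fin n → Fin n → Eu n → ℝ) (u : ℝ → Eu n → Eu n) (s : ℝ) (y : Eu n) : ℝ≥0∞ :=
  ∑ i, ∑ j, ‖vor ω₀ u i j s y‖ₑ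

section

variable {u : ℝ → Eu n → Eu n} {p : ℝ → Eu n → ℝ} {ω₀ : Fin n → Fin n → Eu n → ℝ} {A s t T : ℝ}

lemma vorDen_of_pos (hs : 0 < s) (y : Eu n) :
    vorDen u s y = ∑ i, ∑ j, ‖vorticity u i j s y‖ₑ := if_pos hs

lemma vorNorm_of_pos (hs : 0 < s) : vorNorm ω₀ u s = vorDen u s := by
  funext y
  simp only [vorNorm, vorDen_of_pos hs, vor_of_pos ω₀ u _ _ hs]

lemma enorm_vorticity_le (hs : 0 < s) (i j : Fin n) (y : Eu n) :
    ‖vorticity u i j s y‖ₑ ≤ vorDen u s y := by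
  rw [vorDen_of_pos hs]
  exact (single_le_sum (f := fun j => ‖vorticity u i j s y‖ₑ) (fun _ _ => zero_le)
    (Finset.mem_univ j)).trans (single_le_sum
      (f := fun i => ∑ j, ‖vorticity u i j s y‖ₑ) (fun _ _ => zero_le) (Finset.mem_univ i))

lemma enorm_vor_le (i j : Fin n) (y : Eu n) : ‖vor ω₀ u i j s y‖ₑ ≤ vorNorm ω₀ u s y :=
  (single_le_sum (f := fun j => ‖vor ω₀ u i j s y‖ₑ) (fun _ _ => zero_le)
    (Finset.mem_univ j)).trans (single_le_sum
      (f := fun i => ∑ j, ‖vor ω₀ u i j s y‖ₑ) (fun _ _ => zero_le) (Finset.mem_univ i))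

lemma SmoothPos.measurable_indicator {F : ℝ → Eu n → ℝ} (hF : SmoothPos F) :
    Measurable ((Ioi (0 : ℝ) ×ˢ univ).indicator fun z : ℝ × Eu n => F z.1 z.2) := by
  classical
  have := hF.continuousOn.measurable_piecewise (g := fun _ => (0 : ℝ))
    (continuousOn_const) (isOpen_posTime (n := n)).measurableSet
  convert! this using 1
  exact piecewise_eq_indicator.symm

lemma IsNSSolution.measurable_vorDen (h : IsNSSolution u p) :
    Measurable fun z : ℝ × Eu n => vorDen u z.1 z.2 := by
  have e : (fun z : ℝ × Eu n => vorDen u z.1 z.2) = fun z => ∑ i, ∑ j,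
      ‖(Ioi (0 : ℝ) ×ˢ univ).indicator (fun z : ℝ × Eu n => vorticity u i j z.1 z.2) z‖ₑ := by
    funext z
    by_cases hz : 0 < z.1
    · rw [vorDen_of_pos hz]
      refine sum_congr rfl fun i _ => sum_congr rfl fun j _ => ?_
      rw [indicator_of_mem]
      exact ⟨hz, mem_univ _⟩
    · rw [vorDen, if_neg hz]
      symm
      refine sum_eq_zero fun i _ => sum_eq_zero fun j _ => ?_
      rw [indicator_of_notMem (fun h => hz h.1), enorm_zero]
  rw [e]
  exact Finset.measurable_fun_sum _ fun i _ => Finset.measurable_fun_sum _ fun j _ =>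
    (h.smooth_vorticity i j).measurable_indicator.enorm

lemma IsNSSolution.measurable_vorDen_slice (h : IsNSSolution u p) (s : ℝ) :
    Measurable (vorDen u s) := h.measurable_vorDen.comp measurable_prodMk_left

lemma DecayFlow.aemeasurable_vor (h : DecayFlow ω₀ u p A) (hs : 0 ≤ s) (i j : Fin n) :
    AEStronglyMeasurable (vor ω₀ u i j s) volume := by
  rcases hs.eq_or_lt with rfl | hs
  · rw [vor_zero]; exact (h.integrable₀ i j).1
  · rw [vor_of_pos _ _ _ _ hs]
    exact (h.sol.contDiff_vorticity hs i j).continuous.aestronglyMeasurable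

lemma DecayFlow.aemeasurable_vorNorm (h : DecayFlow ω₀ u p A) (hs : 0 ≤ s) :
    AEMeasurable (vorNorm ω₀ u s) volume :=
  aemeasurable_fun_sum _ fun i _ => aemeasurable_fun_sum _ fun j _ =>
    (h.aemeasurable_vor hs i j).enorm

lemma integral_heatKernel_sq_le {τ : ℝ} (hτ : 0 < τ) (x : Eu n) :
    Integrable (fun y => heatKernel τ (x - y) ^ 2) ∧
      ∫ y, heatKernel τ (x - y) ^ 2 ≤ (4 * π * τ) ^ (-(n : ℝ) / 2) := by
  have hI := (integrable_heatKernel hτ).comp_sub_left x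
  have hle : ∀ y, heatKernel τ (x - y) ^ 2 ≤
      (4 * π * τ) ^ (-(n : ℝ) / 2) * heatKernel τ (x - y) := fun y => by
    rw [sq]
    exact mul_le_mul_of_nonneg_right (heatKernel_le hτ _) (heatKernel_nonneg hτ.le _)
  have hI2 : Integrable (fun y => heatKernel τ (x - y) ^ 2) :=
    (hI.const_mul ((4 * π * τ) ^ (-(n : ℝ) / 2))).mono' (hI.1.pow 2)
      (.of_forall fun y => by rw [norm_of_nonneg (sq_nonneg _)]; exact hle y)
  refine ⟨hI2, (integral_mono hI2 (hI.const_mul _) hle).trans_eq ?_⟩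
  rw [integral_const_mul, integral_heatKernel_sub hτ, mul_one]

/-- Integrability of the vorticity against the heat kernel, from the bound in `L²`. -/
lemma exists_integral_vorticity_heatKernel_le (h : IsNSSolution u p) (hA : VelocityBound u A)
    (T : ℝ) : ∃ C, 0 ≤ C ∧ ∀ i j, ∀ s, 0 < s → s ≤ T → ∀ τ, 0 < τ → ∀ x : Eu n,
      Integrable (fun y => vorticity u i j s y * heatKernel τ (x - y)) ∧
      ∫ y, ‖vorticity u i j s y * heatKernel τ (x - y)‖ ≤
        s ^ (-(1 / 2) : ℝ) * (C + (4 * π * τ) ^ (-(n : ℝ) / 2)) := by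
  obtain ⟨C, hC0, hC⟩ := h.exists_integral_vorticity_sq_le hA T
  refine ⟨C, hC0, fun i j s hs hsT τ hτ x => ?_⟩
  obtain ⟨i1, b1⟩ := hC i j s hs hsT
  obtain ⟨i2, b2⟩ := integral_heatKernel_sq_le hτ x
  have hs2 : s ^ (-(1 / 2) : ℝ) * s ^ (1 / 2 : ℝ) = 1 := by rw [← rpow_add hs]; norm_num
  have hs3 : s ^ (1 / 2 : ℝ) = s ^ (-(1 / 2) : ℝ) * s := by
    rw [← Real.rpow_add_one hs.ne']; norm_num
  have hp : 0 < s ^ (-(1 / 2) : ℝ) := by positivity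
  have hp2 : 0 < s ^ (1 / 2 : ℝ) := by positivity
  have hle : ∀ y, ‖vorticity u i j s y * heatKernel τ (x - y)‖ ≤
      s ^ (1 / 2 : ℝ) * vorticity u i j s y ^ 2 +
        s ^ (-(1 / 2) : ℝ) * heatKernel τ (x - y) ^ 2 := by
    intro y
    rw [norm_mul, norm_eq_abs, norm_eq_abs]
    set a := |vorticity u i j s y|
    set b := |heatKernel τ (x - y)|
    rw [← sq_abs (vorticity u i j s y), ← sq_abs (heatKernel τ (x - y))]
    have h0 : 0 ≤ s ^ (-(1 / 2) : ℝ) * (s ^ (1 / 2 : ℝ) * a - b) ^ 2 := by positivity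
    have e : s ^ (-(1 / 2) : ℝ) * (s ^ (1 / 2 : ℝ) * a - b) ^ 2 =
        (s ^ (-(1 / 2) : ℝ) * s ^ (1 / 2 : ℝ)) * (s ^ (1 / 2 : ℝ) * a ^ 2 - 2 * a * b) +
          s ^ (-(1 / 2) : ℝ) * b ^ 2 := by ring
    rw [hs2, one_mul] at e
    have hab : 0 ≤ a * b := by positivity
    linarith
  have iD := (i1.const_mul (s ^ (1 / 2 : ℝ))).fun_add (i2.const_mul (s ^ (-(1 / 2) : ℝ)))
  have hcont : Continuous fun y => vorticity u i j s y * heatKernel τ (x - y) :=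
    (h.contDiff_vorticity hs i j).continuous.mul
      ((continuous_heatKernel τ).comp (continuous_const.sub continuous_id))
  have iI := iD.mono' hcont.aestronglyMeasurable (.of_forall hle)
  refine ⟨iI, (integral_mono iI.norm iD hle).trans ?_⟩
  rw [integral_add (i1.const_mul _) (i2.const_mul _), integral_const_mul, integral_const_mul,
    mul_add]
  refine add_le_add ?_ (mul_le_mul_of_nonneg_left b2 hp.le)
  rw [hs3, mul_assoc]
  refine mul_le_mul_of_nonneg_left ?_ hp.le
  rw [le_div_iff₀ hs] at b1
  linarith

/-- The heat kernel is an approximate identity for continuous functions with locally uniformly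
bounded `L²` norms. -/
lemma tendsto_integral_mul_heatKernel {f : ℝ → Eu n → ℝ} (hT : 0 < T) (x : Eu n)
    (hf : SmoothPos f) {M : ℝ} (hM : ∀ s ∈ Ioo (T / 2) T, Integrable (fun y => f s y ^ 2) ∧
      ∫ y, f s y ^ 2 ≤ M)
    (hint : ∀ s ∈ Ioo (T / 2) T, Integrable fun y => f s y * heatKernel (T - s) (x - y)) :
    Tendsto (fun s => ∫ y, f s y * heatKernel (T - s) (x - y)) (𝓝[<] T) (𝓝 (f T x)) := by
  rw [Metric.tendsto_nhds]
  intro ε hε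
  have hM0 : 0 ≤ M := by
    have hmid : (3 / 4 * T) ∈ Ioo (T / 2) T := ⟨by linarith, by linarith⟩
    exact (integral_nonneg fun y => sq_nonneg _).trans (hM _ hmid).2
  obtain ⟨δ, hδ, hcl⟩ := Metric.continuousAt_iff.1 ((hf.contDiffAt hT x).continuousAt) (ε / 2)
    (by positivity)
  obtain ⟨C1, hC1, hG1⟩ := exists_pow_mul_heatKernel_le n (n + 4)
  obtain ⟨C2, hC2, hG2⟩ := exists_pow_mul_heatKernel_le n 2
  set c1 : ℝ := C1 * (8 * π) ^ (-(n : ℝ) / 2) / δ ^ (n + 4) with hc1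
  -- off the ball the kernel is at most `c1 * τ ^ 2`
  have hoff : ∀ τ, 0 < τ → ∀ z : Eu n, δ ≤ ‖z‖ → heatKernel τ z ≤ c1 * τ ^ 2 := by
    intro τ hτ z hz
    have h1 := hG1 τ z hτ
    have h2 := heatKernel_le (n := n) (t := 2 * τ) (by positivity) z
    have h3 : δ ^ (n + 4) * heatKernel τ z ≤ ‖z‖ ^ (n + 4) * heatKernel τ z := by
      have := heatKernel_nonneg hτ.le z
      gcongr
    rw [hc1, div_mul_eq_mul_div, le_div_iff₀ (by positivity)]
    calc heatKernel τ z * δ ^ (n + 4) ≤ C1 * τ ^ (((n + 4 : ℕ) : ℝ) / 2) *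
          (4 * π * (2 * τ)) ^ (-(n : ℝ) / 2) := by
          rw [mul_comm]
          refine h3.trans (h1.trans ?_)
          gcongr
      _ = C1 * (8 * π) ^ (-(n : ℝ) / 2) * τ ^ 2 := by
          rw [show 4 * π * (2 * τ) = 8 * π * τ by ring,
            mul_rpow (by positivity) hτ.le, ← rpow_natCast τ 2]
          have : τ ^ (((n + 4 : ℕ) : ℝ) / 2) * τ ^ (-(n : ℝ) / 2) = τ ^ ((2 : ℕ) : ℝ) := by
            rw [← rpow_add hτ]; congr 1; push_cast; ring
          rw [← this]; ring
  have hc10 : 0 ≤ c1 := by positivity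
  set E : ℝ → ℝ := fun τ => ε / 2 + |f T x| / δ ^ 2 * (C2 * τ) + √c1 * τ * (M + 1) with hE
  have hElim : Tendsto (fun s => E (T - s)) (𝓝[<] T) (𝓝 (ε / 2)) := by
    have : Continuous fun s => E (T - s) := by rw [hE]; fun_prop
    have h2 := (this.tendsto T).mono_left (nhdsWithin_le_nhds (s := Iio T))
    simpa [hE] using h2
  have hEs : ∀ᶠ s in 𝓝[<] T, E (T - s) < ε := hElim.eventually_lt_const (by linarith)
  filter_upwards [hEs, Ioo_mem_nhdsLT (show max (T / 2) (T - δ) < T from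
    max_lt (by linarith) (by linarith))] with s hsE hs
  have hs1 : s ∈ Ioo (T / 2) T := ⟨(le_max_left _ _).trans_lt hs.1, hs.2⟩
  have hs2 : T - s < δ := by linarith [(le_max_right (T / 2) (T - δ)).trans_lt hs.1]
  refine lt_of_le_of_lt ?_ hsE
  set τ := T - s with hτ
  have hτ0 : 0 < τ := sub_pos.2 hs.2
  have iG := (integrable_heatKernel hτ0).comp_sub_left x
  obtain ⟨iM, bM⟩ := hM s hs1
  have i2 : Integrable fun y => ‖x - y‖ ^ 2 * heatKernel τ (x - y) := by
    refine (((integrable_heatKernel (n := n) (t := 2 * τ) (by positivity)).comp_sub_left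
      x).const_mul (C2 * τ)).mono' ?_ (.of_forall fun y => ?_)
    · exact (((continuous_const.sub continuous_id).norm.pow 2).mul
        ((continuous_heatKernel τ).comp (continuous_const.sub continuous_id))).aestronglyMeasurable
    · rw [norm_of_nonneg (mul_nonneg (by positivity) (heatKernel_nonneg hτ0.le _))]
      simpa using hG2 τ (x - y) hτ0
  have b2 : ∫ y, ‖x - y‖ ^ 2 * heatKernel τ (x - y) ≤ C2 * τ := by
    have h1 := integral_mono i2 (((integrable_heatKernel (n := n) (t := 2 * τ)
      (by positivity)).comp_sub_left x).const_mul (C2 * τ)) (fun y => by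
        simpa using hG2 τ (x - y) hτ0)
    rwa [integral_const_mul, integral_heatKernel_sub (by positivity), mul_one] at h1
  have hpt : ∀ y, ‖(f s y - f T x) * heatKernel τ (x - y)‖ ≤
      ε / 2 * heatKernel τ (x - y) + |f T x| / δ ^ 2 * (‖x - y‖ ^ 2 * heatKernel τ (x - y)) +
        √c1 * τ * (f s y ^ 2 + heatKernel τ (x - y)) := by
    intro y
    have hG := heatKernel_nonneg hτ0.le (x - y)
    rw [norm_mul, norm_of_nonneg hG, norm_eq_abs]
    by_cases hy : ‖x - y‖ < δ
    · have := hcl (x := (s, y)) (by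
        rw [Prod.dist_eq]
        refine max_lt ?_ ?_
        · rw [dist_eq, abs_sub_comm, abs_of_pos hτ0]; exact hs2
        · rw [dist_comm, dist_eq_norm]; exact hy)
      rw [dist_eq] at this
      have h1 := mul_le_mul_of_nonneg_right this.le hG
      have h2 : 0 ≤ |f T x| / δ ^ 2 * (‖x - y‖ ^ 2 * heatKernel τ (x - y)) := by positivity
      have h3 : 0 ≤ √c1 * τ * (f s y ^ 2 + heatKernel τ (x - y)) := by positivity
      linarith
    · rw [not_lt] at hy
      have h1 : |f T x| * heatKernel τ (x - y) ≤
          |f T x| / δ ^ 2 * (‖x - y‖ ^ 2 * heatKernel τ (x - y)) := by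
        rw [div_mul_eq_mul_div, le_div_iff₀ (by positivity), mul_assoc]
        refine mul_le_mul_of_nonneg_left ?_ (abs_nonneg _)
        rw [mul_comm]
        gcongr
      have h2 : |f s y| * heatKernel τ (x - y) ≤
          √c1 * τ * (f s y ^ 2 + heatKernel τ (x - y)) := by
        set g := heatKernel τ (x - y)
        have hg : √g ≤ √c1 * τ := by
          rw [← sqrt_sq hτ0.le, ← Real.sqrt_mul hc10]
          exact Real.sqrt_le_sqrt (hoff τ hτ0 _ hy)
        have hgg : √g ^ 2 = g := sq_sqrt hG
        calc |f s y| * g = √g * (|f s y| * √g) := by nth_rewrite 1 [← hgg]; ring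
          _ ≤ √c1 * τ * (|f s y| * √g) := by gcongr
          _ ≤ √c1 * τ * (f s y ^ 2 + g) := by
            have : |f s y| * √g ≤ f s y ^ 2 + g := by
              nlinarith [sq_nonneg (|f s y| - √g), sq_abs (f s y), sq_nonneg (f s y), hG]
            gcongr
      have h3 := mul_le_mul_of_nonneg_right (abs_sub (f s y) (f T x)) hG
      have h4 : 0 ≤ ε / 2 * heatKernel τ (x - y) := by positivity
      linarith
  have e : (∫ y, f s y * heatKernel τ (x - y)) - f T x =
      ∫ y, (f s y - f T x) * heatKernel τ (x - y) := by
    simp_rw [sub_mul]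
    rw [integral_sub (hint s hs1) (iG.const_mul _), integral_const_mul,
      integral_heatKernel_sub hτ0, mul_one]
  rw [dist_eq, e]
  have iR : Integrable fun y => ε / 2 * heatKernel τ (x - y) +
      |f T x| / δ ^ 2 * (‖x - y‖ ^ 2 * heatKernel τ (x - y)) +
        √c1 * τ * (f s y ^ 2 + heatKernel τ (x - y)) :=
    ((iG.const_mul _).fun_add (i2.const_mul _)).fun_add ((iM.fun_add iG).const_mul _)
  refine (norm_integral_le_of_norm_le iR (.of_forall hpt)).trans ?_
  rw [integral_add ((iG.const_mul _).fun_add (i2.const_mul _)) ((iM.fun_add iG).const_mul _),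
    integral_add (iG.const_mul _) (i2.const_mul _), integral_const_mul, integral_const_mul,
    integral_const_mul, integral_add iM iG, integral_heatKernel_sub hτ0, mul_one, hE]
  have : 0 ≤ |f T x| / δ ^ 2 := by positivity
  have h4 : 0 ≤ √c1 * τ := by positivity
  simp only
  gcongr

end

/-- Convolution with `G(2τ)`, for functions with values in `[0, ∞]`. -/
def gaussConv (τ : ℝ) (f : Eu n → ℝ≥0∞) (x : Eu n) : ℝ≥0∞ :=
  ∫⁻ y, ofReal (heatKernel (2 * τ) (x - y)) * f y

lemma lintegral_mul_lintegral_kernel {α β : Type*} [MeasurableSpace α] [MeasurableSpace β]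
    {μ : Measure α} {ν : Measure β} [SFinite μ] [SFinite ν] {k₁ : α → ℝ≥0∞} {k₂ : α → β → ℝ≥0∞}
    {f : β → ℝ≥0∞} (h₁ : Measurable k₁) (h₂ : Measurable (Function.uncurry k₂))
    (hf : AEMeasurable f ν) :
    ∫⁻ z, k₁ z * ∫⁻ y, k₂ z y * f y ∂ν ∂μ = ∫⁻ y, (∫⁻ z, k₁ z * k₂ z y ∂μ) * f y ∂ν := by
  have h21 : ∀ z, Measurable (k₂ z) := fun z => h₂.comp measurable_prodMk_left
  have h22 : ∀ y, Measurable fun z => k₂ z y := fun y => h₂.comp measurable_prodMk_right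
  calc ∫⁻ z, k₁ z * ∫⁻ y, k₂ z y * f y ∂ν ∂μ
      = ∫⁻ z, ∫⁻ y, k₁ z * (k₂ z y * f y) ∂ν ∂μ :=
        lintegral_congr fun z => (lintegral_const_mul'' _ ((h21 z).aemeasurable.mul hf)).symm
    _ = ∫⁻ y, ∫⁻ z, k₁ z * (k₂ z y * f y) ∂μ ∂ν :=
        lintegral_lintegral_swap ((h₁.comp measurable_fst).aemeasurable.mul
          (h₂.aemeasurable.mul hf.comp_snd))
    _ = ∫⁻ y, (∫⁻ z, k₁ z * k₂ z y ∂μ) * f y ∂ν := by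
        refine lintegral_congr fun y => ?_
        rw [← lintegral_mul_const _ (h₁.fun_mul (h22 y))]
        exact lintegral_congr fun z => (mul_assoc _ _ _).symm

lemma measurable_heatKernel_sub (r : ℝ) :
    Measurable (Function.uncurry fun x y : Eu n => ofReal (heatKernel r (x - y))) :=
  ((continuous_heatKernel r).comp (continuous_fst.sub continuous_snd)).measurable.ennreal_ofReal

lemma measurable_heatKernel_const_sub (r : ℝ) (x : Eu n) :
    Measurable fun y : Eu n => ofReal (heatKernel r (x - y)) :=
  ((continuous_heatKernel r).comp (continuous_const.sub continuous_id)).measurable.ennreal_ofReal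

lemma gaussConv_gaussConv {σ τ : ℝ} (hσ : 0 < σ) (hτ : 0 < τ) {f : Eu n → ℝ≥0∞}
    (hf : AEMeasurable f) (x : Eu n) :
    gaussConv σ (gaussConv τ f) x = gaussConv (σ + τ) f x := by
  unfold gaussConv
  rw [lintegral_mul_lintegral_kernel (measurable_heatKernel_const_sub _ x)
    (measurable_heatKernel_sub _) hf]
  refine lintegral_congr fun y => ?_
  rw [lintegral_heatKernel_mul (mul_pos two_pos hσ) (mul_pos two_pos hτ) x y, mul_add]

lemma lintegral_gaussConv {τ : ℝ} (hτ : 0 < τ) {f : Eu n → ℝ≥0∞} (hf : AEMeasurable f) :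
    ∫⁻ x, gaussConv τ f x = ∫⁻ y, f y := by
  unfold gaussConv
  rw [lintegral_lintegral_swap]
  · refine lintegral_congr fun y => ?_
    have hm : Measurable fun z : Eu n => ofReal (heatKernel (2 * τ) (z - y)) :=
      ((continuous_heatKernel _).comp (continuous_id.sub continuous_const)).measurable.ennreal_ofReal
    rw [lintegral_mul_const _ hm, lintegral_heatKernel_sub_right (by positivity), one_mul]
  · exact ((continuous_heatKernel _).comp
      (continuous_fst.sub continuous_snd)).measurable.ennreal_ofReal.aemeasurable.mul hf.comp_snd

section

variable {u : ℝ → Eu n → Eu n} {p : ℝ → Eu n → ℝ} {ω₀ : Fin n → Fin n → Eu n → ℝ} {A s t T : ℝ}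

lemma intervalIntegrable_rpow_half (a b : ℝ) :
    IntegrableOn (fun s : ℝ => s ^ (-(1 / 2) : ℝ)) (Ioo a b) := by
  rcases le_or_gt a b with hab | hab
  · exact (intervalIntegrable_iff_integrableOn_Ioo_of_le hab).1
      (intervalIntegral.intervalIntegrable_rpow' (by norm_num))
  · rw [Ioo_eq_empty hab.not_gt]; exact integrableOn_empty

lemma DecayFlow.integrable_vor_heatKernel (h : DecayFlow ω₀ u p A) (ht : 0 ≤ t) {τ : ℝ}
    (hτ : 0 < τ) (x : Eu n) (i j : Fin n) :
    Integrable fun y => vor ω₀ u i j t y * heatKernel τ (x - y) := by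
  rcases ht.eq_or_lt with rfl | ht
  · rw [vor_zero]
    exact (h.integrable₀ i j).mul_bdd
      ((continuous_heatKernel τ).comp (continuous_const.sub continuous_id)).aestronglyMeasurable
      (.of_forall fun y => by
        rw [norm_of_nonneg (heatKernel_nonneg hτ.le _)]; exact heatKernel_le hτ _)
  · rw [vor_of_pos _ _ _ _ ht]
    obtain ⟨C, -, hC⟩ := exists_integral_vorticity_heatKernel_le h.sol h.bound t
    exact (hC i j t ht le_rfl τ hτ x).1

lemma DecayFlow.gaussConv_vorNorm_lt_top (h : DecayFlow ω₀ u p A) (ht : 0 ≤ t) {τ : ℝ}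
    (hτ : 0 < τ) (x : Eu n) : gaussConv τ (vorNorm ω₀ u t) x < ⊤ := by
  unfold gaussConv vorNorm
  have hk := measurable_heatKernel_const_sub (2 * τ) x
  simp_rw [mul_sum]
  rw [lintegral_finsetSum' _ fun i _ => aemeasurable_fun_sum _ fun j _ =>
    hk.aemeasurable.fun_mul (h.aemeasurable_vor ht i j).enorm]
  refine sum_lt_top.2 fun i _ => ?_
  rw [lintegral_finsetSum' _ fun j _ => hk.aemeasurable.fun_mul (h.aemeasurable_vor ht i j).enorm]
  refine sum_lt_top.2 fun j _ => ?_
  refine lt_of_eq_of_lt (lintegral_congr fun y => ?_)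
    (h.integrable_vor_heatKernel ht (τ := 2 * τ) (by positivity) x i j).2
  rw [enorm_mul, mul_comm, enorm_of_nonneg (heatKernel_nonneg (by positivity) _)]

/-- The pointwise Duhamel inequality. -/
lemma DecayFlow.exists_duhamel_le (h : DecayFlow ω₀ u p A) :
    ∃ c : ℝ, 0 < c ∧ ∀ (t₀ T : ℝ), 0 ≤ t₀ → t₀ < T → ∀ (x : Eu n) (i j : Fin n),
      ‖vorticity u i j T x‖ₑ ≤
        ‖∫ y, vor ω₀ u i j t₀ y * heatKernel (T - t₀) (x - y)‖ₑ +
        ∫⁻ s in Ioo t₀ T, ofReal (c * (1 + s) ^ (-((n : ℝ) + 1) / 2) *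
          (T - s) ^ (-(1 / 2) : ℝ)) * gaussConv (T - s) (vorDen u s) x := by
  obtain ⟨c, hc, hcd⟩ := exists_abs_pderiv_heatKernel_le n
  have hA := h.bound
  have hA0 := hA.pos
  refine ⟨A * (2 * c), by positivity, fun t₀ T ht₀ hT x i j => ?_⟩
  set RHS := ‖∫ y, vor ω₀ u i j t₀ y * heatKernel (T - t₀) (x - y)‖ₑ +
        ∫⁻ s in Ioo t₀ T, ofReal (A * (2 * c) * (1 + s) ^ (-((n : ℝ) + 1) / 2) *
          (T - s) ^ (-(1 / 2) : ℝ)) * gaussConv (T - s) (vorDen u s) x with hRHS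
  have hT0 : 0 < T := ht₀.trans_lt hT
  obtain ⟨C, hC0, hC⟩ := exists_integral_vorticity_heatKernel_le h.sol h.bound T
  obtain ⟨C', hC'0, hC'⟩ := h.sol.exists_integral_vorticity_sq_le hA T
  have hlim : Tendsto (fun s => ∫ y, vorticity u i j s y * heatKernel (T - s) (x - y)) (𝓝[<] T)
      (𝓝 (vorticity u i j T x)) := by
    refine tendsto_integral_mul_heatKernel hT0 x (h.sol.smooth_vorticity i j)
      (M := C' / (T / 2)) (fun s hs => ?_) (fun s hs => ?_)
    · have hs0 : 0 < s := lt_trans (by positivity) hs.1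
      obtain ⟨a, b⟩ := hC' i j s hs0 hs.2.le
      exact ⟨a, b.trans (div_le_div_of_nonneg_left hC'0 (by positivity) hs.1.le)⟩
    · exact (hC i j s (lt_trans (by positivity) hs.1) hs.2.le _ (sub_pos.2 hs.2) x).1
  refine le_of_tendsto (continuous_enorm.continuousAt.tendsto.comp hlim) ?_
  filter_upwards [Ioo_mem_nhdsLT hT] with t₁ ht₁
  have ht₁0 : 0 < t₁ := ht₀.trans_lt ht₁.1
  -- Duhamel's formula up to time `t₁`
  set L : ℝ := max (2 ^ ((n : ℝ) / 2)) (c * (T - t₁) ^ (-(1 / 2) : ℝ)) with hL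
  have hL0 : 0 ≤ L := le_max_of_le_left (by positivity)
  have hTt : 0 < T - t₁ := sub_pos.2 ht₁.2
  have hB : ∀ s ∈ Ioo t₀ t₁, ∀ y, |heatKernel (T - s) (x - y)| ≤
      L * heatKernel (2 * (T - s)) (x - y) ∧
      ∀ k, |pderiv k (heatKernel (T - s)) (x - y)| ≤ L * heatKernel (2 * (T - s)) (x - y) := by
    intro s hs y
    have hsT : 0 < T - s := by linarith [hs.2]
    have hG : 0 ≤ heatKernel (2 * (T - s)) (x - y) := heatKernel_nonneg (by positivity) _
    refine ⟨?_, fun k => (hcd (T - s) k (x - y) hsT).trans ?_⟩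
    · rw [abs_of_pos (heatKernel_pos hsT _)]
      exact (heatKernel_le_two_mul hsT _).trans (mul_le_mul_of_nonneg_right (le_max_left _ _) hG)
    · refine mul_le_mul_of_nonneg_right (le_max_of_le_right ?_) hG
      refine mul_le_mul_of_nonneg_left ?_ hc.le
      exact rpow_le_rpow_of_nonpos hTt (by linarith [hs.2]) (by norm_num)
  have hmeasw : ∀ i j, AEStronglyMeasurable (fun z : ℝ × Eu n => vorticity u i j z.1 z.2)
      ((volume.restrict (Ioo t₀ t₁)).prod volume) := by
    intro i j
    have hmr : (volume.restrict (Ioo t₀ t₁)).prod (volume : Measure (Eu n)) =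
        (volume : Measure (ℝ × Eu n)).restrict (Ioo t₀ t₁ ×ˢ univ) := by
      rw [Measure.volume_eq_prod, ← Measure.prod_restrict, Measure.restrict_univ]
    rw [hmr]
    exact ((h.sol.smooth_vorticity i j).continuousOn.mono (prod_mono
      (fun _ hs => ht₀.trans_lt hs.1) subset_rfl)).aestronglyMeasurable
      (measurableSet_Ioo.prod MeasurableSet.univ)
  have hint : ∀ i j, Integrable (fun z : ℝ × Eu n => vorticity u i j z.1 z.2 *
      (L * heatKernel (2 * (T - z.1)) (x - z.2))) ((volume.restrict (Ioo t₀ t₁)).prod volume) := by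
    intro i j
    have hmK : Measurable fun z : ℝ × Eu n => heatKernel (2 * (T - z.1)) (x - z.2) :=
      measurable_heatKernel.comp (f := fun z : ℝ × Eu n => (2 * (T - z.1), x - z.2)) (by fun_prop)
    have hm : AEStronglyMeasurable (fun z : ℝ × Eu n => vorticity u i j z.1 z.2 *
        (L * heatKernel (2 * (T - z.1)) (x - z.2))) ((volume.restrict (Ioo t₀ t₁)).prod volume) :=
      (hmeasw i j).mul (hmK.const_mul L).aestronglyMeasurable
    have hb : ∀ s ∈ Ioo t₀ t₁,
        Integrable (fun y => vorticity u i j s y * (L * heatKernel (2 * (T - s)) (x - y))) ∧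
        ∫ y, ‖vorticity u i j s y * (L * heatKernel (2 * (T - s)) (x - y))‖ ≤
          L * (C + (4 * π * (2 * (T - t₁))) ^ (-(n : ℝ) / 2)) * s ^ (-(1 / 2) : ℝ) := by
      intro s hs
      have hs0 := ht₀.trans_lt hs.1
      have hsT : 0 < T - s := by linarith [hs.2]
      obtain ⟨a, b⟩ := hC i j s hs0 (by linarith [hs.2]) (2 * (T - s)) (by positivity) x
      have e : (fun y => vorticity u i j s y * (L * heatKernel (2 * (T - s)) (x - y))) =
          fun y => L * (vorticity u i j s y * heatKernel (2 * (T - s)) (x - y)) := by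
        funext y; ring
      rw [e]
      refine ⟨a.const_mul L, ?_⟩
      have e' : ∀ y, ‖vorticity u i j s y * (L * heatKernel (2 * (T - s)) (x - y))‖ =
          L * ‖vorticity u i j s y * heatKernel (2 * (T - s)) (x - y)‖ := fun y => by
        rw [mul_left_comm, norm_mul, norm_of_nonneg hL0]
      simp_rw [e']
      rw [integral_const_mul, mul_assoc]
      refine mul_le_mul_of_nonneg_left (b.trans ?_) hL0
      rw [mul_comm]
      refine mul_le_mul_of_nonneg_right ?_ (by positivity)
      gcongr 1
      exact rpow_le_rpow_of_nonpos (by positivity) (by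
        have := hs.2
        have := pi_pos
        gcongr) (by have : (0 : ℝ) ≤ n := n.cast_nonneg
                    linarith)
    rw [integrable_prod_iff hm]
    refine ⟨?_, ?_⟩
    · filter_upwards [ae_restrict_mem measurableSet_Ioo] with s hs using (hb s hs).1
    · refine ((intervalIntegrable_rpow_half t₀ t₁).const_mul
        (L * (C + (4 * π * (2 * (T - t₁))) ^ (-(n : ℝ) / 2)))).mono' 
        hm.norm.integral_prod_right' ?_
      filter_upwards [ae_restrict_mem measurableSet_Ioo] with s hs
      rw [norm_of_nonneg (integral_nonneg fun _ => norm_nonneg _)]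
      exact (hb s hs).2
  have hw1 : vor ω₀ u i j t₁ = vorticity u i j t₁ := vor_of_pos _ _ _ _ ht₁0
  have hD := duhamel h.sol hA h.weak (isHeatSolution_heatKernel h.two_le) ht₀ ht₁.1 ht₁.2 x i j
    hB hint (hw1 ▸ h.integrable_vor_heatKernel ht₁0.le hTt x i j)
    (h.integrable_vor_heatKernel ht₀ (sub_pos.2 hT) x i j)
  rw [sub_eq_iff_eq_add'] at hD
  simp only [Function.comp_apply]
  rw [hD]
  refine (enorm_add_le _ _).trans (add_le_add le_rfl ?_)
  refine (enorm_integral_le_lintegral_enorm _).trans ?_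
  refine (lintegral_prod_le _).trans ?_
  refine (lintegral_mono_set (t := Ioo t₀ T) (Ioo_subset_Ioo_right ht₁.2.le)).trans ?_
  refine setLIntegral_mono' measurableSet_Ioo fun s hs => ?_
  have hs0 := ht₀.trans_lt hs.1
  have hsT : 0 < T - s := sub_pos.2 hs.2
  rw [gaussConv, ← lintegral_ofReal_mul]
  refine lintegral_mono fun y => ?_
  have hG : 0 ≤ heatKernel (2 * (T - s)) (x - y) := heatKernel_nonneg (by positivity) _
  have hder : ∀ k, ‖pderiv k (heatKernel (T - s)) (x - y)‖ₑ ≤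
      ofReal (c * (T - s) ^ (-(1 / 2) : ℝ) * heatKernel (2 * (T - s)) (x - y)) := by
    intro k
    rw [← ofReal_norm]
    exact ofReal_le_ofReal (hcd (T - s) k (x - y) hsT)
  have hu : ∀ k, ‖u s y k‖ₑ ≤ ofReal (A * (1 + s) ^ (-((n : ℝ) + 1) / 2)) := by
    intro k
    rw [← ofReal_norm]
    exact ofReal_le_ofReal ((VelocityBound.abs_coord_le _ k).trans (hA.sup_le s hs0 y))
  have hcol : ∀ j, ∑ k, ‖vorticity u k j s y‖ₑ ≤ vorDen u s y := by
    intro j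
    rw [vorDen_of_pos hs0]
    exact sum_le_sum fun k _ =>
      single_le_sum (f := fun j => ‖vorticity u k j s y‖ₑ) (fun _ _ => zero_le) (Finset.mem_univ j)
  set a := ofReal (A * (1 + s) ^ (-((n : ℝ) + 1) / 2)) with ha
  set g := ofReal (c * (T - s) ^ (-(1 / 2) : ℝ) * heatKernel (2 * (T - s)) (x - y)) with hg
  calc ‖duhamelIntegrand u heatKernel T x i j s y‖ₑ
      ≤ ∑ k, (a * ‖vorticity u k i s y‖ₑ * g + a * ‖vorticity u k j s y‖ₑ * g) := by
        refine (enorm_sum_le _ _).trans (sum_le_sum fun k _ => (enorm_sub_le).trans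
          (add_le_add ?_ ?_))
        all_goals
          rw [enorm_mul, enorm_mul]
          gcongr
        exacts [hu k, hder j, hu k, hder i]
    _ = a * (∑ k, ‖vorticity u k i s y‖ₑ) * g + a * (∑ k, ‖vorticity u k j s y‖ₑ) * g := by
        rw [sum_add_distrib, mul_sum, mul_sum, sum_mul, sum_mul]
    _ ≤ a * vorDen u s y * g + a * vorDen u s y * g := by
        gcongr
        exacts [hcol i, hcol j]
    _ = (2 * a * g) * vorDen u s y := by ring
    _ = _ := by
        have e2 : 2 * a * g = ofReal (2 * (A * (1 + s) ^ (-((n : ℝ) + 1) / 2)) *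
            (c * (T - s) ^ (-(1 / 2) : ℝ) * heatKernel (2 * (T - s)) (x - y))) := by
          rw [ofReal_mul (by positivity), ofReal_mul two_pos.le,
            ENNReal.ofReal_ofNat]
        rw [← mul_assoc, e2, ← ofReal_mul (by positivity)]
        congr 2
        ring

/-- The weaker form of the Duhamel inequality that is closed under Gaussian convolution. -/
lemma DecayFlow.exists_vorDen_le (h : DecayFlow ω₀ u p A) :
    ∃ c : ℝ, 0 < c ∧ ∀ (t₀ T : ℝ), 0 ≤ t₀ → t₀ < T → ∀ x : Eu n,
      vorDen u T x ≤ ofReal c * (gaussConv (T - t₀) (vorNorm ω₀ u t₀) x +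
        ∫⁻ s in Ioo t₀ T, ofReal ((1 + s) ^ (-(3 / 2) : ℝ) *
          (T - s) ^ (-(1 / 2) : ℝ)) * gaussConv (T - s) (vorDen u s) x) := by
  obtain ⟨c, hc, hD⟩ := h.exists_duhamel_le
  set c' : ℝ := max c (2 ^ ((n : ℝ) / 2)) with hc'
  have hc'0 : 0 < c' := hc.trans_le (le_max_left _ _)
  refine ⟨(n : ℝ) ^ 2 * c', by
    have : 0 < n := by have := h.two_le; omega
    positivity, fun t₀ T ht₀ hT x => ?_⟩
  have hT0 : 0 < T := ht₀.trans_lt hT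
  set I := ∫⁻ s in Ioo t₀ T, ofReal ((1 + s) ^ (-(3 / 2) : ℝ) *
          (T - s) ^ (-(1 / 2) : ℝ)) * gaussConv (T - s) (vorDen u s) x with hI
  have hij : ∀ i j, ‖vorticity u i j T x‖ₑ ≤ ofReal c' *
      (gaussConv (T - t₀) (vorNorm ω₀ u t₀) x + I) := by
    intro i j
    refine (hD t₀ T ht₀ hT x i j).trans ?_
    rw [mul_add]
    refine add_le_add ?_ ?_
    · refine (enorm_integral_le_lintegral_enorm _).trans ?_
      rw [gaussConv, ← lintegral_ofReal_mul]
      refine lintegral_mono fun y => ?_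
      rw [enorm_mul, mul_comm, ← mul_assoc, ← ofReal_mul hc'0.le]
      refine mul_le_mul' ?_ (enorm_vor_le i j y)
      rw [enorm_of_nonneg (heatKernel_nonneg (sub_pos.2 hT).le _)]
      refine ofReal_le_ofReal ((heatKernel_le_two_mul (sub_pos.2 hT) _).trans ?_)
      have := sub_pos.2 hT
      exact mul_le_mul_of_nonneg_right (le_max_right _ _) (heatKernel_nonneg (by positivity) _)
    · rw [hI, ← lintegral_ofReal_mul]
      refine setLIntegral_mono' measurableSet_Ioo fun s hs => ?_
      rw [← mul_assoc, ← ofReal_mul hc'0.le]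
      refine mul_le_mul' (ofReal_le_ofReal ?_) le_rfl
      have hs0 : 0 < s := ht₀.trans_lt hs.1
      have hsT : 0 < T - s := sub_pos.2 hs.2
      rw [mul_assoc]
      have h2 : (2 : ℝ) ≤ n := by exact_mod_cast h.two_le
      have h3 : (1 + s) ^ (-((n : ℝ) + 1) / 2) ≤ (1 + s) ^ (-(3 / 2) : ℝ) :=
        Real.rpow_le_rpow_of_exponent_le (by linarith) (by linarith)
      have h4 : c ≤ c' := le_max_left _ _
      gcongr
  rw [vorDen_of_pos hT0]
  calc ∑ i, ∑ j, ‖vorticity u i j T x‖ₑ ≤ ∑ _i : Fin n, ∑ _j : Fin n, ofReal c' *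
      (gaussConv (T - t₀) (vorNorm ω₀ u t₀) x + I) :=
        sum_le_sum fun i _ => sum_le_sum fun j _ => hij i j
    _ = ofReal ((n : ℝ) ^ 2 * c') *
      (gaussConv (T - t₀) (vorNorm ω₀ u t₀) x + I) := by
        rw [ofReal_mul (by positivity)]
        simp only [sum_const, card_univ, Fintype.card_fin, nsmul_eq_mul]
        rw [ofReal_pow (by positivity), ofReal_natCast]
        ring

end

section Gronwall

lemma lintegral_Ioo_ofReal {f : ℝ → ℝ} {a b : ℝ} (hab : a ≤ b)
    (hf : IntervalIntegrable f volume a b) (h0 : ∀ s ∈ Ioo a b, 0 ≤ f s) :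
    ∫⁻ s in Ioo a b, ofReal (f s) = ofReal (∫ s in a..b, f s) := by
  rw [intervalIntegral.integral_of_le hab, integral_Ioc_eq_integral_Ioo,
    ofReal_integral_eq_lintegral_ofReal]
  · exact (intervalIntegrable_iff_integrableOn_Ioo_of_le hab).1 hf
  · filter_upwards [ae_restrict_mem measurableSet_Ioo] with s hs using h0 s hs

lemma lintegral_Ioo_sub_rpow {a r : ℝ} (har : a ≤ r) :
    ∫⁻ s in Ioo a r, ofReal ((r - s) ^ (-(1 / 2) : ℝ)) = ofReal (2 * (r - a) ^ (1 / 2 : ℝ)) := by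
  rw [lintegral_Ioo_ofReal har]
  · rw [intervalIntegral.integral_comp_sub_left (fun s => s ^ (-(1 / 2) : ℝ)) r,
      integral_rpow (Or.inl (by norm_num)), sub_self, Real.zero_rpow (by norm_num)]
    congr 1; norm_num; ring
  · have := (intervalIntegral.intervalIntegrable_rpow' (a := r - a) (b := r - r)
      (r := -(1 / 2)) (by norm_num)).comp_sub_left r
    simpa using this
  · intro s hs
    exact rpow_nonneg (sub_pos.2 hs.2).le _

lemma lintegral_Ioo_rpow {r : ℝ} (hr : 0 ≤ r) :
    ∫⁻ s in Ioo 0 r, ofReal (s ^ (-(1 / 2) : ℝ)) = ofReal (2 * r ^ (1 / 2 : ℝ)) := by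
  rw [lintegral_Ioo_ofReal hr (intervalIntegral.intervalIntegrable_rpow' (by norm_num))
    (fun s hs => rpow_nonneg hs.1.le _), integral_rpow (Or.inl (by norm_num)),
    Real.zero_rpow (by norm_num)]
  congr 1; norm_num; ring

def gronwallWeight (lam s : ℝ) : ℝ := exp (-(2 * lam) * (1 + s) ^ (-(1 / 2) : ℝ))

lemma hasDerivAt_gronwallWeight (lam : ℝ) {s : ℝ} (hs : 0 ≤ s) :
    HasDerivAt (gronwallWeight lam) (lam * (1 + s) ^ (-(3 / 2) : ℝ) * gronwallWeight lam s) s := by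
  have h1 : HasDerivAt (fun s : ℝ => (1 + s) ^ (-(1 / 2) : ℝ))
      (1 * (-(1 / 2) : ℝ) * (1 + s) ^ ((-(1 / 2) : ℝ) - 1)) s :=
    ((hasDerivAt_id s).const_add 1).rpow_const (Or.inl (by simp; linarith))
  have h2 := (h1.const_mul (-(2 * lam))).exp
  refine h2.congr_deriv ?_
  rw [show (-(1 / 2) : ℝ) - 1 = -(3 / 2) by norm_num]
  simp only [gronwallWeight]
  ring

lemma gronwallWeight_pos (lam s : ℝ) : 0 < gronwallWeight lam s := exp_pos _

lemma gronwallWeight_le_one {lam s : ℝ} (hl : 0 ≤ lam) (hs : 0 ≤ s) : gronwallWeight lam s ≤ 1 := by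
  rw [gronwallWeight, Real.exp_le_one_iff, neg_mul]
  have : 0 ≤ (1 + s) ^ (-(1 / 2) : ℝ) := by positivity
  rw [neg_nonpos]
  positivity

lemma exp_le_gronwallWeight {lam s : ℝ} (hl : 0 ≤ lam) (hs : 0 ≤ s) :
    exp (-(2 * lam)) ≤ gronwallWeight lam s := by
  refine exp_le_exp.2 ?_
  have : (1 + s) ^ (-(1 / 2) : ℝ) ≤ 1 :=
    Real.rpow_le_one_of_one_le_of_nonpos (by linarith) (by norm_num)
  nlinarith

lemma gronwallWeight_mono {lam s r : ℝ} (hl : 0 ≤ lam) (hs : 0 ≤ s) (hsr : s ≤ r) :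
    gronwallWeight lam s ≤ gronwallWeight lam r := by
  refine exp_le_exp.2 ?_
  have : (1 + r) ^ (-(1 / 2) : ℝ) ≤ (1 + s) ^ (-(1 / 2) : ℝ) :=
    rpow_le_rpow_of_nonpos (by linarith) (by linarith) (by norm_num)
  nlinarith

lemma lintegral_gronwallWeight_le {lam δ t₀ r : ℝ} (hl : 0 < lam) (hδ : 0 < δ) (ht₀ : 0 ≤ t₀)
    (hr : t₀ ≤ r) :
    ∫⁻ s in Ioo t₀ r, ofReal ((1 + s) ^ (-(3 / 2) : ℝ) * (r - s) ^ (-(1 / 2) : ℝ) *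
      gronwallWeight lam s) ≤
    ofReal (gronwallWeight lam r * (2 * δ ^ (1 / 2 : ℝ) + (lam * δ ^ (1 / 2 : ℝ))⁻¹)) := by
  have hc : ∀ s, 0 ≤ s → ContinuousAt (fun s : ℝ => (1 + s) ^ (-(3 / 2) : ℝ) *
      gronwallWeight lam s) s := fun s hs => by
    refine ContinuousAt.mul ?_ (hasDerivAt_gronwallWeight lam hs).continuousAt
    exact (continuousAt_const.add continuousAt_id).rpow_const (Or.inl (by simp; linarith))
  have hci : IntervalIntegrable (fun s : ℝ => (1 + s) ^ (-(3 / 2) : ℝ) * gronwallWeight lam s)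
      volume t₀ r := by
    refine ContinuousOn.intervalIntegrable fun s hs => (hc s ?_).continuousWithinAt
    rw [uIcc_of_le hr] at hs
    exact ht₀.trans hs.1
  have hftc : ∫ s in t₀..r, (1 + s) ^ (-(3 / 2) : ℝ) * gronwallWeight lam s =
      lam⁻¹ * gronwallWeight lam r - lam⁻¹ * gronwallWeight lam t₀ := by
    refine intervalIntegral.integral_eq_sub_of_hasDerivAt
      (f := fun s => lam⁻¹ * gronwallWeight lam s) (fun s hs => ?_) hci
    rw [uIcc_of_le hr] at hs
    refine ((hasDerivAt_gronwallWeight lam (ht₀.trans hs.1)).const_mul lam⁻¹).congr_deriv ?_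
    field_simp
  have hδi : δ ^ (-(1 / 2) : ℝ) = (δ ^ (1 / 2 : ℝ))⁻¹ := rpow_neg hδ.le _
  have hpt : ∀ s ∈ Ioo t₀ r, ofReal ((1 + s) ^ (-(3 / 2) : ℝ) *
      (r - s) ^ (-(1 / 2) : ℝ) * gronwallWeight lam s) ≤
      (Ioo (r - δ) r).indicator (fun s => ofReal (gronwallWeight lam r) *
        ofReal ((r - s) ^ (-(1 / 2) : ℝ))) s +
      ofReal (δ ^ (-(1 / 2) : ℝ)) * ofReal ((1 + s) ^ (-(3 / 2) : ℝ) * gronwallWeight lam s) := by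
    intro s hs
    have hs0 : 0 ≤ s := ht₀.trans hs.1.le
    have hrs : 0 < r - s := sub_pos.2 hs.2
    have hw := gronwallWeight_pos lam s
    by_cases hsδ : r - δ < s
    · rw [indicator_of_mem (show s ∈ Ioo (r - δ) r from ⟨hsδ, hs.2⟩),
        ← ofReal_mul (gronwallWeight_pos _ _).le]
      refine le_add_right (ofReal_le_ofReal ?_)
      have h1 : (1 + s) ^ (-(3 / 2) : ℝ) ≤ 1 :=
        Real.rpow_le_one_of_one_le_of_nonpos (by linarith) (by norm_num)
      have h2 := gronwallWeight_mono hl.le hs0 hs.2.le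
      calc _ ≤ 1 * (r - s) ^ (-(1 / 2) : ℝ) * gronwallWeight lam r := by gcongr
        _ = _ := by ring
    · refine le_add_left ?_
      rw [← ofReal_mul (by positivity)]
      refine ofReal_le_ofReal ?_
      have h1 : (r - s) ^ (-(1 / 2) : ℝ) ≤ δ ^ (-(1 / 2) : ℝ) :=
        rpow_le_rpow_of_nonpos hδ (by linarith) (by norm_num)
      calc _ ≤ (1 + s) ^ (-(3 / 2) : ℝ) * δ ^ (-(1 / 2) : ℝ) * gronwallWeight lam s := by gcongr
        _ = _ := by ring
  have hm : Measurable ((Ioo (r - δ) r).indicator (fun s =>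
      ofReal (gronwallWeight lam r) * ofReal ((r - s) ^ (-(1 / 2) : ℝ)))) :=
    Measurable.indicator (by fun_prop) measurableSet_Ioo
  refine (setLIntegral_mono' measurableSet_Ioo hpt).trans ?_
  rw [lintegral_add_left hm, lintegral_ofReal_mul,
    lintegral_Ioo_ofReal hr hci (fun s hs => by
      have := gronwallWeight_pos lam s
      have := ht₀.trans hs.1.le
      positivity), hftc, ← ofReal_mul (by positivity)]
  have h1 : ∫⁻ s in Ioo t₀ r, (Ioo (r - δ) r).indicator (fun s =>
      ofReal (gronwallWeight lam r) * ofReal ((r - s) ^ (-(1 / 2) : ℝ))) s ≤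
      ofReal (gronwallWeight lam r * (2 * δ ^ (1 / 2 : ℝ))) := by
    refine (setLIntegral_le_lintegral _ _).trans ?_
    rw [lintegral_indicator measurableSet_Ioo, lintegral_ofReal_mul,
      lintegral_Ioo_sub_rpow (by linarith), sub_sub_cancel,
      ← ofReal_mul (gronwallWeight_pos _ _).le]
  have hw0 := gronwallWeight_pos lam r
  have hw1 := gronwallWeight_pos lam t₀
  refine (add_le_add h1 (ofReal_le_ofReal (?_ : _ ≤
    gronwallWeight lam r * (lam * δ ^ (1 / 2 : ℝ))⁻¹))).trans_eq ?_
  · rw [hδi, mul_inv]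
    have : 0 ≤ (δ ^ (1 / 2 : ℝ))⁻¹ * (lam⁻¹ * gronwallWeight lam t₀) := by positivity
    calc _ = (δ ^ (1 / 2 : ℝ))⁻¹ * (lam⁻¹ * gronwallWeight lam r) -
          (δ ^ (1 / 2 : ℝ))⁻¹ * (lam⁻¹ * gronwallWeight lam t₀) := by ring
      _ ≤ (δ ^ (1 / 2 : ℝ))⁻¹ * (lam⁻¹ * gronwallWeight lam r) := by linarith
      _ = _ := by ring
  · rw [← ofReal_add (by positivity) (by positivity), mul_add]

/-- A Gronwall inequality with an integrable singular kernel, uniform on `[0, ∞)`. -/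
lemma exists_singular_gronwall {c : ℝ} (hc : 0 < c) : ∃ C : ℝ, 0 < C ∧ ∀ (t₀ r₁ : ℝ),
    0 ≤ t₀ → ∀ (W : ℝ → ℝ≥0∞) (w₀ M : ℝ≥0∞), M ≠ ⊤ → (∀ r ∈ Ioo t₀ r₁, W r ≤ M) →
    (∀ r ∈ Ioo t₀ r₁, W r ≤ ofReal c * (w₀ + ∫⁻ s in Ioo t₀ r,
      ofReal ((1 + s) ^ (-(3 / 2) : ℝ) * (r - s) ^ (-(1 / 2) : ℝ)) * W s)) →
    ∀ r ∈ Ioo t₀ r₁, W r ≤ ofReal C * w₀ := by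
  set lam : ℝ := 32 * c ^ 2 with hlam
  set d : ℝ := 1 / (8 * c) with hd
  have hl : 0 < lam := by positivity
  have hd0 : 0 < d := by positivity
  have hdd : (d ^ 2) ^ (1 / 2 : ℝ) = d := by rw [← sqrt_eq_rpow, sqrt_sq hd0.le]
  have hhalf : c * (2 * d + (lam * d)⁻¹) = 1 / 2 := by rw [hd, hlam]; field_simp; norm_num
  refine ⟨2 * c * exp (2 * lam), by positivity, fun t₀ r₁ ht₀ W w₀ M hM hWM hW => ?_⟩
  set ψ := gronwallWeight lam with hψ
  set S : ℝ≥0∞ := ⨆ r ∈ Ioo t₀ r₁, W r * ofReal (ψ r)⁻¹ with hS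
  have hψi : ∀ r, 0 ≤ r → (ψ r)⁻¹ ≤ exp (2 * lam) := by
    intro r hr
    rw [← neg_neg (2 * lam), exp_neg]
    exact inv_anti₀ (exp_pos _) (exp_le_gronwallWeight hl.le hr)
  have hStop : S ≠ ⊤ := by
    refine ne_top_of_le_ne_top (mul_ne_top hM (ofReal_ne_top (r := exp (2 * lam)))) ?_
    exact iSup₂_le fun r hr => mul_le_mul' (hWM r hr) (ofReal_le_ofReal (hψi r (ht₀.trans hr.1.le)))
  have hWS : ∀ r ∈ Ioo t₀ r₁, W r ≤ ofReal (ψ r) * S := by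
    intro r hr
    have h1 : W r * ofReal (ψ r)⁻¹ ≤ S :=
      le_iSup₂ (f := fun r (_ : r ∈ Ioo t₀ r₁) => W r * ofReal (ψ r)⁻¹) r hr
    calc W r = ofReal (ψ r) * (W r * ofReal (ψ r)⁻¹) := by
          rw [mul_left_comm, ← ofReal_mul (gronwallWeight_pos _ _).le,
            mul_inv_cancel₀ (gronwallWeight_pos _ _).ne', ofReal_one, mul_one]
      _ ≤ _ := mul_le_mul' le_rfl h1
  have hS2 : S ≤ ofReal (c * exp (2 * lam)) * w₀ + ofReal (1 / 2) * S := by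
    refine iSup₂_le fun r hr => ?_
    have hr0 : 0 ≤ r := ht₀.trans hr.1.le
    have hI : ∫⁻ s in Ioo t₀ r, ofReal ((1 + s) ^ (-(3 / 2) : ℝ) *
        (r - s) ^ (-(1 / 2) : ℝ)) * W s ≤
        ofReal (ψ r * (2 * d + (lam * d)⁻¹)) * S := by
      have := lintegral_gronwallWeight_le hl (δ := d ^ 2) (by positivity) ht₀ hr.1.le
      rw [hdd] at this
      refine le_trans ?_ (mul_le_mul' this le_rfl)
      rw [← lintegral_mul_const' _ _ hStop]
      refine setLIntegral_mono' measurableSet_Ioo fun s hs => ?_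
      rw [ofReal_mul (p := (1 + s) ^ (-(3 / 2) : ℝ) * (r - s) ^ (-(1 / 2) : ℝ))
        (by have := ht₀.trans hs.1.le
            have := sub_pos.2 hs.2
            positivity), mul_assoc]
      exact mul_le_mul' le_rfl (hWS s ⟨hs.1, hs.2.trans hr.2⟩)
    calc W r * ofReal (ψ r)⁻¹
        ≤ ofReal c * (w₀ + ofReal (ψ r * (2 * d + (lam * d)⁻¹)) * S) *
          ofReal (ψ r)⁻¹ :=
          mul_le_mul' ((hW r hr).trans (mul_le_mul' le_rfl (add_le_add le_rfl hI))) le_rfl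
      _ = ofReal (c * (ψ r)⁻¹) * w₀ +
          ofReal (c * (ψ r * (2 * d + (lam * d)⁻¹)) * (ψ r)⁻¹) * S := by
          have hp := gronwallWeight_pos lam r
          rw [ofReal_mul hc.le, ofReal_mul (p := c * (ψ r * (2 * d + (lam * d)⁻¹)))
            (by positivity), ofReal_mul hc.le]
          ring
      _ ≤ _ := by
          have hp := gronwallWeight_pos lam r
          refine add_le_add (mul_le_mul' (ofReal_le_ofReal
            (mul_le_mul_of_nonneg_left (hψi r hr0) hc.le)) le_rfl)
            (mul_le_mul' (ofReal_le_ofReal (le_of_eq ?_)) le_rfl)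
          rw [← hhalf, mul_assoc, mul_right_comm (ψ r), mul_inv_cancel₀ hp.ne', one_mul]
  -- absorb
  have hS3 : S ≤ ofReal (2 * c * exp (2 * lam)) * w₀ := by
    have hhalfS : ofReal (1 / 2) * S + ofReal (1 / 2) * S = S := by
      rw [← add_mul, ← ofReal_add (by norm_num) (by norm_num)]; norm_num
    have hne : ofReal (1 / 2) * S ≠ ⊤ := mul_ne_top ofReal_ne_top hStop
    have h1 : ofReal (1 / 2) * S ≤ ofReal (c * exp (2 * lam)) * w₀ := by
      rw [← hhalfS] at hS2
      refine (ENNReal.add_le_add_iff_right hne).1 ?_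
      rwa [hhalfS] at hS2 ⊢
    calc S = ofReal 2 * (ofReal (1 / 2) * S) := by
          rw [← mul_assoc, ← ofReal_mul (by norm_num)]; norm_num
      _ ≤ ofReal 2 * (ofReal (c * exp (2 * lam)) * w₀) := mul_le_mul' le_rfl h1
      _ = _ := by rw [← mul_assoc, ← ofReal_mul (by norm_num), mul_assoc]
  intro r hr
  refine (hWS r hr).trans ?_
  calc ofReal (ψ r) * S ≤ 1 * S := by
        refine mul_le_mul' ?_ le_rfl
        rw [← ofReal_one]
        exact ofReal_le_ofReal (gronwallWeight_le_one hl.le (ht₀.trans hr.1.le))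
    _ ≤ _ := by rw [one_mul]; exact hS3

end Gronwall

section

variable {u : ℝ → Eu n → Eu n} {p : ℝ → Eu n → ℝ} {ω₀ : Fin n → Fin n → Eu n → ℝ} {A s t T : ℝ}

lemma IsNSSolution.measurable_gaussConv (h : IsNSSolution u p) (r : ℝ) :
    Measurable fun q : ℝ × Eu n => gaussConv (r - q.1) (vorDen u q.1) q.2 := by
  unfold gaussConv
  refine Measurable.lintegral_prod_right' (f := fun w : (ℝ × Eu n) × Eu n =>
    ofReal (heatKernel (2 * (r - w.1.1)) (w.1.2 - w.2)) * vorDen u w.1.1 w.2) ?_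
  refine Measurable.mul ?_ ?_
  · exact (measurable_heatKernel.comp (f := fun w : (ℝ × Eu n) × Eu n =>
      (2 * (r - w.1.1), w.1.2 - w.2)) (by fun_prop)).ennreal_ofReal
  · exact h.measurable_vorDen.comp (f := fun w : (ℝ × Eu n) × Eu n => (w.1.1, w.2)) (by fun_prop)

lemma aemeasurable_gaussConv (τ : ℝ) {f : Eu n → ℝ≥0∞} (hf : AEMeasurable f) :
    AEMeasurable (gaussConv τ f) := by
  have h2 : AEMeasurable (fun z : Eu n × Eu n => f z.2) (volume.prod volume) := hf.comp_snd
  exact AEMeasurable.lintegral_prod_right' (ν := volume) (f := fun z : Eu n × Eu n =>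
    ofReal (heatKernel (2 * τ) (z.1 - z.2)) * f z.2)
    ((measurable_heatKernel_sub (2 * τ)).aemeasurable.mul h2)

lemma rpow_half_mul_le {s r : ℝ} (hs : 0 < s) (hr : s < r) :
    (r - s) ^ (-(1 / 2) : ℝ) * s ^ (-(1 / 2) : ℝ) ≤
      (r / 2) ^ (-(1 / 2) : ℝ) * (s ^ (-(1 / 2) : ℝ) + (r - s) ^ (-(1 / 2) : ℝ)) := by
  have h1 : 0 < r - s := sub_pos.2 hr
  have ha : 0 ≤ s ^ (-(1 / 2) : ℝ) := by positivity
  have hb : 0 ≤ (r - s) ^ (-(1 / 2) : ℝ) := by positivity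
  have hr2 : 0 ≤ (r / 2) ^ (-(1 / 2) : ℝ) := by have := hs.trans hr; positivity
  rcases le_total s (r / 2) with h | h
  · have : (r - s) ^ (-(1 / 2) : ℝ) ≤ (r / 2) ^ (-(1 / 2) : ℝ) :=
      rpow_le_rpow_of_nonpos (by linarith) (by linarith) (by norm_num)
    nlinarith
  · have : s ^ (-(1 / 2) : ℝ) ≤ (r / 2) ^ (-(1 / 2) : ℝ) :=
      rpow_le_rpow_of_nonpos (by linarith) (by linarith) (by norm_num)
    nlinarith

lemma lintegral_rpow_half_mul_le {t₀ r : ℝ} (ht₀ : 0 ≤ t₀) (hr : t₀ < r) :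
    ∫⁻ s in Ioo t₀ r, ofReal ((r - s) ^ (-(1 / 2) : ℝ) * s ^ (-(1 / 2) : ℝ)) ≤
      ofReal ((r / 2) ^ (-(1 / 2) : ℝ) * (2 * r ^ (1 / 2 : ℝ) + 2 * r ^ (1 / 2 : ℝ))) := by
  have hr0 : 0 < r := ht₀.trans_lt hr
  refine (lintegral_mono_set (Ioo_subset_Ioo_left ht₀)).trans ?_
  have hm : Measurable fun s : ℝ => ofReal (s ^ (-(1 / 2) : ℝ)) := by fun_prop
  refine (setLIntegral_mono' (g := fun s => ofReal ((r / 2) ^ (-(1 / 2) : ℝ)) *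
    (ofReal (s ^ (-(1 / 2) : ℝ)) + ofReal ((r - s) ^ (-(1 / 2) : ℝ))))
    measurableSet_Ioo fun s hs => ?_).trans ?_
  · have h1 := sub_pos.2 hs.2
    have h2 := hs.1
    rw [← ofReal_add (by positivity) (by positivity), ← ofReal_mul (by positivity)]
    exact ofReal_le_ofReal (rpow_half_mul_le hs.1 hs.2)
  · rw [lintegral_ofReal_mul, lintegral_add_left hm,
      lintegral_Ioo_rpow hr0.le, lintegral_Ioo_sub_rpow hr0.le, sub_zero,
      ← ofReal_add (by positivity) (by positivity), ← ofReal_mul (by positivity)]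

/-- The vorticity is dominated by Gaussian averages of itself at earlier times, uniformly in
time. -/
theorem DecayFlow.exists_vorDen_le_gaussConv (h : DecayFlow ω₀ u p A) :
    ∃ C : ℝ, 0 < C ∧ ∀ (t₀ T : ℝ), 0 ≤ t₀ → t₀ < T → ∀ x : Eu n,
      vorDen u T x ≤ ofReal C * gaussConv (T - t₀) (vorNorm ω₀ u t₀) x := by
  obtain ⟨c, hc, hD⟩ := h.exists_vorDen_le
  obtain ⟨C, hC, hG⟩ := exists_singular_gronwall hc
  refine ⟨c * (1 + C * (exp 2 * 3)), by positivity, fun t₀ T ht₀ hT x => ?_⟩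
  have hT0 : 0 < T := ht₀.trans_lt hT
  set W : ℝ → ℝ≥0∞ := fun r => gaussConv (T - r) (vorDen u r) x with hWdef
  set w₀ := gaussConv (T - t₀) (vorNorm ω₀ u t₀) x with hw₀
  have hw₀t : w₀ < ⊤ := h.gaussConv_vorNorm_lt_top ht₀ (sub_pos.2 hT) x
  have hmW : Measurable W :=
    (h.sol.measurable_gaussConv T).comp (f := fun r : ℝ => (r, x)) (by fun_prop)
  have hineq : ∀ r ∈ Ioo t₀ T, W r ≤ ofReal c * (w₀ + ∫⁻ s in Ioo t₀ r,
      ofReal ((1 + s) ^ (-(3 / 2) : ℝ) * (r - s) ^ (-(1 / 2) : ℝ)) * W s) := by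
    intro r hr
    have hTr : 0 < T - r := sub_pos.2 hr.2
    have hmg := h.sol.measurable_gaussConv r
    have hmk : Measurable fun s : ℝ =>
        ofReal ((1 + s) ^ (-(3 / 2) : ℝ) * (r - s) ^ (-(1 / 2) : ℝ)) := by fun_prop
    set k : ℝ → ℝ≥0∞ := fun s =>
        ofReal ((1 + s) ^ (-(3 / 2) : ℝ) * (r - s) ^ (-(1 / 2) : ℝ)) with hk
    have hmG := measurable_heatKernel_const_sub (n := n) (2 * (T - r)) x
    have hm2 : AEMeasurable fun z => gaussConv (r - t₀) (vorNorm ω₀ u t₀) z :=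
      aemeasurable_gaussConv _ (h.aemeasurable_vorNorm ht₀)
    have hsplit : W r ≤ ∫⁻ z, ofReal (heatKernel (2 * (T - r)) (x - z)) *
        (ofReal c * (gaussConv (r - t₀) (vorNorm ω₀ u t₀) z +
          ∫⁻ s in Ioo t₀ r, k s * gaussConv (r - s) (vorDen u s) z)) :=
      lintegral_mono fun z => mul_le_mul' le_rfl (hD t₀ r ht₀ hr.1 z)
    refine hsplit.trans (le_of_eq ?_)
    have e1 : ∀ z, ofReal (heatKernel (2 * (T - r)) (x - z)) *
        (ofReal c * (gaussConv (r - t₀) (vorNorm ω₀ u t₀) z +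
          ∫⁻ s in Ioo t₀ r, k s * gaussConv (r - s) (vorDen u s) z)) =
        ofReal c * (ofReal (heatKernel (2 * (T - r)) (x - z)) *
          gaussConv (r - t₀) (vorNorm ω₀ u t₀) z +
          ofReal (heatKernel (2 * (T - r)) (x - z)) *
          ∫⁻ s in Ioo t₀ r, k s * gaussConv (r - s) (vorDen u s) z) := fun z => by ring
    simp_rw [e1]
    rw [lintegral_ofReal_mul, lintegral_add_left' (hmG.aemeasurable.fun_mul hm2)]
    congr 2
    · have := gaussConv_gaussConv hTr (sub_pos.2 hr.1) (h.aemeasurable_vorNorm ht₀) x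
      rw [sub_add_sub_cancel] at this
      exact this
    · have e2 : ∀ z, ∫⁻ s in Ioo t₀ r, k s * gaussConv (r - s) (vorDen u s) z =
          ∫⁻ s in Ioo t₀ r, gaussConv (r - s) (vorDen u s) z * k s := fun z =>
        lintegral_congr fun s => mul_comm _ _
      simp_rw [e2]
      rw [lintegral_mul_lintegral_kernel (k₂ := fun z s => gaussConv (r - s) (vorDen u s) z) hmG
        (hmg.comp (f := fun q : Eu n × ℝ => (q.2, q.1)) (by fun_prop)) hmk.aemeasurable]
      refine setLIntegral_congr_fun measurableSet_Ioo fun s hs => ?_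
      rw [mul_comm]
      congr 1
      have := gaussConv_gaussConv hTr (sub_pos.2 hs.2)
        (h.sol.measurable_vorDen_slice s).aemeasurable x
      rw [sub_add_sub_cancel] at this
      exact this
  -- boundedness away from time `T`
  obtain ⟨D, hD0, hDb⟩ := exists_integral_vorticity_heatKernel_le h.sol h.bound T
  have hWle : ∀ r₁, r₁ < T → ∀ s ∈ Ioo t₀ r₁, W s ≤ ofReal ((n : ℝ) ^ 2 *
      (D + (4 * π * (2 * (T - r₁))) ^ (-(n : ℝ) / 2))) * ofReal (s ^ (-(1 / 2) : ℝ)) := by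
    intro r₁ hr₁ s hs
    have hs0 : 0 < s := ht₀.trans_lt hs.1
    have hsT : 0 < T - s := by linarith [hs.2]
    have hTr : 0 < T - r₁ := sub_pos.2 hr₁
    have hij : ∀ i j, ∫⁻ y, ofReal (heatKernel (2 * (T - s)) (x - y)) *
        ‖vorticity u i j s y‖ₑ ≤ ofReal (s ^ (-(1 / 2) : ℝ) *
          (D + (4 * π * (2 * (T - r₁))) ^ (-(n : ℝ) / 2))) := by
      intro i j
      obtain ⟨a, b⟩ := hDb i j s hs0 (by linarith [hs.2]) (2 * (T - s)) (by positivity) x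
      have e : ∫⁻ y, ofReal (heatKernel (2 * (T - s)) (x - y)) *
          ‖vorticity u i j s y‖ₑ =
          ofReal (∫ y, ‖vorticity u i j s y * heatKernel (2 * (T - s)) (x - y)‖) := by
        rw [ofReal_integral_norm_eq_lintegral_enorm a]
        refine lintegral_congr fun y => ?_
        rw [enorm_mul, mul_comm, enorm_of_nonneg (heatKernel_nonneg (by positivity) _)]
      rw [e]
      refine ofReal_le_ofReal (b.trans ?_)
      refine mul_le_mul_of_nonneg_left ?_ (by positivity)
      gcongr 1
      exact rpow_le_rpow_of_nonpos (by positivity) (by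
        have := hs.2
        have := pi_pos
        gcongr) (by have : (0 : ℝ) ≤ n := n.cast_nonneg
                    linarith)
    have hmG := measurable_heatKernel_const_sub (n := n) (2 * (T - s)) x
    have hmw : ∀ i j, Measurable fun y => ‖vorticity u i j s y‖ₑ := fun i j =>
      (h.sol.contDiff_vorticity hs0 i j).continuous.measurable.enorm
    have e : W s = ∑ i, ∑ j, ∫⁻ y, ofReal (heatKernel (2 * (T - s)) (x - y)) *
        ‖vorticity u i j s y‖ₑ := by
      simp only [hWdef, gaussConv, vorDen_of_pos hs0, mul_sum]
      rw [lintegral_finsetSum _ fun i _ => Finset.measurable_fun_sum _ fun j _ =>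
        hmG.fun_mul (hmw i j)]
      exact sum_congr rfl fun i _ => lintegral_finsetSum _ fun j _ => hmG.fun_mul (hmw i j)
    rw [e]
    calc _ ≤ ∑ _i : Fin n, ∑ _j : Fin n, ofReal (s ^ (-(1 / 2) : ℝ) *
          (D + (4 * π * (2 * (T - r₁))) ^ (-(n : ℝ) / 2))) :=
          sum_le_sum fun i _ => sum_le_sum fun j _ => hij i j
      _ = _ := by
          simp only [sum_const, card_univ, Fintype.card_fin, nsmul_eq_mul]
          rw [ofReal_mul (by positivity), ofReal_mul (p := (n : ℝ) ^ 2)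
            (by positivity), ofReal_pow (by positivity), ofReal_natCast]
          ring
  have hWw : ∀ r ∈ Ioo t₀ T, W r ≤ ofReal C * w₀ := by
    intro r hr
    obtain ⟨r₁, hr₁, hr₁T⟩ := exists_between hr.2
    set L := ofReal ((n : ℝ) ^ 2 * (D + (4 * π * (2 * (T - r₁))) ^ (-(n : ℝ) / 2))) with hL
    have hM : ∀ q ∈ Ioo t₀ r₁, W q ≤ ofReal c * (w₀ + L * ofReal (4 * 2 ^ (1 / 2 : ℝ))) := by
      intro q hq
      have hq0 : 0 < q := ht₀.trans_lt hq.1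
      refine (hineq q ⟨hq.1, hq.2.trans hr₁T⟩).trans (mul_le_mul' le_rfl (add_le_add le_rfl ?_))
      have e4 : (q / 2) ^ (-(1 / 2) : ℝ) * (2 * q ^ (1 / 2 : ℝ) + 2 * q ^ (1 / 2 : ℝ)) =
          4 * 2 ^ (1 / 2 : ℝ) := by
        rw [div_rpow hq0.le (by norm_num), rpow_neg hq0.le, rpow_neg (by norm_num : (0 : ℝ) ≤ 2)]
        have : q ^ (1 / 2 : ℝ) ≠ 0 := by positivity
        field_simp; ring
      rw [← e4]
      refine le_trans ?_ (mul_le_mul' le_rfl (lintegral_rpow_half_mul_le ht₀ hq.1))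
      rw [← lintegral_ofReal_mul]
      refine setLIntegral_mono' measurableSet_Ioo fun s hs => ?_
      have hs0 : 0 < s := ht₀.trans_lt hs.1
      have hqs := sub_pos.2 hs.2
      calc _ ≤ ofReal ((q - s) ^ (-(1 / 2) : ℝ)) *
            (L * ofReal (s ^ (-(1 / 2) : ℝ))) := by
            refine mul_le_mul' (ofReal_le_ofReal ?_) (hWle r₁ hr₁T s ⟨hs.1, hs.2.trans hq.2⟩)
            exact mul_le_of_le_one_left (by positivity)
              (Real.rpow_le_one_of_one_le_of_nonpos (by linarith) (by norm_num))
        _ = _ := by rw [ofReal_mul (p := (q - s) ^ (-(1 / 2) : ℝ)) (by positivity)]; ring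
    refine hG t₀ r₁ ht₀ W w₀ _ ?_ hM (fun q hq => hineq q ⟨hq.1, hq.2.trans hr₁T⟩) r ⟨hr.1, hr₁⟩
    exact mul_ne_top ofReal_ne_top (add_ne_top.2 ⟨hw₀t.ne, mul_ne_top ofReal_ne_top ofReal_ne_top⟩)
  -- conclusion
  have hk : ∫⁻ s in Ioo t₀ T, ofReal ((1 + s) ^ (-(3 / 2) : ℝ) *
      (T - s) ^ (-(1 / 2) : ℝ)) ≤ ofReal (exp 2 * 3) := by
    have h1 := lintegral_gronwallWeight_le (lam := 1) (δ := 1) one_pos one_pos ht₀ hT.le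
    have h2 : ∫⁻ s in Ioo t₀ T, ofReal ((1 + s) ^ (-(3 / 2) : ℝ) *
        (T - s) ^ (-(1 / 2) : ℝ)) ≤ ofReal (exp 2) *
        ∫⁻ s in Ioo t₀ T, ofReal ((1 + s) ^ (-(3 / 2) : ℝ) *
          (T - s) ^ (-(1 / 2) : ℝ) * gronwallWeight 1 s) := by
      rw [← lintegral_ofReal_mul]
      refine setLIntegral_mono' measurableSet_Ioo fun s hs => ?_
      have hs0 : 0 < s := ht₀.trans_lt hs.1
      have hTs := sub_pos.2 hs.2
      rw [← ofReal_mul (exp_pos _).le]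
      refine ofReal_le_ofReal ?_
      have h3 := exp_le_gronwallWeight (lam := 1) zero_le_one hs0.le
      have h4 : 1 ≤ exp 2 * gronwallWeight 1 s := by
        calc (1 : ℝ) = exp 2 * exp (-(2 * 1)) := by rw [← exp_add]; norm_num
          _ ≤ _ := mul_le_mul_of_nonneg_left h3 (exp_pos _).le
      calc _ = ((1 + s) ^ (-(3 / 2) : ℝ) * (T - s) ^ (-(1 / 2) : ℝ)) * 1 := by ring
        _ ≤ ((1 + s) ^ (-(3 / 2) : ℝ) * (T - s) ^ (-(1 / 2) : ℝ)) *
            (exp 2 * gronwallWeight 1 s) := by gcongr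
        _ = _ := by ring
    refine h2.trans ?_
    rw [ofReal_mul (exp_pos _).le]
    refine mul_le_mul' le_rfl (h1.trans (ofReal_le_ofReal ?_))
    have := gronwallWeight_le_one (lam := 1) zero_le_one hT0.le
    norm_num
    linarith
  refine (hD t₀ T ht₀ hT x).trans ?_
  rw [ofReal_mul hc.le, mul_assoc]
  refine mul_le_mul' le_rfl ?_
  rw [ofReal_add zero_le_one (by positivity), ofReal_one, add_mul, one_mul]
  refine add_le_add le_rfl ?_
  calc _ ≤ ∫⁻ s in Ioo t₀ T, ofReal ((1 + s) ^ (-(3 / 2) : ℝ) *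
        (T - s) ^ (-(1 / 2) : ℝ)) * (ofReal C * w₀) :=
        setLIntegral_mono' measurableSet_Ioo fun s hs => mul_le_mul' le_rfl (hWw s hs)
    _ = (∫⁻ s in Ioo t₀ T, ofReal ((1 + s) ^ (-(3 / 2) : ℝ) *
        (T - s) ^ (-(1 / 2) : ℝ))) * (ofReal C * w₀) :=
        lintegral_mul_const' _ _ (mul_ne_top ofReal_ne_top hw₀t.ne)
    _ ≤ ofReal (exp 2 * 3) * (ofReal C * w₀) := mul_le_mul' hk le_rfl
    _ = _ := by rw [ofReal_mul hC.le]; ring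

/-- `w = ∑ ∂_k F_k` in the sense of distributions. -/
def WeakDiv (w : Eu n → ℝ) (F : Fin n → Eu n → ℝ) : Prop :=
  ∀ φ : Eu n → ℝ, IsTest φ → ∫ x, w x * φ x = -∫ x, ∑ k, F k x * pderiv k φ x

/-- Test functions of linear growth are admissible for integrable fields. -/
lemma WeakDiv.integral_mul {w : Eu n → ℝ} {F : Fin n → Eu n → ℝ} (h : WeakDiv w F)
    (hF : ∀ k, Integrable (F k)) {g : Eu n → ℝ} (hg : ContDiff ℝ ∞ g) {M : ℝ}
    (h0 : ∀ x, |g x| ≤ M * (1 + ‖x‖)) (h1 : ∀ k x, |pderiv k g x| ≤ M)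
    (hI : Integrable fun y => w y * g y) :
    ∫ y, w y * g y = -∫ y, ∑ k, F k y * pderiv k g y := by
  obtain ⟨c, hc, hcut⟩ := exists_abs_deriv_cutoff_le (n := n)
  have hM0 : 0 ≤ M := by simpa using (abs_nonneg _).trans (h0 0)
  have hL : Tendsto (fun R : ℝ => ∫ y, w y * g y * cutoff R y) atTop (𝓝 (∫ y, w y * g y)) := by
    refine tendsto_integral_filter_of_dominated_convergence (fun y => ‖w y * g y‖)
      (.of_forall fun R => hI.1.mul (contDiff_cutoff R).continuous.aestronglyMeasurable)
      (.of_forall fun R => .of_forall fun y => ?_) hI.norm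
      (.of_forall fun y => ?_)
    · rw [norm_mul _ (cutoff R y), norm_of_nonneg (cutoff_nonneg R y)]
      exact mul_le_of_le_one_right (norm_nonneg _) (cutoff_le_one _ _)
    · simpa using (tendsto_cutoff y).const_mul (w y * g y)
  have hs : ∀ R, ContDiff ℝ ∞ fun y => g y * cutoff R y := fun R => hg.mul (contDiff_cutoff R)
  have hd : ∀ R i y, pderiv i (fun y => g y * cutoff R y) y =
      pderiv i g y * cutoff R y + g y * pderiv i (cutoff R) y := fun R i y =>
    pderiv_mul i ((hg.differentiable (by simp)) y) (((contDiff_cutoff R).differentiable (by simp)) y)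
  have hR : Tendsto (fun R : ℝ => -∫ y, ∑ k, F k y * pderiv k (fun y => g y * cutoff R y) y) atTop
      (𝓝 (-∫ y, ∑ k, F k y * pderiv k g y)) := by
    refine Tendsto.neg (tendsto_integral_filter_of_dominated_convergence
      (fun y => ∑ k, ‖F k y‖ * (M + 3 * M * c)) (.of_forall fun R => ?_) ?_
      (integrable_finsetSum _ fun k _ => (hF k).norm.mul_const _) (.of_forall fun y => ?_))
    · exact Finset.aestronglyMeasurable_fun_sum _ fun k _ => (hF k).1.mul
        (contDiff_pderiv k (hs R)).continuous.aestronglyMeasurable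
    · filter_upwards [eventually_ge_atTop 1] with R hR
      have hR0 : 0 < R := by linarith
      refine .of_forall fun y => (norm_sum_le _ _).trans (sum_le_sum fun k _ => ?_)
      rw [norm_mul, hd]
      refine mul_le_mul_of_nonneg_left ((norm_add_le _ _).trans (add_le_add ?_ ?_)) (norm_nonneg _)
      · rw [norm_mul, norm_of_nonneg (cutoff_nonneg R y)]
        exact (mul_le_of_le_one_right (norm_nonneg _) (cutoff_le_one _ _)).trans (h1 k y)
      · rw [norm_mul, norm_eq_abs, norm_eq_abs]
        by_cases hy : y ∈ Metric.closedBall (0 : Eu n) (2 * R)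
        · have hy' : ‖y‖ ≤ 2 * R := by simpa using hy
          calc _ ≤ M * (1 + ‖y‖) * (c * R⁻¹) :=
                mul_le_mul (h0 y) ((hcut R hR y).1 k) (abs_nonneg _) (by positivity)
            _ ≤ M * (3 * R) * (c * R⁻¹) := by gcongr; linarith
            _ = _ := by field_simp
        · have : y ∉ tsupport (cutoff R) := fun hyt => hy <| closure_minimal
            (fun z (hz : cutoff R z ≠ 0) => by_contra fun hz' => hz (cutoff_eq_zero hR0 hz')) Metric.isClosed_closedBall hyt
          rw [pderiv_eq_zero_of_notMem_tsupport k this, abs_zero, mul_zero]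
          positivity
    · refine tendsto_finsetSum _ fun k _ => Tendsto.const_mul _ ?_
      simp_rw [hd]
      have hz : Tendsto (fun R => pderiv k (cutoff R) y) atTop (𝓝 0) := by
        refine squeeze_zero_norm' (a := fun R : ℝ => c * R⁻¹) ?_ (by
          simpa using tendsto_inv_atTop_zero.const_mul c)
        filter_upwards [eventually_ge_atTop 1] with R hR using (hcut R hR y).1 k
      simpa using ((tendsto_cutoff y).const_mul (pderiv k g y)).add (hz.const_mul (g y))
  refine tendsto_nhds_unique hL (hR.congr' ?_)
  filter_upwards [eventually_gt_atTop 0] with R hR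
  simp_rw [mul_assoc]
  exact (h _ ⟨hs R, (hasCompactSupport_cutoff hR).mul_left⟩).symm

lemma weakDiv_of_contDiff {F : Fin n → Eu n → ℝ} (hF : ∀ k, ContDiff ℝ ∞ (F k)) :
    WeakDiv (fun x => ∑ k, pderiv k (F k) x) F := by
  intro φ hφ
  simp_rw [sum_mul]
  rw [integral_finsetSum _ fun k _ => integrable_mul_of_hasCompactSupport
      (contDiff_pderiv k (hF k)).continuous hφ.1.continuous hφ.2,
    integral_finsetSum _ fun k _ => integrable_mul_of_hasCompactSupport (hF k).continuous
      (contDiff_pderiv k hφ.1).continuous (hasCompactSupport_pderiv k hφ.2),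
    ← sum_neg_distrib]
  exact sum_congr rfl fun k _ => integral_pderiv_mul k (hF k) hφ.1 hφ.2

def curlField (a : Eu n → Eu n) (i j k : Fin n) (y : Eu n) : ℝ :=
  (if k = i then a y j else 0) - if k = j then a y i else 0

lemma sum_curlField_mul (a : Eu n → Eu n) (i j : Fin n) (y : Eu n) (d : Fin n → ℝ) :
    ∑ k, curlField a i j k y * d k = a y j * d i - a y i * d j := by
  simp [curlField, sub_mul, sum_sub_distrib]

lemma integrable_coord {a : Eu n → Eu n} (ha : Integrable a) (j : Fin n) :
    Integrable fun y => a y j :=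
  (proj (𝕜 := ℝ) j).integrable_comp ha

lemma integrable_curlField {a : Eu n → Eu n} (ha : Integrable a) (i j k : Fin n) :
    Integrable (curlField a i j k) := by
  have : ∀ (q : Prop) [Decidable q] (l : Fin n), Integrable fun y => if q then a y l else 0 := by
    intro q _ l
    split_ifs
    exacts [integrable_coord ha l, integrable_zero _ _ _]
  exact (this _ j).sub' (this _ i)

lemma IsWeakVorticity.weakDiv {a : Eu n → Eu n} {b : Fin n → Fin n → Eu n → ℝ}
    (h : IsWeakVorticity a b) (i j : Fin n) : WeakDiv (b i j) (curlField a i j) := fun φ hφ => by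
  simp_rw [sum_curlField_mul]
  exact h i j φ hφ

lemma IsNSSolution.isWeakVorticity (h : IsNSSolution u p) (ht : 0 < t) :
    IsWeakVorticity (u t) fun i j => vorticity u i j t := by
  intro i j φ hφ
  have iu : ∀ i j, Integrable fun y => pderiv i (fun y => u t y j) y * φ y := fun i j =>
    integrable_mul_of_hasCompactSupport (contDiff_pderiv i (h.contDiff_comp ht j)).continuous
      hφ.1.continuous hφ.2
  have iv : ∀ i j, Integrable fun y => u t y j * pderiv i φ y := fun i j =>
    integrable_mul_of_hasCompactSupport (h.contDiff_comp ht j).continuous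
      (contDiff_pderiv i hφ.1).continuous (hasCompactSupport_pderiv i hφ.2)
  simp_rw [vorticity, sub_mul]
  rw [integral_sub (iu i j) (iu j i), integral_pderiv_mul i (h.contDiff_comp ht j) hφ.1 hφ.2,
    integral_pderiv_mul j (h.contDiff_comp ht i) hφ.1 hφ.2, integral_sub (iv i j) (iv j i)]
  ring

/-- Transfer of the curl onto a bounded test function. -/
lemma integral_vorticity_mul (h : IsNSSolution u p) (hA : VelocityBound u A) (ht : 0 < t)
    (i j : Fin n) {g : Eu n → ℝ} (hg : ContDiff ℝ ∞ g) {M : ℝ} (h0 : ∀ x, |g x| ≤ M)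
    (h1 : ∀ k x, |pderiv k g x| ≤ M) (hI : Integrable fun y => vorticity u i j t y * g y) :
    ∫ y, vorticity u i j t y * g y = -∫ y, (u t y j * pderiv i g y - u t y i * pderiv j g y) := by
  have := ((h.isWeakVorticity ht).weakDiv i j).integral_mul
    (integrable_curlField (hA.integrable t ht.le) i j) hg (fun x => (h0 x).trans
      (le_mul_of_one_le_right ((abs_nonneg _).trans (h0 0)) (by linarith [norm_nonneg x]))) h1 hI
  simpa only [sum_curlField_mul] using this

lemma DecayFlow.lintegral_vorNorm_zero_lt_top (h : DecayFlow ω₀ u p A) :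
    ∫⁻ y, vorNorm ω₀ u 0 y < ⊤ := by
  unfold vorNorm
  simp_rw [vor_zero]
  rw [lintegral_finsetSum' _ fun i _ => aemeasurable_fun_sum _ fun j _ =>
    (h.integrable₀ i j).1.enorm]
  refine sum_lt_top.2 fun i _ => ?_
  rw [lintegral_finsetSum' _ fun j _ => (h.integrable₀ i j).1.enorm]
  exact sum_lt_top.2 fun j _ => (h.integrable₀ i j).2

lemma DecayFlow.exists_lintegral_vorDen_le_const (h : DecayFlow ω₀ u p A) :
    ∃ M : ℝ, 0 < M ∧ ∀ t, 0 < t → ∫⁻ x, vorDen u t x ≤ ofReal M := by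
  obtain ⟨C, hC, hS⟩ := h.exists_vorDen_le_gaussConv
  set V := ∫⁻ y, vorNorm ω₀ u 0 y with hV
  have hVt : V ≠ ⊤ := h.lintegral_vorNorm_zero_lt_top.ne
  refine ⟨C * V.toReal + 1, by positivity, fun t ht => ?_⟩
  calc ∫⁻ x, vorDen u t x ≤ ∫⁻ x, ofReal C * gaussConv (t - 0) (vorNorm ω₀ u 0) x :=
        lintegral_mono fun x => hS 0 t le_rfl ht x
    _ = ofReal C * V := by
        rw [lintegral_ofReal_mul, sub_zero, lintegral_gaussConv ht (h.aemeasurable_vorNorm le_rfl)]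
    _ ≤ _ := by
        rw [← ofReal_toReal hVt, ← ofReal_mul hC.le]
        exact ofReal_le_ofReal (by simp [ENNReal.toReal_ofReal])

lemma DecayFlow.lintegral_heat_vorticity_le (h : DecayFlow ω₀ u p A) {c : ℝ} (hc : 0 < c)
    (hcd : ∀ (t : ℝ) (j : Fin n) (x : Eu n), 0 < t →
      |pderiv j (heatKernel t) x| ≤ c * t ^ (-(1 / 2) : ℝ) * heatKernel (2 * t) x)
    (ht : 0 < t) (i j : Fin n) :
    ∫⁻ x, ‖∫ y, vorticity u i j t y * heatKernel t (x - y)‖ₑ ≤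
      ofReal (2 * c * t ^ (-(1 / 2) : ℝ) * (A * (1 + t) ^ (-(1 / 2) : ℝ))) := by
  have hG : ContDiff ℝ ∞ (heatKernel (n := n) t) :=
    (isHeatSolution_heatKernel h.two_le).smooth.slice ht
  set f : Eu n → ℝ≥0∞ := fun y => ofReal (2 * c * t ^ (-(1 / 2) : ℝ)) * ‖u t y‖ₑ with hf
  have hfm : AEMeasurable f := (h.bound.integrable t ht.le).1.enorm.const_mul _
  have hpt : ∀ x, ‖∫ y, vorticity u i j t y * heatKernel t (x - y)‖ₑ ≤ gaussConv t f x := by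
    intro x
    have hpd : ∀ k y, |pderiv k (fun y => heatKernel t (x - y)) y| ≤
        c * t ^ (-(1 / 2) : ℝ) * heatKernel (2 * t) (x - y) := fun k y => by
      rw [pderiv_comp_const_sub hG, abs_neg]; exact hcd t k _ ht
    have hI := h.integrable_vor_heatKernel ht.le ht x i j
    rw [vor_of_pos _ _ _ _ ht] at hI
    rw [integral_vorticity_mul h.sol h.bound ht i j (contDiff_const_sub_comp hG x)
      (M := max ((4 * π * t) ^ (-(n : ℝ) / 2))
        (c * t ^ (-(1 / 2) : ℝ) * (4 * π * (2 * t)) ^ (-(n : ℝ) / 2)))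
      (fun y => by rw [abs_of_pos (heatKernel_pos ht _)]
                   exact (heatKernel_le ht _).trans (le_max_left _ _))
      (fun k y => (hpd k y).trans (le_max_of_le_right (mul_le_mul_of_nonneg_left
        (heatKernel_le (by positivity) _) (by positivity)))) hI, enorm_neg]
    refine (enorm_integral_le_lintegral_enorm _).trans (lintegral_mono fun y => ?_)
    have hk : 0 ≤ heatKernel (2 * t) (x - y) := heatKernel_nonneg (by positivity) _
    rw [hf]
    simp only
    rw [← mul_assoc, ← ofReal_mul hk, ← ofReal_norm, ← ofReal_norm, ← ofReal_mul (by positivity)]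
    refine ofReal_le_ofReal ((norm_sub_le _ _).trans ?_)
    rw [norm_mul, norm_mul]
    have a1 := mul_le_mul (VelocityBound.abs_coord_le (u t y) j) (hpd i y) (abs_nonneg _) (norm_nonneg _)
    have a2 := mul_le_mul (VelocityBound.abs_coord_le (u t y) i) (hpd j y) (abs_nonneg _) (norm_nonneg _)
    simp only [norm_eq_abs] at a1 a2 ⊢
    linarith
  refine (lintegral_mono hpt).trans ?_
  rw [lintegral_gaussConv ht hfm, hf, lintegral_ofReal_mul,
    ofReal_mul (p := 2 * c * t ^ (-(1 / 2) : ℝ)) (by positivity), ← ofReal_integral_norm_eq_lintegral_enorm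
    (h.bound.integrable t ht.le)]
  exact mul_le_mul' le_rfl (ofReal_le_ofReal (h.bound.integral_le t ht.le))

/-- Decay of the vorticity in `L¹`. -/
theorem DecayFlow.exists_lintegral_vorDen_le (h : DecayFlow ω₀ u p A) :
    ∃ C : ℝ, 0 < C ∧ ∀ t, 0 < t → ∫⁻ x, vorDen u t x ≤ ofReal (C / (1 + t)) := by
  obtain ⟨M, hM, hMb⟩ := h.exists_lintegral_vorDen_le_const
  obtain ⟨d, hd, hD⟩ := h.exists_duhamel_le
  obtain ⟨c, hc, hcd⟩ := exists_abs_pderiv_heatKernel_le n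
  have hA := h.bound.pos
  have hn0 : (2 : ℝ) ≤ n := by exact_mod_cast h.two_le
  set C : ℝ := (n : ℝ) ^ 2 * (8 * c * A + 8 * d * M) with hC
  refine ⟨2 * M + C, by positivity, fun t ht => ?_⟩
  rcases le_or_gt t 1 with ht1 | ht1
  · refine (hMb t ht).trans (ofReal_le_ofReal ?_)
    rw [le_div_iff₀ (by positivity)]
    have : 0 ≤ C := by positivity
    nlinarith
  set t₀ := t / 2 with ht₀
  have ht₀0 : 0 < t₀ := by positivity
  have hlt : t₀ < t := by rw [ht₀]; linarith
  have htt : t - t₀ = t₀ := by rw [ht₀]; ring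
  have hij : ∀ i j, ∫⁻ x, ‖vorticity u i j t x‖ₑ ≤ ofReal ((8 * c * A + 8 * d * M) / (1 + t)) := by
    intro i j
    set k : ℝ → ℝ≥0∞ := fun s => ofReal (d * (1 + s) ^ (-((n : ℝ) + 1) / 2) *
          (t - s) ^ (-(1 / 2) : ℝ)) with hk
    have hmk : Measurable k := by fun_prop
    have hmg := h.sol.measurable_gaussConv t
    have h1 : ∫⁻ x, ‖vorticity u i j t x‖ₑ ≤
        (∫⁻ x, ‖∫ y, vorticity u i j t₀ y * heatKernel t₀ (x - y)‖ₑ) +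
        ∫⁻ x, ∫⁻ s in Ioo t₀ t, k s * gaussConv (t - s) (vorDen u s) x := by
      have hm : Measurable fun x => ∫⁻ s in Ioo t₀ t, k s * gaussConv (t - s) (vorDen u s) x :=
        Measurable.lintegral_prod_right' (f := fun q : Eu n × ℝ =>
          k q.2 * gaussConv (t - q.2) (vorDen u q.2) q.1)
          ((hmk.comp measurable_snd).mul
            (hmg.comp (f := fun q : Eu n × ℝ => (q.2, q.1)) (by fun_prop)))
      rw [← lintegral_add_right _ hm]
      refine lintegral_mono fun x => ?_
      have := hD t₀ t ht₀0.le hlt x i j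
      rwa [vor_of_pos _ _ _ _ ht₀0, htt] at this
    have h2 : ∫⁻ x, ∫⁻ s in Ioo t₀ t, k s * gaussConv (t - s) (vorDen u s) x ≤
        ofReal (8 * d * M / (1 + t)) := by
      rw [lintegral_lintegral_swap]
      · calc ∫⁻ s in Ioo t₀ t, ∫⁻ x, k s * gaussConv (t - s) (vorDen u s) x
            ≤ ∫⁻ s in Ioo t₀ t, ofReal (d * M * (1 + t₀) ^ (-(3 / 2) : ℝ)) *
                ofReal ((t - s) ^ (-(1 / 2) : ℝ)) := by
              refine setLIntegral_mono' measurableSet_Ioo fun s hs => ?_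
              have hs0 : 0 < s := ht₀0.trans hs.1
              have hts : 0 < t - s := sub_pos.2 hs.2
              rw [lintegral_ofReal_mul,
                lintegral_gaussConv hts (h.sol.measurable_vorDen_slice s).aemeasurable]
              refine (mul_le_mul' le_rfl (hMb s hs0)).trans ?_
              rw [← ofReal_mul (by positivity), ← ofReal_mul (by positivity)]
              refine ofReal_le_ofReal ?_
              have h3 : (1 + s) ^ (-((n : ℝ) + 1) / 2) ≤ (1 + t₀) ^ (-(3 / 2) : ℝ) :=
                (Real.rpow_le_rpow_of_exponent_le (by linarith) (by linarith)).trans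
                  (rpow_le_rpow_of_nonpos (by linarith) (by linarith [hs.1]) (by norm_num))
              calc _ ≤ d * (1 + t₀) ^ (-(3 / 2) : ℝ) * (t - s) ^ (-(1 / 2) : ℝ) * M := by gcongr
                _ = _ := by ring
          _ = ofReal (d * M * (1 + t₀) ^ (-(3 / 2) : ℝ) * (2 * t₀ ^ (1 / 2 : ℝ))) := by
              rw [lintegral_ofReal_mul, lintegral_Ioo_sub_rpow hlt.le,
                htt, ← ofReal_mul (by positivity)]
          _ ≤ _ := by
              refine ofReal_le_ofReal ?_
              have h4 : (1 + t₀) ^ (-(3 / 2) : ℝ) * t₀ ^ (1 / 2 : ℝ) ≤ (1 + t₀)⁻¹ := by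
                calc _ ≤ (1 + t₀) ^ (-(3 / 2) : ℝ) * (1 + t₀) ^ (1 / 2 : ℝ) := by gcongr; linarith
                  _ = (1 + t₀)⁻¹ := by rw [← rpow_add (by positivity), ← rpow_neg_one]; norm_num
              have h5 : (1 + t₀)⁻¹ ≤ 4 / (1 + t) := by
                rw [inv_eq_one_div, div_le_div_iff₀ (by positivity) (by positivity), ht₀]
                linarith
              calc _ = 2 * d * M * ((1 + t₀) ^ (-(3 / 2) : ℝ) * t₀ ^ (1 / 2 : ℝ)) := by ring
                _ ≤ 2 * d * M * (4 / (1 + t)) := by gcongr; exact h4.trans h5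
                _ = _ := by ring
      · exact ((hmk.comp measurable_snd).mul
            (hmg.comp (f := fun q : Eu n × ℝ => (q.2, q.1)) (by fun_prop))).aemeasurable
    refine h1.trans ((add_le_add (h.lintegral_heat_vorticity_le hc hcd ht₀0 i j) h2).trans ?_)
    rw [← ofReal_add (by positivity) (by positivity), add_div]
    refine ofReal_le_ofReal (add_le_add ?_ le_rfl)
    have h6 : t₀ ^ (-(1 / 2) : ℝ) * (1 + t₀) ^ (-(1 / 2) : ℝ) ≤ 4 / (1 + t) := by
      calc _ ≤ t₀ ^ (-(1 / 2) : ℝ) * t₀ ^ (-(1 / 2) : ℝ) := by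
            refine mul_le_mul_of_nonneg_left ?_ (by positivity)
            exact rpow_le_rpow_of_nonpos ht₀0 (by linarith) (by norm_num)
        _ = t₀⁻¹ := by rw [← rpow_add ht₀0, ← rpow_neg_one]; norm_num
        _ ≤ 4 / (1 + t) := by
            rw [inv_eq_one_div, div_le_div_iff₀ (by positivity) (by positivity), ht₀]
            linarith
    calc _ = 2 * c * A * (t₀ ^ (-(1 / 2) : ℝ) * (1 + t₀) ^ (-(1 / 2) : ℝ)) := by ring
      _ ≤ 2 * c * A * (4 / (1 + t)) := by gcongr
      _ = _ := by ring
  have hmw : ∀ i j, Measurable fun y => ‖vorticity u i j t y‖ₑ := fun i j =>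
    (h.sol.contDiff_vorticity ht i j).continuous.measurable.enorm
  simp_rw [vorDen_of_pos ht]
  rw [lintegral_finsetSum _ fun i _ => Finset.measurable_fun_sum _ fun j _ => hmw i j]
  calc _ ≤ ∑ _i : Fin n, ∑ _j : Fin n, ofReal ((8 * c * A + 8 * d * M) / (1 + t)) :=
        sum_le_sum fun i _ => (lintegral_finsetSum _ fun j _ => hmw i j).trans_le
          (sum_le_sum fun j _ => hij i j)
    _ = ofReal (C / (1 + t)) := by
        simp only [sum_const, card_univ, Fintype.card_fin, nsmul_eq_mul]
        rw [hC, mul_div_assoc, ofReal_mul (p := (n : ℝ) ^ 2) (by positivity),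
          ofReal_pow (by positivity), ofReal_natCast]
        ring
    _ ≤ _ := by
        refine ofReal_le_ofReal ?_
        gcongr
        linarith

lemma add_pow_le_two_pow_mul {a b : ℝ} (ha : 0 ≤ a) (hb : 0 ≤ b) (k : ℕ) :
    (a + b) ^ k ≤ 2 ^ k * (a ^ k + b ^ k) := by
  rcases le_total a b with h | h
  · calc (a + b) ^ k ≤ (2 * b) ^ k := by gcongr; linarith
      _ ≤ _ := by rw [mul_pow]; gcongr; linarith [pow_nonneg ha k]
  · calc (a + b) ^ k ≤ (2 * a) ^ k := by gcongr; linarith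
      _ ≤ _ := by rw [mul_pow]; gcongr; linarith [pow_nonneg hb k]

lemma exists_lintegral_pow_gaussConv_le (n k : ℕ) : ∃ C : ℝ, 0 < C ∧ ∀ (τ : ℝ), 0 < τ →
    ∀ f : Eu n → ℝ≥0∞, AEMeasurable f → ∫⁻ x, ofReal (‖x‖ ^ k) * gaussConv τ f x ≤
      ofReal C * ((∫⁻ y, ofReal (‖y‖ ^ k) * f y) + ofReal (τ ^ ((k : ℝ) / 2)) * ∫⁻ y, f y) := by
  obtain ⟨D, hD, hDb⟩ := exists_pow_mul_heatKernel_le n k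
  refine ⟨2 ^ k * (1 + D * 2 ^ ((k : ℝ) / 2)), by positivity, fun τ hτ f hf => ?_⟩
  have hm : Measurable fun x : Eu n => ofReal (‖x‖ ^ k) := by fun_prop
  set b : ℝ := D * (2 * τ) ^ ((k : ℝ) / 2) with hb
  have hker : ∀ y : Eu n, ∫⁻ x, ofReal (‖x‖ ^ k) *
      ofReal (heatKernel (2 * τ) (x - y)) ≤ ofReal (2 ^ k * (‖y‖ ^ k + b)) := by
    intro y
    have hGm : ∀ r : ℝ, Measurable fun x : Eu n => ofReal (heatKernel r (x - y)) := fun r =>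
      ((continuous_heatKernel r).comp (continuous_id.sub continuous_const)).measurable.ennreal_ofReal
    calc _ ≤ ∫⁻ x, (ofReal (2 ^ k * ‖y‖ ^ k) * ofReal (heatKernel (2 * τ) (x - y)) +
          ofReal (2 ^ k * b) * ofReal (heatKernel (2 * (2 * τ)) (x - y))) := by
          refine lintegral_mono fun x => ?_
          have g1 : 0 ≤ heatKernel (2 * τ) (x - y) := heatKernel_nonneg (by positivity) _
          have g2 : 0 ≤ heatKernel (2 * (2 * τ)) (x - y) := heatKernel_nonneg (by positivity) _
          rw [← ofReal_mul (by positivity), ← ofReal_mul (by positivity),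
            ← ofReal_mul (by positivity), ← ofReal_add (by positivity) (by positivity)]
          refine ofReal_le_ofReal ?_
          have h1 : ‖x‖ ^ k ≤ 2 ^ k * (‖y‖ ^ k + ‖x - y‖ ^ k) := by
            refine le_trans ?_ (add_pow_le_two_pow_mul (norm_nonneg y) (norm_nonneg (x - y)) k)
            gcongr
            calc ‖x‖ = ‖y + (x - y)‖ := by congr 1; abel
              _ ≤ _ := norm_add_le _ _
          have h2 := hDb (2 * τ) (x - y) (by positivity)
          calc _ ≤ 2 ^ k * (‖y‖ ^ k + ‖x - y‖ ^ k) * heatKernel (2 * τ) (x - y) := by gcongr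
            _ = 2 ^ k * ‖y‖ ^ k * heatKernel (2 * τ) (x - y) +
                2 ^ k * (‖x - y‖ ^ k * heatKernel (2 * τ) (x - y)) := by ring
            _ ≤ 2 ^ k * ‖y‖ ^ k * heatKernel (2 * τ) (x - y) +
                2 ^ k * (b * heatKernel (2 * (2 * τ)) (x - y)) := by gcongr
            _ = _ := by ring
      _ = _ := by
          rw [lintegral_add_left ((hGm _).const_mul _), lintegral_const_mul _ (hGm _),
            lintegral_const_mul _ (hGm _), lintegral_heatKernel_sub_right (by positivity),
            lintegral_heatKernel_sub_right (by positivity), mul_one, mul_one,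
            ← ofReal_add (by positivity) (by positivity), mul_add]
  unfold gaussConv
  rw [lintegral_mul_lintegral_kernel hm (measurable_heatKernel_sub (2 * τ)) hf]
  calc _ ≤ ∫⁻ y, ofReal (2 ^ k) * (ofReal (‖y‖ ^ k) * f y + ofReal b * f y) := by
        refine lintegral_mono fun y => ?_
        refine (mul_le_mul' (hker y) le_rfl).trans_eq ?_
        rw [ofReal_mul (by positivity), ofReal_add (by positivity) (by positivity)]
        ring
    _ = ofReal (2 ^ k) * ((∫⁻ y, ofReal (‖y‖ ^ k) * f y) + ofReal b * ∫⁻ y, f y) := by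
        rw [lintegral_ofReal_mul,
          lintegral_add_left' (hm.aemeasurable.fun_mul hf), lintegral_const_mul'' _ hf]
    _ ≤ _ := by
        rw [ofReal_mul (p := 2 ^ k) (by positivity), mul_assoc]
        refine mul_le_mul' le_rfl ?_
        rw [mul_add]
        refine add_le_add (le_mul_of_one_le_left' ?_) ?_
        · rw [← ofReal_one]
          exact ofReal_le_ofReal (by
            have : 0 ≤ D * 2 ^ ((k : ℝ) / 2) := by positivity
            linarith)
        · rw [← mul_assoc, ← ofReal_mul (by positivity)]
          refine mul_le_mul' (ofReal_le_ofReal ?_) le_rfl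
          rw [hb, mul_rpow (by norm_num) hτ.le, ← mul_assoc]
          gcongr
          linarith

lemma DecayFlow.lintegral_pow_vorNorm_zero_lt_top (h : DecayFlow ω₀ u p A) :
    ∫⁻ y, ofReal (‖y‖ ^ (n + 1)) * vorNorm ω₀ u 0 y < ⊤ := by
  unfold vorNorm
  simp_rw [vor_zero, mul_sum]
  have hm : Measurable fun x : Eu n => ofReal (‖x‖ ^ (n + 1)) := by fun_prop
  rw [lintegral_finsetSum' _ fun i _ => aemeasurable_fun_sum _ fun j _ =>
    hm.aemeasurable.fun_mul (h.integrable₀ i j).1.enorm]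
  refine sum_lt_top.2 fun i _ => ?_
  rw [lintegral_finsetSum' _ fun j _ => hm.aemeasurable.fun_mul (h.integrable₀ i j).1.enorm]
  refine sum_lt_top.2 fun j _ => ?_
  refine lt_of_le_of_lt (lintegral_mono (g := fun y => ‖ω₀ i j y‖ₑ + ‖‖y‖ ^ (n + 2) * ω₀ i j y‖ₑ)
    fun y => ?_) ?_
  · beta_reduce
    rw [enorm_mul (‖y‖ ^ (n + 2)), enorm_of_nonneg (r := ‖y‖ ^ (n + 2)) (by positivity),
      ← one_add_mul,
      ← ofReal_one, ← ofReal_add zero_le_one (by positivity)]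
    refine mul_le_mul' (ofReal_le_ofReal ?_) le_rfl
    rcases le_total ‖y‖ 1 with hy | hy
    · have := pow_le_one₀ (n := n + 1) (norm_nonneg y) hy
      have := pow_nonneg (norm_nonneg y) (n + 2)
      linarith
    · have := pow_le_pow_right₀ hy (show n + 1 ≤ n + 2 by omega)
      linarith
  · rw [lintegral_add_left' (h.integrable₀ i j).1.enorm]
    exact ENNReal.add_lt_top.2 ⟨(h.integrable₀ i j).2, (h.weight i j).2⟩

/-- Growth of the `(n + 1)`-st moment of the vorticity. -/
theorem DecayFlow.exists_lintegral_pow_vorDen_le (h : DecayFlow ω₀ u p A) :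
    ∃ C : ℝ, 0 < C ∧ ∀ t, 0 < t → ∫⁻ x, ofReal (‖x‖ ^ (n + 1)) * vorDen u t x ≤
      ofReal (C * (1 + t) ^ (((n : ℝ) - 1) / 2)) := by
  obtain ⟨C₁, hC₁, hS⟩ := h.exists_vorDen_le_gaussConv
  obtain ⟨C₂, hC₂, hG⟩ := exists_lintegral_pow_gaussConv_le n (n + 1)
  obtain ⟨C₃, hC₃, hM⟩ := h.exists_lintegral_vorDen_le
  have hn : (2 : ℝ) ≤ n := by exact_mod_cast h.two_le
  set β : ℝ := ((n : ℝ) - 1) / 2 with hβ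
  have hβ2 : 1 / 2 ≤ β := by rw [hβ]; linarith
  set m : ℝ → ℝ≥0∞ := fun t => ∫⁻ x, ofReal (‖x‖ ^ (n + 1)) * vorDen u t x with hm
  set c := C₁ * C₂ with hc
  have hc0 : 0 < c := by positivity
  have hstep : ∀ t₀ t, 0 ≤ t₀ → t₀ < t → m t ≤ ofReal c *
      ((∫⁻ y, ofReal (‖y‖ ^ (n + 1)) * vorNorm ω₀ u t₀ y) +
        ofReal (t ^ (((n + 1 : ℕ) : ℝ) / 2)) * ∫⁻ y, vorNorm ω₀ u t₀ y) := by
    intro t₀ t ht₀ ht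
    have htt : 0 < t - t₀ := sub_pos.2 ht
    calc m t ≤ ∫⁻ x, ofReal C₁ * (ofReal (‖x‖ ^ (n + 1)) *
          gaussConv (t - t₀) (vorNorm ω₀ u t₀) x) := by
          refine lintegral_mono fun x => ?_
          rw [mul_left_comm]
          exact mul_le_mul' le_rfl (hS t₀ t ht₀ ht x)
      _ ≤ ofReal C₁ * (ofReal C₂ * ((∫⁻ y, ofReal (‖y‖ ^ (n + 1)) *
          vorNorm ω₀ u t₀ y) + ofReal ((t - t₀) ^ (((n + 1 : ℕ) : ℝ) / 2)) *
            ∫⁻ y, vorNorm ω₀ u t₀ y)) := by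
          rw [lintegral_ofReal_mul]
          exact mul_le_mul' le_rfl (hG _ htt _ (h.aemeasurable_vorNorm ht₀))
      _ ≤ _ := by
          rw [← mul_assoc, ← ofReal_mul hC₁.le]
          refine mul_le_mul' le_rfl (add_le_add le_rfl (mul_le_mul' (ofReal_le_ofReal ?_) le_rfl))
          gcongr
          linarith
  set lam : ℝ := 2 * ((2 * c) ^ 2 + 1) with hlam
  have hl0 : 0 < lam := by positivity
  have hl2 : 2 ≤ lam := by rw [hlam]; nlinarith [sq_nonneg (2 * c)]
  have hcl : c * (2 / lam) ^ β ≤ 1 / 2 := by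
    have h1 : 2 / lam = ((2 * c) ^ 2 + 1)⁻¹ := by rw [hlam]; field_simp
    have h2 : 2 * c ≤ ((2 * c) ^ 2 + 1) ^ β := by
      calc 2 * c = ((2 * c) ^ 2) ^ (1 / 2 : ℝ) := by rw [← sqrt_eq_rpow, sqrt_sq (by positivity)]
        _ ≤ ((2 * c) ^ 2 + 1) ^ (1 / 2 : ℝ) := by gcongr; linarith
        _ ≤ _ := Real.rpow_le_rpow_of_exponent_le (by nlinarith [sq_nonneg (2 * c)]) hβ2
    rw [h1, inv_rpow (by positivity), ← div_eq_mul_inv, div_le_iff₀ (by positivity)]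
    linarith
  set V₀ := ∫⁻ y, vorNorm ω₀ u 0 y with hV₀
  set V₁ := ∫⁻ y, ofReal (‖y‖ ^ (n + 1)) * vorNorm ω₀ u 0 y with hV₁
  have hV₀t : V₀ ≠ ⊤ := h.lintegral_vorNorm_zero_lt_top.ne
  have hV₁t : V₁ ≠ ⊤ := h.lintegral_pow_vorNorm_zero_lt_top.ne
  set C₄ : ℝ := c * (V₁.toReal + lam ^ (((n + 1 : ℕ) : ℝ) / 2) * V₀.toReal) with hC₄
  set C₅ : ℝ := c * (C₃ * lam) with hC₅
  set M : ℝ := C₄ + 2 * C₅ with hMdef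
  have hC₄0 : 0 ≤ C₄ := by positivity
  have hC₅0 : 0 < C₅ := by positivity
  have hM0 : 0 < M := by positivity
  have hsmall : ∀ t, 0 < t → t ≤ lam → m t ≤ ofReal (M * (1 + t) ^ β) := by
    intro t ht htl
    refine (hstep 0 t le_rfl ht).trans ?_
    rw [← hV₀, ← hV₁, ← ofReal_toReal hV₀t, ← ofReal_toReal hV₁t,
      ← ofReal_mul (by positivity), ← ofReal_add (by positivity) (by positivity),
      ← ofReal_mul (by positivity)]
    refine ofReal_le_ofReal ?_
    have h1 : 1 ≤ (1 + t) ^ β := Real.one_le_rpow (by linarith) (by linarith)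
    calc _ ≤ C₄ := by rw [hC₄]; gcongr
      _ ≤ M := by linarith
      _ ≤ M * (1 + t) ^ β := le_mul_of_one_le_right hM0.le h1
  have hind : ∀ k : ℕ, ∀ t, 0 < t → t ≤ lam ^ (k + 1) → m t ≤ ofReal (M * (1 + t) ^ β) := by
    intro k
    induction k with
    | zero => intro t ht htl; exact hsmall t ht (by simpa using htl)
    | succ k ih =>
      intro t ht htl
      rcases le_or_gt t lam with hle | hlt
      · exact hsmall t ht hle
      have ht₀ : 0 < t / lam := by positivity
      have hone : 1 ≤ t / lam := by rw [le_div_iff₀ hl0]; linarith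
      have hlt' : t / lam < t := div_lt_self ht (by linarith)
      have hIH := ih (t / lam) ht₀ (by rw [div_le_iff₀ hl0, ← pow_succ]; exact htl)
      have hst := hstep (t / lam) t ht₀.le hlt'
      rw [vorNorm_of_pos ht₀] at hst
      refine hst.trans ((mul_le_mul' le_rfl (add_le_add hIH (mul_le_mul' le_rfl
        (hM _ ht₀)))).trans ?_)
      rw [← ofReal_mul (by positivity), ← ofReal_add (by positivity) (by positivity),
        ← ofReal_mul (by positivity)]
      refine ofReal_le_ofReal ?_
      have h1 : (1 + t / lam) ^ β ≤ (2 / lam) ^ β * (1 + t) ^ β := by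
        rw [← mul_rpow (by positivity) (by positivity)]
        refine rpow_le_rpow (by positivity) ?_ (by linarith)
        calc 1 + t / lam ≤ t / lam + t / lam := by linarith
          _ = 2 / lam * t := by ring
          _ ≤ _ := by gcongr; linarith
      have h2 : t ^ (((n + 1 : ℕ) : ℝ) / 2) * (C₃ / (1 + t / lam)) ≤ C₃ * lam * (1 + t) ^ β := by
        have e : t ^ (((n + 1 : ℕ) : ℝ) / 2) = t ^ β * t := by
          rw [← Real.rpow_add_one ht.ne']; congr 1; rw [hβ]; push_cast; ring
        calc _ ≤ t ^ β * t * (C₃ / (t / lam)) := by rw [e]; gcongr; linarith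
          _ = C₃ * lam * t ^ β := by field_simp
          _ ≤ _ := by gcongr; linarith
      calc _ ≤ c * (M * ((2 / lam) ^ β * (1 + t) ^ β) + C₃ * lam * (1 + t) ^ β) := by gcongr
        _ = (c * (2 / lam) ^ β * M + C₅) * (1 + t) ^ β := by rw [hC₅]; ring
        _ ≤ (1 / 2 * M + C₅) * (1 + t) ^ β := by gcongr
        _ ≤ _ := by
          refine mul_le_mul_of_nonneg_right ?_ (by positivity)
          linarith
  refine ⟨M, hM0, fun t ht => ?_⟩
  obtain ⟨k, hk⟩ := pow_unbounded_of_one_lt t (show 1 < lam by linarith)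
  exact hind k t ht (hk.le.trans (pow_le_pow_right₀ (by linarith) (by omega)))

lemma parabolic_weight_le (hs : 0 ≤ s) (y : Eu n) : (1 + s + ‖y‖ ^ 2) ^ (((n : ℝ) + 1) / 2) ≤
    2 ^ (((n : ℝ) + 1) / 2) * ((1 + s) ^ (((n : ℝ) + 1) / 2) + ‖y‖ ^ (n + 1)) := by
  have e : ‖y‖ ^ (n + 1) = (‖y‖ ^ 2) ^ (((n : ℝ) + 1) / 2) := by
    rw [← rpow_natCast, ← rpow_natCast, ← rpow_mul (norm_nonneg y)]
    congr 1; push_cast; ring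
  rw [e, mul_add, ← mul_rpow (by norm_num) (by positivity),
    ← mul_rpow (by norm_num) (by positivity)]
  rcases le_total (1 + s) (‖y‖ ^ 2) with h | h
  · exact (rpow_le_rpow (by positivity) (by linarith) (by positivity)).trans
      (le_add_of_nonneg_left (by positivity))
  · exact (rpow_le_rpow (by positivity) (by linarith) (by positivity)).trans
      (le_add_of_nonneg_right (by positivity))

lemma heatKernel_le_rpow (ht : 0 < t) (x : Eu n) : heatKernel t x ≤ t ^ (-(n : ℝ) / 2) := by
  refine (heatKernel_le ht x).trans (rpow_le_rpow_of_nonpos ht ?_ ?_)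
  · nlinarith [Real.pi_gt_three]
  · have : (0 : ℝ) ≤ n := by positivity
    linarith

/-- Pointwise decay of the vorticity. -/
theorem DecayFlow.exists_vorDen_decay (h : DecayFlow ω₀ u p A) :
    ∃ C : ℝ, 0 < C ∧ ∀ t, 1 ≤ t → ∀ x : Eu n,
      ofReal ((1 + t + ‖x‖ ^ 2) ^ (((n : ℝ) + 1) / 2)) * vorDen u t x ≤
        ofReal (C * t ^ (-(1 / 2) : ℝ)) := by
  obtain ⟨C₁, hC₁, hS⟩ := h.exists_vorDen_le_gaussConv
  obtain ⟨C₂, hC₂, hM⟩ := h.exists_lintegral_vorDen_le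
  obtain ⟨C₃, hC₃, hm⟩ := h.exists_lintegral_pow_vorDen_le
  obtain ⟨D, hD, hDb⟩ := exists_pow_mul_heatKernel_le n (n + 1)
  have hn : (2 : ℝ) ≤ n := by exact_mod_cast h.two_le
  set r : ℝ := ((n : ℝ) + 1) / 2 with hr
  set K : ℝ := 2 ^ r * (2 ^ r + 2 ^ (n + 1) * (1 + D)) with hK
  refine ⟨C₁ * K * (2 * C₂ + C₃ * 2 ^ (((n : ℝ) - 1) / 2)), by positivity, fun t ht x => ?_⟩
  have ht0 : 0 < t := by linarith
  set g := vorDen u (t / 2) with hg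
  have hgm : Measurable g := h.sol.measurable_vorDen_slice _
  set a : ℝ := t ^ (-(n : ℝ) / 2) with ha
  have ha0 : 0 < a := by positivity
  have hra : t ^ r * a = t ^ (1 / 2 : ℝ) := by rw [ha, ← rpow_add ht0]; congr 1; rw [hr]; ring
  have hker : ∀ y : Eu n, (1 + t + ‖x‖ ^ 2) ^ r * heatKernel (2 * (t - t / 2)) (x - y) ≤
      K * (t ^ (1 / 2 : ℝ) + a * ‖y‖ ^ (n + 1)) := by
    intro y
    rw [show 2 * (t - t / 2) = t by ring]
    have h1 : ‖x‖ ^ (n + 1) ≤ 2 ^ (n + 1) * (‖y‖ ^ (n + 1) + ‖x - y‖ ^ (n + 1)) := by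
      refine le_trans ?_ (add_pow_le_two_pow_mul (norm_nonneg y) (norm_nonneg (x - y)) _)
      gcongr
      calc ‖x‖ = ‖y + (x - y)‖ := by congr 1; abel
        _ ≤ _ := norm_add_le _ _
    have h2 : (1 + t) ^ r ≤ 2 ^ r * t ^ r := by
      rw [← mul_rpow (by norm_num) ht0.le]
      exact rpow_le_rpow (by positivity) (by linarith) (by positivity)
    have hG0 := heatKernel_nonneg ht0.le (x - y)
    have hGa : heatKernel t (x - y) ≤ a := heatKernel_le_rpow ht0 _
    have hGD : ‖x - y‖ ^ (n + 1) * heatKernel t (x - y) ≤ D * t ^ (1 / 2 : ℝ) := by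
      refine (hDb t (x - y) ht0).trans ?_
      have : heatKernel (2 * t) (x - y) ≤ a := by
        refine (heatKernel_le_rpow (by positivity) _).trans
          (rpow_le_rpow_of_nonpos ht0 (by linarith) (by linarith))
      calc _ ≤ D * t ^ (((n + 1 : ℕ) : ℝ) / 2) * a := by gcongr
        _ = D * t ^ (1 / 2 : ℝ) := by rw [← hra, hr]; push_cast; ring
    calc _ ≤ 2 ^ r * (2 ^ r * t ^ r + 2 ^ (n + 1) * (‖y‖ ^ (n + 1) + ‖x - y‖ ^ (n + 1))) *
          heatKernel t (x - y) := by
          gcongr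
          exact (parabolic_weight_le ht0.le x).trans (by gcongr)
      _ = 2 ^ r * ((2 ^ r * t ^ r + 2 ^ (n + 1) * ‖y‖ ^ (n + 1)) * heatKernel t (x - y) +
          2 ^ (n + 1) * (‖x - y‖ ^ (n + 1) * heatKernel t (x - y))) := by ring
      _ ≤ 2 ^ r * ((2 ^ r * t ^ r + 2 ^ (n + 1) * ‖y‖ ^ (n + 1)) * a +
          2 ^ (n + 1) * (D * t ^ (1 / 2 : ℝ))) := by gcongr
      _ = 2 ^ r * (2 ^ r + 2 ^ (n + 1) * D) * t ^ (1 / 2 : ℝ) +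
          2 ^ r * 2 ^ (n + 1) * (a * ‖y‖ ^ (n + 1)) := by rw [← hra]; ring
      _ ≤ K * t ^ (1 / 2 : ℝ) + K * (a * ‖y‖ ^ (n + 1)) := by
          have p1 : (0 : ℝ) < 2 ^ r * 2 ^ (n + 1) := by positivity
          have p2 : (0 : ℝ) < 2 ^ r * 2 ^ r := by positivity
          have p3 : (0 : ℝ) < 2 ^ r * 2 ^ (n + 1) * D := by positivity
          gcongr <;> rw [hK] <;> linarith
      _ = _ := by ring
  have hpm : Measurable fun y : Eu n => ofReal (‖y‖ ^ (n + 1)) := by fun_prop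
  calc _ ≤ ofReal ((1 + t + ‖x‖ ^ 2) ^ r) * (ofReal C₁ *
        gaussConv (t - t / 2) (vorNorm ω₀ u (t / 2)) x) :=
        mul_le_mul' le_rfl (hS (t / 2) t (by positivity) (by linarith) x)
    _ = ofReal C₁ * ∫⁻ y, ofReal ((1 + t + ‖x‖ ^ 2) ^ r *
        heatKernel (2 * (t - t / 2)) (x - y)) * g y := by
        rw [vorNorm_of_pos (by positivity), mul_left_comm, gaussConv, ← lintegral_ofReal_mul]
        congr 1
        refine lintegral_congr fun y => ?_
        rw [ofReal_mul (by positivity), mul_assoc]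
    _ ≤ ofReal C₁ * ∫⁻ y, ofReal K * (ofReal (t ^ (1 / 2 : ℝ)) * g y +
        ofReal a * (ofReal (‖y‖ ^ (n + 1)) * g y)) := by
        refine mul_le_mul' le_rfl (lintegral_mono fun y => ?_)
        refine (mul_le_mul' (ofReal_le_ofReal (hker y)) le_rfl).trans_eq ?_
        rw [ofReal_mul (by positivity), ofReal_add (by positivity) (by positivity),
          ofReal_mul ha0.le]
        ring
    _ ≤ ofReal C₁ * (ofReal K * (ofReal (t ^ (1 / 2 : ℝ)) *
        ofReal (C₂ / (1 + t / 2)) + ofReal a *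
          ofReal (C₃ * (1 + t / 2) ^ (((n : ℝ) - 1) / 2)))) := by
        rw [lintegral_ofReal_mul, lintegral_add_left (hgm.const_mul _),
          lintegral_const_mul _ hgm, lintegral_ofReal_mul]
        gcongr
        · exact hM _ (by positivity)
        · exact hm _ (by positivity)
    _ = ofReal (C₁ * (K * (t ^ (1 / 2 : ℝ) * (C₂ / (1 + t / 2)) +
          a * (C₃ * (1 + t / 2) ^ (((n : ℝ) - 1) / 2))))) := by
        rw [← ofReal_mul (by positivity), ← ofReal_mul (by positivity),
          ← ofReal_add (by positivity) (by positivity),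
          ← ofReal_mul (by positivity), ← ofReal_mul (by positivity)]
    _ ≤ _ := by
        refine ofReal_le_ofReal ?_
        have e1 : t ^ (1 / 2 : ℝ) = t * t ^ (-(1 / 2) : ℝ) := by
          rw [← Real.rpow_one_add' ht0.le (by norm_num)]; norm_num
        have e2 : a * t ^ (((n : ℝ) - 1) / 2) = t ^ (-(1 / 2) : ℝ) := by
          rw [ha, ← rpow_add ht0]; congr 1; ring
        have h1 : t ^ (1 / 2 : ℝ) * (C₂ / (1 + t / 2)) ≤ 2 * C₂ * t ^ (-(1 / 2) : ℝ) := by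
          rw [e1, mul_div_assoc', div_le_iff₀ (by positivity)]
          have : 0 < C₂ * t ^ (-(1 / 2) : ℝ) := by positivity
          nlinarith
        have h2 : (1 + t / 2) ^ (((n : ℝ) - 1) / 2) ≤
            2 ^ (((n : ℝ) - 1) / 2) * t ^ (((n : ℝ) - 1) / 2) := by
          rw [← mul_rpow (by norm_num) ht0.le]
          exact rpow_le_rpow (by positivity) (by linarith) (by linarith)
        calc _ ≤ C₁ * (K * (2 * C₂ * t ^ (-(1 / 2) : ℝ) + a * (C₃ * (2 ^ (((n : ℝ) - 1) / 2) *
              t ^ (((n : ℝ) - 1) / 2))))) := by gcongr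
          _ = C₁ * (K * (2 * C₂ * t ^ (-(1 / 2) : ℝ) + C₃ * 2 ^ (((n : ℝ) - 1) / 2) *
              (a * t ^ (((n : ℝ) - 1) / 2)))) := by ring
          _ = _ := by rw [e2]; ring

def flux (u : ℝ → Eu n → Eu n) (s : ℝ) (y : Eu n) : ℝ≥0∞ :=
  ofReal ((1 + s + ‖y‖ ^ 2) ^ (((n : ℝ) + 1) / 2)) * vorDen u s y * ‖u s y‖ₑ

lemma IsNSSolution.measurable_flux (h : IsNSSolution u p) :
    Measurable fun z : ℝ × Eu n => flux u z.1 z.2 := by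
  have hu : Measurable ((Ioi (0 : ℝ) ×ˢ univ).indicator fun z : ℝ × Eu n => u z.1 z.2) := by
    classical
    have := h.smooth_velocity.continuousOn.measurable_piecewise (g := fun _ => (0 : Eu n))
      continuousOn_const (isOpen_posTime (n := n)).measurableSet
    convert! this using 1
    exact piecewise_eq_indicator.symm
  have e : (fun z : ℝ × Eu n => flux u z.1 z.2) = fun z =>
      ofReal ((1 + z.1 + ‖z.2‖ ^ 2) ^ (((n : ℝ) + 1) / 2)) * vorDen u z.1 z.2 *
        ‖(Ioi (0 : ℝ) ×ˢ univ).indicator (fun z : ℝ × Eu n => u z.1 z.2) z‖ₑ := by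
    funext z
    by_cases hz : 0 < z.1
    · have hz' : z ∈ Ioi (0 : ℝ) ×ˢ (univ : Set (Eu n)) := ⟨hz, mem_univ _⟩
      rw [indicator_of_mem hz']; rfl
    · simp [flux, vorDen, hz]
  rw [e]
  exact ((by fun_prop : Measurable fun z : ℝ × Eu n =>
    ofReal ((1 + z.1 + ‖z.2‖ ^ 2) ^ (((n : ℝ) + 1) / 2))).mul h.measurable_vorDen).mul hu.enorm

lemma VelocityBound.enorm_le (h : VelocityBound u A) (hs : 0 < s) (y : Eu n) :
    ‖u s y‖ₑ ≤ ofReal (A * (1 + s) ^ (-((n : ℝ) + 1) / 2)) := by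
  rw [← ofReal_norm]
  exact ofReal_le_ofReal (h.sup_le s hs y)

lemma DecayFlow.exists_lintegral_flux_le (h : DecayFlow ω₀ u p A) :
    ∃ C : ℝ, 0 < C ∧ ∀ s, 0 < s → ∫⁻ y, flux u s y ≤ ofReal (C / (1 + s)) := by
  obtain ⟨C₂, hC₂, hM⟩ := h.exists_lintegral_vorDen_le
  obtain ⟨C₃, hC₃, hm⟩ := h.exists_lintegral_pow_vorDen_le
  have hA := h.bound.pos
  set r : ℝ := ((n : ℝ) + 1) / 2 with hr
  refine ⟨A * (2 ^ r * (C₂ + C₃)), by positivity, fun s hs => ?_⟩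
  have hgm : Measurable (vorDen u s) := h.sol.measurable_vorDen_slice _
  calc _ ≤ ∫⁻ y, ofReal (A * (1 + s) ^ (-((n : ℝ) + 1) / 2)) * (ofReal (2 ^ r) *
        (ofReal ((1 + s) ^ r) * vorDen u s y + ofReal (‖y‖ ^ (n + 1)) * vorDen u s y)) := by
        refine lintegral_mono fun y => ?_
        rw [flux, mul_comm, ← add_mul, ← mul_assoc (ofReal (2 ^ r)),
          ← ofReal_add (by positivity) (by positivity), ← ofReal_mul (by positivity)]
        gcongr
        · exact h.bound.enorm_le hs y
        · exact parabolic_weight_le hs.le y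
    _ ≤ ofReal (A * (1 + s) ^ (-((n : ℝ) + 1) / 2)) * (ofReal (2 ^ r) *
        (ofReal ((1 + s) ^ r) * ofReal (C₂ / (1 + s)) +
          ofReal (C₃ * (1 + s) ^ (((n : ℝ) - 1) / 2)))) := by
        rw [lintegral_ofReal_mul,
          lintegral_ofReal_mul, lintegral_add_left (hgm.const_mul _),
          lintegral_const_mul _ hgm]
        gcongr
        · exact hM _ hs
        · exact hm _ hs
    _ = ofReal (A * (1 + s) ^ (-((n : ℝ) + 1) / 2) * (2 ^ r * ((1 + s) ^ r * (C₂ / (1 + s)) +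
          C₃ * (1 + s) ^ (((n : ℝ) - 1) / 2)))) := by
        rw [← ofReal_mul (by positivity), ← ofReal_add (by positivity) (by positivity),
          ← ofReal_mul (by positivity), ← ofReal_mul (by positivity)]
    _ ≤ _ := by
        refine ofReal_le_ofReal (le_of_eq ?_)
        have hs1 : 0 < 1 + s := by linarith
        have e1 : (1 + s) ^ (-((n : ℝ) + 1) / 2) * (1 + s) ^ r = 1 := by
          rw [← rpow_add hs1, hr, ← add_div]; simp
        have e2 : (1 + s) ^ (((n : ℝ) - 1) / 2) = (1 + s) ^ r / (1 + s) := by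
          rw [← Real.rpow_sub_one hs1.ne']; congr 1; rw [hr]; ring
        rw [e2]
        calc _ = (1 + s) ^ (-((n : ℝ) + 1) / 2) * (1 + s) ^ r * (A * (2 ^ r * (C₂ + C₃)) / (1 + s)) := by
              ring
          _ = _ := by rw [e1, one_mul]

lemma DecayFlow.exists_flux_le (h : DecayFlow ω₀ u p A) :
    ∃ C : ℝ, 0 < C ∧ ∀ s, 1 ≤ s → ∀ y, flux u s y ≤ ofReal (C * s ^ (-(n : ℝ) / 2 - 1)) := by
  obtain ⟨C, hC, hb⟩ := h.exists_vorDen_decay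
  have hA := h.bound.pos
  refine ⟨C * A, by positivity, fun s hs y => ?_⟩
  have hs0 : 0 < s := by linarith
  refine (mul_le_mul' (hb s hs y) (h.bound.enorm_le hs0 y)).trans ?_
  rw [← ofReal_mul (by positivity)]
  refine ofReal_le_ofReal ?_
  have h1 : (1 + s) ^ (-((n : ℝ) + 1) / 2) ≤ s ^ (-((n : ℝ) + 1) / 2) := by
    refine rpow_le_rpow_of_nonpos hs0 (by linarith) ?_
    have : (0 : ℝ) ≤ n := by positivity
    linarith
  calc _ ≤ C * s ^ (-(1 / 2) : ℝ) * (A * s ^ (-((n : ℝ) + 1) / 2)) := by gcongr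
    _ = C * A * (s ^ (-(1 / 2) : ℝ) * s ^ (-((n : ℝ) + 1) / 2)) := by ring
    _ = _ := by
        rw [← rpow_add hs0]
        ring_nf

def vorVel (u : ℝ → Eu n → Eu n) (h k : Fin n) (s : ℝ) (y : Eu n) : ℝ :=
  vorticity u h k s y * u s y h

lemma enorm_vorVel_le (hs : 0 < s) (h k : Fin n) (y : Eu n) :
    ‖vorVel u h k s y‖ₑ ≤ vorDen u s y * ‖u s y‖ₑ := by
  rw [vorVel, enorm_mul]
  gcongr
  · exact enorm_vorticity_le hs h k y
  · rw [← ofReal_norm, ← ofReal_norm]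
    exact ofReal_le_ofReal (VelocityBound.abs_coord_le (u s y) h)

/-- A weight of parabolic degree `d ≤ n + 1` against `ω u`, in terms of the flux. -/
lemma ofReal_mul_enorm_vorVel_le (hs : 0 < s) (h k : Fin n) (y : Eu n) {d : ℝ}
    (hd : d ≤ (n : ℝ) + 1) : ofReal ((1 + s + ‖y‖ ^ 2) ^ (d / 2)) * ‖vorVel u h k s y‖ₑ ≤
      ofReal ((1 + s) ^ ((d - (n + 1)) / 2)) * flux u s y := by
  rw [flux, mul_assoc, ← mul_assoc (ofReal ((1 + s) ^ ((d - (n + 1)) / 2))),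
    ← ofReal_mul (by positivity)]
  refine mul_le_mul' (ofReal_le_ofReal ?_) (enorm_vorVel_le hs h k y)
  have hp : 0 < 1 + s + ‖y‖ ^ 2 := by positivity
  have e : (1 + s + ‖y‖ ^ 2) ^ (d / 2) = (1 + s + ‖y‖ ^ 2) ^ ((d - (n + 1)) / 2) *
      (1 + s + ‖y‖ ^ 2) ^ (((n : ℝ) + 1) / 2) := by
    rw [← rpow_add hp]; congr 1; ring
  rw [e]
  refine mul_le_mul_of_nonneg_right ?_ (by positivity)
  exact rpow_le_rpow_of_nonpos (by positivity) (by nlinarith [sq_nonneg ‖y‖]) (by linarith)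

lemma enorm_momentIntegrand_le (hs : 0 < s) (l : ℕ) (β : Fin n → ℕ) (h k : Fin n) (y : Eu n)
    (hd : 2 * l + ∑ i, β i ≤ n + 1) : ‖momentIntegrand u l β h k s y‖ₑ ≤
      ofReal ((1 + s) ^ ((((2 * l + ∑ i, β i : ℕ) : ℝ) - (n + 1)) / 2)) * flux u s y := by
  refine le_trans ?_ (ofReal_mul_enorm_vorVel_le hs h k y (by exact_mod_cast hd))
  rw [momentIntegrand, ← vorVel, enorm_mul]
  refine mul_le_mul' ?_ le_rfl
  rw [← ofReal_norm]
  refine ofReal_le_ofReal ?_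
  rw [norm_mul, norm_pow, norm_neg, norm_of_nonneg hs.le, norm_eq_abs]
  calc _ ≤ s ^ l * ‖y‖ ^ (∑ i, β i) := by gcongr; exact abs_negPow_le y β
    _ ≤ _ := pow_mul_pow_le_rpow hs.le y _ _
    _ ≤ _ := by
      push_cast
      exact rpow_le_rpow (by positivity) (by linarith) (by positivity)

lemma SmoothPos.aestronglyMeasurable {F : ℝ → Eu n → ℝ} (hF : SmoothPos F) {S : Set ℝ}
    (hS : MeasurableSet S) (hS0 : S ⊆ Ioi 0) :
    AEStronglyMeasurable (fun z : ℝ × Eu n => F z.1 z.2) ((volume.restrict S).prod volume) := by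
  have e : (volume.restrict S).prod (volume : Measure (Eu n)) =
      (volume : Measure (ℝ × Eu n)).restrict (S ×ˢ univ) := by
    rw [Measure.volume_eq_prod, ← Measure.prod_restrict, Measure.restrict_univ]
  rw [e]
  exact (hF.continuousOn.mono (prod_mono hS0 subset_rfl)).aestronglyMeasurable
    (hS.prod MeasurableSet.univ)

lemma ae_prod_mem {S : Set ℝ} (hS : MeasurableSet S) :
    ∀ᵐ z : ℝ × Eu n ∂((volume.restrict S).prod volume), z.1 ∈ S := by
  have := (Measure.quasiMeasurePreserving_fst (μ := volume.restrict S)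
    (ν := (volume : Measure (Eu n)))).ae (ae_restrict_mem hS)
  exact this

lemma IsNSSolution.smooth_vorVel (h : IsNSSolution u p) (i k : Fin n) : SmoothPos (vorVel u i k) :=
  (h.smooth_vorticity i k).mul (h.smooth_comp i)

lemma IsNSSolution.aestronglyMeasurable_momentIntegrand (hu : IsNSSolution u p) {S : Set ℝ}
    (hS : MeasurableSet S) (hS0 : S ⊆ Ioi 0) (l : ℕ) (β : Fin n → ℕ) (h k : Fin n) :
    AEStronglyMeasurable (fun z : ℝ × Eu n => momentIntegrand u l β h k z.1 z.2)
      ((volume.restrict S).prod volume) := by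
  have hc : Continuous fun z : ℝ × Eu n => (-z.1) ^ l * negPow β z.2 := by unfold negPow; fun_prop
  exact hc.aestronglyMeasurable.mul ((hu.smooth_vorVel h k).aestronglyMeasurable hS hS0)

lemma lintegral_Ioi_one_add_rpow {e : ℝ} (ht : 0 ≤ t) (he : 0 < e) :
    ∫⁻ s in Ioi t, ofReal ((1 + s) ^ (-e - 1)) = ofReal ((1 + t) ^ (-e) / e) := by
  have h1 := integrableOn_add_rpow_Ioi_of_lt (a := -e - 1) (c := t) (m := 1) (by linarith) (by linarith)
  have h2 : IntegrableOn (fun s : ℝ => (1 + s) ^ (-e - 1)) (Ioi t) := by simpa [add_comm] using h1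
  rw [← ofReal_integral_eq_lintegral_ofReal h2]
  · congr 1
    have h3 := integral_Ioi_add_rpow (t := t) (a := 1) (e := e + 1) (by linarith) (by linarith)
    rw [show -(e + 1) = -e - 1 by ring, show 1 - (e + 1) = -e by ring, add_sub_cancel_right,
      add_comm t 1] at h3
    simpa only [add_comm] using h3
  · filter_upwards [ae_restrict_mem measurableSet_Ioi] with s hs
    have : t < s := hs
    exact rpow_nonneg (by linarith) _

/-- Tails of the space-time moments. -/
lemma DecayFlow.exists_lintegral_moment_le (hu : DecayFlow ω₀ u p A) (l : ℕ) (β : Fin n → ℕ)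
    (h k : Fin n) (hd : 2 * l + ∑ i, β i ≤ n) : ∃ C : ℝ, 0 < C ∧ ∀ t, 0 ≤ t →
      ∫⁻ z, ‖momentIntegrand u l β h k z.1 z.2‖ₑ ∂((volume.restrict (Ioi t)).prod volume) ≤
        ofReal (C * (1 + t) ^ ((((2 * l + ∑ i, β i : ℕ) : ℝ) - (n + 1)) / 2)) := by
  obtain ⟨C, hC, hF⟩ := hu.exists_lintegral_flux_le
  set m : ℕ := 2 * l + ∑ i, β i with hm
  set e : ℝ := ((n : ℝ) + 1 - m) / 2 with he
  have hmn : (m : ℝ) ≤ n := by exact_mod_cast hd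
  have he0 : 0 < e := by rw [he]; linarith
  refine ⟨C / e, by positivity, fun t ht => ?_⟩
  have hme := (hu.sol.aestronglyMeasurable_momentIntegrand (S := Ioi t) measurableSet_Ioi
    (Ioi_subset_Ioi ht) l β h k).enorm
  rw [lintegral_prod _ hme]
  calc _ ≤ ∫⁻ s in Ioi t, ofReal C * ofReal ((1 + s) ^ (-e - 1)) := by
        refine setLIntegral_mono' measurableSet_Ioi fun s hs => ?_
        have hs0 : 0 < s := ht.trans_lt hs
        refine (lintegral_mono fun y => enorm_momentIntegrand_le hs0 l β h k y (by omega)).trans ?_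
        rw [lintegral_ofReal_mul]
        refine (mul_le_mul' le_rfl (hF s hs0)).trans_eq ?_
        rw [← ofReal_mul (by positivity), ← ofReal_mul (by positivity), ← hm,
          show ((m : ℝ) - (n + 1)) / 2 = -e by rw [he]; ring, Real.rpow_sub_one (by positivity)]
        congr 1; ring
    _ = _ := by
        rw [lintegral_ofReal_mul, lintegral_Ioi_one_add_rpow ht he0,
          ← ofReal_mul hC.le, show ((m : ℝ) - (n + 1)) / 2 = -e by rw [he]; ring]
        congr 1; ring

lemma DecayFlow.integrable_momentIntegrand (hu : DecayFlow ω₀ u p A) (l : ℕ)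
    (β : Fin n → ℕ) (h k : Fin n) (hd : 2 * l + ∑ i, β i ≤ n) :
    Integrable (fun z : ℝ × Eu n => momentIntegrand u l β h k z.1 z.2)
      ((volume.restrict (Ioi (0 : ℝ))).prod volume) := by
  obtain ⟨C, -, hC⟩ := hu.exists_lintegral_moment_le l β h k hd
  exact ⟨hu.sol.aestronglyMeasurable_momentIntegrand measurableSet_Ioi subset_rfl l β h k,
    (hC 0 le_rfl).trans_lt ofReal_lt_top⟩

end

section

variable {u : ℝ → Eu n → Eu n} {p : ℝ → Eu n → ℝ} {ω₀ : Fin n → Fin n → Eu n → ℝ} {A s t : ℝ}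

lemma measurable_decayKernel : Measurable fun z : ℝ × Eu n => decayKernel z.1 z.2 := by
  unfold decayKernel; fun_prop

lemma decayKernel_le (ht : 0 < t) (z : Eu n) : decayKernel t z ≤ t ^ (-((n : ℝ) + 1) / 2) := by
  refine rpow_le_rpow_of_nonpos ht (by nlinarith [sq_nonneg ‖z‖]) ?_
  have : (0 : ℝ) ≤ n := by positivity
  linarith

lemma exists_lintegral_decayKernel_le (n : ℕ) : ∃ C : ℝ, 0 < C ∧ ∀ τ, 0 < τ →
    ∫⁻ z : Eu n, ofReal (decayKernel τ z) ≤ ofReal (C * τ ^ (-(1 / 2) : ℝ)) := by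
  have hf : Integrable fun z : Eu n => (1 + ‖z‖ ^ 2) ^ (-((n : ℝ) + 1) / 2) :=
    integrable_rpow_neg_one_add_norm_sq (by rw [finrank_euclideanSpace_fin]; linarith)
  refine ⟨(∫ z : Eu n, (1 + ‖z‖ ^ 2) ^ (-((n : ℝ) + 1) / 2)) + 1, by positivity, fun τ hτ => ?_⟩
  have hs : 0 < sqrt τ := sqrt_pos.2 hτ
  have e : ∀ z : Eu n, decayKernel τ z = τ ^ (-((n : ℝ) + 1) / 2) *
      (1 + ‖(sqrt τ)⁻¹ • z‖ ^ 2) ^ (-((n : ℝ) + 1) / 2) := fun z => by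
    rw [← mul_rpow hτ.le (by positivity), norm_smul, norm_inv, norm_of_nonneg hs.le,
      mul_pow, inv_pow, sq_sqrt hτ.le, decayKernel]
    congr 1; field_simp
  have hI : Integrable fun z : Eu n => decayKernel τ z := by
    simp_rw [e]
    exact (hf.comp_smul (inv_ne_zero hs.ne')).const_mul _
  rw [← ofReal_integral_eq_lintegral_ofReal hI (.of_forall fun z => decayKernel_nonneg hτ.le z)]
  refine ofReal_le_ofReal ?_
  simp_rw [e]
  rw [integral_const_mul, Measure.integral_comp_inv_smul_of_nonneg volume
    (fun z : Eu n => (1 + ‖z‖ ^ 2) ^ (-((n : ℝ) + 1) / 2)) hs.le, finrank_euclideanSpace_fin,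
    smul_eq_mul, ← mul_assoc, sqrt_eq_rpow, ← rpow_natCast, ← rpow_mul hτ.le,
    ← rpow_add hτ, show -((n : ℝ) + 1) / 2 + 1 / 2 * n = -(1 / 2) by ring, mul_comm]
  gcongr
  linarith

lemma lintegral_decayKernel_sub (τ : ℝ) (y : Eu n) :
    ∫⁻ x : Eu n, ofReal (decayKernel τ (x - y)) = ∫⁻ x : Eu n, ofReal (decayKernel τ x) :=
  lintegral_sub_right_eq_self (fun x : Eu n => ofReal (decayKernel τ x)) y

lemma lintegral_decayKernel_const_sub (τ : ℝ) (x : Eu n) :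
    ∫⁻ y : Eu n, ofReal (decayKernel τ (x - y)) = ∫⁻ x : Eu n, ofReal (decayKernel τ x) :=
  lintegral_sub_left_eq_self (fun x : Eu n => ofReal (decayKernel τ x)) x

lemma lintegral_Ioo_log_add_rpow_le {α β : ℝ} (ht : 0 ≤ t) (hα : 0 ≤ α) (hβ : 0 ≤ β) :
    ∫⁻ s in Ioo 0 t, ofReal (α * (1 + s)⁻¹ + β * (t - s) ^ (-(1 / 2) : ℝ)) ≤
      ofReal (α * log (2 + t) + β * (2 * t ^ (1 / 2 : ℝ))) := by
  have hc : ContinuousOn (fun s : ℝ => (1 + s)⁻¹) (uIcc 0 t) := by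
    rw [uIcc_of_le ht]
    exact ContinuousOn.inv₀ (by fun_prop) fun s hs => by linarith [hs.1]
  have h1 : ∫⁻ s in Ioo 0 t, ofReal ((1 + s)⁻¹) ≤ ofReal (log (2 + t)) := by
    rw [lintegral_Ioo_ofReal ht hc.intervalIntegrable fun s hs => inv_nonneg.2 (by linarith [hs.1]),
      intervalIntegral.integral_comp_add_left (fun s : ℝ => s⁻¹), integral_inv_of_pos (by norm_num)
      (by linarith)]
    refine ofReal_le_ofReal (Real.log_le_log (by positivity) ?_)
    simp only [add_zero, div_one]; linarith
  have hm : Measurable fun s : ℝ => ofReal ((1 + s)⁻¹) := by fun_prop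
  calc _ = ∫⁻ s in Ioo 0 t, (ofReal α * ofReal ((1 + s)⁻¹) +
        ofReal β * ofReal ((t - s) ^ (-(1 / 2) : ℝ))) := by
        refine setLIntegral_congr_fun measurableSet_Ioo fun s hs => ?_
        have : 0 < t - s := sub_pos.2 hs.2
        have : 0 < 1 + s := by linarith [hs.1]
        rw [ofReal_add (by positivity) (by positivity), ofReal_mul hα, ofReal_mul hβ]
    _ ≤ ofReal α * ofReal (log (2 + t)) + ofReal β *
        ofReal (2 * t ^ (1 / 2 : ℝ)) := by
        rw [lintegral_add_left (hm.const_mul _), lintegral_ofReal_mul,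
          lintegral_ofReal_mul, lintegral_Ioo_sub_rpow ht, sub_zero]
        gcongr
    _ = _ := by
        rw [← ofReal_mul hα, ← ofReal_mul hβ, ← ofReal_add
          (mul_nonneg hα (Real.log_nonneg (by linarith))) (by positivity)]

lemma one_le_log_two_add (ht : 1 ≤ t) : 1 ≤ log (2 + t) := by
  rw [Real.le_log_iff_exp_le (by linarith)]
  linarith [Real.exp_one_lt_d9]

/-- The kernel dominating the Taylor remainders. -/
def remainderKernel (t : ℝ) (x : Eu n) (z : ℝ × Eu n) : ℝ≥0∞ :=
  ofReal (decayKernel (t - z.1) (x - z.2) + decayKernel t x)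

lemma measurable_remainderKernel (t : ℝ) :
    Measurable (Function.uncurry (remainderKernel (n := n) t)) := by
  unfold remainderKernel decayKernel Function.uncurry; fun_prop

lemma measurable_remainderKernel_apply (t : ℝ) (x : Eu n) : Measurable (remainderKernel t x) := by
  unfold remainderKernel decayKernel; fun_prop

lemma IsNSSolution.measurable_flux_slice (h : IsNSSolution u p) (s : ℝ) : Measurable (flux u s) :=
  Measurable.of_uncurry_left (f := flux u) h.measurable_flux

/-- The contribution of the nonlinearity to the remainder. -/
def fluxPotential (u : ℝ → Eu n → Eu n) (t : ℝ) (x : Eu n) : ℝ≥0∞ :=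
  ∫⁻ z, remainderKernel t x z * flux u z.1 z.2 ∂((volume.restrict (Ioo 0 t)).prod volume)

lemma DecayFlow.exists_lintegral_fluxPotential_le (h : DecayFlow ω₀ u p A) :
    ∃ C : ℝ, 0 < C ∧ ∀ t, 1 ≤ t → ∫⁻ x, fluxPotential u t x ≤
      ofReal (C * (t ^ (-(1 / 2) : ℝ) * log (2 + t))) := by
  obtain ⟨C, hC, hF⟩ := h.exists_lintegral_flux_le
  obtain ⟨c, hc, hD⟩ := exists_lintegral_decayKernel_le n
  refine ⟨2 * c * C * 6, by positivity, fun t ht => ?_⟩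
  have ht0 : 0 < t := by linarith
  have hfm := h.sol.measurable_flux
  set m := (volume.restrict (Ioo 0 t)).prod (volume : Measure (Eu n)) with hm
  have hswap := lintegral_mul_lintegral_kernel (μ := (volume : Measure (Eu n))) (ν := m)
    (k₁ := fun _ => 1) measurable_const (measurable_remainderKernel t) hfm.aemeasurable
  simp only [one_mul] at hswap
  unfold fluxPotential
  rw [← hm, hswap]
  have hmk : Measurable fun z : ℝ × Eu n => ofReal (2 * c * (t - z.1) ^ (-(1 / 2) : ℝ)) := by
    fun_prop
  calc _ ≤ ∫⁻ z, ofReal (2 * c * (t - z.1) ^ (-(1 / 2) : ℝ)) * flux u z.1 z.2 ∂m := by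
        refine lintegral_mono_ae ?_
        filter_upwards [ae_prod_mem (n := n) (measurableSet_Ioo (a := (0 : ℝ)) (b := t))] with z hz
        refine mul_le_mul' ?_ le_rfl
        have hts : 0 < t - z.1 := sub_pos.2 hz.2
        have hm1 : Measurable fun x : Eu n => ofReal (decayKernel t x) :=
          (measurable_decayKernel.comp measurable_prodMk_left).ennreal_ofReal
        calc _ = (∫⁻ x : Eu n, ofReal (decayKernel (t - z.1) (x - z.2))) +
              ∫⁻ x : Eu n, ofReal (decayKernel t x) := by
              rw [← lintegral_add_right _ hm1]
              exact lintegral_congr fun x => ofReal_add (decayKernel_nonneg hts.le _)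
                (decayKernel_nonneg ht0.le _)
          _ ≤ ofReal (c * (t - z.1) ^ (-(1 / 2) : ℝ)) +
              ofReal (c * t ^ (-(1 / 2) : ℝ)) := by
              rw [lintegral_decayKernel_sub]
              exact add_le_add (hD _ hts) (hD _ ht0)
          _ ≤ _ := by
              rw [← ofReal_add (by positivity) (by positivity)]
              refine ofReal_le_ofReal ?_
              have : t ^ (-(1 / 2) : ℝ) ≤ (t - z.1) ^ (-(1 / 2) : ℝ) :=
                rpow_le_rpow_of_nonpos hts (by linarith [hz.1]) (by norm_num)
              nlinarith
    _ = ∫⁻ s in Ioo 0 t, ofReal (2 * c * (t - s) ^ (-(1 / 2) : ℝ)) * ∫⁻ y, flux u s y := by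
        rw [hm, lintegral_prod _ (hmk.fun_mul hfm).aemeasurable]
        exact lintegral_congr fun s => lintegral_const_mul'
          (ofReal (2 * c * (t - s) ^ (-(1 / 2) : ℝ))) (flux u s) ofReal_ne_top
    _ ≤ ∫⁻ s in Ioo 0 t, ofReal (2 * c * C) * ofReal
          (2 * t ^ (-(1 / 2) : ℝ) * (1 + s)⁻¹ + 2 * t⁻¹ * (t - s) ^ (-(1 / 2) : ℝ)) := by
        refine setLIntegral_mono' measurableSet_Ioo fun s hs => ?_
        have hts : 0 < t - s := sub_pos.2 hs.2
        have hs1 : 0 < 1 + s := by linarith [hs.1]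
        refine (mul_le_mul' le_rfl (hF s hs.1)).trans ?_
        rw [← ofReal_mul (by positivity), ← ofReal_mul (by positivity)]
        refine ofReal_le_ofReal ?_
        have key : (t - s) ^ (-(1 / 2) : ℝ) * (1 + s)⁻¹ ≤
            2 * t ^ (-(1 / 2) : ℝ) * (1 + s)⁻¹ + 2 * t⁻¹ * (t - s) ^ (-(1 / 2) : ℝ) := by
          rcases le_total s (t / 2) with h1 | h1
          · refine le_add_of_le_of_nonneg ?_ (by positivity)
            gcongr
            calc _ ≤ (t / 2) ^ (-(1 / 2) : ℝ) :=
                  rpow_le_rpow_of_nonpos (by positivity) (by linarith) (by norm_num)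
              _ = 2 ^ (1 / 2 : ℝ) * t ^ (-(1 / 2) : ℝ) := by
                  rw [div_rpow ht0.le (by norm_num), rpow_neg (by norm_num : (0:ℝ) ≤ 2),
                    div_inv_eq_mul, mul_comm]
              _ ≤ 2 ^ (1 : ℝ) * t ^ (-(1 / 2) : ℝ) := by gcongr <;> norm_num
              _ = _ := by rw [Real.rpow_one]
          · refine le_add_of_nonneg_of_le (by positivity) ?_
            rw [mul_comm]
            gcongr
            rw [← div_eq_mul_inv, inv_eq_one_div, div_le_div_iff₀ hs1 ht0]
            linarith
        calc _ = 2 * c * C * ((t - s) ^ (-(1 / 2) : ℝ) * (1 + s)⁻¹) := by ring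
          _ ≤ _ := by gcongr
    _ ≤ _ := by
        rw [lintegral_ofReal_mul]
        refine (mul_le_mul' le_rfl (lintegral_Ioo_log_add_rpow_le ht0.le (by positivity)
          (by positivity))).trans ?_
        rw [← ofReal_mul (by positivity)]
        refine ofReal_le_ofReal ?_
        rw [mul_assoc _ (6 : ℝ)]
        refine mul_le_mul_of_nonneg_left ?_ (by positivity)
        have e1 : t⁻¹ * t ^ (1 / 2 : ℝ) = t ^ (-(1 / 2) : ℝ) := by
          rw [← rpow_neg_one, ← rpow_add ht0]; norm_num
        have hL := one_le_log_two_add ht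
        have h3 : t ^ (-(1 / 2) : ℝ) ≤ t ^ (-(1 / 2) : ℝ) * log (2 + t) :=
          le_mul_of_one_le_right (by positivity) hL
        calc _ = 2 * (t ^ (-(1 / 2) : ℝ) * log (2 + t)) + 4 * (t⁻¹ * t ^ (1 / 2 : ℝ)) := by ring
          _ ≤ _ := by rw [e1]; linarith

lemma DecayFlow.exists_fluxPotential_le (h : DecayFlow ω₀ u p A) :
    ∃ C : ℝ, 0 < C ∧ ∀ t, 2 ≤ t → ∀ x, fluxPotential u t x ≤
      ofReal (C * (t ^ (-((n : ℝ) + 1) / 2) * log (2 + t))) := by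
  obtain ⟨C, hC, hF⟩ := h.exists_lintegral_flux_le
  obtain ⟨B, hB, hS⟩ := h.exists_flux_le
  obtain ⟨c, hc, hD⟩ := exists_lintegral_decayKernel_le n
  set k : ℝ := 2 ^ ((n : ℝ) / 2 + 1) with hk
  refine ⟨2 * C * k + 2 * B * k * c, by positivity, fun t ht x => ?_⟩
  have ht0 : 0 < t := by linarith
  have hfm := h.sol.measurable_flux
  have hn0 : (0 : ℝ) ≤ n := by positivity
  set a : ℝ := (t / 2) ^ (-((n : ℝ) + 1) / 2) with ha
  set b : ℝ := (t / 2) ^ (-(n : ℝ) / 2 - 1) with hb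
  have hkm : Measurable fun z => remainderKernel t x z * flux u z.1 z.2 :=
    (measurable_remainderKernel_apply t x).mul hfm
  have hslice : ∀ s ∈ Ioo 0 t, ∫⁻ y, remainderKernel t x (s, y) * flux u s y ≤
      ofReal (2 * C * a * (1 + s)⁻¹ + B * b * c * (t - s) ^ (-(1 / 2) : ℝ)) := by
    intro s hs
    have hts : 0 < t - s := sub_pos.2 hs.2
    have hs1 : 0 < 1 + s := by linarith [hs.1]
    have hta : decayKernel t x ≤ a := (decayKernel_le ht0 x).trans
      (rpow_le_rpow_of_nonpos (by positivity) (by linarith) (by linarith))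
    have hone : ∀ f : Eu n → ℝ, (∀ y, f y ≤ a) → ∫⁻ y, ofReal (f y) * flux u s y ≤
        ofReal (C * a * (1 + s)⁻¹) := fun f hf => by
      calc _ ≤ ofReal a * ∫⁻ y, flux u s y := by
            rw [← lintegral_ofReal_mul]
            exact lintegral_mono fun y => mul_le_mul' (ofReal_le_ofReal (hf y)) le_rfl
        _ ≤ _ := by
            refine (mul_le_mul' le_rfl (hF s hs.1)).trans_eq ?_
            rw [← ofReal_mul (by positivity)]
            congr 1; ring
    have hsplit : ∫⁻ y, remainderKernel t x (s, y) * flux u s y =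
        (∫⁻ y, ofReal (decayKernel (t - s) (x - y)) * flux u s y) +
          ∫⁻ y, ofReal (decayKernel t x) * flux u s y := by
      rw [← lintegral_add_right _ ((h.sol.measurable_flux_slice s).const_mul _)]
      refine lintegral_congr fun y => ?_
      rw [← add_mul, ← ofReal_add (decayKernel_nonneg hts.le _) (decayKernel_nonneg ht0.le _)]
      rfl
    have hfirst : ∫⁻ y, ofReal (decayKernel (t - s) (x - y)) * flux u s y ≤
        ofReal (C * a * (1 + s)⁻¹ + B * b * c * (t - s) ^ (-(1 / 2) : ℝ)) := by
      rcases le_total s (t / 2) with h1 | h1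
      · refine (hone _ fun y => (decayKernel_le hts _).trans ?_).trans
          (ofReal_le_ofReal (le_add_of_nonneg_right (by positivity)))
        exact rpow_le_rpow_of_nonpos (by positivity) (by linarith) (by linarith)
      · have hsb : s ^ (-(n : ℝ) / 2 - 1) ≤ b :=
          rpow_le_rpow_of_nonpos (by positivity) h1 (by linarith)
        calc _ ≤ ∫⁻ y, ofReal (B * b) * ofReal (decayKernel (t - s) (x - y)) := by
              refine lintegral_mono fun y => ?_
              rw [mul_comm]
              refine mul_le_mul' ((hS s (by linarith) y).trans (ofReal_le_ofReal ?_)) le_rfl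
              gcongr
          _ ≤ ofReal (B * b) * ofReal (c * (t - s) ^ (-(1 / 2) : ℝ)) := by
              rw [lintegral_ofReal_mul, lintegral_decayKernel_const_sub]
              exact mul_le_mul' le_rfl (hD _ hts)
          _ ≤ _ := by
              rw [← ofReal_mul (by positivity)]
              refine ofReal_le_ofReal ?_
              have : 0 ≤ C * a * (1 + s)⁻¹ := by positivity
              linarith
    rw [hsplit]
    refine (add_le_add hfirst (hone _ fun _ => hta)).trans_eq ?_
    rw [← ofReal_add (by positivity) (by positivity)]
    congr 1; ring
  rw [fluxPotential, lintegral_prod _ hkm.aemeasurable]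
  refine (setLIntegral_mono' measurableSet_Ioo hslice).trans
    ((lintegral_Ioo_log_add_rpow_le ht0.le (by positivity) (by positivity)).trans
      (ofReal_le_ofReal ?_))
  have hhalf : ∀ e : ℝ, -((n : ℝ) / 2 + 1) ≤ e → (t / 2) ^ e ≤ k * t ^ e := fun e he => by
    rw [div_rpow ht0.le (by norm_num), div_eq_mul_inv, ← rpow_neg (by norm_num), mul_comm]
    gcongr
    exact Real.rpow_le_rpow_of_exponent_le (by norm_num) (by linarith)
  have hL := one_le_log_two_add (t := t) (by linarith)
  have e1 : t ^ (-(n : ℝ) / 2 - 1) * t ^ (1 / 2 : ℝ) = t ^ (-((n : ℝ) + 1) / 2) := by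
    rw [← rpow_add ht0]; congr 1; ring
  calc _ ≤ 2 * C * (k * t ^ (-((n : ℝ) + 1) / 2)) * log (2 + t) +
        B * (k * t ^ (-(n : ℝ) / 2 - 1)) * c * (2 * t ^ (1 / 2 : ℝ)) := by
        gcongr
        · exact hhalf _ (by linarith)
        · exact hhalf _ (by linarith)
    _ = 2 * C * k * (t ^ (-((n : ℝ) + 1) / 2) * log (2 + t)) +
        2 * B * k * c * (t ^ (-(n : ℝ) / 2 - 1) * t ^ (1 / 2 : ℝ)) := by ring
    _ ≤ 2 * C * k * (t ^ (-((n : ℝ) + 1) / 2) * log (2 + t)) +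
        2 * B * k * c * (t ^ (-((n : ℝ) + 1) / 2) * log (2 + t)) := by
        rw [e1]
        gcongr
        exact le_mul_of_one_le_right (by positivity) hL
    _ = _ := by ring

/-- The contribution of the initial vorticity to the remainder. -/
def initialPotential (ω₀ : Fin n → Fin n → Eu n → ℝ) (t : ℝ) (x : Eu n) : ℝ≥0∞ :=
  ∫⁻ y, remainderKernel t x (0, y) * ∑ i, ∑ j, ‖‖y‖ ^ (n + 2) * ω₀ i j y‖ₑ

lemma DecayFlow.exists_initialPotential_le (h : DecayFlow ω₀ u p A) :
    ∃ C : ℝ, 0 < C ∧ ∀ t, 0 < t →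
      ∫⁻ x, initialPotential ω₀ t x ≤ ofReal (C * t ^ (-(1 / 2) : ℝ)) ∧
      ∀ x, initialPotential ω₀ t x ≤ ofReal (C * t ^ (-((n : ℝ) + 1) / 2)) := by
  obtain ⟨c, hc, hD⟩ := exists_lintegral_decayKernel_le n
  set w : Eu n → ℝ≥0∞ := fun y => ∑ i, ∑ j, ‖‖y‖ ^ (n + 2) * ω₀ i j y‖ₑ with hw
  have hwm : AEMeasurable w := aemeasurable_fun_sum _ fun i _ =>
    aemeasurable_fun_sum _ fun j _ => (h.weight i j).1.enorm
  have hwt : ∫⁻ y, w y ≠ ⊤ := by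
    rw [lintegral_finsetSum' _ fun i _ => aemeasurable_fun_sum _ fun j _ =>
      (h.weight i j).1.enorm]
    refine (sum_lt_top.2 fun i _ => ?_).ne
    rw [lintegral_finsetSum' _ fun j _ => (h.weight i j).1.enorm]
    exact sum_lt_top.2 fun j _ => (h.weight i j).2
  set W := (∫⁻ y, w y).toReal with hW
  have hWe : ∫⁻ y, w y = ofReal W := (ofReal_toReal hwt).symm
  have hW0 : 0 ≤ W := ENNReal.toReal_nonneg
  refine ⟨2 * (c + 1) * (W + 1), by positivity, fun t ht => ⟨?_, fun x => ?_⟩⟩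
  · have hmk : Measurable (Function.uncurry fun x y : Eu n => remainderKernel t x (0, y)) := by
      unfold remainderKernel decayKernel Function.uncurry; fun_prop
    have hswap := lintegral_mul_lintegral_kernel (μ := (volume : Measure (Eu n)))
      (k₁ := fun _ => 1) measurable_const hmk hwm
    simp only [one_mul] at hswap
    unfold initialPotential
    rw [hswap]
    calc _ ≤ ∫⁻ y, ofReal (2 * c * t ^ (-(1 / 2) : ℝ)) * w y := by
          refine lintegral_mono fun y => mul_le_mul' ?_ le_rfl
          have hm1 : Measurable fun x : Eu n => ofReal (decayKernel t x) :=
            (measurable_decayKernel.comp measurable_prodMk_left).ennreal_ofReal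
          calc _ = (∫⁻ x : Eu n, ofReal (decayKernel t (x - y))) +
                ∫⁻ x : Eu n, ofReal (decayKernel t x) := by
                rw [← lintegral_add_right _ hm1]
                refine lintegral_congr fun x => ?_
                rw [remainderKernel, sub_zero, ofReal_add (decayKernel_nonneg ht.le _)
                  (decayKernel_nonneg ht.le _)]
            _ ≤ ofReal (c * t ^ (-(1 / 2) : ℝ)) + ofReal (c * t ^ (-(1 / 2) : ℝ)) := by
                rw [lintegral_decayKernel_sub]
                exact add_le_add (hD _ ht) (hD _ ht)
            _ = _ := by
                rw [← ofReal_add (by positivity) (by positivity)]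
                congr 1; ring
      _ ≤ _ := by
          rw [lintegral_ofReal_mul, hWe, ← ofReal_mul (by positivity)]
          refine ofReal_le_ofReal ?_
          rw [mul_right_comm]
          gcongr <;> linarith
  · calc _ ≤ ∫⁻ y, ofReal (2 * t ^ (-((n : ℝ) + 1) / 2)) * w y := by
          refine lintegral_mono fun y => mul_le_mul' (ofReal_le_ofReal ?_) le_rfl
          simp only [sub_zero]
          linarith [decayKernel_le ht (x - y), decayKernel_le ht x]
      _ ≤ _ := by
          rw [lintegral_ofReal_mul, hWe, ← ofReal_mul (by positivity)]
          refine ofReal_le_ofReal ?_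
          rw [mul_right_comm]
          gcongr <;> nlinarith

/-- The function dominating the remainder of the expansion. -/
def remainderBound (ω₀ : Fin n → Fin n → Eu n → ℝ) (u : ℝ → Eu n → Eu n) (t : ℝ) (x : Eu n) : ℝ≥0∞ :=
  fluxPotential u t x + initialPotential ω₀ t x + ofReal (decayKernel t x)

lemma DecayFlow.exists_remainderBound_le (h : DecayFlow ω₀ u p A) :
    ∃ C : ℝ, 0 < C ∧ ∀ t, 2 ≤ t →
      ∫⁻ x, remainderBound ω₀ u t x ≤ ofReal (C * (t ^ (-(1 / 2) : ℝ) * log (2 + t))) ∧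
      ∀ x, remainderBound ω₀ u t x ≤ ofReal (C * (t ^ (-((n : ℝ) + 1) / 2) * log (2 + t))) := by
  obtain ⟨C₁, hC₁, h₁⟩ := h.exists_lintegral_fluxPotential_le
  obtain ⟨C₂, hC₂, h₂⟩ := h.exists_fluxPotential_le
  obtain ⟨C₃, hC₃, h₃⟩ := h.exists_initialPotential_le
  obtain ⟨c, hc, hD⟩ := exists_lintegral_decayKernel_le n
  refine ⟨C₁ + C₂ + C₃ + c + 1, by positivity, fun t ht => ?_⟩
  have ht0 : 0 < t := by linarith
  have hL := one_le_log_two_add (t := t) (by linarith)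
  obtain ⟨i1, i2⟩ := h₃ t ht0
  have hle : ∀ e : ℝ, t ^ e ≤ t ^ e * log (2 + t) := fun e =>
    le_mul_of_one_le_right (by positivity) hL
  have hcomb : ∀ {e a b d : ℝ} {X Y Z : ℝ≥0∞}, 0 ≤ a → 0 ≤ b → 0 ≤ d →
      a + b + d ≤ C₁ + C₂ + C₃ + c + 1 → X ≤ ofReal (a * (t ^ e * log (2 + t))) →
      Y ≤ ofReal (b * t ^ e) → Z ≤ ofReal (d * t ^ e) → X + Y + Z ≤
        ofReal ((C₁ + C₂ + C₃ + c + 1) * (t ^ e * log (2 + t))) := by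
    intro e a b d X Y Z ha hb hd hs hX hY hZ
    have hte : 0 < t ^ e := by positivity
    refine (add_le_add (add_le_add hX hY) hZ).trans ?_
    rw [← ofReal_add (by positivity) (by positivity), ← ofReal_add (by positivity) (by positivity)]
    refine ofReal_le_ofReal ?_
    calc _ ≤ a * (t ^ e * log (2 + t)) + b * (t ^ e * log (2 + t)) +
          d * (t ^ e * log (2 + t)) := by gcongr <;> exact hle e
      _ = (a + b + d) * (t ^ e * log (2 + t)) := by ring
      _ ≤ _ := by gcongr
  have hm1 : Measurable fun x : Eu n => ofReal (decayKernel t x) :=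
    (measurable_decayKernel.comp measurable_prodMk_left).ennreal_ofReal
  have hmf : Measurable fun x : Eu n => fluxPotential u t x :=
    Measurable.lintegral_prod_right' (f := fun q : Eu n × (ℝ × Eu n) =>
      remainderKernel t q.1 q.2 * flux u q.2.1 q.2.2)
      ((measurable_remainderKernel t).mul (h.sol.measurable_flux.comp measurable_snd))
  refine ⟨?_, fun x => hcomb hC₂.le hC₃.le zero_le_one (by linarith) (h₂ t ht x) (i2 x)
    (ofReal_le_ofReal ((decayKernel_le ht0 x).trans_eq (one_mul _).symm))⟩
  unfold remainderBound
  rw [lintegral_add_right _ hm1, lintegral_add_left hmf]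
  exact hcomb hC₁.le hC₃.le hc.le (by linarith) (h₁ t (by linarith)) i1 (hD t ht0)

lemma eLpNorm_le_of_lintegral_le_of_le {F : Type*} [NormedAddCommGroup F] {g : Eu n → F} {S I : ℝ}
    (hS : 0 < S) (hI : 0 < I) (h1 : ∫⁻ x, ‖g x‖ₑ ≤ ofReal I)
    (h2 : ∀ x, ‖g x‖ₑ ≤ ofReal S) {q : ℝ≥0∞} (hq : 1 ≤ q) :
    eLpNorm g q volume ≤ ofReal (S ^ (1 - (q⁻¹).toReal) * I ^ (q⁻¹).toReal) := by
  rcases eq_or_ne q ⊤ with rfl | hqt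
  · rw [eLpNorm_exponent_top]
    simpa using eLpNormEssSup_le_of_ae_enorm_bound (.of_forall h2)
  have hq0 : q ≠ 0 := (zero_lt_one.trans_le hq).ne'
  set r := q.toReal with hr
  have hr1 : 1 ≤ r := by rw [hr, ← ENNReal.toReal_one]; exact ENNReal.toReal_mono hqt hq
  have hS0 : ofReal S ≠ 0 := by simpa using hS
  rw [eLpNorm_eq_lintegral_rpow_enorm_toReal hq0 hqt, ← hr, ENNReal.toReal_inv, ← hr]
  have h3 : ∫⁻ x, ‖g x‖ₑ ^ r ≤ ofReal (S ^ (r - 1)) * ofReal I := by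
    calc _ ≤ ∫⁻ x, ofReal (S ^ (r - 1)) * ‖g x‖ₑ := by
          refine lintegral_mono fun x => ?_
          calc ‖g x‖ₑ ^ r = ‖g x‖ₑ ^ (r - 1) * ‖g x‖ₑ := by
                conv_lhs => rw [show r = (r - 1) + 1 by ring]
                rw [ENNReal.rpow_add_of_nonneg _ _ (by linarith) zero_le_one, ENNReal.rpow_one]
            _ ≤ ofReal S ^ (r - 1) * ‖g x‖ₑ := by
                exact mul_le_mul' (ENNReal.rpow_le_rpow (h2 x) (by linarith)) le_rfl
            _ = _ := by rw [ENNReal.ofReal_rpow_of_pos hS]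
      _ ≤ _ := by
          rw [lintegral_ofReal_mul]
          exact mul_le_mul' le_rfl h1
  refine (ENNReal.rpow_le_rpow h3 (by positivity)).trans_eq ?_
  rw [← ofReal_mul (by positivity), ENNReal.ofReal_rpow_of_pos (by positivity),
    mul_rpow (by positivity) hI.le, ← rpow_mul hS.le]
  congr 3
  · field_simp
  · simp

lemma WeakDivFree.weakDiv {a : Eu n → Eu n} (h : WeakDivFree a) :
    WeakDiv (fun _ => 0) fun k y => a y k := fun φ hφ => by
  rw [h φ hφ]; simp

lemma WeakDivFree.integral_sum_mul {a : Eu n → Eu n} (h : WeakDivFree a) (ha : Integrable a)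
    {g : Eu n → ℝ} (hg : ContDiff ℝ ∞ g) {M : ℝ} (h0 : ∀ x, |g x| ≤ M * (1 + ‖x‖))
    (h1 : ∀ k x, |pderiv k g x| ≤ M) : ∫ y, ∑ k, a y k * pderiv k g y = 0 := by
  have := h.weakDiv.integral_mul (fun k => integrable_coord ha k) hg h0 h1 (by simp)
  simpa using this.symm

lemma IsNSSolution.weakDivFree (h : IsNSSolution u p) (ht : 0 < t) : WeakDivFree (u t) := by
  intro φ hφ
  have := weakDiv_of_contDiff (fun k => h.contDiff_comp ht k) φ hφ
  simp_rw [h.div_free t ht, zero_mul, integral_zero] at this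
  linarith

lemma pderiv_coord (k j : Fin n) (x : Eu n) :
    pderiv k (fun y : Eu n => y j) x = if j = k then 1 else 0 := by
  have : HasFDerivAt (fun y : Eu n => y j) (proj (𝕜 := ℝ) j) x := (proj (𝕜 := ℝ) j).hasFDerivAt
  rw [pderiv, this.fderiv, coe_proj]
  simp

lemma contDiff_coord (j : Fin n) : ContDiff ℝ ∞ fun y : Eu n => y j := (proj (𝕜 := ℝ) j).contDiff

lemma WeakDivFree.integral_coord {a : Eu n → Eu n} (h : WeakDivFree a) (ha : Integrable a)
    (j : Fin n) : ∫ y, a y j = 0 := by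
  have := h.integral_sum_mul ha (contDiff_coord j) (M := 1)
    (fun x => by linarith [VelocityBound.abs_coord_le x j])
    (fun k x => by rw [pderiv_coord]; split_ifs <;> simp)
  simpa [pderiv_coord] using this

lemma negPow_of_sum_le_one {β : Fin n → ℕ} (h : ∑ i, β i ≤ 1) :
    (negPow β = fun _ => 1) ∨ ∃ l, negPow β = fun y => -(y l) := by
  by_cases h0 : ∀ i, β i = 0
  · left; funext y; simp [negPow, h0]
  · push Not at h0
    obtain ⟨l, hl⟩ := h0
    right
    refine ⟨l, funext fun y => ?_⟩
    rw [← Finset.add_sum_erase _ _ (Finset.mem_univ l)] at h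
    have hz : ∑ i ∈ Finset.univ.erase l, β i = 0 := by omega
    rw [Finset.sum_eq_zero_iff] at hz
    rw [negPow, Finset.prod_eq_single l (fun i _ hi => by
      rw [hz i (Finset.mem_erase.2 ⟨hi, Finset.mem_univ i⟩), pow_zero]) (by simp),
      show β l = 1 by omega, pow_one]

lemma DecayFlow.integrable_pow_mul_initial (h : DecayFlow ω₀ u p A) {k : ℕ} (hk : k ≤ n + 2)
    (i j : Fin n) : Integrable fun y => ‖y‖ ^ k * ω₀ i j y := by
  refine ((h.integrable₀ i j).norm.fun_add (h.weight i j).norm).mono'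
    ((by fun_prop : Continuous fun y : Eu n => ‖y‖ ^ k).aestronglyMeasurable.mul
      (h.integrable₀ i j).1) (.of_forall fun y => ?_)
  rw [norm_mul, norm_mul, ← one_add_mul, norm_pow, norm_pow, norm_norm]
  refine mul_le_mul_of_nonneg_right ?_ (norm_nonneg _)
  rcases le_total ‖y‖ 1 with hy | hy
  · have := pow_le_one₀ (n := k) (norm_nonneg y) hy
    have := pow_nonneg (norm_nonneg y) (n + 2)
    linarith
  · have := pow_le_pow_right₀ hy hk
    linarith

lemma DecayFlow.integrable_negPow_mul_initial (h : DecayFlow ω₀ u p A) {β : Fin n → ℕ}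
    (hβ : ∑ i, β i ≤ n + 2) (i j : Fin n) : Integrable fun y => negPow β y * ω₀ i j y := by
  refine (h.integrable_pow_mul_initial hβ i j).norm.mono' (AEStronglyMeasurable.mul
    (Continuous.aestronglyMeasurable (by unfold negPow; fun_prop)) (h.integrable₀ i j).1)
    (.of_forall fun y => ?_)
  rw [norm_mul, norm_mul, norm_pow, norm_norm]
  exact mul_le_mul_of_nonneg_right (abs_negPow_le y β) (norm_nonneg _)

/-- The moments of order at most one of the initial vorticity vanish. -/
lemma DecayFlow.integral_negPow_mul_initial (h : DecayFlow ω₀ u p A) {β : Fin n → ℕ}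
    (hβ : ∑ i, β i ≤ 1) (i j : Fin n) : ∫ y, negPow β y * ω₀ i j y = 0 := by
  have ha := h.bound.integrable 0 le_rfl
  have hI := h.integrable_negPow_mul_initial (β := β) (by omega) i j
  have key : ∀ c : Fin n → ℝ, (∀ k, |c k| ≤ 1) → ContDiff ℝ ∞ (negPow β) →
      (∀ k y, pderiv k (negPow β) y = c k) → ∫ y, negPow β y * ω₀ i j y = 0 := by
    intro c hc hs hp
    simp_rw [mul_comm (negPow β _)] at hI ⊢
    rw [(h.weak.weakDiv i j).integral_mul (integrable_curlField ha i j) hs (M := 1) (fun x => ?_)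
      (fun k y => (hp k y).symm ▸ hc k) hI]
    · simp_rw [hp, sum_curlField_mul]
      rw [integral_sub ((integrable_coord ha j).mul_const _) ((integrable_coord ha i).mul_const _),
        integral_mul_const, integral_mul_const, h.div.integral_coord ha, h.div.integral_coord ha]
      simp
    · refine (abs_negPow_le x β).trans ?_
      rw [one_mul]
      interval_cases ∑ i, β i
      · simp
      · simp
  rcases negPow_of_sum_le_one hβ with e | ⟨l, e⟩
  · exact key (fun _ => 0) (by simp) (e ▸ contDiff_const) fun k y => by rw [e]; simp [pderiv]
  · refine key (fun k => -if l = k then 1 else 0) (fun k => by split_ifs <;> simp)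
      (e ▸ (contDiff_coord l).neg) fun k y => ?_
    rw [e, ← pderiv_coord k l y, pderiv, pderiv, fderiv_fun_neg]
    rfl

lemma DecayFlow.integrable_vorVel (hu : DecayFlow ω₀ u p A) (hs : 0 < s) (h k : Fin n) :
    Integrable (vorVel u h k s) := by
  obtain ⟨C, hC, hF⟩ := hu.exists_lintegral_flux_le
  refine ⟨((hu.sol.smooth_vorVel h k).slice hs).continuous.aestronglyMeasurable, ?_⟩
  refine (lintegral_mono fun y => ?_).trans_lt ((hF s hs).trans_lt ofReal_lt_top)
  have := ofReal_mul_enorm_vorVel_le (u := u) hs h k y (d := (n : ℝ) + 1) le_rfl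
  rw [sub_self, zero_div, rpow_zero, ofReal_one, one_mul] at this
  refine le_trans (le_mul_of_one_le_left' ?_) this
  rw [← ofReal_one]
  exact ofReal_le_ofReal (Real.one_le_rpow (by nlinarith [sq_nonneg ‖y‖]) (by positivity))

/-- The total Lamb vector vanishes. -/
lemma DecayFlow.sum_integral_vorVel (hu : DecayFlow ω₀ u p A) (hs : 0 < s) (j : Fin n) :
    ∑ h, ∫ y, vorVel u h j s y = 0 := by
  have hc := fun k => hu.sol.contDiff_comp hs k
  have hdf := fun k y => (hc k).differentiable (by simp) y
  set e : Eu n → ℝ := fun y => ∑ h, u s y h * u s y h with he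
  have hec : ContDiff ℝ ∞ e := ContDiff.sum fun k _ => (hc k).mul (hc k)
  set F : Fin n → Eu n → ℝ := fun k y => u s y k * u s y j - if k = j then 1 / 2 * e y else 0 with hF
  have hite : ∀ k, ContDiff ℝ ∞ fun y => if k = j then 1 / 2 * e y else 0 := fun k => by
    split_ifs
    exacts [contDiff_const.mul hec, contDiff_const]
  have hFc : ∀ k, ContDiff ℝ ∞ (F k) := fun k => ((hc k).mul (hc j)).sub (hite k)
  have hpd : ∀ y, ∑ k, pderiv k (F k) y = ∑ h, vorVel u h j s y := by
    intro y
    have h1 : ∀ k, pderiv k (F k) y = pderiv k (fun y => u s y k) y * u s y j +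
        u s y k * pderiv k (fun y => u s y j) y -
          if k = j then ∑ h, u s y h * pderiv j (fun y => u s y h) y else 0 := by
      intro k
      rw [hF, pderiv_sub k (((hdf k y)).fun_mul (hdf j y)) ((hite k).differentiable (by simp) y),
        pderiv_mul k (hdf k y) (hdf j y)]
      congr 1
      split_ifs with hk
      · subst hk
        have h0 : pderiv k (fun _ : Eu n => (1 / 2 : ℝ)) y = 0 := by simp [pderiv]
        rw [pderiv_mul k (differentiableAt_const _) (hec.differentiable (by simp) y), h0, zero_mul,
          zero_add, he, pderiv_sum _ k fun h _ => (hdf h y).fun_mul (hdf h y), mul_sum]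
        refine sum_congr rfl fun h _ => ?_
        rw [pderiv_mul k (hdf h y) (hdf h y)]
        ring
      · simp [pderiv]
    simp_rw [h1]
    rw [sum_sub_distrib, sum_add_distrib, ← sum_mul, hu.sol.div_free s hs y, zero_mul, zero_add]
    simp only [Finset.sum_ite_eq', Finset.mem_univ, if_true, ← sum_sub_distrib]
    exact sum_congr rfl fun h _ => by rw [vorVel, vorticity]; ring
  have hprod : ∀ k l, Integrable fun y => u s y k * u s y l := fun k l => by
    refine (hu.bound.integrable_sq hs).mono' ((hc k).continuous.mul (hc l).continuous).aestronglyMeasurable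
      (.of_forall fun y => ?_)
    rw [norm_mul, sq]
    exact mul_le_mul (VelocityBound.abs_coord_le _ _) (VelocityBound.abs_coord_le _ _)
      (norm_nonneg _) (norm_nonneg _)
  have hFI : ∀ k, Integrable (F k) := fun k => by
    refine (hprod k j).sub' ?_
    split_ifs
    exacts [(integrable_finsetSum _ fun h _ => hprod h h).const_mul _, integrable_zero _ _ _]
  have hI := integrable_finsetSum Finset.univ fun h _ => hu.integrable_vorVel hs h j
  have := (weakDiv_of_contDiff hFc).integral_mul hFI (g := fun _ => 1) contDiff_const (M := 1)
    (fun x => by simp) (fun k x => by simp [pderiv]) (by simpa only [hpd, mul_one] using hI)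
  simp only [hpd, mul_one] at this
  rw [← integral_finsetSum _ fun h _ => hu.integrable_vorVel hs h j, this]
  simp [pderiv]

/-- The term of parabolic order `m` of the Taylor polynomial of `K`, paired with the moments `M`. -/
def taylorTerm (K : ℝ → Eu n → ℝ) (M : ℕ → (Fin n → ℕ) → ℝ) (t : ℝ) (x : Eu n) (m : ℕ) : ℝ :=
  ∑ l ∈ Finset.range (m / 2 + 1), ∑ β ∈ multiIndices n (m - 2 * l),
    mixedDeriv l β K t x / ((l.factorial : ℝ) * multiFactorial β) * M l β

lemma parabolic_degree {l m : ℕ} {β : Fin n → ℕ} (hl : l ∈ Finset.range (m / 2 + 1))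
    (hβ : β ∈ multiIndices n (m - 2 * l)) : 2 * l + ∑ i, β i = m := by
  rw [sum_of_mem_multiIndices hβ]
  have := Finset.mem_range.1 hl
  omega

lemma taylorTerm_congr {K : ℝ → Eu n → ℝ} {M M' : ℕ → (Fin n → ℕ) → ℝ} {x : Eu n} {m : ℕ}
    (h : ∀ l β, 2 * l + ∑ i, β i = m → M l β = M' l β) :
    taylorTerm K M t x m = taylorTerm K M' t x m :=
  sum_congr rfl fun l hl => sum_congr rfl fun β hβ => by rw [h l β (parabolic_degree hl hβ)]

lemma sum_taylorTerm {ι : Type*} (S : Finset ι) (K : ℝ → Eu n → ℝ)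
    (M : ι → ℕ → (Fin n → ℕ) → ℝ) (x : Eu n) (m : ℕ) :
    ∑ i ∈ S, taylorTerm K (M i) t x m = taylorTerm K (fun l β => ∑ i ∈ S, M i l β) t x m := by
  simp_rw [taylorTerm, mul_sum]
  rw [sum_comm]
  exact sum_congr rfl fun l _ => sum_comm

lemma HomSymbol.exists_taylor_integral (hn : 2 ≤ n) {p N : ℕ} {P : Eu n → ℂ} (hp : p + 1 ≤ 2)
    (hP : HomSymbol (p + 1) P) (hN : N + (p + 1) = n + 2) (K : ℝ → Eu n → ℝ)
    (hK : ∀ s, 0 < s → K s = realKernel P s) :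
    ∃ C : ℝ≥0∞, C ≠ ⊤ ∧ ∀ {X : Type} [MeasurableSpace X] (m : Measure X) (f : X → ℝ)
      (ζ : X → ℝ × Eu n) (W : X → ℝ≥0∞) (t : ℝ) (x : Eu n), 0 < t →
      (∀ᵐ z ∂m, 0 ≤ (ζ z).1 ∧ (ζ z).1 < t ∧
        ofReal (((ζ z).1 + ‖(ζ z).2‖ ^ 2) ^ (((N : ℝ) + 1) / 2)) * ‖f z‖ₑ ≤ W z) →
      AEStronglyMeasurable (fun z => K (t - (ζ z).1) (x - (ζ z).2) * f z) m →
      (∀ l β, 2 * l + ∑ i, β i ≤ N →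
        Integrable (fun z => (-(ζ z).1) ^ l * negPow β (ζ z).2 * f z) m) →
      ∫⁻ z, remainderKernel t x (ζ z) * W z ∂m ≠ ⊤ →
      Integrable (fun z => K (t - (ζ z).1) (x - (ζ z).2) * f z) m ∧
      ofReal ((t + ‖x‖ ^ 2) ^ ((n : ℝ) / 2)) *
        ‖∫ z, K (t - (ζ z).1) (x - (ζ z).2) * f z ∂m - ∑ k ∈ Finset.range (N + 1),
          taylorTerm K (fun l β => ∫ z, (-(ζ z).1) ^ l * negPow β (ζ z).2 * f z ∂m) t x k‖ₑ ≤
        C * ∫⁻ z, remainderKernel t x (ζ z) * W z ∂m := by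
  obtain ⟨C, hC, hT⟩ := hP.exists_real_taylor hn hp hN K hK
  refine ⟨ofReal C, ofReal_ne_top, fun {X} _ m f ζ W t x ht hz hmeas hI hfin => ?_⟩
  have hQ : ∀ z, (∑ k ∈ Finset.range (N + 1), taylorTerm K
      (fun l β => (-(ζ z).1) ^ l * negPow β (ζ z).2) t x k) * f z =
      ∑ k ∈ Finset.range (N + 1), ∑ l ∈ Finset.range (k / 2 + 1), ∑ β ∈ multiIndices n (k - 2 * l),
        mixedDeriv l β K t x / ((l.factorial : ℝ) * multiFactorial β) *
          ((-(ζ z).1) ^ l * negPow β (ζ z).2 * f z) := fun z => by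
    simp_rw [taylorTerm, sum_mul, mul_assoc]
  set Q : X → ℝ := fun z => (∑ k ∈ Finset.range (N + 1), taylorTerm K
      (fun l β => (-(ζ z).1) ^ l * negPow β (ζ z).2) t x k) * f z with hQdef
  have hterm : ∀ k ∈ Finset.range (N + 1), ∀ l ∈ Finset.range (k / 2 + 1),
      ∀ β ∈ multiIndices n (k - 2 * l), Integrable (fun z =>
        mixedDeriv l β K t x / ((l.factorial : ℝ) * multiFactorial β) *
          ((-(ζ z).1) ^ l * negPow β (ζ z).2 * f z)) m := fun k hk l hl β hβ =>
    (hI l β ((parabolic_degree hl hβ).trans_le (by have := Finset.mem_range.1 hk; omega))).const_mul _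
  have hQI : Integrable Q m := by
    refine Integrable.congr (integrable_finsetSum _ fun k hk => integrable_finsetSum _ fun l hl =>
      integrable_finsetSum _ fun β hβ => hterm k hk l hl β hβ) (.of_forall fun z => (hQ z).symm)
  have hQint : ∫ z, Q z ∂m = ∑ k ∈ Finset.range (N + 1),
      taylorTerm K (fun l β => ∫ z, (-(ζ z).1) ^ l * negPow β (ζ z).2 * f z ∂m) t x k := by
    rw [integral_congr_ae (.of_forall hQ), integral_finsetSum _ fun k hk =>
      integrable_finsetSum _ fun l hl => integrable_finsetSum _ fun β hβ => hterm k hk l hl β hβ]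
    refine sum_congr rfl fun k hk => ?_
    rw [integral_finsetSum _ fun l hl => integrable_finsetSum _ fun β hβ => hterm k hk l hl β hβ]
    refine sum_congr rfl fun l hl => ?_
    rw [integral_finsetSum _ fun β hβ => hterm k hk l hl β hβ]
    exact sum_congr rfl fun β hβ => integral_const_mul _ _
  set ρ := ofReal ((t + ‖x‖ ^ 2) ^ ((n : ℝ) / 2)) with hρ
  have hρ0 : ρ ≠ 0 := (ENNReal.ofReal_pos.2 (by positivity)).ne'
  set D : X → ℝ := fun z => K (t - (ζ z).1) (x - (ζ z).2) * f z - Q z with hD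
  have hle : ρ * ∫⁻ z, ‖D z‖ₑ ∂m ≤ ofReal C * ∫⁻ z, remainderKernel t x (ζ z) * W z ∂m := by
    rw [← lintegral_ofReal_mul, ← lintegral_ofReal_mul]
    refine lintegral_mono_ae ?_
    filter_upwards [hz] with z ⟨h0, h1, h2⟩
    have key := hT t (ζ z).1 x (ζ z).2 h0 h1
    rw [hD, hQdef]
    beta_reduce
    rw [← sub_mul, enorm_mul, ← mul_assoc, Real.enorm_eq_ofReal_abs, ← ofReal_mul (by positivity)]
    refine (mul_le_mul' (ofReal_le_ofReal key) le_rfl).trans ?_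
    rw [ofReal_mul hC, ofReal_mul (by positivity), mul_assoc, mul_assoc,
      mul_left_comm (ofReal (((ζ z).1 + ‖(ζ z).2‖ ^ 2) ^ (((N : ℝ) + 1) / 2)))]
    exact mul_le_mul' le_rfl (mul_le_mul' le_rfl h2)
  have hDI : Integrable D m := ⟨hmeas.sub hQI.1, ENNReal.lt_top_of_mul_ne_top_right
    (ne_top_of_le_ne_top (mul_ne_top ofReal_ne_top hfin) hle) hρ0⟩
  have hKI : Integrable (fun z => K (t - (ζ z).1) (x - (ζ z).2) * f z) m := by
    refine (hDI.fun_add hQI).congr (.of_forall fun z => ?_)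
    simp [hD]
  refine ⟨hKI, ?_⟩
  rw [← hQint, ← integral_sub hKI hQI]
  exact (mul_le_mul' le_rfl (enorm_integral_le_lintegral_enorm _)).trans hle

lemma restrict_prod_volume (S : Set ℝ) : (volume.restrict S).prod (volume : Measure (Eu n)) =
    (volume : Measure (ℝ × Eu n)).restrict (S ×ˢ univ) := by
  rw [Measure.volume_eq_prod, ← Measure.prod_restrict, Measure.restrict_univ]

lemma spaceTimeMoment_eq {l : ℕ} {β : Fin n → ℕ} {h k : Fin n} {S : Set ℝ}
    (hI : Integrable (fun z : ℝ × Eu n => momentIntegrand u l β h k z.1 z.2)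
      ((volume.restrict S).prod volume)) :
    spaceTimeMoment u S l β h k =
      ∫ z : ℝ × Eu n, momentIntegrand u l β h k z.1 z.2 ∂((volume.restrict S).prod volume) :=
  (integral_prod _ hI).symm

lemma DecayFlow.integrable_momentIntegrand_of_subset (hu : DecayFlow ω₀ u p A) {l : ℕ}
    {β : Fin n → ℕ} (h k : Fin n) (hd : 2 * l + ∑ i, β i ≤ n) {S : Set ℝ} (hS : S ⊆ Ioi 0) :
    Integrable (fun z : ℝ × Eu n => momentIntegrand u l β h k z.1 z.2)
      ((volume.restrict S).prod volume) := by
  have := hu.integrable_momentIntegrand l β h k hd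
  rw [restrict_prod_volume] at this ⊢
  exact this.mono_measure (Measure.restrict_mono (prod_mono hS subset_rfl) le_rfl)

lemma DecayFlow.exists_taylor_flux (hu : DecayFlow ω₀ u p A) {P : Eu n → ℂ}
    (hP : HomSymbol 2 P) (K : ℝ → Eu n → ℝ) (hK : ∀ s, 0 < s → K s = realKernel P s) :
    ∃ C : ℝ≥0∞, C ≠ ⊤ ∧ ∀ t, 2 ≤ t → ∀ (x : Eu n) (h k : Fin n),
      Integrable (fun z : ℝ × Eu n => K (t - z.1) (x - z.2) * vorVel u h k z.1 z.2)
        ((volume.restrict (Ioo 0 t)).prod volume) ∧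
      ofReal ((t + ‖x‖ ^ 2) ^ ((n : ℝ) / 2)) *
        ‖∫ z : ℝ × Eu n, K (t - z.1) (x - z.2) * vorVel u h k z.1 z.2
            ∂((volume.restrict (Ioo 0 t)).prod volume) - ∑ m ∈ Finset.range (n + 1),
          taylorTerm K (fun l β => spaceTimeMoment u (Ioc 0 t) l β h k) t x m‖ₑ ≤
        C * fluxPotential u t x := by
  obtain ⟨C, hC, hT⟩ := hP.exists_taylor_integral (p := 1) hu.two_le le_rfl rfl K hK
  obtain ⟨B, hB, hF⟩ := hu.exists_fluxPotential_le
  refine ⟨C, hC, fun t ht x h k => ?_⟩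
  have ht0 : 0 < t := by linarith
  have hmom : ∀ l β, 2 * l + ∑ i, β i ≤ n → Integrable (fun z : ℝ × Eu n =>
      (-z.1) ^ l * negPow β z.2 * vorVel u h k z.1 z.2) ((volume.restrict (Ioo 0 t)).prod volume) :=
    fun l β hd => hu.integrable_momentIntegrand_of_subset h k hd Ioo_subset_Ioi_self
  have hmeas : AEStronglyMeasurable (fun z : ℝ × Eu n => K (t - z.1) (x - z.2) * vorVel u h k z.1 z.2)
      ((volume.restrict (Ioo 0 t)).prod volume) := by
    refine AEStronglyMeasurable.mul ?_ ((hu.sol.smooth_vorVel h k).aestronglyMeasurable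
      measurableSet_Ioo Ioo_subset_Ioi_self)
    rw [restrict_prod_volume]
    exact (((isHeatSolution_realKernel hu.two_le hP hK).smooth.continuousOn_backward t x).mono
      (prod_mono Ioo_subset_Iio_self subset_rfl)).aestronglyMeasurable
        (measurableSet_Ioo.prod MeasurableSet.univ)
  have hae : ∀ᵐ z : ℝ × Eu n ∂(volume.restrict (Ioo 0 t)).prod volume, 0 ≤ z.1 ∧ z.1 < t ∧
      ofReal ((z.1 + ‖z.2‖ ^ 2) ^ (((n : ℝ) + 1) / 2)) * ‖vorVel u h k z.1 z.2‖ₑ ≤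
        flux u z.1 z.2 := by
    filter_upwards [ae_prod_mem (n := n) (measurableSet_Ioo (a := (0 : ℝ)) (b := t))] with z hz
    have hz0 := hz.1
    refine ⟨hz0.le, hz.2, ?_⟩
    have := ofReal_mul_enorm_vorVel_le (u := u) hz0 h k z.2 (d := (n : ℝ) + 1) le_rfl
    rw [sub_self, zero_div, rpow_zero, ofReal_one, one_mul] at this
    refine le_trans (mul_le_mul' (ofReal_le_ofReal ?_) le_rfl) this
    exact rpow_le_rpow (by positivity) (by linarith) (by positivity)
  obtain ⟨i1, i2⟩ := hT ((volume.restrict (Ioo 0 t)).prod volume) (fun z => vorVel u h k z.1 z.2)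
    (fun z => z) (fun z => flux u z.1 z.2) t x ht0 hae hmeas hmom
    (ne_top_of_le_ne_top ofReal_ne_top (hF t ht x))
  refine ⟨i1, le_trans (le_of_eq ?_) i2⟩
  congr 3
  refine sum_congr rfl fun m hm => taylorTerm_congr fun l β hd => ?_
  have hd' : 2 * l + ∑ i, β i ≤ n := by have := Finset.mem_range.1 hm; omega
  rw [spaceTimeMoment_eq (hu.integrable_momentIntegrand_of_subset h k hd' Ioc_subset_Ioi_self),
    ← restrict_Ioo_eq_restrict_Ioc]
  rfl

lemma exists_abs_rieszInvHeat_le (hn : 2 ≤ n) {δ : ℝ} (hδ : 0 < δ) : ∃ M : ℝ, 0 ≤ M ∧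
    ∀ τ, δ ≤ τ → ∀ (k : Fin n) (z : Eu n), |rieszInvHeat k τ z| ≤ M ∧
      ∀ j, |pderiv j (rieszInvHeat k τ) z| ≤ M := by
  have hn' : (2 : ℝ) ≤ n := by exact_mod_cast hn
  choose C₁ h₁ hC₁ using fun k : Fin n => exists_abs_realKernel_le hn le_rfl (HomSymbol.grad k)
  choose C₂ h₂ hC₂ using fun k j : Fin n =>
    exists_abs_realKernel_le hn one_le_two (HomSymbol.rieszRiesz k j)
  have hb : ∀ {C e τ : ℝ} (z : Eu n), 0 ≤ C → e ≤ 0 → δ ≤ τ → C * (τ + ‖z‖ ^ 2) ^ e ≤ C * δ ^ e :=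
    fun z hC he hτ => mul_le_mul_of_nonneg_left
      (rpow_le_rpow_of_nonpos hδ (by nlinarith [sq_nonneg ‖z‖]) he) hC
  set e₁ : ℝ := -((n : ℝ) + (1 : ℕ) - 2) / 2 with he₁
  set e₂ : ℝ := -((n : ℝ) + (2 : ℕ) - 2) / 2 with he₂
  have a1 : e₁ ≤ 0 := by rw [he₁]; push_cast; linarith
  have a2 : e₂ ≤ 0 := by rw [he₂]; push_cast; linarith
  have p1 : ∀ k, 0 ≤ C₁ k * δ ^ e₁ := fun k => mul_nonneg (h₁ k) (by positivity)
  have p2 : ∀ k j, 0 ≤ C₂ k j * δ ^ e₂ := fun k j => mul_nonneg (h₂ k j) (by positivity)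
  refine ⟨∑ k, (C₁ k * δ ^ e₁ + ∑ j, C₂ k j * δ ^ e₂), sum_nonneg fun k _ =>
    add_nonneg (p1 k) (sum_nonneg fun j _ => p2 k j), fun τ hτ k z => ?_⟩
  have hτ0 : 0 < τ := hδ.trans_le hτ
  have hk := single_le_sum (f := fun k => C₁ k * δ ^ e₁ + ∑ j, C₂ k j * δ ^ e₂)
    (fun k _ => add_nonneg (p1 k) (sum_nonneg fun j _ => p2 k j)) (Finset.mem_univ k)
  refine ⟨?_, fun j => ?_⟩
  · rw [rieszInvHeat_eq hτ0]
    refine ((hC₁ k τ z hτ0).trans (hb z (h₁ k) a1 hτ)).trans (le_trans ?_ hk)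
    exact le_add_of_nonneg_right (sum_nonneg fun j _ => p2 k j)
  · rw [pderiv_rieszInvHeat hn hτ0, rieszRieszHeat_eq hτ0]
    refine ((hC₂ k j τ z hτ0).trans (hb z (h₂ k j) a2 hτ)).trans (le_trans ?_ hk)
    exact (single_le_sum (f := fun j => C₂ k j * δ ^ e₂) (fun j _ => p2 k j)
      (Finset.mem_univ j)).trans (le_add_of_nonneg_left (p1 k))

lemma Integrable.mul_of_abs_le {f g : Eu n → ℝ} {M : ℝ} (hf : Integrable f) (hg : Continuous g)
    (h : ∀ y, |g y| ≤ M) : Integrable fun y => f y * g y :=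
  (hf.norm.mul_const M).mono' (hf.1.mul hg.aestronglyMeasurable) (.of_forall fun y => by
    rw [norm_mul]; exact mul_le_mul_of_nonneg_left (h y) (norm_nonneg _))

lemma DecayFlow.integrable_vorticity (hu : DecayFlow ω₀ u p A) (hs : 0 < s) (i j : Fin n) :
    Integrable (vorticity u i j s) := by
  obtain ⟨C, -, hM⟩ := hu.exists_lintegral_vorDen_le
  exact ⟨(hu.sol.contDiff_vorticity hs i j).continuous.aestronglyMeasurable,
    (lintegral_mono fun y => enorm_vorticity_le hs i j y).trans_lt
      ((hM s hs).trans_lt ofReal_lt_top)⟩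

lemma DecayFlow.integrable_vorticity_prod (hu : DecayFlow ω₀ u p A) (t : ℝ) (i j : Fin n) :
    Integrable (fun z : ℝ × Eu n => vorticity u i j z.1 z.2)
      ((volume.restrict (Ioo 0 t)).prod volume) := by
  obtain ⟨M, -, hM⟩ := hu.exists_lintegral_vorDen_le_const
  have hm := (hu.sol.smooth_vorticity i j).aestronglyMeasurable (S := Ioo 0 t) measurableSet_Ioo
    Ioo_subset_Ioi_self
  refine ⟨hm, ?_⟩
  rw [HasFiniteIntegral, lintegral_prod _ hm.enorm]
  calc _ ≤ ∫⁻ _ in Ioo 0 t, ofReal M := by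
        refine setLIntegral_mono' measurableSet_Ioo fun s hs => ?_
        exact (lintegral_mono fun y => enorm_vorticity_le hs.1 i j y).trans (hM s hs.1)
    _ < ⊤ := by
        rw [setLIntegral_const]
        exact ENNReal.mul_lt_top ofReal_lt_top measure_Ioo_lt_top

/-- The Biot–Savart law against the heat kernel. -/
lemma DecayFlow.sum_integral_vorticity_rieszInvHeat (hu : DecayFlow ω₀ u p A) (hs : 0 < s)
    {τ : ℝ} (hτ : 0 < τ) (x : Eu n) (j : Fin n) :
    ∑ k, ∫ y, vorticity u k j s y * rieszInvHeat k τ (x - y) =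
      -∫ y, u s y j * heatKernel τ (x - y) := by
  obtain ⟨M, hM0, hM⟩ := exists_abs_rieszInvHeat_le hu.two_le hτ
  have hH := fun k => (isHeatSolution_rieszInvHeat hu.two_le k).smooth.slice hτ
  have hg := fun k => contDiff_const_sub_comp (hH k) x
  have hpd : ∀ k l y, pderiv l (fun y => rieszInvHeat k τ (x - y)) y =
      -rieszRieszHeat k l τ (x - y) := fun k l y => by
    rw [pderiv_comp_const_sub (hH k), pderiv_rieszInvHeat hu.two_le hτ]
  have hb : ∀ k l y, |pderiv l (fun y => rieszInvHeat k τ (x - y)) y| ≤ M := fun k l y => by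
    rw [pderiv_comp_const_sub (hH k), abs_neg]
    exact (hM τ le_rfl k _).2 l
  have hui := fun j => integrable_coord (hu.bound.integrable s hs.le) j
  have hI : ∀ i k l, Integrable fun y => u s y i * pderiv l (fun y => rieszInvHeat k τ (x - y)) y :=
    fun i k l => Integrable.mul_of_abs_le (hui i) (contDiff_pderiv l (hg k)).continuous (hb k l)
  have h1 : ∀ k, ∫ y, vorticity u k j s y * rieszInvHeat k τ (x - y) =
      (∫ y, u s y k * pderiv j (fun y => rieszInvHeat k τ (x - y)) y) -
        ∫ y, u s y j * pderiv k (fun y => rieszInvHeat k τ (x - y)) y := fun k => by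
    rw [integral_vorticity_mul hu.sol hu.bound hs k j (hg k) (fun y => (hM τ le_rfl k _).1)
      (hb k) (Integrable.mul_of_abs_le (hu.integrable_vorticity hs k j) (hg k).continuous
        fun y => (hM τ le_rfl k _).1), integral_sub (hI j k k) (hI k k j), neg_sub]
  have h2 := (hu.sol.weakDivFree hs).integral_sum_mul (hu.bound.integrable s hs.le) (hg j) (M := M)
    (fun y => ((hM τ le_rfl j _).1).trans (le_mul_of_one_le_right hM0 (by linarith [norm_nonneg y])))
    (hb j)
  simp_rw [h1]
  rw [sum_sub_distrib, ← integral_finsetSum _ fun k _ => hI k k j,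
    ← integral_finsetSum _ fun k _ => hI j k k]
  have h3 : ∀ y, ∑ k, u s y k * pderiv j (fun y => rieszInvHeat k τ (x - y)) y =
      ∑ k, u s y k * pderiv k (fun y => rieszInvHeat j τ (x - y)) y := fun y =>
    sum_congr rfl fun k _ => by rw [hpd, hpd, rieszRieszHeat_symm hτ]
  have h4 : ∀ y, ∑ k, u s y j * pderiv k (fun y => rieszInvHeat k τ (x - y)) y =
      u s y j * heatKernel τ (x - y) := fun y => by
    simp_rw [hpd]
    rw [← mul_sum, sum_neg_distrib, sum_rieszRieszHeat hu.two_le hτ, neg_neg]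
  simp_rw [h3, h4]
  rw [h2, zero_sub]

lemma DecayFlow.tendsto_integral_velocity_heatKernel (hu : DecayFlow ω₀ u p A) (ht : 0 < t)
    (x : Eu n) (j : Fin n) :
    Tendsto (fun s => ∫ y, u s y j * heatKernel (t - s) (x - y)) (𝓝[<] t) (𝓝 (u t x j)) := by
  have hA := hu.bound
  refine tendsto_integral_mul_heatKernel (f := fun s y => u s y j) ht x (hu.sol.smooth_comp j)
    (M := A * A) (fun s hs => ?_) fun s hs => ?_
  · have hs0 : 0 < s := by linarith [hs.1]
    have hle : ∀ y, u s y j ^ 2 ≤ ‖u s y‖ ^ 2 := fun y => by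
      rw [← sq_abs]
      exact pow_le_pow_left₀ (abs_nonneg _) (VelocityBound.abs_coord_le _ _) 2
    have hI : Integrable fun y => u s y j ^ 2 := (hA.integrable_sq hs0).mono'
      ((hu.sol.contDiff_comp hs0 j).continuous.pow 2).aestronglyMeasurable
      (.of_forall fun y => by rw [norm_of_nonneg (sq_nonneg _)]; exact hle y)
    refine ⟨hI, (integral_mono hI (hA.integrable_sq hs0) hle).trans ?_⟩
    calc _ ≤ ∫ y, A * ‖u s y‖ := by
          refine integral_mono (hA.integrable_sq hs0) ((hA.integrable s hs0.le).norm.const_mul A)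
            fun y => ?_
          rw [sq]; exact mul_le_mul_of_nonneg_right (hA.norm_le hs0 y) (norm_nonneg _)
      _ ≤ A * A := by
          rw [integral_const_mul]
          exact mul_le_mul_of_nonneg_left (hA.norm_integral_le hs0.le) hA.pos.le
  · have hs0 : 0 < s := by linarith [hs.1]
    have hts : 0 < t - s := sub_pos.2 hs.2
    refine Integrable.mul_of_abs_le (integrable_coord (hA.integrable s hs0.le) j)
      ((continuous_heatKernel (t - s)).comp (continuous_const.sub continuous_id))
      (M := (4 * π * (t - s)) ^ (-(n : ℝ) / 2)) fun y => ?_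
    rw [abs_of_nonneg (heatKernel_nonneg hts.le _)]
    exact heatKernel_le hts _

/-- The representation of the velocity through the vorticity. -/
lemma DecayFlow.velocity_eq (hu : DecayFlow ω₀ u p A) (ht : 0 < t) (x : Eu n) (j : Fin n)
    (hG : ∀ h k, Integrable (fun z : ℝ × Eu n => heatKernel (t - z.1) (x - z.2) *
      vorVel u h k z.1 z.2) ((volume.restrict (Ioo 0 t)).prod volume))
    (hR : ∀ i l h k, Integrable (fun z : ℝ × Eu n => rieszRieszHeat i l (t - z.1) (x - z.2) *
      vorVel u h k z.1 z.2) ((volume.restrict (Ioo 0 t)).prod volume)) :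
    u t x j = -(∑ k, ∫ y, rieszInvHeat k t (x - y) * ω₀ k j y) -
      (∑ h, ∫ z : ℝ × Eu n, heatKernel (t - z.1) (x - z.2) * vorVel u h j z.1 z.2
        ∂((volume.restrict (Ioo 0 t)).prod volume)) -
      ∑ k, ∑ h, ∫ z : ℝ × Eu n, rieszRieszHeat k j (t - z.1) (x - z.2) * vorVel u h k z.1 z.2
        ∂((volume.restrict (Ioo 0 t)).prod volume) := by
  set Φ : ℝ × Eu n → ℝ := fun z => (∑ h, heatKernel (t - z.1) (x - z.2) * vorVel u h j z.1 z.2) +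
    ∑ k, ∑ h, rieszRieszHeat k j (t - z.1) (x - z.2) * vorVel u h k z.1 z.2 with hΦ
  have i1 := integrable_finsetSum Finset.univ fun h (_ : h ∈ Finset.univ) => hG h j
  have i2 := integrable_finsetSum Finset.univ fun k (_ : k ∈ Finset.univ) =>
    integrable_finsetSum Finset.univ fun h (_ : h ∈ Finset.univ) => hR k j h k
  have hΦI : Integrable Φ ((volume.restrict (Ioo 0 t)).prod volume) := i1.fun_add i2
  set S₀ : ℝ := ∑ k, ∫ y, rieszInvHeat k t (x - y) * ω₀ k j y with hS₀
  have hmono : ∀ {f : ℝ × Eu n → ℝ} {t₁ : ℝ}, t₁ ≤ t →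
      Integrable f ((volume.restrict (Ioo 0 t)).prod volume) →
      Integrable f ((volume.restrict (Ioo 0 t₁)).prod volume) := fun {f t₁} h1 hf => by
    rw [restrict_prod_volume] at hf ⊢
    exact hf.mono_measure (Measure.restrict_mono (prod_mono (Ioo_subset_Ioo_right h1) subset_rfl) le_rfl)
  have hstep : ∀ t₁ ∈ Ioo 0 t, -(∫ y, u t₁ y j * heatKernel (t - t₁) (x - y)) - S₀ =
      ∫ s in Ioc 0 t₁, ∫ y, Φ (s, y) := by
    intro t₁ ht₁
    have hδ : 0 < t - t₁ := sub_pos.2 ht₁.2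
    obtain ⟨M, hM0, hM⟩ := exists_abs_rieszInvHeat_le hu.two_le hδ
    have hcont : ∀ k τ, 0 < τ → Continuous fun y => rieszInvHeat k τ (x - y) := fun k τ hτ =>
      (contDiff_const_sub_comp ((isHeatSolution_rieszInvHeat hu.two_le k).smooth.slice hτ) x).continuous
    have hduh : ∀ k, (∫ y, vorticity u k j t₁ y * rieszInvHeat k (t - t₁) (x - y)) -
        ∫ y, rieszInvHeat k t (x - y) * ω₀ k j y =
        ∫ z : ℝ × Eu n, duhamelIntegrand u (rieszInvHeat k) t x k j z.1 z.2
          ∂((volume.restrict (Ioo 0 t₁)).prod volume) := by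
      intro k
      rw [← duhamel hu.sol hu.bound hu.weak (isHeatSolution_rieszInvHeat hu.two_le k) le_rfl ht₁.1
        ht₁.2 x k j (B := fun _ _ => M) (fun s hs y => hM (t - s) (by linarith [hs.2]) k (x - y))
        (fun i j => (hu.integrable_vorticity_prod t₁ i j).mul_const M)
        (Integrable.mul_of_abs_le (hu.integrable_vorticity ht₁.1 k j) (hcont k _ hδ)
          fun y => (hM _ le_rfl k _).1)
        (by
          rw [vor_zero]
          exact Integrable.mul_of_abs_le (hu.integrable₀ k j) (hcont k _ (by linarith))
            fun y => (hM _ (by linarith [ht₁.1]) k _).1), vor_zero, sub_zero]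
      simp_rw [mul_comm (ω₀ k j _)]
    have hD : ∀ z : ℝ × Eu n, z.1 ∈ Ioo 0 t₁ → ∀ k,
        duhamelIntegrand u (rieszInvHeat k) t x k j z.1 z.2 =
        ∑ h, (rieszRieszHeat k j (t - z.1) (x - z.2) * vorVel u h k z.1 z.2 -
          rieszRieszHeat k k (t - z.1) (x - z.2) * vorVel u h j z.1 z.2) := fun z hz k => by
      have : 0 < t - z.1 := by linarith [hz.2]
      simp_rw [duhamelIntegrand, pderiv_rieszInvHeat hu.two_le this, vorVel]
      exact sum_congr rfl fun h _ => by ring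
    have hDI : ∀ k, Integrable (fun z : ℝ × Eu n => duhamelIntegrand u (rieszInvHeat k) t x k j z.1 z.2)
        ((volume.restrict (Ioo 0 t₁)).prod volume) := fun k => by
      refine (integrable_finsetSum Finset.univ fun h _ => (hmono ht₁.2.le (hR k j h k)).sub'
        (hmono ht₁.2.le (hR k k h j))).congr ?_
      filter_upwards [ae_prod_mem (n := n) measurableSet_Ioo] with z hz using (hD z hz k).symm
    have hint : ∫ s in Ioc 0 t₁, ∫ y, Φ (s, y) =
        ∫ z, Φ z ∂((volume.restrict (Ioo 0 t₁)).prod volume) := by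
      rw [← restrict_Ioo_eq_restrict_Ioc]
      exact (integral_prod _ (hmono ht₁.2.le hΦI)).symm
    rw [hint, ← hu.sum_integral_vorticity_rieszInvHeat ht₁.1 hδ, hS₀, ← sum_sub_distrib]
    simp_rw [hduh]
    rw [← integral_finsetSum _ fun k _ => hDI k]
    refine integral_congr_ae ?_
    filter_upwards [ae_prod_mem (n := n) (measurableSet_Ioo (a := (0 : ℝ)) (b := t₁))] with z hz
    have htz : 0 < t - z.1 := by linarith [hz.2]
    simp_rw [hD z hz, sum_sub_distrib, hΦ]
    have : ∑ k, ∑ h, rieszRieszHeat k k (t - z.1) (x - z.2) * vorVel u h j z.1 z.2 =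
        -∑ h, heatKernel (t - z.1) (x - z.2) * vorVel u h j z.1 z.2 := by
      rw [sum_comm]
      simp_rw [← sum_mul, sum_rieszRieszHeat hu.two_le htz, neg_mul, sum_neg_distrib]
    rw [this]
    ring
  have hlim : Tendsto (fun t₁ => ∫ s in Ioc 0 t₁, ∫ y, Φ (s, y)) (𝓝[<] t)
      (𝓝 (∫ s in Ioc 0 t, ∫ y, Φ (s, y))) := by
    have hφ : IntegrableOn (fun s => ∫ y, Φ (s, y)) (Icc 0 t) := by
      rw [integrableOn_Icc_iff_integrableOn_Ioo]
      exact hΦI.integral_prod_left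
    exact ((intervalIntegral.continuousOn_primitive hφ) t (right_mem_Icc.2 ht.le)).mono_left
      (nhdsWithin_le_of_mem (Icc_mem_nhdsLT ht))
  have heq := tendsto_nhds_unique (hlim.congr' (by
    filter_upwards [Ioo_mem_nhdsLT ht] with t₁ ht₁ using (hstep t₁ ht₁).symm))
    (((hu.tendsto_integral_velocity_heatKernel ht x j).neg).sub_const S₀)
  rw [← restrict_Ioo_eq_restrict_Ioc, ← integral_prod _ hΦI, hΦ, integral_add i1 i2,
    integral_finsetSum _ fun h _ => hG h j, integral_finsetSum _ fun k _ =>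
      integrable_finsetSum Finset.univ fun h _ => hR k j h k] at heq
  simp_rw [integral_finsetSum Finset.univ fun h _ => hR _ j h _] at heq
  linarith

/-- `(t + |x|²)^{n/2} |E(t, x)|` is dominated by a multiple of `Θ(t, x)` for `t ≥ 2`. -/
def Dominated (Θ : ℝ → Eu n → ℝ≥0∞) (E : ℝ → Eu n → ℝ) : Prop :=
  ∃ C : ℝ≥0∞, C ≠ ⊤ ∧ ∀ t, 2 ≤ t → ∀ x : Eu n,
    ofReal ((t + ‖x‖ ^ 2) ^ ((n : ℝ) / 2)) * ‖E t x‖ₑ ≤ C * Θ t x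

namespace Dominated

variable {Θ Θ' : ℝ → Eu n → ℝ≥0∞} {E F : ℝ → Eu n → ℝ}

lemma add (h : Dominated Θ E) (h' : Dominated Θ F) : Dominated Θ fun t x => E t x + F t x := by
  obtain ⟨C, hC, hE⟩ := h
  obtain ⟨D, hD, hF⟩ := h'
  refine ⟨C + D, add_ne_top.2 ⟨hC, hD⟩, fun t ht x => ?_⟩
  rw [add_mul]
  refine (mul_le_mul' le_rfl (enorm_add_le _ _)).trans ?_
  rw [mul_add]
  exact add_le_add (hE t ht x) (hF t ht x)

lemma neg (h : Dominated Θ E) : Dominated Θ fun t x => -E t x := by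
  obtain ⟨C, hC, hE⟩ := h
  exact ⟨C, hC, fun t ht x => by rw [enorm_neg]; exact hE t ht x⟩

lemma sum {ι : Type*} (S : Finset ι) {E : ι → ℝ → Eu n → ℝ} (h : ∀ i ∈ S, Dominated Θ (E i)) :
    Dominated Θ fun t x => ∑ i ∈ S, E i t x := by
  classical
  induction S using induction_on with
  | empty => exact ⟨0, ENNReal.zero_ne_top, fun t _ x => by simp⟩
  | insert a S ha ih =>
    simp_rw [sum_insert ha]
    exact (h a (Finset.mem_insert_self a S)).add (ih fun i hi => h i (Finset.mem_insert_of_mem hi))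

end Dominated

lemma taylorTerm_of_forall_eq_zero {K : ℝ → Eu n → ℝ} {M : ℕ → (Fin n → ℕ) → ℝ} {x : Eu n} {m : ℕ}
    (hM : ∀ l β, l ≠ 0 → M l β = 0) : taylorTerm K M t x m =
      ∑ β ∈ multiIndices n m, multiDeriv β (K t) x / multiFactorial β * M 0 β := by
  rw [taylorTerm, Finset.sum_eq_single 0 (fun l _ hl => by simp [hM l _ hl]) (by simp)]
  simp [mixedDeriv]

lemma sum_Icc_one (f : ℕ → ℝ) (N : ℕ) :
    ∑ m ∈ Finset.Icc 1 N, f m = ∑ m ∈ Finset.range N, f (m + 1) := by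
  induction N with
  | zero => simp
  | succ N ih => rw [Finset.sum_range_succ, ← ih, Finset.sum_Icc_succ_top (by omega)]

lemma DecayFlow.dominated_initial (hu : DecayFlow ω₀ u p A) (k j : Fin n) :
    Dominated (remainderBound ω₀ u) fun t x => (∫ y, rieszInvHeat k t (x - y) * ω₀ k j y) -
      ∑ m ∈ Finset.Icc 1 n, ∑ α ∈ multiIndices n (m + 1),
        multiDeriv α (rieszInvHeat k t) x / multiFactorial α * ∫ y, negPow α y * ω₀ k j y := by
  obtain ⟨C, hC, hT⟩ := (HomSymbol.grad k).exists_taylor_integral (p := 0) (N := n + 1) hu.two_le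
    (by norm_num) rfl (rieszInvHeat k) fun s hs => rieszInvHeat_eq hs k
  obtain ⟨B, -, hB⟩ := hu.exists_initialPotential_le
  refine ⟨C, hC, fun t ht x => ?_⟩
  have ht0 : 0 < t := by linarith
  have hcont : Continuous fun y => rieszInvHeat k (t - 0) (x - y) :=
    (contDiff_const_sub_comp ((isHeatSolution_rieszInvHeat hu.two_le k).smooth.slice
      (by simpa using ht0)) x).continuous
  have hae : ∀ᵐ y : Eu n, (0 : ℝ) ≤ 0 ∧ 0 < t ∧
      ofReal ((0 + ‖y‖ ^ 2) ^ ((((n + 1 : ℕ) : ℝ) + 1) / 2)) * ‖ω₀ k j y‖ₑ ≤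
        ∑ i, ∑ j, ‖‖y‖ ^ (n + 2) * ω₀ i j y‖ₑ := .of_forall fun y => by
    refine ⟨le_rfl, ht0, ?_⟩
    have e : (0 + ‖y‖ ^ 2) ^ ((((n + 1 : ℕ) : ℝ) + 1) / 2) = ‖y‖ ^ (n + 2) := by
      rw [zero_add, ← rpow_natCast, ← rpow_natCast, ← rpow_mul (norm_nonneg y)]
      congr 1; push_cast; ring
    calc _ = ‖‖y‖ ^ (n + 2) * ω₀ k j y‖ₑ := by
          rw [e, enorm_mul (‖y‖ ^ (n + 2)), enorm_of_nonneg (r := ‖y‖ ^ (n + 2)) (by positivity)]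
      _ ≤ _ := (single_le_sum (f := fun j => ‖‖y‖ ^ (n + 2) * ω₀ k j y‖ₑ) (fun _ _ => zero_le)
          (Finset.mem_univ j)).trans (single_le_sum
            (f := fun i => ∑ j, ‖‖y‖ ^ (n + 2) * ω₀ i j y‖ₑ) (fun _ _ => zero_le) (Finset.mem_univ k))
  obtain ⟨-, h2⟩ := hT volume (ω₀ k j) (fun y => (0, y)) _ t x ht0 hae
    (hcont.aestronglyMeasurable.mul (hu.integrable₀ k j).1)
    (fun l β hd => by
      refine (((hu.integrable_negPow_mul_initial (β := β) (by omega) k j)).const_mul ((-(0 : ℝ)) ^ l)).congr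
        (.of_forall fun y => ?_)
      simp only; ring)
    (ne_top_of_le_ne_top ofReal_ne_top ((hB t ht0).2 x))
  refine le_trans (le_trans (le_of_eq ?_) h2) (mul_le_mul' le_rfl
    (le_trans le_add_self le_self_add))
  have hz : ∀ m, taylorTerm (rieszInvHeat k) (fun l β => ∫ y, (-(0 : ℝ)) ^ l * negPow β y * ω₀ k j y)
      t x m = ∑ α ∈ multiIndices n m, multiDeriv α (rieszInvHeat k t) x / multiFactorial α *
        ∫ y, negPow α y * ω₀ k j y := fun m => by
    rw [taylorTerm_of_forall_eq_zero fun l β hl => by simp [hl]]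
    simp
  have hlow : ∀ m, m ≤ 1 → ∑ α ∈ multiIndices n m, multiDeriv α (rieszInvHeat k t) x /
      multiFactorial α * ∫ y, negPow α y * ω₀ k j y = 0 := fun m hm =>
    sum_eq_zero fun α hα => by
      rw [hu.integral_negPow_mul_initial ((sum_of_mem_multiIndices hα).trans_le hm), mul_zero]
  simp only [hz]
  rw [sum_Icc_one, sum_range_succ', sum_range_succ', hlow 0 zero_le_one,
    hlow (0 + 1) le_rfl, add_zero, add_zero, sub_zero]

lemma DecayFlow.dominated_flux (hu : DecayFlow ω₀ u p A) {P : Eu n → ℂ}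
    (hP : HomSymbol 2 P) (K : ℝ → Eu n → ℝ) (hK : ∀ s, 0 < s → K s = realKernel P s)
    (h k : Fin n) :
    Dominated (remainderBound ω₀ u) fun t x =>
      (∫ z : ℝ × Eu n, K (t - z.1) (x - z.2) * vorVel u h k z.1 z.2
        ∂((volume.restrict (Ioo 0 t)).prod volume)) - ∑ m ∈ Finset.range (n + 1),
          taylorTerm K (fun l β => spaceTimeMoment u (Ioc 0 t) l β h k) t x m := by
  obtain ⟨C, hC, hT⟩ := hu.exists_taylor_flux hP K hK
  exact ⟨C, hC, fun t ht x => ((hT t ht x h k).2).trans (mul_le_mul' le_rfl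
    (le_trans le_self_add le_self_add))⟩

lemma DecayFlow.dominated_tail (hu : DecayFlow ω₀ u p A) (l : ℕ) (β : Fin n → ℕ) (h k : Fin n)
    (hd : 2 * l + ∑ i, β i ≤ n) :
    Dominated (remainderBound ω₀ u) fun t x =>
      mixedDeriv l β heatKernel t x / ((l.factorial : ℝ) * multiFactorial β) *
        spaceTimeMoment u (Ioi t) l β h k := by
  obtain ⟨B, hB, hM⟩ := hu.exists_lintegral_moment_le l β h k hd
  set m : ℕ := 2 * l + ∑ i, β i with hm
  set r : ℝ := ((n : ℝ) + 1 - m) / 2 with hr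
  have hr0 : 0 ≤ r := by
    have : (m : ℝ) ≤ n := by exact_mod_cast hd
    rw [hr]; linarith
  obtain ⟨D, hD, hG⟩ := exists_mixedDeriv_heatKernel_le hu.two_le l β r
  set c : ℝ := (l.factorial : ℝ) * multiFactorial β with hc
  refine ⟨ofReal (D * |c⁻¹| * B), ofReal_ne_top, fun t ht x => ?_⟩
  have ht0 : 0 < t := by linarith
  have hρ : 0 < t + ‖x‖ ^ 2 := by positivity
  have h1 : ‖spaceTimeMoment u (Ioi t) l β h k‖ₑ ≤ ofReal (B * t ^ (-r)) := by
    rw [spaceTimeMoment_eq (hu.integrable_momentIntegrand_of_subset h k hd (Ioi_subset_Ioi ht0.le))]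
    refine (enorm_integral_le_lintegral_enorm _).trans ((hM t ht0.le).trans (ofReal_le_ofReal ?_))
    rw [show ((m : ℝ) - (n + 1)) / 2 = -r by rw [hr]; ring]
    exact mul_le_mul_of_nonneg_left (rpow_le_rpow_of_nonpos ht0 (by linarith) (by linarith)) hB.le
  have h2 : (t + ‖x‖ ^ 2) ^ ((n : ℝ) / 2) * |mixedDeriv l β heatKernel t x / c| * (B * t ^ (-r)) ≤
      D * |c⁻¹| * B * decayKernel t x := by
    have e : (t + ‖x‖ ^ 2) ^ ((n : ℝ) / 2) * (t + ‖x‖ ^ 2) ^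
        (-((n : ℝ) + 2 * l + (∑ j, β j : ℕ)) / 2 - r) = decayKernel t x := by
      rw [decayKernel, ← rpow_add hρ]
      congr 1
      rw [hr, hm]; push_cast; ring
    have e2 : t ^ r * t ^ (-r) = 1 := by rw [← rpow_add ht0]; simp
    calc _ = (t + ‖x‖ ^ 2) ^ ((n : ℝ) / 2) * (|mixedDeriv l β heatKernel t x| * |c⁻¹|) *
          (B * t ^ (-r)) := by
          rw [div_eq_mul_inv (mixedDeriv l β heatKernel t x), abs_mul]
      _ ≤ (t + ‖x‖ ^ 2) ^ ((n : ℝ) / 2) * (D * t ^ r * (t + ‖x‖ ^ 2) ^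
          (-((n : ℝ) + 2 * l + (∑ j, β j : ℕ)) / 2 - r) * |c⁻¹|) * (B * t ^ (-r)) := by
          gcongr
          exact hG t x ht0
      _ = D * |c⁻¹| * B * ((t + ‖x‖ ^ 2) ^ ((n : ℝ) / 2) * (t + ‖x‖ ^ 2) ^
          (-((n : ℝ) + 2 * l + (∑ j, β j : ℕ)) / 2 - r)) * (t ^ r * t ^ (-r)) := by ring
      _ = _ := by rw [e, e2, mul_one]
  rw [enorm_mul, ← mul_assoc, Real.enorm_eq_ofReal_abs (mixedDeriv l β heatKernel t x / c),
    ← ofReal_mul (by positivity)]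
  refine (mul_le_mul' le_rfl h1).trans ?_
  rw [← ofReal_mul (by positivity)]
  refine (ofReal_le_ofReal h2).trans ?_
  rw [ofReal_mul (by positivity)]
  exact mul_le_mul' le_rfl le_add_self

lemma DecayFlow.sum_spaceTimeMoment_zero (hu : DecayFlow ω₀ u p A) {l : ℕ} {β : Fin n → ℕ}
    (hd : 2 * l + ∑ i, β i = 0) (t : ℝ) (k : Fin n) :
    ∑ h, spaceTimeMoment u (Ioc 0 t) l β h k = 0 := by
  obtain rfl : l = 0 := by omega
  have hβ : β = 0 := funext fun i => (Finset.sum_eq_zero_iff.1 (show ∑ i, β i = 0 by omega)) i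
    (Finset.mem_univ i)
  subst hβ
  unfold spaceTimeMoment
  rw [← integral_finsetSum _ fun h _ => (hu.integrable_momentIntegrand_of_subset (l := 0) (β := 0) h k
    (by simp) Ioc_subset_Ioi_self).integral_prod_left]
  refine setIntegral_eq_zero_of_forall_eq_zero fun s hs => ?_
  have := hu.sum_integral_vorVel hs.1 k
  simpa [momentIntegrand, negPow, vorVel] using this

lemma DecayFlow.spaceTimeMoment_split (hu : DecayFlow ω₀ u p A) {l : ℕ} {β : Fin n → ℕ}
    (hd : 2 * l + ∑ i, β i ≤ n) (ht : 0 ≤ t) (h k : Fin n) :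
    spaceTimeMoment u (Ioi 0) l β h k =
      spaceTimeMoment u (Ioc 0 t) l β h k + spaceTimeMoment u (Ioi t) l β h k := by
  rw [spaceTimeMoment, ← Ioc_union_Ioi_eq_Ioi ht, setIntegral_union Ioc_disjoint_Ioi_same measurableSet_Ioi
    (hu.integrable_momentIntegrand_of_subset h k hd Ioc_subset_Ioi_self).integral_prod_left
    (hu.integrable_momentIntegrand_of_subset h k hd (Ioi_subset_Ioi ht)).integral_prod_left]
  rfl

/-- The sum over the low orders drops out by the vanishing of the total Lamb vector. -/
lemma DecayFlow.sum_range_taylorTerm (hu : DecayFlow ω₀ u p A) (K : ℝ → Eu n → ℝ) (t : ℝ)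
    (x : Eu n) (k : Fin n) : ∑ h, ∑ m ∈ Finset.range (n + 1),
      taylorTerm K (fun l β => spaceTimeMoment u (Ioc 0 t) l β h k) t x m =
    ∑ m ∈ Finset.Icc 1 n, taylorTerm K (fun l β => ∑ h, spaceTimeMoment u (Ioc 0 t) l β h k) t x m := by
  rw [sum_comm]
  simp_rw [sum_taylorTerm]
  rw [sum_range_succ', sum_Icc_one, taylorTerm_congr (m := 0) (M' := fun _ _ => 0)
    fun l β hd => hu.sum_spaceTimeMoment_zero hd t k]
  simp [taylorTerm]

theorem DecayFlow.dominated_expansionError (hu : DecayFlow ω₀ u p A) (j : Fin n) :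
    Dominated (remainderBound ω₀ u) fun t x => expansionError ω₀ u t x j := by
  have hn := hu.two_le
  have dA := Dominated.sum Finset.univ fun k _ => hu.dominated_initial k j
  have dB := Dominated.sum Finset.univ fun h _ => hu.dominated_flux HomSymbol.heat heatKernel
    (fun s hs => heatKernel_eq_realKernel hn hs) h j
  have dD := Dominated.sum Finset.univ fun k _ => Dominated.sum Finset.univ fun h _ =>
    hu.dominated_flux (HomSymbol.rieszRiesz k j) (rieszRieszHeat k j)
      (fun s hs => rieszRieszHeat_eq hs k j) h k
  have dT := Dominated.sum (Finset.Icc 1 n) fun m hm => Dominated.sum (Finset.range (m / 2 + 1))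
    fun l hl => Dominated.sum (multiIndices n (m - 2 * l)) fun β hβ => Dominated.sum Finset.univ
      fun h _ => hu.dominated_tail l β h j
        ((parabolic_degree hl hβ).trans_le (Finset.mem_Icc.1 hm).2)
  obtain ⟨C, hC, hE⟩ := ((dA.neg.add dB.neg).add dD.neg).add dT
  obtain ⟨C₁, -, hTG⟩ := hu.exists_taylor_flux HomSymbol.heat heatKernel
    fun s hs => heatKernel_eq_realKernel hn hs
  refine ⟨C, hC, fun t ht x => le_trans (le_of_eq ?_) (hE t ht x)⟩
  have ht0 : 0 < t := by linarith
  congr 2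
  have hrep := hu.velocity_eq ht0 x j (fun h k => (hTG t ht x h k).1) fun i l h k => by
    obtain ⟨_, -, hTR⟩ := hu.exists_taylor_flux (HomSymbol.rieszRiesz i l) (rieszRieszHeat i l)
      fun s hs => rieszRieszHeat_eq hs i l
    exact (hTR t ht x h k).1
  have hU : ∀ m ∈ Finset.Icc 1 n, profileU ω₀ u m j t x + profileUS u m j t x =
      -(∑ k, ∑ α ∈ multiIndices n (m + 1), multiDeriv α (rieszInvHeat k t) x / multiFactorial α *
        ∫ y, negPow α y * ω₀ k j y) -
      taylorTerm heatKernel (fun l β => ∑ h, spaceTimeMoment u (Ioc 0 t) l β h j) t x m -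
      (∑ l ∈ Finset.range (m / 2 + 1), ∑ β ∈ multiIndices n (m - 2 * l), ∑ h,
        mixedDeriv l β heatKernel t x / ((l.factorial : ℝ) * multiFactorial β) *
          spaceTimeMoment u (Ioi t) l β h j) -
      ∑ k, taylorTerm (rieszRieszHeat k j)
        (fun l β => ∑ h, spaceTimeMoment u (Ioc 0 t) l β h k) t x m := by
    intro m hm
    have e1 : ∑ l ∈ Finset.range (m / 2 + 1), ∑ β ∈ multiIndices n (m - 2 * l), ∑ h : Fin n,
        mixedDeriv l β heatKernel t x / ((l.factorial : ℝ) * multiFactorial β) *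
          spaceTimeMoment u (Ioi 0) l β h j =
        taylorTerm heatKernel (fun l β => ∑ h, spaceTimeMoment u (Ioc 0 t) l β h j) t x m +
        ∑ l ∈ Finset.range (m / 2 + 1), ∑ β ∈ multiIndices n (m - 2 * l), ∑ h,
          mixedDeriv l β heatKernel t x / ((l.factorial : ℝ) * multiFactorial β) *
            spaceTimeMoment u (Ioi t) l β h j := by
      simp_rw [taylorTerm, ← sum_add_distrib, mul_sum, ← sum_add_distrib]
      refine sum_congr rfl fun l hl => sum_congr rfl fun β hβ =>
        sum_congr rfl fun h _ => ?_
      rw [hu.spaceTimeMoment_split ((parabolic_degree hl hβ).trans_le (Finset.mem_Icc.1 hm).2)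
        ht0.le, mul_add]
    have e2 : ∑ l ∈ Finset.range (m / 2 + 1), ∑ β ∈ multiIndices n (m - 2 * l), ∑ k : Fin n,
        ∑ h : Fin n, mixedDeriv l β (rieszRieszHeat k j) t x /
          ((l.factorial : ℝ) * multiFactorial β) * spaceTimeMoment u (Ioc 0 t) l β h k =
        ∑ k, taylorTerm (rieszRieszHeat k j)
          (fun l β => ∑ h, spaceTimeMoment u (Ioc 0 t) l β h k) t x m := by
      simp_rw [taylorTerm, mul_sum]
      rw [sum_comm (s := Finset.univ)]
      exact sum_congr rfl fun l _ => sum_comm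
    rw [profileU, profileUS, e1, e2, sum_comm (s := multiIndices n (m + 1))]
    ring
  change u t x j - ∑ m ∈ Finset.Icc 1 n, (profileU ω₀ u m j t x + profileUS u m j t x) = _
  rw [sum_congr rfl hU, hrep]
  simp_rw [sum_sub_distrib, hu.sum_range_taylorTerm, sum_neg_distrib]
  rw [sum_comm (s := Finset.Icc 1 n) (t := Finset.univ), sum_comm (s := Finset.Icc 1 n)
    (t := Finset.univ)]
  ring

lemma enorm_le_sum_enorm_coord (v : Eu n) : ‖v‖ₑ ≤ ∑ j, ‖v j‖ₑ := by
  have : v = ∑ j, single j (v j) := by ext i; simp [Finset.sum_apply]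
  conv_lhs => rw [this]
  refine (enorm_sum_le _ _).trans (sum_le_sum fun j _ => ?_)
  rw [← ofReal_norm, ← ofReal_norm, PiLp.norm_single]

theorem DecayFlow.exists_eLpNorm_expansionError_le (hu : DecayFlow ω₀ u p A) {q : ℝ≥0∞}
    (hq : 1 ≤ q) {μ : ℝ} (hμ0 : 0 ≤ μ) (hμn : μ ≤ n) : ∃ C : ℝ, ∀ t, 2 ≤ t →
      eLpNorm (fun x : Eu n => ‖x‖ ^ μ • expansionError ω₀ u t x) q volume ≤
        ofReal (C * (t ^ (-(n : ℝ) / 2 * (1 - (q⁻¹).toReal) - (n : ℝ) / 2 - 1 / 2 + μ / 2)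
          * log (2 + t))) := by
  choose C hC hE using hu.dominated_expansionError
  obtain ⟨B, hB, hΘ⟩ := hu.exists_remainderBound_le
  set K : ℝ := (∑ j, C j).toReal + 1 with hK
  have hK0 : 0 < K := by positivity
  have hCK : ∑ j, C j ≤ ofReal K := by
    rw [← ofReal_toReal (ENNReal.sum_ne_top.2 fun j _ => hC j)]
    exact ofReal_le_ofReal (by rw [hK]; linarith)
  refine ⟨K * B, fun t ht => ?_⟩
  have ht0 : 0 < t := by linarith
  have hL : 0 < log (2 + t) := Real.log_pos (by linarith)
  set a : ℝ := t ^ ((μ - n) / 2) * K with ha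
  have ha0 : 0 < a := by positivity
  have hpt : ∀ x : Eu n, ‖‖x‖ ^ μ • expansionError ω₀ u t x‖ₑ ≤
      ofReal a * remainderBound ω₀ u t x := by
    intro x
    have hρ : 0 < t + ‖x‖ ^ 2 := by positivity
    have hw : ‖x‖ ^ μ ≤ t ^ ((μ - n) / 2) * (t + ‖x‖ ^ 2) ^ ((n : ℝ) / 2) := by
      calc ‖x‖ ^ μ = (‖x‖ ^ 2) ^ (μ / 2) := by
            rw [← rpow_natCast, ← rpow_mul (norm_nonneg x)]; congr 1; push_cast; ring
        _ ≤ (t + ‖x‖ ^ 2) ^ (μ / 2) := rpow_le_rpow (by positivity) (by linarith) (by linarith)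
        _ = (t + ‖x‖ ^ 2) ^ ((μ - n) / 2) * (t + ‖x‖ ^ 2) ^ ((n : ℝ) / 2) := by
            rw [← rpow_add hρ]; congr 1; ring
        _ ≤ _ := mul_le_mul_of_nonneg_right (rpow_le_rpow_of_nonpos ht0
            (by nlinarith [sq_nonneg ‖x‖]) (by linarith)) (by positivity)
    rw [enorm_smul, enorm_of_nonneg (by positivity)]
    calc _ ≤ ofReal (t ^ ((μ - n) / 2)) *
          (ofReal ((t + ‖x‖ ^ 2) ^ ((n : ℝ) / 2)) * ∑ j, ‖expansionError ω₀ u t x j‖ₑ) := by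
          rw [← mul_assoc, ← ofReal_mul (by positivity)]
          exact mul_le_mul' (ofReal_le_ofReal hw) (enorm_le_sum_enorm_coord _)
      _ ≤ ofReal (t ^ ((μ - n) / 2)) * (ofReal K * remainderBound ω₀ u t x) := by
          refine mul_le_mul' le_rfl ?_
          rw [mul_sum]
          refine (sum_le_sum fun j _ => hE j t ht x).trans ?_
          rw [← sum_mul]
          exact mul_le_mul' hCK le_rfl
      _ = _ := by rw [← mul_assoc, ← ofReal_mul (by positivity)]
  obtain ⟨h1, h2⟩ := hΘ t ht
  set S : ℝ := a * (B * (t ^ (-((n : ℝ) + 1) / 2) * log (2 + t))) with hS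
  set I : ℝ := a * (B * (t ^ (-(1 / 2) : ℝ) * log (2 + t))) with hI
  have hS0 : 0 < S := by positivity
  have hI0 : 0 < I := by positivity
  refine (eLpNorm_le_of_lintegral_le_of_le hS0 hI0 ?_ (fun x => (hpt x).trans ?_) hq).trans
    (le_of_eq ?_)
  · refine (lintegral_mono hpt).trans ?_
    rw [lintegral_ofReal_mul, hI, ofReal_mul ha0.le]
    exact mul_le_mul' le_rfl h1
  · rw [hS, ofReal_mul ha0.le]
    exact mul_le_mul' le_rfl (h2 x)
  · set θ := (q⁻¹).toReal with hθ
    set Y : ℝ := a * B * log (2 + t) with hY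
    have hY0 : 0 < Y := by positivity
    have eS : S = Y * t ^ (-((n : ℝ) + 1) / 2) := by rw [hS, hY]; ring
    have eI : I = Y * t ^ (-(1 / 2) : ℝ) := by rw [hI, hY]; ring
    rw [eS, eI, mul_rpow hY0.le (by positivity), mul_rpow hY0.le (by positivity),
      ← rpow_mul ht0.le, ← rpow_mul ht0.le]
    have e1 : Y ^ (1 - θ) * Y ^ θ = Y := by rw [← rpow_add hY0]; simp
    congr 1
    calc _ = (Y ^ (1 - θ) * Y ^ θ) *
          (t ^ (-((n : ℝ) + 1) / 2 * (1 - θ)) * t ^ (-(1 / 2) * θ : ℝ)) := by ring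
      _ = K * B * (t ^ ((μ - n) / 2) * (t ^ (-((n : ℝ) + 1) / 2 * (1 - θ)) *
          t ^ (-(1 / 2) * θ : ℝ)) * log (2 + t)) := by rw [e1, hY, ha]; ring
      _ = _ := by
          rw [← rpow_add ht0, ← rpow_add ht0, show (μ - n) / 2 +
            (-((n : ℝ) + 1) / 2 * (1 - θ) + -(1 / 2) * θ) =
            -(n : ℝ) / 2 * (1 - θ) - n / 2 - 1 / 2 + μ / 2 by ring]

end

end NSAsymp

end

theorem proposition1p2 (n : ℕ) (hn : 2 ≤ n)
    (ω₀ : Fin n → Fin n → NSAsymp.Eu n → ℝ)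
    (u : ℝ → NSAsymp.Eu n → NSAsymp.Eu n) (p : ℝ → NSAsymp.Eu n → ℝ)
    (hω₀_one : ∀ i j, MemLp (ω₀ i j) 1 volume)
    (hω₀_top : ∀ i j, MemLp (ω₀ i j) ∞ volume)
    (hω₀_weight : ∀ i j, Integrable (fun x : NSAsymp.Eu n => ‖x‖ ^ (n + 2) * ω₀ i j x) volume)
    (h_div : NSAsymp.WeakDivFree (u 0))
    (h_vort : NSAsymp.IsWeakVorticity (u 0) ω₀)
    (h_bs : NSAsymp.BiotSavart (u 0) ω₀)
    (h_sol : NSAsymp.IsNSSolution u p)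
    (h_decay : NSAsymp.VelocityDecay u) :
    (∀ (l : ℕ) (β : Fin n → ℕ) (h k : Fin n), 2 * l + ∑ i, β i ≤ n →
      Integrable (fun z : ℝ × NSAsymp.Eu n => NSAsymp.momentIntegrand u l β h k z.1 z.2)
        ((volume.restrict (Ioi (0 : ℝ))).prod volume)) ∧
    ∀ (q : ℝ≥0∞) (μ : ℝ), 0 ≤ μ → (q = 1 ∧ μ ≤ (n : ℝ) - 1 ∨ 1 < q ∧ μ ≤ (n : ℝ)) →
      ∃ C : ℝ, ∀ᶠ t : ℝ in atTop,
        eLpNorm (fun x : NSAsymp.Eu n => ‖x‖ ^ μ • NSAsymp.expansionError ω₀ u t x) q volume ≤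
          ENNReal.ofReal (C * (t ^ (-(n : ℝ) / 2 * (1 - (q⁻¹).toReal) - (n : ℝ) / 2 - 1 / 2 + μ / 2)
            * Real.log (2 + t))) := by
  obtain ⟨A, hA⟩ := h_sol.exists_velocityBound h_decay h_bs.1
  have hu : NSAsymp.DecayFlow ω₀ u p A :=
    { two_le := hn
      sol := h_sol
      bound := hA
      weak := h_vort
      integrable₀ := fun i j => memLp_one_iff_integrable.1 (hω₀_one i j)
      weight := hω₀_weight
      div := h_div }
  refine ⟨fun l β h k hd => hu.integrable_momentIntegrand l β h k hd, fun q μ hμ0 hq => ?_⟩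
  have hq1 : 1 ≤ q := hq.elim (fun h => h.1.ge) fun h => h.1.le
  have hμn : μ ≤ n := hq.elim (fun h => h.2.trans (by linarith)) fun h => h.2
  obtain ⟨C, hC⟩ := hu.exists_eLpNorm_expansionError_le hq1 hμ0 hμn
  exact ⟨C, (eventually_ge_atTop 2).mono hC⟩
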